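/- Let $e\neq0$, $c>0$, $m>0$ be real. Let $L^2_3$ be the Hilbert space of square integrable fields $\mathbb R^3\to\mathbb C^3$, $L^2_*$ its closed subspace of divergence-free fields, $M:L^2_3\to L^2_*$ the orthogonal projection, and $H^s_*$ the divergence-free fields of Sobolev class $H^s$. For $\lambda\ge 0$ put $$G_\lambda(x)=\frac{e^{-\sqrt\lambda|x|}}{4\pi|x|},\qquad \Gamma_m(\lambda)=-\frac{mc^2}{4\pi e^2}+\frac{\sqrt\lambda}{6\pi},\qquad \lambda_0=\Big(\frac{3mc^2}{2e^2}\Big)^2,$$ and for $A\in L^2_*$, $Q\in\mathbb C^3$, $\lambda>0$ put $A_\lambda=A-\frac{4\pi e}{c}MQG_\lambda$ (it depends on $Q$). The field $MQG_0$ is the one whose distributional Fourier transform is the transverse part $\hat F(k)-|k|^{-2}(k\cdot\hat F(k))k$ of that $\hat F$ of $F=QG_0$. Write $\frac1{4\pi r^2}\int_{S_r}f\,d\mu_r$ for the mean of $f$ over the sphere of radius $r$ centred at $0$; for a class of functions modulo null sets it is defined for almost every $r>0$, and below its continuous version in $r>0$ is meant (its existence being part of the claims). For a density $\rho$ let $E(\rho)=\frac1{4\pi}\iint\frac{\rho(x)\rho(y)}{|x-y|}dx\,dy$,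 $\rho_r(x)=r^{-3}\rho(r^{-1}x)$, $m_r=m-\frac{8\pi e^2}{3c^2}E(\rho_r)$ and, when $m_r\ne0$, $$H_r=-\Delta+\frac{4\pi e^2}{m_rc^2}\,M\,\rho_r\otimes\rho_r\quad\text{on } H^2_*,\qquad (\rho_r\otimes\rho_r)A=\rho_r\int\rho_rA .$$ **Theorem 3.1.** There is a self-adjoint operator $H_m$ in $L^2_*$, bounded below, with the following properties. *Convergence.* For every square integrable, spherically symmetric probability density $\rho$ with bounded support, $\rho_r\to\delta_0$ weakly as $r\downarrow0$, $m_r\neq0$ for all small $r>0$, $H_r$ is self-adjoint whenever $r>0$ and $m_r\ne0$, and $H_r\to H_m$ in norm resolvent sense as $r\downarrow0$. *The operator.* For every $\lambda>0$: $A\in D(H_m)$ if and only if there is $Q_A\in\mathbb C^3$ such that $A_\lambda=A-\frac{4\pi e}cMQ_AG_\lambda\in H^2_*$ and $$\lim_{r\downarrow0}\frac1{4\pi r^2}\int_{S_r}\Big(A-\frac{4\pi e}cMQ_AG_0\Big)d\mu_r=-\frac{mc}e\,Q_A ,$$ and then $(H_m+\lambda)A=(-\Delta+\lambda)A_\lambda$.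 If $A\in D(H_m)$ is real-valued, so is $H_mA$. *Spectrum.* $\sigma_{ess}(H_m)=\sigma_{ac}(H_m)=[0,+\infty)$, $\sigma_{sc}(H_m)=\emptyset$, and $\sigma_p(H_m)=\{-\lambda_0\}$. The eigenspace of $-\lambda_0$ has dimension three and, for every orthonormal basis $e_1,e_2,e_3$ of $\mathbb C^3$ (in particular of $\mathbb R^3$), the vectors $$X_j^0=3\sqrt{2\pi m}\,\frac ce\,Me_jG_{\lambda_0},\qquad j=1,2,3,$$ form an orthonormal basis of it. *Quadratic form.* Let $F_m$, with domain $D(F_m)$, be the (closed) quadratic form of $H_m$. For every $\lambda>0$: $A\in D(F_m)$ if and only if there is $Q_A\in\mathbb C^3$ with $A_\lambda=A-\frac{4\pi e}cMQ_AG_\lambda\in H^1_*$, and then $$F_m(A,A)+\lambda\|A\|_2^2=\big\|(-\Delta+\lambda)^{1/2}A_\lambda\big\|_2^2+\Big(\frac{4\pi e}c\Big)^2\Gamma_m(\lambda)\,|Q_A|^2 .$$ *Charge.* For $A\in D(F_m)$ the vector $Q_A$ is given by $$Q_A=\frac{3c}{2e}\lim_{r\downarrow0}\,r\,\frac1{4\pi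 r^2}\int_{S_r}A\,d\mu_r ,$$ and $Q_A\in\mathbb R^3$ if $A$ is real-valued. -/

import Mathlib

open MeasureTheory Filter Topology Set
open scoped SchwartzMap FourierTransform Laplacian LineDeriv ENNReal

noncomputable section

namespace PointCharge

/-! ### Unbounded operators on a complex Hilbert space -/

section Operators

variable {E : Type*} [NormedAddCommGroup E] [InnerProductSpace ℂ E]

/-- `R` is the resolvent `(H - z)⁻¹`: a bounded, everywhere defined, two-sided inverse of
`H - z : D(H) → E`. -/
def IsResolventAt (H : E →ₗ.[ℂ] E) (z : ℂ) (R : E →L[ℂ] E) : Prop :=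
  (∀ x : E, ∃ h : R x ∈ H.domain, H ⟨R x, h⟩ - z • R x = x) ∧
    ∀ x : H.domain, R (H x - z • (x : E)) = x

/-- The spectrum of an unbounded operator, the complement of its resolvent set. -/
def spec (H : E →ₗ.[ℂ] E) : Set ℂ := {z | ¬ ∃ R : E →L[ℂ] E, IsResolventAt H z R}

/-- The eigenspace `{x ∈ D(H) | H x = z x}`. -/
def eigenspace (H : E →ₗ.[ℂ] E) (z : ℂ) : Submodule ℂ E where
  carrier := {x | ∃ h : x ∈ H.domain, H ⟨x, h⟩ = z • x}
  zero_mem' := ⟨H.domain.zero_mem, by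
    rw [smul_zero]; exact H.map_zero⟩
  add_mem' := by
    rintro x y ⟨hx, hx'⟩ ⟨hy, hy'⟩
    refine ⟨H.domain.add_mem hx hy, ?_⟩
    rw [smul_add, ← hx', ← hy']
    exact H.map_add ⟨x, hx⟩ ⟨y, hy⟩
  smul_mem' := by
    rintro a x ⟨hx, hx'⟩
    refine ⟨H.domain.smul_mem a hx, ?_⟩
    rw [smul_comm, ← hx']
    exact H.map_smul a ⟨x, hx⟩

/-- The point spectrum: the set of eigenvalues. -/
def pointSpectrum (H : E →ₗ.[ℂ] E) : Set ℂ := {z | eigenspace H z ≠ ⊥}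

/-- The discrete spectrum: isolated points of the spectrum that are eigenvalues of finite
multiplicity. -/
def discreteSpectrum (H : E →ₗ.[ℂ] E) : Set ℂ :=
  {z | eigenspace H z ≠ ⊥ ∧ FiniteDimensional ℂ (eigenspace H z) ∧
    ∃ ε > 0, spec H ∩ Metric.ball z ε = {z}}

/-- The essential spectrum (of a self-adjoint operator). -/
def essentialSpectrum (H : E →ₗ.[ℂ] E) : Set ℂ := spec H \ discreteSpectrum H

/-- `μ` is the spectral measure of the self-adjoint operator `H` at the vector `x`: the finite Borel
measure on `ℝ` with `⟨x, (H - z)⁻¹ x⟩ = ∫ (t - z)⁻¹ dμ(t)` for all nonreal `z`. -/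
def IsSpectralMeasure (H : E →ₗ.[ℂ] E) (x : E) (μ : Measure ℝ) : Prop :=
  IsFiniteMeasure μ ∧ ∀ z : ℂ, z.im ≠ 0 →
    ∃ R : E →L[ℂ] E, IsResolventAt H z R ∧ inner ℂ x (R x) = ∫ t : ℝ, ((t : ℂ) - z)⁻¹ ∂μ

/-- The absolutely continuous subspace of `H`, consisting of the vectors with absolutely continuous
spectral measure. (These vectors already form a closed subspace when `H` is self-adjoint; span and
closure only package this.) -/
def acSubspace (H : E →ₗ.[ℂ] E) : Submodule ℂ E :=
  (Submodule.span ℂ {x : E | ∃ μ : Measure ℝ, IsSpectralMeasure H x μ ∧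
    μ ≪ (volume : Measure ℝ)}).topologicalClosure

/-- The singular continuous subspace of `H`, consisting of the vectors whose spectral measure has no
atoms and is singular with respect to the Lebesgue measure. -/
def scSubspace (H : E →ₗ.[ℂ] E) : Submodule ℂ E :=
  (Submodule.span ℂ {x : E | ∃ μ : Measure ℝ, IsSpectralMeasure H x μ ∧
    (∀ t, μ {t} = 0) ∧ μ ⟂ₘ (volume : Measure ℝ)}).topologicalClosure

/-- The part of `H` in a subspace `K`: its restriction to `{x ∈ D(H) ∩ K | H x ∈ K}`, as an operator
in `K`. -/
def partOn (H : E →ₗ.[ℂ] E) (K : Submodule ℂ E) : K →ₗ.[ℂ] K where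
  domain :=
    { carrier := {x | ∃ h : (x : E) ∈ H.domain, H ⟨x, h⟩ ∈ K}
      zero_mem' := ⟨H.domain.zero_mem, by
        have h : H ⟨((0 : K) : E), H.domain.zero_mem⟩ = 0 := H.map_zero
        rw [h]; exact K.zero_mem⟩
      add_mem' := by
        rintro x y ⟨hx, hx'⟩ ⟨hy, hy'⟩
        refine ⟨H.domain.add_mem hx hy, ?_⟩
        have h : H ⟨((x + y : K) : E), H.domain.add_mem hx hy⟩ = H ⟨x, hx⟩ + H ⟨y, hy⟩ :=
          H.map_add ⟨x, hx⟩ ⟨y, hy⟩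
        rw [h]; exact K.add_mem hx' hy'
      smul_mem' := by
        rintro a x ⟨hx, hx'⟩
        refine ⟨H.domain.smul_mem a hx, ?_⟩
        have h : H ⟨((a • x : K) : E), H.domain.smul_mem a hx⟩ = a • H ⟨x, hx⟩ :=
          H.map_smul a ⟨x, hx⟩
        rw [h]; exact K.smul_mem a hx' }
  toFun :=
    { toFun := fun x => ⟨H ⟨((x : K) : E), x.2.1⟩, x.2.2⟩
      map_add' := fun x y => Subtype.ext
        (H.map_add ⟨((x : K) : E), x.2.1⟩ ⟨((y : K) : E), y.2.1⟩)
      map_smul' := fun a x => Subtype.ext (H.map_smul a ⟨((x : K) : E), x.2.1⟩) }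

/-- The absolutely continuous spectrum. -/
def acSpectrum (H : E →ₗ.[ℂ] E) : Set ℂ := spec (partOn H (acSubspace H))

/-- The singular continuous spectrum. -/
def scSpectrum (H : E →ₗ.[ℂ] E) : Set ℂ := spec (partOn H (scSubspace H))

/-- Convergence of the operators `H i` to `H'` in norm resolvent sense along the filter `l`: for
every nonreal `z` the resolvents at `z` exist and converge in operator norm. -/
def NormResolventTendsto {ι : Type*} (H : ι → E →ₗ.[ℂ] E) (l : Filter ι) (H' : E →ₗ.[ℂ] E) :
    Prop :=
  ∀ z : ℂ, z.im ≠ 0 → ∃ (R : ι → E →L[ℂ] E) (R' : E →L[ℂ] E),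
    (∀ᶠ i in l, IsResolventAt (H i) z (R i)) ∧ IsResolventAt H' z R' ∧ Tendsto R l (𝓝 R')

/-- `A` belongs to the form domain of the lower semibounded self-adjoint operator `H`, and its
quadratic form takes the value `v` at `A`. The form is the closure of `u ↦ ⟨u, H u⟩` on `D(H)`:
there are `uₙ ∈ D(H)` that converge to `A`, are Cauchy for the form, and `⟨uₙ, H uₙ⟩ → v`. -/
def HasFormValue (H : E →ₗ.[ℂ] E) (A : E) (v : ℝ) : Prop :=
  ∃ u : ℕ → H.domain, Tendsto (fun n => (u n : E)) atTop (𝓝 A) ∧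
    (∀ ε > 0, ∃ N, ∀ n ≥ N, ∀ k ≥ N,
      |(inner ℂ ((u n - u k : H.domain) : E) (H (u n - u k))).re| < ε) ∧
    Tendsto (fun n => (inner ℂ (u n : E) (H (u n))).re) atTop (𝓝 v)

end Operators

/-! ### Vector fields on `ℝ³` -/

/-- Physical space. -/
abbrev R3 : Type := EuclideanSpace ℝ (Fin 3)

/-- The complexification of `ℝ³`, in which the fields and the charges take their values. -/
abbrev C3 : Type := EuclideanSpace ℂ (Fin 3)

/-- Square integrable vector fields. -/
abbrev L2 : Type := Lp C3 2 (volume : Measure R3)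

/-- An `L²` field as a tempered distribution. -/
abbrev asDist (A : L2) : 𝓢'(R3, C3) := Lp.toTemperedDistribution A

/-- The `i`-th standard unit vector of `ℝ³`. -/
abbrev unitVec (i : Fin 3) : R3 := EuclideanSpace.single i 1

/-- Divergence-free square integrable fields: `∫ ∇φ · A = 0` for every Schwartz function `φ`, that
is `div A = 0` in the sense of tempered distributions. -/
def L2star : Submodule ℂ L2 where
  carrier := {A | ∀ φ : 𝓢(R3, ℂ), ∑ i, asDist A (∂_{unitVec i} φ) i = 0}
  zero_mem' := by
    intro φ
    have h : asDist 0 = 0 := map_zero (Lp.toTemperedDistributionCLM C3 (volume : Measure R3) 2)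
    simp [h]
  add_mem' := by
    intro A B hA hB φ
    have h : asDist (A + B) = asDist A + asDist B :=
      map_add (Lp.toTemperedDistributionCLM C3 (volume : Measure R3) 2) A B
    have := congrArg₂ (· + ·) (hA φ) (hB φ)
    simpa [h, Finset.sum_add_distrib] using this
  smul_mem' := by
    intro a A hA φ
    have h : asDist (a • A) = a • asDist A :=
      map_smul (Lp.toTemperedDistributionCLM C3 (volume : Measure R3) 2) a A
    have := congrArg (a * ·) (hA φ)
    simpa [h, Finset.mul_sum] using this

theorem isClosed_L2star : IsClosed (L2star : Set L2) := by
  have h : (L2star : Set L2) =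
      ⋂ φ : 𝓢(R3, ℂ), {A : L2 | ∑ i, asDist A (∂_{unitVec i} φ) i = 0} := by
    ext A
    simp only [Set.mem_iInter, Set.mem_ofPred_eq]
    exact Iff.rfl
  rw [h]
  refine isClosed_iInter fun φ => isClosed_eq ?_ continuous_const
  refine continuous_finsetSum _ fun i _ => ?_
  have h1 : Continuous fun A : L2 => asDist A (∂_{unitVec i} φ) :=
    (PointwiseConvergenceCLM.evalCLM (RingHom.id ℂ) C3 (∂_{unitVec i} φ)).continuous.comp
      (Lp.toTemperedDistributionCLM C3 (volume : Measure R3) 2).continuous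
  exact (EuclideanSpace.proj i : C3 →L[ℂ] ℂ).continuous.comp h1

instance instCompleteSpaceL2star : CompleteSpace L2star := isClosed_L2star.completeSpace_coe

/-- The projection `M` of `L²` onto the divergence-free fields. -/
def M : L2 →L[ℂ] L2star := L2star.orthogonalProjectionOnto

open Classical in
/-- The `L²` class of a function (`0` if the function is not square integrable). -/
def toL2 (f : R3 → C3) : L2 := if h : MemLp f 2 volume then h.toLp f else 0

/-- The divergence-free fields of Sobolev class `H^s`. -/
def Hstar (s : ℝ) : Submodule ℂ L2star where
  carrier := {A | TemperedDistribution.MemSobolev s 2 (asDist (A : L2))}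
  zero_mem' := by
    have h : asDist ((0 : L2star) : L2) = 0 :=
      map_zero (Lp.toTemperedDistributionCLM C3 (volume : Measure R3) 2)
    simp only [Set.mem_ofPred_eq, h]
    exact TemperedDistribution.memSobolev_fun_zero R3 C3 s 2
  add_mem' := by
    intro A B hA hB
    have h : asDist ((A + B : L2star) : L2) = asDist (A : L2) + asDist (B : L2) :=
      map_add (Lp.toTemperedDistributionCLM C3 (volume : Measure R3) 2) (A : L2) (B : L2)
    simp only [Set.mem_ofPred_eq, h]
    exact TemperedDistribution.MemSobolev.add hA hB
  smul_mem' := by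
    intro a A hA
    have h : asDist ((a • A : L2star) : L2) = a • asDist (A : L2) :=
      map_smul (Lp.toTemperedDistributionCLM C3 (volume : Measure R3) 2) a (A : L2)
    simp only [Set.mem_ofPred_eq, h]
    exact TemperedDistribution.MemSobolev.smul a hA

theorem laplacian_lineDeriv_comm (φ : 𝓢(R3, ℂ)) (v : R3) : Δ (∂_{v} φ) = ∂_{v} (Δ φ) := by
  have h1 : Function.HasTemperateGrowth (fun x : R3 => inner ℝ x v) := by fun_prop
  have h2 : Function.HasTemperateGrowth (fun x : R3 => ‖x‖ ^ 2) := by fun_prop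
  have e1 : ∀ a : ℂ, ∀ ψ : 𝓢(R3, ℂ), Δ (a • ψ) = a • Δ ψ := fun a ψ => by
    simp only [← SchwartzMap.laplacianCLM_eq (𝕜 := ℂ), map_smul]
  have e2 : ∀ a : ℝ, ∀ ψ : 𝓢(R3, ℂ), ∂_{v} (a • ψ) = a • ∂_{v} ψ := fun a ψ =>
    LineDeriv.lineDerivOp_smul v a ψ
  rw [SchwartzMap.lineDeriv_eq_fourierMultiplierCLM v φ, e1,
    SchwartzMap.laplacian_eq_fourierMultiplierCLM, SchwartzMap.laplacian_eq_fourierMultiplierCLM,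
    e2, SchwartzMap.lineDeriv_eq_fourierMultiplierCLM,
    SchwartzMap.fourierMultiplierCLM_fourierMultiplierCLM_apply h1 h2,
    SchwartzMap.fourierMultiplierCLM_fourierMultiplierCLM_apply h2 h1,
    mul_comm (fun x : R3 => ‖x‖ ^ 2), smul_comm]

theorem exists_neg_laplacian (A : Hstar 2) :
    ∃ B : L2star, asDist (B : L2) = -Δ (asDist ((A : L2star) : L2)) := by
  have hA : TemperedDistribution.MemSobolev 2 2 (asDist ((A : L2star) : L2)) := A.2
  have h := hA.laplacian
  rw [show (2 : ℝ) - 2 = 0 by norm_num, TemperedDistribution.memSobolev_zero_iff] at h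
  obtain ⟨f, hf⟩ := h
  have hn : asDist (-f) = -asDist f :=
    map_neg (Lp.toTemperedDistributionCLM C3 (volume : Measure R3) 2) f
  have hB : asDist (-f) = -Δ (asDist ((A : L2star) : L2)) := by rw [hf]; exact hn
  refine ⟨⟨-f, fun φ => ?_⟩, hB⟩
  have h3 : ∀ i, asDist (-f) (∂_{unitVec i} φ) i
      = -(asDist ((A : L2star) : L2) (∂_{unitVec i} (Δ φ)) i) := by
    intro i
    have h4 : asDist (-f) (∂_{unitVec i} φ)
        = -(asDist ((A : L2star) : L2) (∂_{unitVec i} (Δ φ))) := by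
      rw [hB, ← laplacian_lineDeriv_comm, ← TemperedDistribution.laplacian_apply_apply]
      rfl
    rw [h4]; rfl
  rw [Finset.sum_congr rfl fun i _ => h3 i, Finset.sum_neg_distrib,
    (A : L2star).2 (Δ φ), neg_zero]

theorem asDist_injective : Function.Injective asDist :=
  LinearMap.ker_eq_bot.mp
    (Lp.ker_toTemperedDistributionCLM_eq_bot (F := C3) (μ := (volume : Measure R3)) (p := 2))

/-- The free operator `-Δ` on divergence-free fields, with domain `H²`. -/
def negLaplacian : L2star →ₗ.[ℂ] L2star where
  domain := Hstar 2
  toFun :=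
    { toFun := fun A => (exists_neg_laplacian A).choose
      map_add' := by
        intro A B
        apply Subtype.ext
        apply asDist_injective
        have hadd : ∀ X Y : L2, asDist (X + Y) = asDist X + asDist Y :=
          map_add (Lp.toTemperedDistributionCLM C3 (volume : Measure R3) 2)
        have hL : ∀ S T : 𝓢'(R3, C3), Δ (S + T) = Δ S + Δ T := fun S T => by
          simp only [← TemperedDistribution.laplacianCLM_apply, map_add]
        rw [(exists_neg_laplacian (A + B)).choose_spec]
        simp only [Submodule.coe_add, hadd, (exists_neg_laplacian A).choose_spec,
          (exists_neg_laplacian B).choose_spec, hL]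
        abel
      map_smul' := by
        intro a A
        apply Subtype.ext
        apply asDist_injective
        have hsm : ∀ X : L2, asDist (a • X) = a • asDist X :=
          map_smul (Lp.toTemperedDistributionCLM C3 (volume : Measure R3) 2) a
        have hL : ∀ S : 𝓢'(R3, C3), Δ (a • S) = a • Δ S := fun S => by
          simp only [← TemperedDistribution.laplacianCLM_apply, map_smul]
        rw [(exists_neg_laplacian (a • A)).choose_spec]
        simp only [Submodule.coe_smul, hsm, (exists_neg_laplacian A).choose_spec, hL,
          RingHom.id_apply, smul_neg] }

theorem negLaplacian_spec (A : negLaplacian.domain) :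
    asDist (negLaplacian A : L2) = -Δ (asDist ((A : L2star) : L2)) :=
  (exists_neg_laplacian A).choose_spec

/-- `B = (-Δ + λ)^{1/2} A`, through the symbol `(4π²|k|² + λ)^{1/2}`
(the Fourier transform being `∫ e^{-2πi k·x} f(x) dx`). -/
def IsSqrtFree (lam : ℝ) (A : L2star) (B : L2) : Prop :=
  asDist B = TemperedDistribution.fourierMultiplierCLM C3
    (fun k : R3 => ((Real.sqrt (4 * Real.pi ^ 2 * ‖k‖ ^ 2 + lam) : ℝ) : ℂ)) (asDist (A : L2))

/-! ### The regularized operators -/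

/-- The electrostatic energy `E(ρ)`. -/
def energy (ρ : R3 → ℝ) : ℝ := 1 / (4 * Real.pi) * ∫ x, ∫ y, ρ x * ρ y / ‖x - y‖

/-- The rescaled density `ρ_r(x) = r⁻³ ρ(r⁻¹ x)`. -/
def rescale (ρ : R3 → ℝ) (r : ℝ) (x : R3) : ℝ := (r ^ 3)⁻¹ * ρ (r⁻¹ • x)

/-- The renormalized mass `m_r = m - (8πe²/3c²) E(ρ_r)`. -/
def renMass (e c m : ℝ) (ρ : R3 → ℝ) (r : ℝ) : ℝ :=
  m - 8 * Real.pi * e ^ 2 / (3 * c ^ 2) * energy (rescale ρ r)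

/-- The operator `ρ ⊗ ρ` on `L²`, `A ↦ ρ ⟨ρ, A⟩` with `⟨ρ, A⟩ = ∫ ρ A` a vector. With `ρ_j = ρ e_j`
it reads `A ↦ ∑ⱼ ⟨ρ_j, A⟩ ρ_j`. -/
def rhoTensor (ρ : R3 → ℝ) : L2 →ₗ[ℂ] L2 where
  toFun A := ∑ j : Fin 3, (inner ℂ (toL2 fun x => (ρ x : ℂ) • EuclideanSpace.single j 1) A : ℂ) •
    toL2 fun x => (ρ x : ℂ) • EuclideanSpace.single j 1
  map_add' A B := by simp [inner_add_right, add_smul, Finset.sum_add_distrib]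
  map_smul' a A := by simp [inner_smul_right, mul_smul, Finset.smul_sum]

/-- The regularized operator `H_r = -Δ + (4πe²/(m_r c²)) M · ρ_r ⊗ ρ_r` on divergence-free fields,
with domain `H²`. -/
def Hreg (e c m : ℝ) (ρ : R3 → ℝ) (r : ℝ) : L2star →ₗ.[ℂ] L2star :=
  (((4 * Real.pi * e ^ 2 / (renMass e c m ρ r * c ^ 2) : ℝ) : ℂ) •
    (M.toLinearMap ∘ₗ rhoTensor (rescale ρ r) ∘ₗ L2star.subtype)) +ᵥ negLaplacian

/-- `ρ_r` converges weakly to `δ₀` as `r ↓ 0`. -/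
def WeaklyTendstoDelta (ρ : R3 → ℝ) : Prop :=
  ∀ f : BoundedContinuousFunction R3 ℝ,
    Tendsto (fun r => ∫ x, rescale ρ r x * f x) (𝓝[>] 0) (𝓝 (f 0))

/-! ### The point interaction -/

/-- `G_λ(x) = e^{-√λ |x|} / (4π |x|)`, for `λ ≥ 0`. -/
def green (lam : ℝ) (x : R3) : ℝ := Real.exp (-Real.sqrt lam * ‖x‖) / (4 * Real.pi * ‖x‖)

/-- The field `M Q G_λ`, for `λ > 0` (when `G_λ` is square integrable). -/
def MQG (lam : ℝ) (Q : C3) : L2star := M (toL2 fun x => (green lam x : ℂ) • Q)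

/-- The regular part `A_λ = A - (4πe/c) M Q G_λ`. -/
def regPart (e c lam : ℝ) (A : L2star) (Q : C3) : L2star :=
  A - ((4 * Real.pi * e / c : ℝ) : ℂ) • MQG lam Q

/-- `Γ_m(λ) = -mc²/(4πe²) + √λ/(6π)`. -/
def GammaM (e c m lam : ℝ) : ℝ :=
  -(m * c ^ 2) / (4 * Real.pi * e ^ 2) + Real.sqrt lam / (6 * Real.pi)

/-- `λ₀ = (3mc²/2e²)²`. -/
def lam0 (e c m : ℝ) : ℝ := (3 * m * c ^ 2 / (2 * e ^ 2)) ^ 2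

/-- The tempered distribution `T` is (integration against) the function `f`. -/
def IsFunction (T : 𝓢'(R3, C3)) (f : R3 → C3) : Prop :=
  ∀ φ : 𝓢(R3, ℂ), Integrable (fun x => φ x • f x) volume ∧ T φ = ∫ x, φ x • f x

/-- The component of `w ∈ ℂ³` orthogonal to `k ∈ ℝ³`: `w - (k · w / |k|²) k`. -/
def transverse (k : R3) (w : C3) : C3 :=
  WithLp.toLp 2 fun i => w i - (∑ j, (k j : ℂ) * w j) / ((‖k‖ ^ 2 : ℝ) : ℂ) * (k i : ℂ)

/-- `g = M f` for fields that need not be square integrable: `f` and `g` are tempered, the Fourier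
transform of `f` is a function `F`, and that of `g` is the function `k ↦ F(k) - (k·F(k)/|k|²) k`.
On `L²` this is the orthogonal projection onto the divergence-free fields. It is needed because the
function `G₀(x) = 1/(4π|x|)` is not square integrable. -/
def IsDivFreeProjection (f g : R3 → C3) : Prop :=
  ∃ (S T : 𝓢'(R3, C3)) (F : R3 → C3), IsFunction S f ∧ IsFunction T g ∧
    IsFunction (𝓕 S) F ∧ IsFunction (𝓕 T) fun k => transverse k (F k)

/-- `S r` is the mean `(1/4πr²) ∫_{S_r} f dμ_r` of `f` over the sphere of radius `r`. Since `f` is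
only determined almost everywhere, its means are determined for almost every `r`; `S` is their
continuous representative. -/
def HasSphereMeans (f : R3 → C3) (S : ℝ → C3) : Prop :=
  ContinuousOn S (Ioi 0) ∧ ∀ᵐ r : ℝ, 0 < r →
    Integrable (fun ω : Metric.sphere (0 : R3) 1 => f (r • (ω : R3)))
      (volume : Measure R3).toSphere ∧
    S r = ((4 * Real.pi)⁻¹ : ℝ) •
      ∫ ω : Metric.sphere (0 : R3) 1, f (r • (ω : R3)) ∂(volume : Measure R3).toSphere

/-- The boundary condition
`lim_{r↓0} (1/4πr²) ∫_{S_r} (A - (4πe/c) M Q G₀) dμ_r = -(mc/e) Q`. -/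
def BoundaryCondition (e c m : ℝ) (A : L2star) (Q : C3) : Prop :=
  ∃ (W : R3 → C3) (S : ℝ → C3),
    IsDivFreeProjection (fun x => (green 0 x : ℂ) • Q) W ∧
    HasSphereMeans (fun x => (A : L2) x - ((4 * Real.pi * e / c : ℝ) : ℂ) • W x) S ∧
    Tendsto S (𝓝[>] 0) (𝓝 (-((m * c / e : ℝ) : ℂ) • Q))

/-- The field takes real values. -/
def IsRealField (A : L2) : Prop := ∀ᵐ x, ∀ i, (A x i).im = 0

end PointCharge

end

noncomputable section

namespace PointCharge

/-! ### Tempered distributions given by functions -/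

/-! In Fourier space the divergence-free fields are those with k · `hat A k` = 0 (`mem_L2star_iff`),
−Δ is multiplication by `tau`, and M Q G_λ has the transform (τ + λ)⁻¹ times the transverse part of
Q. Averaging the transverse projection over directions gives the factor 2/3, whence ⟨M Q G_λ, M Q'
G_μ⟩ = ⟨Q, Q'⟩ / (6π(√λ + √μ)) (`inner_MQG_MQG`). This Cauchy kernel in the decay rates carries both
the spectral analysis and the quadratic form.

Let g_λ be the map Q ↦ M Q G_λ (`chargeMap`). If A_λ = (−Δ + λ)⁻¹ f, then A − (4πe/c) M Q G₀ is
continuous, and its value at the origin turns the boundary condition into g_λ† f = (4πe/c) Γ_m(λ) Q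
(`boundaryCondition_iff`). So H_m has to be the operator with resolvent (−Δ + w)⁻¹ + Γ_m(w)⁻¹ g_w
g_w† at −w, and w = 4λ₀ makes Γ_m(w) positive. The resolvent identity carries domain and action to
every λ. This resolvent factors as j j† with j(b, q) = (−Δ + w)^{-1/2} b + Γ_m(w)^{-1/2} g_w q, so
the form norm of A is the norm of its preimage under j (`hasFormValue_iff`). The map j is injective
because A determines its charge: r times the spherical mean tends to 0 for an H¹ field and to Q/(6π)
for M Q G_λ.

Convergence rests on a Krein formula: the resolvent of H_r at −λ is (−Δ + λ)⁻¹ − d_r⁻¹ X_r X_r†,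
where X_r → g_λ in norm. In Fourier space E(ρ) is ∫ |ρ̂|²/τ (`IsDensity.energy_eq_add`), so the
divergence of d_r is cancelled by the renormalized mass and d_r → −Γ_m(λ) (`tendsto_regCoupling`).

For the spectrum put a = √λ₀ and G_s = g_{s²}. The bound states are the G_a Q. Off them, the vectors
x_s = (a + s) G_s Q − 2a G_a Q and y_s = (a² − s²)(−Δ + a²)^{-1/2} G_s Q have the same Gram matrix,
and the resolvent of H_m acts on the x_s exactly as the free one acts on the y_s. Hence x_s ↦ y_s
extends to an intertwining partial isometry, while vectors orthogonal to the bound states and to all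
x_s carry no charge, and there the two resolvents agree (`exists_diagonalization_cauchyRes`). A
spectral measure of H_m is therefore a point mass at −λ₀ plus spectral measures of −Δ, which are
absolutely continuous. Explicit approximate eigenvectors without charge show that all of [0, ∞) is
reached (`exists_weyl`). -/

theorem integrable_smul_of_memLp {F : Type*} [NormedAddCommGroup F] [NormedSpace ℂ F]
    {f : R3 → F} (hf : MemLp f 2 volume) (φ : 𝓢(R3, ℂ)) : Integrable fun x => φ x • f x := by
  have := MemLp.smul (p := 2) (q := 2) (r := 1) hf (φ.memLp 2 volume)
  exact memLp_one_iff_integrable.1 this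

/-- Smooth functions of compact support are Schwartz functions, so the fundamental lemma of the
calculus of variations applies. Local integrability comes from testing against a bump equal to 1
near the given point. -/
theorem ae_eq_zero_of_schwartz {F : Type*} [NormedAddCommGroup F] [NormedSpace ℂ F]
    [CompleteSpace F] {f : R3 → F} (hf : ∀ φ : 𝓢(R3, ℂ), Integrable fun x => φ x • f x)
    (h : ∀ φ : 𝓢(R3, ℂ), ∫ x, φ x • f x = 0) : f =ᵐ[volume] 0 := by
  have toS : ∀ g : R3 → ℝ, ContDiff ℝ (⊤ : ℕ∞) g → HasCompactSupport g →
      ∃ φ : 𝓢(R3, ℂ), ∀ x, φ x = (g x : ℂ) := by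
    intro g g1 g2
    have h₁ : HasCompactSupport (Complex.ofRealCLM ∘ g) := g2.comp_left rfl
    have h₂ : ContDiff ℝ (⊤ : ℕ∞) (Complex.ofRealCLM ∘ g) := by fun_prop
    exact ⟨h₁.toSchwartzMap h₂, fun x => by simp⟩
  have hloc : LocallyIntegrable f volume := by
    intro x
    obtain ⟨g, hg⟩ : ∃ g : ContDiffBump x, g.rIn = 1 :=
      ⟨⟨1, 2, one_pos, one_lt_two⟩, rfl⟩
    obtain ⟨φ, hφ⟩ := toS g g.contDiff g.hasCompactSupport
    refine ⟨Metric.closedBall x 1, Metric.closedBall_mem_nhds x one_pos, ?_⟩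
    refine ((hf φ).integrableOn (s := Metric.closedBall x 1)).congr ?_
    filter_upwards [ae_restrict_mem measurableSet_closedBall] with y hy
    rw [hφ, g.one_of_mem_closedBall (by rwa [hg])]
    simp
  refine ae_eq_zero_of_integral_contDiff_smul_eq_zero hloc fun g g1 g2 => ?_
  obtain ⟨φ, hφ⟩ := toS g g1 g2
  rw [← h φ]
  refine integral_congr_ae (Eventually.of_forall fun x => ?_)
  simp only [hφ, Complex.coe_smul]

theorem IsFunction.ae_eq {T : 𝓢'(R3, C3)} {f g : R3 → C3} (hf : IsFunction T f)
    (hg : IsFunction T g) : f =ᵐ[volume] g := by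
  have := ae_eq_zero_of_schwartz (f := fun x => f x - g x)
    (fun φ => by simp only [smul_sub]; exact (hf φ).1.sub (hg φ).1) fun φ => by
      simp only [smul_sub]
      rw [integral_sub (hf φ).1 (hg φ).1, ← (hf φ).2, ← (hg φ).2, sub_self]
  filter_upwards [this] with x hx
  exact sub_eq_zero.1 hx

theorem IsFunction.congr {T : 𝓢'(R3, C3)} {f g : R3 → C3} (hf : IsFunction T f)
    (h : f =ᵐ[volume] g) : IsFunction T g := by
  intro φ
  have h' : (fun x => φ x • f x) =ᵐ[volume] fun x => φ x • g x := by
    filter_upwards [h] with x hx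
    rw [hx]
  exact ⟨(hf φ).1.congr h', (hf φ).2.trans (integral_congr_ae h')⟩

theorem IsFunction.unique {S T : 𝓢'(R3, C3)} {f : R3 → C3} (hS : IsFunction S f)
    (hT : IsFunction T f) : S = T := by
  ext1 φ
  rw [(hS φ).2, (hT φ).2]

theorem isFunction_asDist (A : L2) : IsFunction (asDist A) A := fun φ =>
  ⟨integrable_smul_of_memLp (Lp.memLp A) φ, Lp.toTemperedDistribution_apply A φ⟩

theorem isFunction_fourier (A : L2) : IsFunction (𝓕 (asDist A)) (𝓕 A : L2) := by
  rw [asDist, Lp.fourier_toTemperedDistribution_eq]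
  exact isFunction_asDist _

theorem IsFunction.smulLeft {T : 𝓢'(R3, C3)} {f : R3 → C3} (hf : IsFunction T f)
    {g : R3 → ℂ} (hg : g.HasTemperateGrowth) :
    IsFunction (TemperedDistribution.smulLeftCLM C3 g T) fun x => g x • f x := by
  intro φ
  have h : ∀ x, SchwartzMap.smulLeftCLM ℂ g φ x • f x = φ x • g x • f x := fun x => by
    rw [SchwartzMap.smulLeftCLM_apply_apply hg, smul_smul, smul_eq_mul, mul_comm]
  have h2 := hf (SchwartzMap.smulLeftCLM ℂ g φ)
  simp only [h] at h2
  exact h2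

theorem IsFunction.eq_asDist {T : 𝓢'(R3, C3)} {f : R3 → C3} (hf : IsFunction T f)
    (h : MemLp f 2 volume) : T = asDist (h.toLp f) :=
  hf.unique ((isFunction_asDist _).congr h.coeFn_toLp)

theorem toL2_eq {f : R3 → C3} (h : MemLp f 2 volume) : toL2 f = h.toLp f := by
  rw [toL2, dif_pos h]

theorem coeFn_toL2 {f : R3 → C3} (h : MemLp f 2 volume) : toL2 f =ᵐ[volume] f := by
  rw [toL2_eq h]
  exact h.coeFn_toLp

/-! ### Sobolev classes and multipliers on the Fourier side -/

/-- The bridge from distributions to functions of k: through it Sobolev classes, −Δ and (−Δ +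
λ)^{1/2} become almost everywhere identities between Plancherel transforms. -/
theorem exists_multiplier_iff {g : R3 → ℂ} (hg : g.HasTemperateGrowth) (A B : L2) :
    asDist B = TemperedDistribution.fourierMultiplierCLM C3 g (asDist A) ↔
      (𝓕 B : L2) =ᵐ[volume] fun k => g k • (𝓕 A : L2) k := by
  have h1 : asDist B = TemperedDistribution.fourierMultiplierCLM C3 g (asDist A) ↔
      𝓕 (asDist B) = TemperedDistribution.smulLeftCLM C3 g (𝓕 (asDist A)) := by
    rw [TemperedDistribution.fourierMultiplierCLM_apply]
    constructor
    · intro h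
      rw [h, FourierTransform.fourier_fourierInv_eq]
    · intro h
      rw [← h, FourierTransform.fourierInv_fourier_eq]
  rw [h1]
  have h2 := (isFunction_fourier A).smulLeft hg
  constructor
  · intro h
    have h3 := isFunction_fourier B
    rw [h] at h3
    exact h3.ae_eq h2
  · intro h
    exact (isFunction_fourier B).unique (h2.congr h.symm)

theorem memSobolev_iff (s : ℝ) (A : L2) : TemperedDistribution.MemSobolev s 2 (asDist A) ↔
    MemLp (fun k => ((((1 + ‖k‖ ^ 2) ^ (s / 2) : ℝ)) : ℂ) • (𝓕 A : L2) k) 2 volume := by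
  have hg : (fun k : R3 => ((((1 + ‖k‖ ^ 2) ^ (s / 2) : ℝ)) : ℂ)).HasTemperateGrowth := by fun_prop
  have h1 : TemperedDistribution.MemSobolev s 2 (asDist A) ↔ ∃ B : L2,
      asDist B = TemperedDistribution.fourierMultiplierCLM C3
        (fun k : R3 => ((((1 + ‖k‖ ^ 2) ^ (s / 2) : ℝ)) : ℂ)) (asDist A) :=
    ⟨fun ⟨B, hB⟩ => ⟨B, hB.symm⟩, fun ⟨B, hB⟩ => ⟨B, hB.symm⟩⟩
  rw [h1]
  constructor
  · rintro ⟨B, hB⟩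
    exact (memLp_congr_ae ((exists_multiplier_iff hg A B).1 hB)).1 (Lp.memLp _)
  · intro h
    refine ⟨𝓕⁻ (h.toLp _), (exists_multiplier_iff hg A _).2 ?_⟩
    rw [FourierTransform.fourier_fourierInv_eq]
    exact h.coeFn_toLp

/-- The symbol `4π²|k|²` of `-Δ`. -/
def tau (k : R3) : ℝ := 4 * Real.pi ^ 2 * ‖k‖ ^ 2

theorem tau_nonneg (k : R3) : 0 ≤ tau k := by unfold tau; positivity

theorem continuous_tau : Continuous tau := by unfold tau; fun_prop

theorem hasTemperateGrowth_tau : (fun k => (tau k : ℂ)).HasTemperateGrowth := by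
  unfold tau
  fun_prop

theorem neg_laplacian_eq (T : 𝓢'(R3, C3)) :
    -Δ T = TemperedDistribution.fourierMultiplierCLM C3 (fun k => (tau k : ℂ)) T := by
  have hg : (fun k : R3 => ((‖k‖ ^ 2 : ℝ) : ℂ)).HasTemperateGrowth := by fun_prop
  have h : (fun k => (tau k : ℂ)) =
      ((4 * Real.pi ^ 2 : ℝ) : ℂ) • (fun k : R3 => ((‖k‖ ^ 2 : ℝ) : ℂ)) := by
    ext k
    simp [tau]
  rw [h, TemperedDistribution.fourierMultiplierCLM_smul hg,
    TemperedDistribution.laplacian_eq_fourierMultiplierCLM]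
  rw [← Complex.coe_smul, ← neg_smul]
  simp only [smul_apply]
  congr 1
  push_cast
  ring

theorem fourier_negLaplacian (A : negLaplacian.domain) :
    (𝓕 (negLaplacian A : L2) : L2) =ᵐ[volume]
      fun k => (tau k : ℂ) • (𝓕 ((A : L2star) : L2) : L2) k := by
  rw [← exists_multiplier_iff hasTemperateGrowth_tau, negLaplacian_spec, neg_laplacian_eq]

/-- The symbol is √λ times the dilate by 2π/√λ of (1 + |x|²)^{1/2}. -/
theorem hasTemperateGrowth_sqrt {lam : ℝ} (hl : 0 < lam) :
    (fun k : R3 => ((Real.sqrt (4 * Real.pi ^ 2 * ‖k‖ ^ 2 + lam) : ℝ) : ℂ)).HasTemperateGrowth := by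
  have h1 : (fun x : R3 => (1 + ‖x‖ ^ 2) ^ (1 / 2 : ℝ)).HasTemperateGrowth := by fun_prop
  have h2 : (fun k : R3 => (2 * Real.pi / Real.sqrt lam) • k).HasTemperateGrowth := by fun_prop
  have h3 := h1.comp h2
  have h4 : (fun k : R3 => ((Real.sqrt (4 * Real.pi ^ 2 * ‖k‖ ^ 2 + lam) : ℝ) : ℂ)) =
      fun k => Complex.ofReal (Real.sqrt lam *
        ((fun x : R3 => (1 + ‖x‖ ^ 2) ^ (1 / 2 : ℝ)) ∘
          fun k : R3 => (2 * Real.pi / Real.sqrt lam) • k) k) := by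
    ext k
    congr 1
    simp only [Function.comp]
    rw [← Real.sqrt_eq_rpow, ← Real.sqrt_mul hl.le, norm_smul, mul_pow, Real.norm_eq_abs, sq_abs,
      div_pow, Real.sq_sqrt hl.le]
    congr 1
    field_simp
    ring
  rw [h4]
  fun_prop

theorem isSqrtFree_iff {lam : ℝ} (hl : 0 < lam) (A : L2star) (B : L2) :
    IsSqrtFree lam A B ↔ (𝓕 B : L2) =ᵐ[volume]
      fun k => ((Real.sqrt (tau k + lam) : ℝ) : ℂ) • (𝓕 (A : L2) : L2) k :=
  exists_multiplier_iff (hasTemperateGrowth_sqrt hl) A B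

/-! ### Divergence-free fields on the Fourier side -/

/-- The bilinear product `k · w`. -/
def dotC (k : R3) (w : C3) : ℂ := ∑ j, (k j : ℂ) * w j

theorem inner_unitVec (k : R3) (i : Fin 3) : inner ℝ k (unitVec i) = k i := by
  rw [unitVec, EuclideanSpace.inner_single_right]
  simp

theorem hasTemperateGrowth_coord (i : Fin 3) :
    Function.HasTemperateGrowth (fun k : R3 => ((k i : ℝ) : ℂ)) := by
  have : (fun k : R3 => ((k i : ℝ) : ℂ)) = fun k => ((inner ℝ k (unitVec i) : ℝ) : ℂ) := by
    ext k
    rw [inner_unitVec]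
  rw [this]
  fun_prop

/-- Every test function is 𝓕ψ for some ψ, and differentiating 𝓕ψ along the i-th axis multiplies ψ by
−2πi kᵢ. The divergence condition thus says that k · Â pairs to zero with every ψ. -/
theorem mem_L2star_iff (A : L2) : A ∈ L2star ↔ ∀ᵐ k, dotC k ((𝓕 A : L2) k) = 0 := by
  have key : ∀ ψ : 𝓢(R3, ℂ), ∑ i, asDist A (∂_{unitVec i} (𝓕 ψ)) i =
      -(2 * Real.pi * Complex.I) * ∫ k, ψ k • dotC k ((𝓕 A : L2) k) := by
    intro ψ
    have h1 : ∀ i : Fin 3, Function.HasTemperateGrowth (fun k : R3 => inner ℝ k (unitVec i)) := by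
      intro i; fun_prop
    have h1' := hasTemperateGrowth_coord
    have h2 : ∀ i : Fin 3, asDist A (∂_{unitVec i} (𝓕 ψ)) =
        (-(2 * Real.pi * Complex.I)) • ∫ k, ψ k • (((k i : ℝ) : ℂ) • (𝓕 A : L2) k) := by
      intro i
      rw [SchwartzMap.lineDerivOp_fourier_eq, ← TemperedDistribution.fourier_apply, map_smul]
      congr 1
      have h3 : (SchwartzMap.smulLeftCLM ℂ (fun k : R3 => inner ℝ k (unitVec i)) ψ : 𝓢(R3, ℂ)) =
          SchwartzMap.smulLeftCLM ℂ (fun k : R3 => ((k i : ℝ) : ℂ)) ψ := by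
        ext k
        rw [SchwartzMap.smulLeftCLM_apply_apply (h1 i), SchwartzMap.smulLeftCLM_apply_apply (h1' i)]
        simp [inner_unitVec]
      rw [h3, ← TemperedDistribution.smulLeftCLM_apply_apply]
      exact ((isFunction_fourier A).smulLeft (h1' i) ψ).2
    have h4 : ∀ i : Fin 3, Integrable fun k => ψ k • (((k i : ℝ) : ℂ) • (𝓕 A : L2) k) :=
      fun i => ((isFunction_fourier A).smulLeft (h1' i) ψ).1
    have h5 : ∀ i : Fin 3, Integrable fun k => ψ k * (((k i : ℝ) : ℂ) * (𝓕 A : L2) k i) := fun i =>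
      ((EuclideanSpace.proj i : C3 →L[ℂ] ℂ).integrable_comp (h4 i))
    simp only [h2, PiLp.smul_apply, smul_eq_mul, dotC]
    rw [← Finset.mul_sum]
    congr 1
    simp only [Finset.mul_sum]
    rw [integral_finsetSum _ fun i _ => h5 i]
    refine Finset.sum_congr rfl fun i _ => ?_
    exact ((EuclideanSpace.proj i : C3 →L[ℂ] ℂ).integral_comp_comm (h4 i)).symm
  have hint : ∀ ψ : 𝓢(R3, ℂ), Integrable fun k => ψ k • dotC k ((𝓕 A : L2) k) := by
    intro ψ
    have h1' := hasTemperateGrowth_coord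
    simp only [dotC, smul_eq_mul, Finset.mul_sum]
    exact integrable_finsetSum _ fun i _ => ((EuclideanSpace.proj i : C3 →L[ℂ] ℂ).integrable_comp
      ((isFunction_fourier A).smulLeft (h1' i) ψ).1)
  constructor
  · intro h
    refine ae_eq_zero_of_schwartz hint fun ψ => ?_
    have h1 := key ψ
    rw [h (𝓕 ψ)] at h1
    have h2 : -(2 * Real.pi * Complex.I) ≠ 0 := by simp [Real.pi_ne_zero]
    exact (mul_eq_zero.1 h1.symm).resolve_left h2
  · intro h φ
    have h1 := key (𝓕⁻ φ)
    rw [FourierTransform.fourier_fourierInv_eq] at h1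
    rw [h1, integral_eq_zero_of_ae, mul_zero]
    filter_upwards [h] with k hk
    simp [hk]

/-! ### The pointwise transverse projection -/

theorem transverse_apply (k : R3) (w : C3) (i : Fin 3) :
    transverse k w i = w i - dotC k w / ((‖k‖ ^ 2 : ℝ) : ℂ) * (k i : ℂ) := rfl

theorem dotC_add (k : R3) (v w : C3) : dotC k (v + w) = dotC k v + dotC k w := by
  simp [dotC, mul_add, Finset.sum_add_distrib]

theorem dotC_smul (k : R3) (a : ℂ) (w : C3) : dotC k (a • w) = a * dotC k w := by
  simp only [dotC, Finset.mul_sum, PiLp.smul_apply, smul_eq_mul]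
  exact Finset.sum_congr rfl fun i _ => by ring

theorem transverse_add (k : R3) (v w : C3) :
    transverse k (v + w) = transverse k v + transverse k w := by
  ext i
  simp only [transverse_apply, dotC_add, PiLp.add_apply]
  ring

theorem transverse_smul (k : R3) (a : ℂ) (w : C3) :
    transverse k (a • w) = a • transverse k w := by
  ext i
  simp only [transverse_apply, dotC_smul, PiLp.smul_apply, smul_eq_mul]
  ring

theorem sum_coord_sq (k : R3) : ∑ i, (k i : ℂ) * (k i : ℂ) = ((‖k‖ ^ 2 : ℝ) : ℂ) := by
  rw [EuclideanSpace.norm_sq_eq]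
  push_cast
  refine Finset.sum_congr rfl fun i _ => ?_
  rw [← sq, ← Complex.ofReal_pow, ← Complex.ofReal_pow, Real.norm_eq_abs, sq_abs]

theorem dotC_transverse (k : R3) (w : C3) : dotC k (transverse k w) = 0 := by
  by_cases hk : k = 0
  · simp [dotC, hk]
  have h1 : ((‖k‖ ^ 2 : ℝ) : ℂ) ≠ 0 := by
    rw [Complex.ofReal_ne_zero]
    positivity
  have h2 : dotC k (transverse k w) =
      dotC k w - dotC k w / ((‖k‖ ^ 2 : ℝ) : ℂ) * ∑ i, (k i : ℂ) * (k i : ℂ) := by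
    rw [dotC, Finset.mul_sum, dotC, ← Finset.sum_sub_distrib]
    refine Finset.sum_congr rfl fun i _ => ?_
    rw [transverse_apply, dotC]
    ring
  rw [h2, sum_coord_sq, div_mul_cancel₀ _ h1, sub_self]

theorem inner_C3 (u w : C3) : inner ℂ u w = ∑ i, (starRingEnd ℂ) (u i) * w i := by
  rw [PiLp.inner_apply]
  exact Finset.sum_congr rfl fun i _ => by simp [mul_comm]

/-- The part removed from w is a multiple of k; as k is real, k · u = 0 also gives ⟨u, k⟩ = 0. -/
theorem inner_transverse_right {k : R3} {u : C3} (w : C3) (h : dotC k u = 0) :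
    inner ℂ u (transverse k w) = inner ℂ u w := by
  have h1 : ∑ i, (starRingEnd ℂ) (u i) * (k i : ℂ) = 0 := by
    have := congrArg (starRingEnd ℂ) h
    rw [dotC, map_sum, map_zero] at this
    rw [← this]
    exact Finset.sum_congr rfl fun i _ => by simp [mul_comm]
  simp only [inner_C3, transverse_apply, mul_sub, Finset.sum_sub_distrib]
  have h2 : ∑ i, (starRingEnd ℂ) (u i) * (dotC k w / ((‖k‖ ^ 2 : ℝ) : ℂ) * (k i : ℂ)) =
      dotC k w / ((‖k‖ ^ 2 : ℝ) : ℂ) * ∑ i, (starRingEnd ℂ) (u i) * (k i : ℂ) := by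
    rw [Finset.mul_sum]
    exact Finset.sum_congr rfl fun i _ => by ring
  rw [h2, h1]
  simp

theorem inner_transverse_left {k : R3} {u : C3} (w : C3) (h : dotC k u = 0) :
    inner ℂ (transverse k w) u = inner ℂ w u := by
  rw [← inner_conj_symm, inner_transverse_right w h, inner_conj_symm]

theorem inner_transverse_transverse (k : R3) (u w : C3) :
    inner ℂ (transverse k u) (transverse k w) = inner ℂ u (transverse k w) :=
  inner_transverse_left u (dotC_transverse k w)

theorem norm_transverse_le (k : R3) (w : C3) : ‖transverse k w‖ ≤ ‖w‖ := by
  have h1 : ‖transverse k w‖ ^ 2 ≤ ‖w‖ * ‖transverse k w‖ := by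
    have h2 := norm_inner_le_norm (𝕜 := ℂ) w (transverse k w)
    rw [← inner_transverse_transverse, inner_self_eq_norm_sq_to_K] at h2
    simpa using h2
  by_cases h : ‖transverse k w‖ = 0
  · rw [h]; exact norm_nonneg _
  · have : 0 < ‖transverse k w‖ := lt_of_le_of_ne (norm_nonneg _) (Ne.symm h)
    nlinarith

theorem measurable_transverse : Measurable fun p : R3 × C3 => transverse p.1 p.2 := by
  have h1 : Measurable fun p : R3 × C3 => fun i : Fin 3 => transverse p.1 p.2 i := by
    refine measurable_pi_lambda _ fun i => ?_
    simp only [transverse_apply, dotC]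
    fun_prop
  exact (WithLp.measurable_toLp 2 (Fin 3 → ℂ)).comp h1

/-! ### Fields through their Fourier transforms -/

/-- The Fourier transform of a divergence-free field. -/
def hat : L2star →ₗᵢ[ℂ] L2 :=
  (Lp.fourierTransformₗᵢ R3 C3).toLinearIsometry.comp L2star.subtypeₗᵢ

theorem hat_apply (A : L2star) : hat A = 𝓕 (A : L2) := rfl

theorem dotC_hat (A : L2star) : ∀ᵐ k, dotC k (hat A k) = 0 := (mem_L2star_iff (A : L2)).1 A.2

theorem dotC_fourierInv {f : R3 → C3} (hf : MemLp f 2 volume) (h : ∀ᵐ k, dotC k (f k) = 0) :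
    𝓕⁻ (hf.toLp f) ∈ L2star := by
  rw [mem_L2star_iff, FourierTransform.fourier_fourierInv_eq]
  filter_upwards [hf.coeFn_toLp, h] with k h1 h2
  rw [h1, h2]

/-- The divergence-free field with a given transverse Fourier transform. -/
def ofHat (f : R3 → C3) (hf : MemLp f 2 volume) (h : ∀ᵐ k, dotC k (f k) = 0) : L2star :=
  ⟨𝓕⁻ (hf.toLp f), dotC_fourierInv hf h⟩

theorem hat_ofHat {f : R3 → C3} (hf : MemLp f 2 volume) (h : ∀ᵐ k, dotC k (f k) = 0) :
    hat (ofHat f hf h) =ᵐ[volume] f := by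
  have : hat (ofHat f hf h) = hf.toLp f := by
    rw [hat_apply]
    exact FourierTransform.fourier_fourierInv_eq (hf.toLp f)
  rw [this]
  exact hf.coeFn_toLp

theorem hat_ext {A B : L2star} (h : hat A =ᵐ[volume] hat B) : A = B :=
  hat.injective (Lp.ext h)

theorem hat_add (A B : L2star) : hat (A + B) =ᵐ[volume] fun k => hat A k + hat B k := by
  rw [map_add]
  exact Lp.coeFn_add _ _

theorem hat_sub (A B : L2star) : hat (A - B) =ᵐ[volume] fun k => hat A k - hat B k := by
  rw [map_sub]
  exact Lp.coeFn_sub _ _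

theorem hat_smul (a : ℂ) (A : L2star) : hat (a • A) =ᵐ[volume] fun k => a • hat A k := by
  rw [map_smul]
  exact Lp.coeFn_smul _ _

theorem inner_eq_integral_hat (A B : L2star) :
    inner ℂ A B = ∫ k, inner ℂ (hat A k) (hat B k) := by
  rw [← hat.inner_map_map, L2.inner_def]

/-! ### Fourier multipliers, fields h(k) Q_⊥ and the projection M on the Fourier side -/

/-- Bounded measurable symbols. -/
def BddMeas (g : R3 → ℂ) : Prop := Measurable g ∧ ∃ C, ∀ k, ‖g k‖ ≤ C

theorem BddMeas.memLp_smul {g : R3 → ℂ} (hg : BddMeas g) {f : R3 → C3} (hf : MemLp f 2 volume) :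
    MemLp (fun k => g k • f k) 2 volume := by
  obtain ⟨hm, C, hC⟩ := hg
  refine MemLp.of_le_mul (c := C) hf (hm.aestronglyMeasurable.smul hf.1)
    (Eventually.of_forall fun k => ?_)
  rw [norm_smul]
  gcongr
  exact hC k

theorem dotC_smul_hat (g : R3 → ℂ) (A : L2star) : ∀ᵐ k, dotC k (g k • hat A k) = 0 := by
  filter_upwards [dotC_hat A] with k h
  rw [dotC_smul, h, mul_zero]

/-- The Fourier multiplier with a bounded measurable symbol, as a linear map. -/
def fmulLM (g : R3 → ℂ) (hg : BddMeas g) : L2star →ₗ[ℂ] L2star where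
  toFun A := ofHat _ (hg.memLp_smul (Lp.memLp (hat A))) (dotC_smul_hat g A)
  map_add' A B := hat_ext (by
    filter_upwards [hat_ofHat (hg.memLp_smul (Lp.memLp (hat A))) (dotC_smul_hat g A),
      hat_ofHat (hg.memLp_smul (Lp.memLp (hat B))) (dotC_smul_hat g B),
      hat_ofHat (hg.memLp_smul (Lp.memLp (hat (A + B)))) (dotC_smul_hat g (A + B)),
      hat_add A B, hat_add (ofHat _ (hg.memLp_smul (Lp.memLp (hat A))) (dotC_smul_hat g A))
        (ofHat _ (hg.memLp_smul (Lp.memLp (hat B))) (dotC_smul_hat g B))] with k h1 h2 h3 h4 h5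
    rw [h3, h5, h1, h2, h4, smul_add])
  map_smul' a A := hat_ext (by
    filter_upwards [hat_ofHat (hg.memLp_smul (Lp.memLp (hat A))) (dotC_smul_hat g A),
      hat_ofHat (hg.memLp_smul (Lp.memLp (hat (a • A)))) (dotC_smul_hat g (a • A)),
      hat_smul a A, hat_smul a (ofHat _ (hg.memLp_smul (Lp.memLp (hat A))) (dotC_smul_hat g A))]
      with k h1 h2 h3 h4
    rw [h2, RingHom.id_apply, h4, h1, h3, smul_comm])

theorem hat_fmulLM {g : R3 → ℂ} (hg : BddMeas g) (A : L2star) :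
    hat (fmulLM g hg A) =ᵐ[volume] fun k => g k • hat A k :=
  hat_ofHat (hg.memLp_smul (Lp.memLp (hat A))) (dotC_smul_hat g A)

theorem norm_fmulLM_le {g : R3 → ℂ} (hg : BddMeas g) {C : ℝ} (hC : ∀ k, ‖g k‖ ≤ C) (A : L2star) :
    ‖fmulLM g hg A‖ ≤ C * ‖A‖ := by
  rw [← hat.norm_map, ← hat.norm_map A]
  refine Lp.norm_le_mul_norm_of_ae_le_mul ?_
  filter_upwards [hat_fmulLM hg A] with k h1
  rw [h1, norm_smul]
  gcongr
  exact hC k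

/-- The Fourier multiplier with a bounded measurable symbol, on divergence-free fields. -/
def fmul (g : R3 → ℂ) (hg : BddMeas g) : L2star →L[ℂ] L2star :=
  (fmulLM g hg).mkContinuous hg.2.choose (norm_fmulLM_le hg hg.2.choose_spec)

theorem hat_fmul {g : R3 → ℂ} (hg : BddMeas g) (A : L2star) :
    hat (fmul g hg A) =ᵐ[volume] fun k => g k • hat A k :=
  hat_fmulLM hg A

theorem memLp_smul_transverse {h : R3 → ℂ} (hh : MemLp h 2 volume) (Q : C3) :
    MemLp (fun k => h k • transverse k Q) 2 volume := by
  refine MemLp.of_le_mul (c := ‖Q‖) hh (hh.1.smul ?_) (Eventually.of_forall fun k => ?_)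
  · exact (measurable_transverse.comp (measurable_id.prodMk measurable_const)).aestronglyMeasurable
  · rw [norm_smul, mul_comm]
    gcongr
    exact norm_transverse_le k Q

theorem dotC_smul_transverse (h : R3 → ℂ) (Q : C3) : ∀ᵐ k, dotC k (h k • transverse k Q) = 0 :=
  Eventually.of_forall fun k => by rw [dotC_smul, dotC_transverse, mul_zero]

/-- The divergence-free field with Fourier transform `h(k)` times the transverse part of `Q`. -/
def gvec (h : R3 → ℂ) (hh : MemLp h 2 volume) : C3 →ₗ[ℂ] L2star where
  toFun Q := ofHat _ (memLp_smul_transverse hh Q) (dotC_smul_transverse h Q)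
  map_add' Q Q' := hat_ext (by
    filter_upwards [hat_ofHat (memLp_smul_transverse hh Q) (dotC_smul_transverse h Q),
      hat_ofHat (memLp_smul_transverse hh Q') (dotC_smul_transverse h Q'),
      hat_ofHat (memLp_smul_transverse hh (Q + Q')) (dotC_smul_transverse h (Q + Q')),
      hat_add (ofHat _ (memLp_smul_transverse hh Q) (dotC_smul_transverse h Q))
        (ofHat _ (memLp_smul_transverse hh Q') (dotC_smul_transverse h Q'))] with k h1 h2 h3 h4
    rw [h3, h4, h1, h2, transverse_add, smul_add])
  map_smul' a Q := hat_ext (by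
    filter_upwards [hat_ofHat (memLp_smul_transverse hh Q) (dotC_smul_transverse h Q),
      hat_ofHat (memLp_smul_transverse hh (a • Q)) (dotC_smul_transverse h (a • Q)),
      hat_smul a (ofHat _ (memLp_smul_transverse hh Q) (dotC_smul_transverse h Q))] with k h1 h2 h3
    rw [h2, RingHom.id_apply, h3, h1, transverse_smul, smul_comm])

theorem hat_gvec {h : R3 → ℂ} (hh : MemLp h 2 volume) (Q : C3) :
    hat (gvec h hh Q) =ᵐ[volume] fun k => h k • transverse k Q :=
  hat_ofHat (memLp_smul_transverse hh Q) (dotC_smul_transverse h Q)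

theorem memLp_transverse_fourier (A : L2) :
    MemLp (fun k => transverse k ((𝓕 A : L2) k)) 2 volume := by
  refine MemLp.of_le (Lp.memLp (𝓕 A : L2)) ?_ (Eventually.of_forall fun k => norm_transverse_le _ _)
  exact (measurable_transverse.comp_aemeasurable
    (measurable_id.aemeasurable.prodMk (Lp.aestronglyMeasurable (𝓕 A : L2)).aemeasurable)
    ).aestronglyMeasurable

/-- By Parseval, a divergence-free test field does not see the longitudinal part of Â, so M A and
the field with transform Â_⊥ have the same inner products with all of `L2star`. -/
theorem hat_M (A : L2) : hat (M A) =ᵐ[volume] fun k => transverse k ((𝓕 A : L2) k) := by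
  have hm := memLp_transverse_fourier A
  have hd : ∀ᵐ k, dotC k (transverse k ((𝓕 A : L2) k)) = 0 :=
    Eventually.of_forall fun k => dotC_transverse _ _
  have h1 : M A = ofHat _ hm hd := by
    refine ext_inner_left ℂ fun C => ?_
    rw [M, Submodule.inner_orthogonalProjectionOnto_eq_of_mem_left, inner_eq_integral_hat,
      ← Lp.inner_fourier_eq, L2.inner_def]
    refine integral_congr_ae ?_
    filter_upwards [dotC_hat C, hat_ofHat hm hd] with k h2 h3
    rw [h3, inner_transverse_right _ h2, hat_apply]
  rw [h1]
  exact hat_ofHat hm hd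

/-! ### Averages of radial functions -/

/-- Radial functions. -/
def IsRadial {F : Type*} (h : R3 → F) : Prop := ∀ k k', ‖k‖ = ‖k'‖ → h k = h k'

theorem integral_comp_isometry {F : Type*} [NormedAddCommGroup F] [NormedSpace ℝ F]
    (U : R3 ≃ₗᵢ[ℝ] R3) (f : R3 → F) : ∫ k, f (U k) = ∫ k, f k :=
  U.measurePreserving.integral_comp U.toHomeomorph.measurableEmbedding f

theorem norm_coord_mul_le (k : R3) (i j : Fin 3) :
    ‖((k i : ℂ) * (k j : ℂ) / ((‖k‖ ^ 2 : ℝ) : ℂ))‖ ≤ 1 := by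
  have h1 : ∀ l, |k l| ≤ ‖k‖ := fun l => PiLp.norm_apply_le k l
  simp only [norm_div, norm_mul, Complex.norm_real, Real.norm_eq_abs]
  rw [abs_of_nonneg (sq_nonneg ‖k‖)]
  refine div_le_one_of_le₀ ?_ (by positivity)
  rw [sq]
  exact mul_le_mul (h1 i) (h1 j) (abs_nonneg _) (norm_nonneg _)

theorem integrable_mul_coord {h : R3 → ℂ} (hint : Integrable h) (i j : Fin 3) :
    Integrable fun k => h k * ((k i : ℂ) * (k j : ℂ) / ((‖k‖ ^ 2 : ℝ) : ℂ)) :=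
  hint.mul_bdd (c := 1) (Measurable.aestronglyMeasurable (by fun_prop))
    (Eventually.of_forall fun k => norm_coord_mul_le k i j)

/-- Invariance under isometries: swapping two coordinates makes the three diagonal integrals equal,
and they add up to ∫ h; reflecting the i-th coordinate changes the sign of an off-diagonal one. -/
theorem integral_mul_coord {h : R3 → ℂ} (hint : Integrable h) (hrad : IsRadial h) (i j : Fin 3) :
    ∫ k, h k * ((k i : ℂ) * (k j : ℂ) / ((‖k‖ ^ 2 : ℝ) : ℂ)) =
      if i = j then (1 / 3 : ℂ) * ∫ k, h k else 0 := by
  have hU : ∀ (U : R3 ≃ₗᵢ[ℝ] R3) (i j : Fin 3),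
      ∫ k, h k * ((k i : ℂ) * (k j : ℂ) / ((‖k‖ ^ 2 : ℝ) : ℂ)) =
        ∫ k, h k * ((U k i : ℂ) * (U k j : ℂ) / ((‖k‖ ^ 2 : ℝ) : ℂ)) := by
    intro U i j
    rw [← integral_comp_isometry U]
    refine integral_congr_ae (Eventually.of_forall fun k => ?_)
    simp only [U.norm_map]
    rw [hrad (U k) k (U.norm_map k)]
  split_ifs with hij
  · subst hij
    have h1 : ∀ j, ∫ k, h k * ((k j : ℂ) * (k j : ℂ) / ((‖k‖ ^ 2 : ℝ) : ℂ)) =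
        ∫ k, h k * ((k i : ℂ) * (k i : ℂ) / ((‖k‖ ^ 2 : ℝ) : ℂ)) := by
      intro j
      rw [hU (LinearIsometryEquiv.piLpCongrLeft 2 ℝ ℝ (Equiv.swap i j)) j j]
      simp [LinearIsometryEquiv.piLpCongrLeft_apply, Equiv.piCongrLeft'_apply]
    have h2 : ∑ j, ∫ k, h k * ((k j : ℂ) * (k j : ℂ) / ((‖k‖ ^ 2 : ℝ) : ℂ)) = ∫ k, h k := by
      rw [← integral_finsetSum _ fun j _ => integrable_mul_coord hint j j]
      refine integral_congr_ae ?_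
      filter_upwards [Measure.ae_ne volume (0 : R3)] with k hk
      have h3 : ((‖k‖ ^ 2 : ℝ) : ℂ) ≠ 0 := by
        rw [Complex.ofReal_ne_zero]
        positivity
      rw [← Finset.mul_sum, ← Finset.sum_div, sum_coord_sq, div_self h3, mul_one]
    rw [Finset.sum_congr rfl fun j _ => h1 j] at h2
    simp only [Finset.sum_const, Finset.card_univ, Fintype.card_fin, nsmul_eq_mul] at h2
    rw [← h2]
    push_cast
    ring
  · have h1 := hU (LinearIsometryEquiv.piLpCongrRight 2
      (fun l => if l = i then LinearIsometryEquiv.neg ℝ else LinearIsometryEquiv.refl ℝ ℝ)) i j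
    have h2 : ∀ k : R3, (((LinearIsometryEquiv.piLpCongrRight 2
      (fun l => if l = i then LinearIsometryEquiv.neg ℝ else LinearIsometryEquiv.refl ℝ ℝ)) k i
        : ℝ) : ℂ) * (((LinearIsometryEquiv.piLpCongrRight 2
      (fun l => if l = i then LinearIsometryEquiv.neg ℝ else LinearIsometryEquiv.refl ℝ ℝ)) k j
        : ℝ) : ℂ) = -((k i : ℂ) * (k j : ℂ)) := by
      intro k
      simp [LinearIsometryEquiv.piLpCongrRight_apply, Ne.symm hij]
    simp only [h2, neg_div, mul_neg] at h1
    rw [integral_neg] at h1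
    exact self_eq_neg.1 h1

theorem integrable_smul_transverse {h : R3 → ℂ} (hint : Integrable h) (Q : C3) :
    Integrable fun k => h k • transverse k Q := by
  refine (hint.norm.mul_const ‖Q‖).mono' (hint.1.smul ?_) (Eventually.of_forall fun k => ?_)
  · exact (measurable_transverse.comp (measurable_id.prodMk measurable_const)).aestronglyMeasurable
  · rw [norm_smul]
    gcongr
    exact norm_transverse_le k Q

/-- 2/3 = 1 − 1/3: the longitudinal projection kᵢkⱼ/|k|² averages to one third of the identity. -/
theorem integral_smul_transverse {h : R3 → ℂ} (hint : Integrable h) (hrad : IsRadial h) (Q : C3) :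
    ∫ k, h k • transverse k Q = ((2 / 3 : ℂ) * ∫ k, h k) • Q := by
  ext i
  have h1 := ((EuclideanSpace.proj i : C3 →L[ℂ] ℂ).integral_comp_comm
    (integrable_smul_transverse hint Q)).symm
  simp only [PiLp.proj_apply] at h1
  rw [h1]
  have h2 : ∀ k, (h k • transverse k Q) i = h k * Q i - ∑ j, Q j *
      (h k * ((k j : ℂ) * (k i : ℂ) / ((‖k‖ ^ 2 : ℝ) : ℂ))) := by
    intro k
    rw [PiLp.smul_apply, smul_eq_mul, transverse_apply, mul_sub, dotC, Finset.sum_div,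
      Finset.sum_mul, Finset.mul_sum]
    congr 1
    exact Finset.sum_congr rfl fun j _ => by ring
  simp only [h2]
  rw [integral_sub (hint.mul_const _)
    (integrable_finsetSum _ fun j _ => (integrable_mul_coord hint j i).const_mul _),
    integral_finsetSum _ fun j _ => (integrable_mul_coord hint j i).const_mul _]
  simp only [integral_const_mul, integral_mul_const, integral_mul_coord hint hrad]
  simp only [mul_ite, mul_zero, Finset.sum_ite_eq', Finset.mem_univ, if_true, PiLp.smul_apply,
    smul_eq_mul]
  ring

/-- The transverse projection is symmetric and idempotent, so a single one is left under the
integral, and the radial average applies to it. -/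
theorem inner_gvec_gvec {h h' : R3 → ℂ} (hh : MemLp h 2 volume) (hh' : MemLp h' 2 volume)
    (hr : IsRadial h) (hr' : IsRadial h') (Q Q' : C3) :
    inner ℂ (gvec h hh Q) (gvec h' hh' Q') =
      (2 / 3 : ℂ) * (∫ k, (starRingEnd ℂ) (h k) * h' k) * inner ℂ Q Q' := by
  have hint : Integrable fun k => (starRingEnd ℂ) (h k) * h' k := by
    have := (hh.star).integrable_mul hh'
    exact this
  have hrad : IsRadial fun k => (starRingEnd ℂ) (h k) * h' k := fun k k' hk => by
    simp only [hr k k' hk, hr' k k' hk]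
  rw [inner_eq_integral_hat]
  have h1 : ∫ k, inner ℂ (hat (gvec h hh Q) k) (hat (gvec h' hh' Q') k) =
      ∫ k, inner ℂ Q (((starRingEnd ℂ) (h k) * h' k) • transverse k Q') := by
    refine integral_congr_ae ?_
    filter_upwards [hat_gvec hh Q, hat_gvec hh' Q'] with k h2 h3
    rw [h2, h3, inner_smul_left, inner_smul_right, inner_transverse_transverse, inner_smul_right,
      mul_assoc]
  rw [h1, integral_inner (integrable_smul_transverse hint Q'), integral_smul_transverse hint hrad,
    inner_smul_right]

/-! ### Fourier transforms of radial functions -/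

/-- The plane with its Euclidean norm. -/
abbrev R2 : Type := EuclideanSpace ℝ (Fin 2)

/-- The splitting of space into the first axis and its orthogonal plane. -/
def axisSplit : R3 ≃ᵐ ℝ × R2 :=
  (MeasurableEquiv.toLp 2 (Fin 3 → ℝ)).symm.trans
    ((MeasurableEquiv.piFinSuccAbove (fun _ : Fin 3 => ℝ) 0).trans
      (MeasurableEquiv.prodCongr (MeasurableEquiv.refl ℝ) (MeasurableEquiv.toLp 2 (Fin 2 → ℝ))))

theorem measurePreserving_axisSplit : MeasurePreserving axisSplit volume volume := by
  refine MeasurePreserving.trans (EuclideanSpace.volume_preserving_symm_measurableEquiv_toLp _) ?_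
  refine MeasurePreserving.trans (volume_preserving_piFinSuccAbove _ 0) ?_
  exact (MeasurePreserving.id volume).prod (PiLp.volume_preserving_toLp (Fin 2))

theorem norm_eq_axisSplit (x : R3) :
    ‖x‖ = Real.sqrt ((axisSplit x).1 ^ 2 + ‖(axisSplit x).2‖ ^ 2) := by
  rw [EuclideanSpace.norm_eq]
  congr 1
  rw [Fin.sum_univ_succ, EuclideanSpace.norm_sq_eq]
  simp only [Real.norm_eq_abs, sq_abs]
  rfl

theorem integral_R3_radial {F : Type*} [NormedAddCommGroup F] [NormedSpace ℝ F] (f : ℝ → F) :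
    ∫ x : R3, f ‖x‖ = ∫ r in Ioi (0 : ℝ), (4 * Real.pi * r ^ 2) • f r := by
  rw [integral_fun_norm_addHaar volume f]
  have h1 : (volume : Measure R3).real (Metric.ball 0 1) = Real.pi * 4 / 3 := by
    rw [Measure.real, EuclideanSpace.volume_ball_fin_three, ENNReal.toReal_mul,
      ENNReal.toReal_ofReal (by positivity)]
    simp
  rw [h1, finrank_euclideanSpace_fin, ← Nat.cast_smul_eq_nsmul ℝ, smul_smul, ← integral_smul]
  refine setIntegral_congr_fun measurableSet_Ioi fun r _ => ?_
  simp only [smul_smul]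
  congr 1
  rw [show 3 - 1 = 2 from rfl]
  push_cast
  ring

theorem integrable_R3_radial {F : Type*} [NormedAddCommGroup F] [NormedSpace ℝ F] {f : ℝ → F} :
    Integrable (fun x : R3 => f ‖x‖) ↔ IntegrableOn (fun r => r ^ 2 • f r) (Ioi 0) := by
  rw [integrable_fun_norm_addHaar volume, finrank_euclideanSpace_fin]

theorem integral_R2_radial {F : Type*} [NormedAddCommGroup F] [NormedSpace ℝ F] (f : ℝ → F) :
    ∫ x : R2, f ‖x‖ = ∫ r in Ioi (0 : ℝ), (2 * Real.pi * r) • f r := by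
  rw [integral_fun_norm_addHaar volume f]
  have h1 : (volume : Measure R2).real (Metric.ball 0 1) = Real.pi := by
    rw [Measure.real, EuclideanSpace.volume_ball_fin_two, ENNReal.toReal_mul,
      ENNReal.toReal_ofReal (by positivity)]
    simp
  rw [h1, finrank_euclideanSpace_fin, ← Nat.cast_smul_eq_nsmul ℝ, smul_smul, ← integral_smul]
  refine setIntegral_congr_fun measurableSet_Ioi fun r _ => ?_
  simp only [smul_smul]
  congr 1
  rw [show 2 - 1 = 1 from rfl]
  push_cast
  ring

/-- Integration of a radial function over a plane at distance `|t|` from the origin. -/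
theorem integral_plane (f : ℝ → ℂ) (t : ℝ) :
    ∫ y : R2, f (Real.sqrt (t ^ 2 + ‖y‖ ^ 2)) =
      ∫ s in Ioi |t|, (2 * Real.pi * s) • f s := by
  rw [integral_R2_radial fun r => f (Real.sqrt (t ^ 2 + r ^ 2))]
  -- With u = r² the shift by t² becomes a translation of the half-line; afterwards v = s² returns
  -- to radii s > |t|.
  have h1 : ∫ r in Ioi (0 : ℝ), (2 * Real.pi * r) • f (Real.sqrt (t ^ 2 + r ^ 2)) =
      Real.pi • ∫ u in Ioi (0 : ℝ), f (Real.sqrt (t ^ 2 + u)) := by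
    rw [← integral_comp_rpow_Ioi_of_pos (g := fun u => f (Real.sqrt (t ^ 2 + u))) (p := 2) two_pos,
      ← integral_smul]
    refine setIntegral_congr_fun measurableSet_Ioi fun r _ => ?_
    simp only [smul_smul, Real.rpow_two]
    rw [show (2 : ℝ) - 1 = 1 by norm_num, Real.rpow_one]
    congr 1
    ring
  have h2 : ∫ u in Ioi (0 : ℝ), f (Real.sqrt (t ^ 2 + u)) =
      ∫ v in Ioi (0 : ℝ), (Ioi (t ^ 2)).indicator (fun v => f (Real.sqrt v)) v := by
    rw [setIntegral_indicator measurableSet_Ioi,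
      inter_eq_self_of_subset_right (Ioi_subset_Ioi (sq_nonneg t))]
    have h := (measurePreserving_add_left volume (t ^ 2)).setIntegral_preimage_emb
      (measurableEmbedding_addLeft (t ^ 2)) (fun v => f (Real.sqrt v)) (Ioi (t ^ 2))
    rw [← h]
    simp
  rw [h1, h2, ← integral_comp_rpow_Ioi_of_pos
    (g := (Ioi (t ^ 2)).indicator (fun v => f (Real.sqrt v))) (p := 2) two_pos, ← integral_smul]
  have h3 : Ioi |t| = Ioi 0 ∩ Ioi |t| :=
    (inter_eq_self_of_subset_right (Ioi_subset_Ioi (abs_nonneg t))).symm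
  rw [h3, ← setIntegral_indicator measurableSet_Ioi]
  refine setIntegral_congr_fun measurableSet_Ioi fun s hs => ?_
  have hs : 0 < s := hs
  have h4 : s ^ 2 ∈ Ioi (t ^ 2) ↔ s ∈ Ioi |t| := by
    simp only [mem_Ioi]
    rw [← sq_abs t]
    exact pow_lt_pow_iff_left₀ (abs_nonneg t) hs.le two_ne_zero
  simp only [Real.rpow_two, indicator, h4, Real.sqrt_sq hs.le]
  split_ifs
  · simp only [smul_smul]
    rw [show (2 : ℝ) - 1 = 1 by norm_num, Real.rpow_one]
    congr 1
    ring
  · simp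

theorem integral_exp_sinc (b s : ℝ) (hs : 0 < s) :
    ∫ t in Ioo (-s) s, Complex.exp (((-b * t : ℝ) : ℂ) * Complex.I) =
      ((2 * s * Real.sinc (b * s) : ℝ) : ℂ) := by
  rw [← integral_Ioc_eq_integral_Ioo, ← intervalIntegral.integral_of_le (by linarith)]
  by_cases hb : b = 0
  · simp only [hb, neg_zero, zero_mul, Complex.ofReal_zero, Complex.exp_zero, Real.sinc_zero,
      intervalIntegral.integral_const]
    simp
    ring
  · have h1 : ∀ t : ℝ, Complex.exp (((-b * t : ℝ) : ℂ) * Complex.I) =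
        Complex.exp ((-(b : ℂ) * Complex.I) * t) := by
      intro t; congr 1; push_cast; ring
    have hb' : (b : ℂ) ≠ 0 := by exact_mod_cast hb
    have h2 : -(b : ℂ) * Complex.I ≠ 0 := by simp [hb]
    simp only [h1]
    rw [integral_exp_mul_complex h2, Real.sinc_of_ne_zero (mul_ne_zero hb hs.ne')]
    have h3 : ((2 * s * (Real.sin (b * s) / (b * s)) : ℝ) : ℂ) = 2 * Complex.sin (b * s) / b := by
      have hs' : (s : ℂ) ≠ 0 := by exact_mod_cast hs.ne'
      push_cast
      field_simp
    rw [h3, Complex.sin]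
    push_cast
    have h4 : (-(b : ℂ) * Complex.I) * s = -(b * s) * Complex.I := by ring
    have h5 : (-(b : ℂ) * Complex.I) * -s = (b * s) * Complex.I := by ring
    rw [h4, h5, div_eq_div_iff h2 hb']
    ring_nf
    rw [Complex.I_sq]
    ring

/-- A reflection sends k to |k| times the first axis. On the plane at height t the integral is that
of 2πs η(s) over s > |t|; exchanging the order leaves the phase integrated over |t| < s, which is 2s
sinc(2π|k|s). -/
theorem fourier_radial {η : ℝ → ℂ} (hm : Measurable η)
    (hint : Integrable fun x : R3 => η ‖x‖) (k : R3) :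
    𝓕 (fun x : R3 => η ‖x‖) k =
      ∫ r in Ioi (0 : ℝ), (4 * Real.pi * r ^ 2 * Real.sinc (2 * Real.pi * ‖k‖ * r)) • η r := by
  set b : ℝ := 2 * Real.pi * ‖k‖ with hb
  set e : ℝ → ℂ := fun t => Complex.exp (((-b * t : ℝ) : ℂ) * Complex.I) with he
  have hecont : Continuous e := by fun_prop
  have henorm : ∀ t, ‖e t‖ = 1 := fun t => Complex.norm_exp_ofReal_mul_I _
  -- rotation to the axis
  have h1 : 𝓕 (fun x : R3 => η ‖x‖) k = ∫ x : R3, e (x 0) * η ‖x‖ := by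
    have hn : ‖k‖ = ‖‖k‖ • unitVec 0‖ := by simp [norm_smul]
    have h2 := Real.fourier_comp_linearIsometry
      (ℝ ∙ (k - ‖k‖ • unitVec 0))ᗮ.reflection (fun x : R3 => η ‖x‖) k
    rw [Submodule.reflection_sub hn] at h2
    have h3 : ((fun x : R3 => η ‖x‖) ∘ (ℝ ∙ (k - ‖k‖ • unitVec 0))ᗮ.reflection) =
        fun x : R3 => η ‖x‖ := by
      ext x
      simp [Function.comp]
    rw [h3] at h2
    rw [h2, Real.fourier_eq']
    refine integral_congr_ae (Eventually.of_forall fun x => ?_)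
    simp only [inner_smul_right, inner_unitVec, he, hb, smul_eq_mul]
    congr 3
    ring_nf
  have hint2 : Integrable fun p : ℝ × R2 => e p.1 * η (Real.sqrt (p.1 ^ 2 + ‖p.2‖ ^ 2)) := by
    rw [← measurePreserving_axisSplit.integrable_comp_emb axisSplit.measurableEmbedding]
    have : (fun x => (fun p : ℝ × R2 => e p.1 * η (Real.sqrt (p.1 ^ 2 + ‖p.2‖ ^ 2)))
        (axisSplit x)) = fun x : R3 => e (x 0) * η ‖x‖ := by
      ext x
      rw [norm_eq_axisSplit x]
      rfl
    refine Integrable.congr (f := fun x : R3 => e (x 0) * η ‖x‖) ?_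
      (Eventually.of_forall fun x => (congrFun this x).symm)
    refine hint.bdd_mul (c := 1) (Measurable.aestronglyMeasurable ?_)
      (Eventually.of_forall fun x => (henorm _).le)
    exact hecont.measurable.comp (by fun_prop)
  have h4 : ∫ x : R3, e (x 0) * η ‖x‖ =
      ∫ p : ℝ × R2, e p.1 * η (Real.sqrt (p.1 ^ 2 + ‖p.2‖ ^ 2)) := by
    rw [← measurePreserving_axisSplit.integral_comp axisSplit.measurableEmbedding]
    refine integral_congr_ae (Eventually.of_forall fun x => ?_)
    simp only
    rw [norm_eq_axisSplit x]
    rfl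
  rw [h1, h4, Measure.volume_eq_prod, integral_prod _ hint2]
  simp only [integral_const_mul, integral_plane]
  -- the remaining double integral
  have h5 : ∀ t, e t * ∫ s in Ioi |t|, (2 * Real.pi * s) • η s =
      ∫ s in Ioi (0 : ℝ), (Ioo (-s) s).indicator e t * ((2 * Real.pi * s) • η s) := by
    intro t
    have h3 : Ioi |t| = Ioi 0 ∩ Ioi |t| :=
      (inter_eq_self_of_subset_right (Ioi_subset_Ioi (abs_nonneg t))).symm
    rw [h3, ← setIntegral_indicator measurableSet_Ioi, ← integral_const_mul]
    refine setIntegral_congr_fun measurableSet_Ioi fun s _ => ?_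
    have h6 : s ∈ Ioi |t| ↔ t ∈ Ioo (-s) s := by
      rw [mem_Ioi, abs_lt, mem_Ioo]
    simp only [indicator, h6]
    split_ifs <;> simp
  simp only [h5]
  have hmeas : Measurable (Function.uncurry fun (t s : ℝ) =>
      (Ioo (-s) s).indicator e t * ((2 * Real.pi * s) • η s)) := by
    have hset : MeasurableSet {p : ℝ × ℝ | p.1 ∈ Ioo (-p.2) p.2} :=
      (measurableSet_lt measurable_snd.neg measurable_fst).inter
        (measurableSet_lt measurable_fst measurable_snd)
    have : (Function.uncurry fun (t s : ℝ) =>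
        (Ioo (-s) s).indicator e t * ((2 * Real.pi * s) • η s)) = fun p : ℝ × ℝ =>
        {p : ℝ × ℝ | p.1 ∈ Ioo (-p.2) p.2}.indicator (fun p => e p.1) p *
          ((2 * Real.pi * p.2) • η p.2) := by
      ext ⟨t, s⟩
      simp [Function.uncurry, indicator]
    rw [this]
    refine Measurable.mul (Measurable.indicator (by fun_prop) hset) ?_
    fun_prop
  have hswap : Integrable (Function.uncurry fun (t s : ℝ) =>
      (Ioo (-s) s).indicator e t * ((2 * Real.pi * s) • η s))
      (volume.prod (volume.restrict (Ioi 0))) := by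
    rw [integrable_prod_iff' hmeas.aestronglyMeasurable]
    have hIoo : ∀ s : ℝ, Integrable ((Ioo (-s) s).indicator e) := fun s => by
      rw [integrable_indicator_iff measurableSet_Ioo]
      exact (hecont.integrableOn_Icc).mono_set Ioo_subset_Icc_self
    constructor
    · exact Eventually.of_forall fun s => (hIoo s).mul_const ((2 * Real.pi * s) • η s)
    -- The phase has modulus 1, so absolute integration in t contributes the length 2s, and what
    -- remains is the radial integrability of η.
    · have h7 : ∀ s ∈ Ioi (0 : ℝ), ∫ t, ‖(Ioo (-s) s).indicator e t * ((2 * Real.pi * s) • η s)‖ =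
          4 * Real.pi * ‖s ^ 2 • η s‖ := by
        intro s hs
        have hs : 0 < s := hs
        simp only [norm_mul, norm_indicator_eq_indicator_norm, henorm]
        rw [integral_mul_const, integral_indicator measurableSet_Ioo]
        simp only [integral_const, norm_smul, Real.norm_eq_abs, abs_mul, abs_pow, abs_of_pos hs,
          abs_of_pos Real.pi_pos]
        rw [Measure.real, Measure.restrict_apply_univ, Real.volume_Ioo,
          ENNReal.toReal_ofReal (by linarith)]
        simp
        ring
      refine IntegrableOn.congr_fun ?_ (fun s hs => (h7 s hs).symm) measurableSet_Ioi
      exact ((integrable_R3_radial.1 hint).norm.const_mul _)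
  rw [integral_integral_swap hswap]
  refine setIntegral_congr_fun measurableSet_Ioi fun s hs => ?_
  rw [integral_mul_const, integral_indicator measurableSet_Ioo, integral_exp_sinc b s hs]
  simp only [Complex.real_smul]
  push_cast
  ring

/-! ### Fourier transforms of integrable functions as distributions -/

theorem exists_dist_of_memLp {p : ℝ≥0∞} [hp : Fact (1 ≤ p)] {f : R3 → C3} (hf : MemLp f p volume)
    (hint : ∀ φ : 𝓢(R3, ℂ), Integrable fun x => φ x • f x) : ∃ T, IsFunction T f := by
  refine ⟨Lp.toTemperedDistribution (hf.toLp f), fun φ => ⟨hint φ, ?_⟩⟩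
  rw [Lp.toTemperedDistribution_apply]
  refine integral_congr_ae ?_
  filter_upwards [hf.coeFn_toLp] with x hx
  rw [hx]

theorem integrable_schwartz_smul_of_bdd {f : R3 → C3} (hm : AEStronglyMeasurable f volume) {C : ℝ}
    (hC : ∀ x, ‖f x‖ ≤ C) (φ : 𝓢(R3, ℂ)) : Integrable fun x => φ x • f x := by
  refine (φ.integrable.norm.mul_const C).mono' (φ.continuous.aestronglyMeasurable.smul hm)
    (Eventually.of_forall fun x => ?_)
  rw [norm_smul]
  gcongr
  exact hC x

theorem integrable_schwartz_smul_of_integrable {f : R3 → C3} (hf : Integrable f)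
    (φ : 𝓢(R3, ℂ)) : Integrable fun x => φ x • f x := by
  obtain ⟨C, hC⟩ := φ.decay 0 0
  refine hf.bdd_smul C φ.continuous.aestronglyMeasurable (Eventually.of_forall fun x => ?_)
  simpa using hC.2 x

theorem norm_fourier_le_integral {F : Type*} [NormedAddCommGroup F] [NormedSpace ℂ F]
    (f : R3 → F) (k : R3) : ‖𝓕 f k‖ ≤ ∫ x, ‖f x‖ :=
  VectorFourier.norm_fourierIntegral_le_integral_norm _ _ _ _ _

theorem norm_fourierInv_le_integral {F : Type*} [NormedAddCommGroup F] [NormedSpace ℂ F]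
    (f : R3 → F) (k : R3) : ‖𝓕⁻ f k‖ ≤ ∫ x, ‖f x‖ := by
  rw [Real.fourierInv_eq_fourier_neg]
  exact norm_fourier_le_integral f _

theorem continuous_fourier {F : Type*} [NormedAddCommGroup F] [NormedSpace ℂ F]
    {f : R3 → F} (hf : Integrable f) : Continuous (𝓕 f) :=
  VectorFourier.fourierIntegral_continuous Real.continuous_fourierChar
    (by exact continuous_inner) hf

theorem continuous_fourierInv {F : Type*} [NormedAddCommGroup F] [NormedSpace ℂ F]
    {f : R3 → F} (hf : Integrable f) : Continuous (𝓕⁻ f) := by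
  have : 𝓕⁻ f = fun x => 𝓕 f (-x) := funext fun x => Real.fourierInv_eq_fourier_neg f x
  rw [this]
  exact (continuous_fourier hf).comp continuous_neg

theorem integral_fourier_smul {F : Type*} [NormedAddCommGroup F] [NormedSpace ℂ F]
    [CompleteSpace F] {φ : R3 → ℂ} {f : R3 → F} (hφ : Integrable φ) (hf : Integrable f) :
    ∫ k, 𝓕 φ k • f k = ∫ x, φ x • 𝓕 f x := by
  have := VectorFourier.integral_fourierIntegral_smul_eq_flip (L := innerₗ R3) (μ := volume)
    (ν := volume) Real.continuous_fourierChar (by exact continuous_inner) hφ hf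
  rw [flip_innerₗ] at this
  exact this

theorem integral_fourierInv_smul {F : Type*} [NormedAddCommGroup F] [NormedSpace ℂ F]
    [CompleteSpace F] {φ : R3 → ℂ} {f : R3 → F} (hφ : Integrable φ) (hf : Integrable f) :
    ∫ k, 𝓕⁻ φ k • f k = ∫ x, φ x • 𝓕⁻ f x := by
  have h1 : ∀ k, 𝓕⁻ φ k = 𝓕 φ (-k) := Real.fourierInv_eq_fourier_neg φ
  have h2 : ∀ k, 𝓕⁻ f k = 𝓕 (fun x => f (-x)) k := fun k => by
    rw [Real.fourierInv_eq_fourier_comp_neg]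
  simp only [h1, h2]
  rw [← integral_fourier_smul hφ hf.comp_neg, ← integral_neg_eq_self]
  simp

theorem exists_dist_fourier {f : R3 → C3} (hf : Integrable f) :
    ∃ T, IsFunction T f ∧ IsFunction (𝓕 T) (𝓕 f) := by
  have hint := integrable_schwartz_smul_of_integrable hf
  obtain ⟨T, hT⟩ := exists_dist_of_memLp (memLp_one_iff_integrable.2 hf) hint
  refine ⟨T, hT, fun φ => ⟨integrable_schwartz_smul_of_bdd
    (continuous_fourier hf).aestronglyMeasurable (norm_fourier_le_integral f) φ, ?_⟩⟩
  rw [TemperedDistribution.fourier_apply, (hT _).2, ← integral_fourier_smul φ.integrable hf]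
  rfl

/-- An integrable f has a bounded inverse transform, which is a tempered distribution through L^∞
even when it is not in L². It is in this sense that G₀ − G_λ and its transverse part are handled. -/
theorem exists_dist_fourierInv {f : R3 → C3} (hf : Integrable f) :
    ∃ T, IsFunction T (𝓕⁻ f) ∧ IsFunction (𝓕 T) f := by
  have hm := (continuous_fourierInv hf).aestronglyMeasurable (μ := volume)
  obtain ⟨T, hT⟩ := exists_dist_of_memLp (p := ⊤)
    (memLp_top_of_bound hm _ (Eventually.of_forall (norm_fourierInv_le_integral f)))
    (integrable_schwartz_smul_of_bdd hm (norm_fourierInv_le_integral f))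
  refine ⟨T, hT, fun φ => ⟨integrable_schwartz_smul_of_integrable hf φ, ?_⟩⟩
  rw [TemperedDistribution.fourier_apply, (hT _).2,
    ← integral_fourierInv_smul (SchwartzMap.integrable _) hf]
  have h1 : ∀ k, 𝓕⁻ (⇑(𝓕 φ : 𝓢(R3, ℂ))) k = φ k := fun k => by
    rw [← SchwartzMap.fourierInv_coe, FourierTransform.fourierInv_fourier_eq]
  simp only [h1]

/-- The Plancherel transform and the Fourier integral define the same tempered distribution. -/
theorem fourier_toLp {f : R3 → C3} (hf : Integrable f) (h2 : MemLp f 2 volume) :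
    (𝓕 (h2.toLp f) : L2) =ᵐ[volume] 𝓕 f := by
  obtain ⟨T, hT, hT'⟩ := exists_dist_fourier hf
  rw [hT.eq_asDist h2] at hT'
  exact (isFunction_fourier _).ae_eq hT'

theorem fourierInv_toLp {f : R3 → C3} (hf : Integrable f) (h2 : MemLp f 2 volume) :
    (𝓕⁻ (h2.toLp f) : L2) =ᵐ[volume] 𝓕⁻ f := by
  obtain ⟨T, hT, hT'⟩ := exists_dist_fourierInv hf
  have h3 : T = asDist (𝓕⁻ (h2.toLp f)) := by
    rw [asDist, ← Lp.fourierInv_toTemperedDistribution_eq, ← asDist, ← hT'.eq_asDist h2,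
      FourierTransform.fourierInv_fourier_eq]
  rw [h3] at hT
  exact (isFunction_asDist _).ae_eq hT

/-! ### The Green function -/

theorem measurable_green (lam : ℝ) : Measurable (green lam) := by
  unfold green
  fun_prop

theorem green_nonneg (lam : ℝ) (x : R3) : 0 ≤ green lam x := by
  unfold green
  positivity

/-- The radial profile of the Green function. -/
def greenProfile (lam r : ℝ) : ℝ := Real.exp (-Real.sqrt lam * r) / (4 * Real.pi * r)

theorem green_eq (lam : ℝ) (x : R3) : green lam x = greenProfile lam ‖x‖ := rfl

theorem measurable_greenProfile (lam : ℝ) : Measurable (greenProfile lam) := by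
  unfold greenProfile
  fun_prop

theorem integrable_green {lam : ℝ} (hl : 0 < lam) : Integrable (green lam) := by
  have hs := Real.sqrt_pos.2 hl
  change Integrable fun x : R3 => greenProfile lam ‖x‖
  rw [integrable_R3_radial]
  have h1 : IntegrableOn (fun r : ℝ => r ^ (1 : ℝ) * Real.exp (-Real.sqrt lam * r)) (Ioi 0) := by
    have := integrableOn_rpow_mul_exp_neg_mul_rpow (s := 1) (p := 1) (b := Real.sqrt lam)
      (by norm_num) (by norm_num) hs
    simpa using this
  refine IntegrableOn.congr_fun (h1.div_const (4 * Real.pi)) (fun r hr => ?_) measurableSet_Ioi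
  have hr : 0 < r := hr
  simp only [greenProfile, smul_eq_mul, Real.rpow_one]
  field_simp

theorem integrableOn_exp_neg {s : ℝ} (hs : 0 < s) :
    IntegrableOn (fun r : ℝ => Real.exp (-s * r)) (Ioi 0) :=
  exp_neg_integrableOn_Ioi 0 hs

theorem green_mul_green (lam mu : ℝ) {r : ℝ} (hr : 0 < r) :
    r ^ 2 * (greenProfile lam r * greenProfile mu r) =
      (16 * Real.pi ^ 2)⁻¹ * Real.exp (-(Real.sqrt lam + Real.sqrt mu) * r) := by
  simp only [greenProfile]
  rw [show -(Real.sqrt lam + Real.sqrt mu) * r = -Real.sqrt lam * r + -Real.sqrt mu * r by ring,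
    Real.exp_add]
  field_simp
  ring

theorem memLp_green {lam : ℝ} (hl : 0 < lam) : MemLp (green lam) 2 volume := by
  have hs := Real.sqrt_pos.2 hl
  rw [memLp_two_iff_integrable_sq (measurable_green lam).aestronglyMeasurable]
  change Integrable fun x : R3 => (fun r => greenProfile lam r ^ 2) ‖x‖
  rw [integrable_R3_radial (f := fun r => greenProfile lam r ^ 2)]
  refine IntegrableOn.congr_fun ((integrableOn_exp_neg (s := Real.sqrt lam + Real.sqrt lam)
    (by positivity)).const_mul (16 * Real.pi ^ 2)⁻¹) (fun r hr => ?_) measurableSet_Ioi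
  simp only [smul_eq_mul]
  rw [sq (greenProfile lam r), green_mul_green lam lam hr]

theorem integral_green_mul_green {lam mu : ℝ} (hl : 0 < lam) (hm : 0 < mu) :
    ∫ x, green lam x * green mu x = (4 * Real.pi * (Real.sqrt lam + Real.sqrt mu))⁻¹ := by
  have hs := Real.sqrt_pos.2 hl
  have ht := Real.sqrt_pos.2 hm
  have h1 := integral_R3_radial (fun r => greenProfile lam r * greenProfile mu r)
  simp only [green_eq]
  rw [h1]
  have h2 : ∫ r in Ioi (0 : ℝ), (4 * Real.pi * r ^ 2) • (greenProfile lam r * greenProfile mu r) =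
      ∫ r in Ioi (0 : ℝ), (4 * Real.pi)⁻¹ * Real.exp (-(Real.sqrt lam + Real.sqrt mu) * r) := by
    refine setIntegral_congr_fun measurableSet_Ioi fun r hr => ?_
    have := green_mul_green lam mu hr
    simp only [smul_eq_mul]
    rw [mul_assoc, this]
    field_simp
    ring
  rw [h2, integral_const_mul, integral_exp_mul_Ioi (by linarith)]
  rw [mul_zero, Real.exp_zero]
  field_simp

/-- Imaginary part of the integral of exp((−s + ib)r) over the half-line. -/
theorem integral_exp_mul_sin {s b : ℝ} (hs : 0 < s) :
    ∫ r in Ioi (0 : ℝ), Real.exp (-s * r) * Real.sin (b * r) = b / (s ^ 2 + b ^ 2) := by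
  have ha : (-(s : ℂ) + b * Complex.I).re < 0 := by simpa using hs
  have h1 := integral_exp_mul_complex_Ioi ha 0
  have h2 := integrableOn_exp_mul_complex_Ioi ha 0
  have h3 := Complex.imCLM.integral_comp_comm h2
  rw [h1] at h3
  have h4 : ∀ r : ℝ, Complex.imCLM (Complex.exp ((-(s : ℂ) + b * Complex.I) * r)) =
      Real.exp (-s * r) * Real.sin (b * r) := by
    intro r
    rw [Complex.imCLM_apply, Complex.exp_im]
    simp
  simp only [h4] at h3
  rw [h3]
  simp only [Complex.ofReal_zero, mul_zero, Complex.exp_zero, Complex.imCLM_apply, neg_div,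
    Complex.neg_im, one_div, Complex.inv_im, Complex.normSq_apply]
  simp
  ring

/-- In the radial formula r² sinc(2π|k|r) G_λ(r) is a multiple of e^{−√λ r} sin(2π|k|r), once k ≠ 0
allows the division by |k|. -/
theorem fourier_green {lam : ℝ} (hl : 0 < lam) {k : R3} (hk : k ≠ 0) :
    𝓕 (fun x => (green lam x : ℂ)) k = (((tau k + lam)⁻¹ : ℝ) : ℂ) := by
  have hs := Real.sqrt_pos.2 hl
  have hb : 0 < 2 * Real.pi * ‖k‖ := by positivity
  have h1 := fourier_radial (η := fun r => (greenProfile lam r : ℂ))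
    (by have := measurable_greenProfile lam; fun_prop) (integrable_green hl).ofReal k
  simp only [green_eq]
  rw [h1]
  have h2 : ∫ r in Ioi (0 : ℝ), (4 * Real.pi * r ^ 2 * Real.sinc (2 * Real.pi * ‖k‖ * r)) •
      (greenProfile lam r : ℂ) = ∫ r in Ioi (0 : ℝ), (((2 * Real.pi * ‖k‖)⁻¹ *
        (Real.exp (-Real.sqrt lam * r) * Real.sin (2 * Real.pi * ‖k‖ * r)) : ℝ) : ℂ) := by
    refine setIntegral_congr_fun measurableSet_Ioi fun r hr => ?_
    have hr : 0 < r := hr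
    rw [Complex.real_smul, ← Complex.ofReal_mul, Real.sinc_of_ne_zero (by positivity), greenProfile]
    congr 1
    field_simp
  rw [h2, integral_complex_ofReal, integral_const_mul, integral_exp_mul_sin hs]
  congr 1
  rw [tau, Real.sq_sqrt hl.le]
  have : 0 < lam + (2 * Real.pi * ‖k‖) ^ 2 := by positivity
  field_simp
  ring

/-- The symbol `(4π²|k|² + λ)⁻¹` of the free resolvent. -/
def res (lam : ℝ) (k : R3) : ℂ := (((tau k + lam)⁻¹ : ℝ) : ℂ)

theorem continuous_res {lam : ℝ} (hl : 0 < lam) : Continuous (res lam) := by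
  unfold res
  have := continuous_tau
  refine Complex.continuous_ofReal.comp (Continuous.inv₀ (by fun_prop) fun k => ?_)
  have := tau_nonneg k
  positivity

theorem isRadial_res (lam : ℝ) : IsRadial (res lam) := fun k k' h => by
  simp only [res, tau, h]

theorem norm_res_le {lam : ℝ} (hl : 0 < lam) (k : R3) : ‖res lam k‖ ≤ lam⁻¹ := by
  have := tau_nonneg k
  rw [res, Complex.norm_real, Real.norm_eq_abs, abs_of_pos (by positivity)]
  exact inv_anti₀ hl (by linarith)

theorem bddMeas_res {lam : ℝ} (hl : 0 < lam) : BddMeas (res lam) :=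
  ⟨(continuous_res hl).measurable, _, norm_res_le hl⟩

theorem memLp_green_smul {lam : ℝ} (hl : 0 < lam) (Q : C3) :
    MemLp (fun x => (green lam x : ℂ) • Q) 2 volume := by
  refine MemLp.of_le_mul (c := ‖Q‖) (memLp_green hl) ?_ (Eventually.of_forall fun x => ?_)
  · have := measurable_green lam
    exact Measurable.aestronglyMeasurable (by fun_prop)
  · rw [norm_smul, mul_comm, Complex.norm_real]

theorem integrable_green_smul {lam : ℝ} (hl : 0 < lam) (Q : C3) :
    Integrable (fun x => (green lam x : ℂ) • Q) :=
  (integrable_green hl).ofReal.smul_const Q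

theorem fourier_smul_const {g : R3 → ℂ} (Q : C3) (k : R3) :
    𝓕 (fun x => g x • Q) k = 𝓕 g k • Q := by
  rw [Real.fourier_eq', Real.fourier_eq', ← integral_smul_const]
  simp only [smul_smul, smul_eq_mul]

theorem fourierInv_smul_const {g : R3 → ℂ} (Q : C3) (k : R3) :
    𝓕⁻ (fun x => g x • Q) k = 𝓕⁻ g k • Q := by
  rw [Real.fourierInv_eq_fourier_neg, Real.fourierInv_eq_fourier_neg, fourier_smul_const]

theorem fourier_toL2_green {lam : ℝ} (hl : 0 < lam) (Q : C3) :
    (𝓕 (toL2 fun x => (green lam x : ℂ) • Q) : L2) =ᵐ[volume] fun k => res lam k • Q := by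
  rw [toL2_eq (memLp_green_smul hl Q)]
  filter_upwards [fourier_toLp (integrable_green_smul hl Q) (memLp_green_smul hl Q),
    Measure.ae_ne volume (0 : R3)] with k h1 hk
  rw [h1, fourier_smul_const, fourier_green hl hk, res]

/-- Read off from Plancherel: times a unit vector, the symbol is the transform of an L² field. -/
theorem memLp_res {lam : ℝ} (hl : 0 < lam) : MemLp (res lam) 2 volume := by
  have h1 := (memLp_congr_ae (fourier_toL2_green hl (EuclideanSpace.single 0 1))).1 (Lp.memLp _)
  refine MemLp.of_le h1 (continuous_res hl).aestronglyMeasurable (Eventually.of_forall fun k => ?_)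
  rw [norm_smul]
  simp

theorem integrable_res_mul_res {lam mu : ℝ} (hl : 0 < lam) (hm : 0 < mu) :
    Integrable fun k => res lam k * res mu k :=
  (memLp_res hl).integrable_mul (memLp_res hm)

/-- Parseval moves the integral to position space, where the product of two Green functions is an
exponential divided by r². -/
theorem integral_res_mul_res {lam mu : ℝ} (hl : 0 < lam) (hm : 0 < mu) :
    ∫ k, res lam k * res mu k = (((4 * Real.pi * (Real.sqrt lam + Real.sqrt mu))⁻¹ : ℝ) : ℂ) := by
  set Q : C3 := EuclideanSpace.single 0 1
  have hQ : inner ℂ Q Q = (1 : ℂ) := by simp [Q]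
  have h1 := Lp.inner_fourier_eq (toL2 fun x => (green lam x : ℂ) • Q)
    (toL2 fun x => (green mu x : ℂ) • Q)
  rw [L2.inner_def, L2.inner_def] at h1
  rw [← integral_green_mul_green hl hm, ← integral_complex_ofReal]
  convert h1 using 1
  · refine integral_congr_ae ?_
    filter_upwards [fourier_toL2_green hl Q, fourier_toL2_green hm Q] with k h2 h3
    rw [h2, h3, inner_smul_left, inner_smul_right, hQ, mul_one, res, res, Complex.conj_ofReal]
  · refine integral_congr_ae ?_
    filter_upwards [coeFn_toL2 (memLp_green_smul hl Q), coeFn_toL2 (memLp_green_smul hm Q)]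
      with k h2 h3
    rw [h2, h3, inner_smul_left, inner_smul_right, hQ, mul_one, Complex.conj_ofReal,
      Complex.ofReal_mul]

theorem MQG_eq {lam : ℝ} (hl : 0 < lam) (Q : C3) :
    MQG lam Q = gvec (res lam) (memLp_res hl) Q := by
  refine hat_ext ?_
  filter_upwards [hat_gvec (memLp_res hl) Q, hat_M (toL2 fun x => (green lam x : ℂ) • Q),
    fourier_toL2_green hl Q] with k h1 h2 h3
  rw [h1, MQG, h2, h3, transverse_smul]

theorem hat_MQG {lam : ℝ} (hl : 0 < lam) (Q : C3) :
    hat (MQG lam Q) =ᵐ[volume] fun k => res lam k • transverse k Q := by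
  rw [MQG_eq hl]
  exact hat_gvec _ Q

/-- The constant is (2/3)/(4π) = 1/(6π). With √λ and √μ as parameters this is a Cauchy kernel. -/
theorem inner_MQG_MQG {lam mu : ℝ} (hl : 0 < lam) (hm : 0 < mu) (Q Q' : C3) :
    inner ℂ (MQG lam Q) (MQG mu Q') =
      (((6 * Real.pi * (Real.sqrt lam + Real.sqrt mu))⁻¹ : ℝ) : ℂ) * inner ℂ Q Q' := by
  rw [MQG_eq hl, MQG_eq hm, inner_gvec_gvec _ _ (isRadial_res lam) (isRadial_res mu)]
  have h1 : ∀ k, (starRingEnd ℂ) (res lam k) = res lam k := fun k => Complex.conj_ofReal _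
  simp only [h1]
  rw [integral_res_mul_res hl hm]
  congr 1
  have := Real.sqrt_pos.2 hl
  have := Real.sqrt_pos.2 hm
  rw [show (2 / 3 : ℂ) = ((2 / 3 : ℝ) : ℂ) by push_cast; ring, ← Complex.ofReal_mul]
  congr 1
  field_simp
  norm_num

/-! ### The difference of the Green functions at `0` and `λ` -/

/-- The symbol `λ / (τ (τ + λ))`, the Fourier transform of `G₀ - G_λ`. -/
def dsym (lam : ℝ) (k : R3) : ℂ := ((lam * ((tau k)⁻¹ * (tau k + lam)⁻¹) : ℝ) : ℂ)

theorem isRadial_dsym (lam : ℝ) : IsRadial (dsym lam) := fun k k' h => by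
  simp only [dsym, tau, h]

/-- The weight r² cancels the singularity 1/τ and leaves a rescaled 1/(1 + x²), integrable with an
arctangent as primitive. -/
theorem dsym_profile {lam : ℝ} (hl : 0 < lam) {r : ℝ} (hr : 0 < r) :
    r ^ 2 * (lam * ((4 * Real.pi ^ 2 * r ^ 2)⁻¹ * (4 * Real.pi ^ 2 * r ^ 2 + lam)⁻¹)) =
      (4 * Real.pi ^ 2)⁻¹ * (1 + (2 * Real.pi / Real.sqrt lam * r) ^ 2)⁻¹ := by
  rw [mul_pow, div_pow, Real.sq_sqrt hl.le]
  field_simp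
  ring

theorem integrable_dsym {lam : ℝ} (hl : 0 < lam) : Integrable (dsym lam) := by
  have hs := Real.sqrt_pos.2 hl
  refine Integrable.ofReal ?_
  change Integrable fun k : R3 => (fun r : ℝ => lam * ((4 * Real.pi ^ 2 * r ^ 2)⁻¹ *
    (4 * Real.pi ^ 2 * r ^ 2 + lam)⁻¹)) ‖k‖
  rw [integrable_R3_radial (f := fun r : ℝ => lam * ((4 * Real.pi ^ 2 * r ^ 2)⁻¹ *
    (4 * Real.pi ^ 2 * r ^ 2 + lam)⁻¹))]
  have h1 := (integrableOn_Ioi_comp_mul_left_iff (fun x : ℝ => (1 + x ^ 2)⁻¹) 0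
    (a := 2 * Real.pi / Real.sqrt lam) (by positivity)).2 integrable_inv_one_add_sq.integrableOn
  exact IntegrableOn.congr_fun (h1.const_mul (4 * Real.pi ^ 2)⁻¹)
    (fun r hr => (dsym_profile hl hr).symm) measurableSet_Ioi

theorem integral_dsym {lam : ℝ} (hl : 0 < lam) :
    ∫ k, dsym lam k = ((Real.sqrt lam / (4 * Real.pi) : ℝ) : ℂ) := by
  have hs := Real.sqrt_pos.2 hl
  unfold dsym
  rw [integral_complex_ofReal]
  congr 1
  have h0 := integral_R3_radial (fun r : ℝ => lam * ((4 * Real.pi ^ 2 * r ^ 2)⁻¹ *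
    (4 * Real.pi ^ 2 * r ^ 2 + lam)⁻¹))
  unfold tau
  rw [h0]
  have h1 : ∫ r in Ioi (0 : ℝ), (4 * Real.pi * r ^ 2) • (lam * ((4 * Real.pi ^ 2 * r ^ 2)⁻¹ *
      (4 * Real.pi ^ 2 * r ^ 2 + lam)⁻¹)) =
      ∫ r in Ioi (0 : ℝ), (Real.pi)⁻¹ * (1 + (2 * Real.pi / Real.sqrt lam * r) ^ 2)⁻¹ := by
    refine setIntegral_congr_fun measurableSet_Ioi fun r hr => ?_
    have := dsym_profile hl hr
    simp only [smul_eq_mul]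
    rw [mul_assoc, this]
    field_simp
  rw [h1, integral_const_mul, integral_comp_mul_left_Ioi (fun x : ℝ => (1 + x ^ 2)⁻¹) 0
    (b := 2 * Real.pi / Real.sqrt lam) (by positivity), mul_zero, integral_Ioi_inv_one_add_sq,
    Real.arctan_zero, smul_eq_mul]
  field_simp
  norm_num

theorem res_sub_res {lam mu : ℝ} (hl : 0 < lam) (hm : 0 < mu) (k : R3) :
    res mu k - res lam k = ((lam - mu : ℝ) : ℂ) * (res mu k * res lam k) := by
  have := tau_nonneg k
  have h1 : tau k + lam ≠ 0 := by positivity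
  have h2 : tau k + mu ≠ 0 := by positivity
  simp only [res, ← Complex.ofReal_sub, ← Complex.ofReal_mul]
  congr 1
  field_simp
  ring

theorem integrable_res_sub_res {lam mu : ℝ} (hl : 0 < lam) (hm : 0 < mu) :
    Integrable fun k => res mu k - res lam k := by
  simp only [res_sub_res hl hm]
  exact (integrable_res_mul_res hm hl).const_mul _

theorem tau_pos {k : R3} (hk : k ≠ 0) : 0 < tau k := by
  unfold tau
  positivity

theorem norm_res_sub_res_le {lam mu : ℝ} (hm : 0 < mu) (hml : mu ≤ lam) {k : R3} (hk : k ≠ 0) :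
    ‖res mu k - res lam k‖ ≤ ‖dsym lam k‖ := by
  have hl := hm.trans_le hml
  have ht := tau_pos hk
  rw [res_sub_res hl hm]
  simp only [res, dsym, ← Complex.ofReal_mul, Complex.norm_real, Real.norm_eq_abs]
  rw [abs_of_nonneg (mul_nonneg (sub_nonneg.2 hml) (by positivity)), abs_of_nonneg (by positivity)]
  have h1 : (tau k + mu)⁻¹ ≤ (tau k)⁻¹ := inv_anti₀ ht (by linarith)
  gcongr
  linarith

theorem res_sub_res_tendsto {lam : ℝ} (hl : 0 < lam) {k : R3} (hk : k ≠ 0) :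
    Tendsto (fun mu : ℝ => res mu k - res lam k) (𝓝 0) (𝓝 (dsym lam k)) := by
  have ht := tau_pos hk
  have h1 : ContinuousAt (fun mu : ℝ => res mu k - res lam k) 0 := by
    unfold res
    refine ContinuousAt.sub ?_ continuousAt_const
    refine Complex.continuous_ofReal.continuousAt.comp (ContinuousAt.inv₀ (by fun_prop) ?_)
    simpa using ht.ne'
  have h2 : res 0 k - res lam k = dsym lam k := by
    simp only [res, dsym, ← Complex.ofReal_sub]
    congr 1
    field_simp
    ring
  rw [← h2]
  exact h1

theorem green_tendsto (x : R3) : Tendsto (fun mu : ℝ => green mu x) (𝓝 0) (𝓝 (green 0 x)) := by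
  have : Continuous fun mu : ℝ => green mu x := by
    unfold green
    fun_prop
  exact this.tendsto 0

theorem green_sub_green_ae {lam mu : ℝ} (hl : 0 < lam) (hm : 0 < mu) :
    (fun x => ((green mu x - green lam x : ℝ) : ℂ)) =ᵐ[volume]
      𝓕⁻ fun k => res mu k - res lam k := by
  -- The L² transform acts on ℂ³-valued fields; the scalar identity is carried on a unit vector and
  -- read off from its first coordinate.
  set Q : C3 := EuclideanSpace.single 0 1
  have hint := (integrable_res_sub_res hl hm).smul_const Q
  have h2 : MemLp (fun k => (res mu k - res lam k) • Q) 2 volume := by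
    refine MemLp.of_le_mul (c := 1) ((memLp_res hm).sub (memLp_res hl)) hint.1
      (Eventually.of_forall fun k => ?_)
    rw [norm_smul]
    simp [Q]
  have h3 : (𝓕 ((toL2 fun x => (green mu x : ℂ) • Q) - toL2 fun x => (green lam x : ℂ) • Q) : L2)
      = h2.toLp _ := by
    have h0 : ∀ A B : L2, (𝓕 (A - B) : L2) = 𝓕 A - 𝓕 B := map_sub (Lp.fourierTransformₗᵢ R3 C3)
    rw [h0]
    refine Lp.ext ?_
    filter_upwards [Lp.coeFn_sub (𝓕 (toL2 fun x => (green mu x : ℂ) • Q) : L2)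
      (𝓕 (toL2 fun x => (green lam x : ℂ) • Q) : L2), fourier_toL2_green hm Q,
      fourier_toL2_green hl Q, h2.coeFn_toLp] with k e1 e2 e3 e4
    rw [e1, e4, Pi.sub_apply, e2, e3, sub_smul]
  have h4 := fourierInv_toLp hint h2
  rw [← h3, FourierTransform.fourierInv_fourier_eq] at h4
  filter_upwards [h4, Lp.coeFn_sub (toL2 fun x => (green mu x : ℂ) • Q)
    (toL2 fun x => (green lam x : ℂ) • Q), coeFn_toL2 (memLp_green_smul hm Q),
    coeFn_toL2 (memLp_green_smul hl Q)] with x e1 e2 e3 e4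
  rw [fourierInv_smul_const, e2, Pi.sub_apply, e3, e4, ← sub_smul] at e1
  have e5 := congrArg (fun w : C3 => w 0) e1
  simpa [Q] using e5

/-- G₀ is not in L², so the identity is first taken for μ = λ/(n + 1) and then n → ∞. Countably many
exceptional null sets occur, and `dsym lam` dominates all the symbols. -/
theorem green_zero_sub_green_ae {lam : ℝ} (hl : 0 < lam) :
    (fun x => ((green 0 x - green lam x : ℝ) : ℂ)) =ᵐ[volume] 𝓕⁻ (dsym lam) := by
  have hmu : ∀ n : ℕ, 0 < lam / (n + 1) := fun n => by positivity
  have hlim : Tendsto (fun n : ℕ => lam / ((n : ℝ) + 1)) atTop (𝓝 0) :=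
    tendsto_const_div_atTop_nhds_zero_nat lam |>.comp (tendsto_add_atTop_nat 1) |>.congr
      fun n => by simp
  filter_upwards [ae_all_iff.2 fun n => green_sub_green_ae hl (hmu n)] with x hx
  have h1 : Tendsto (fun n : ℕ => ((green (lam / (n + 1)) x - green lam x : ℝ) : ℂ)) atTop
      (𝓝 ((green 0 x - green lam x : ℝ) : ℂ)) := by
    refine (Complex.continuous_ofReal.tendsto _).comp ?_
    exact ((green_tendsto x).comp hlim).sub_const _
  have h2 : Tendsto (fun n : ℕ => 𝓕⁻ (fun k => res (lam / (n + 1)) k - res lam k) x) atTop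
      (𝓝 (𝓕⁻ (dsym lam) x)) := by
    simp only [Real.fourierInv_eq']
    refine tendsto_integral_of_dominated_convergence (fun k => ‖dsym lam k‖) (fun n => ?_)
      (integrable_dsym hl).norm (fun n => ?_) ?_
    · have h3 : Continuous fun k : R3 =>
          Complex.exp (((2 * Real.pi * inner ℝ k x : ℝ) : ℂ) * Complex.I) := by fun_prop
      exact h3.aestronglyMeasurable.smul (integrable_res_sub_res hl (hmu n)).1
    · filter_upwards [Measure.ae_ne volume (0 : R3)] with k hk
      rw [norm_smul, Complex.norm_exp_ofReal_mul_I, one_mul]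
      refine norm_res_sub_res_le (hmu n) (div_le_self hl.le ?_) hk
      have : (0 : ℝ) ≤ n := n.cast_nonneg
      linarith
    · filter_upwards [Measure.ae_ne volume (0 : R3)] with k hk
      have h3 := (res_sub_res_tendsto hl hk).comp hlim
      simp only [smul_eq_mul]
      exact h3.const_mul _
  exact tendsto_nhds_unique h1 (h2.congr fun n => (hx n).symm)

/-! ### The field `M Q G₀` -/

theorem IsFunction.add {S T : 𝓢'(R3, C3)} {f g : R3 → C3} (hS : IsFunction S f)
    (hT : IsFunction T g) : IsFunction (S + T) fun x => f x + g x := by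
  intro φ
  simp only [smul_add]
  refine ⟨(hS φ).1.add (hT φ).1, ?_⟩
  rw [integral_add (hS φ).1 (hT φ).1, ← (hS φ).2, ← (hT φ).2]
  rfl

/-- The field `M Q G₀`, as `M Q G_λ` plus a bounded continuous field. -/
def zeroField (lam : ℝ) (Q : C3) (x : R3) : C3 :=
  (MQG lam Q : L2) x + 𝓕⁻ (fun k => dsym lam k • transverse k Q) x

theorem res_add_dsym {lam : ℝ} (hl : 0 < lam) {k : R3} (hk : k ≠ 0) :
    res lam k + dsym lam k = res 0 k := by
  have ht := tau_pos hk
  simp only [res, dsym, ← Complex.ofReal_add]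
  congr 1
  field_simp
  ring

/-- G₀ = G_λ + (G₀ − G_λ), with an L² field and the inverse transform of an integrable symbol; the
two transforms add up to 1/τ, which is `res 0`. -/
theorem isDivFreeProjection_zeroField {lam : ℝ} (hl : 0 < lam) (Q : C3) :
    IsDivFreeProjection (fun x => (green 0 x : ℂ) • Q) (zeroField lam Q) := by
  obtain ⟨S, hS, hS'⟩ := exists_dist_fourierInv ((integrable_dsym hl).smul_const Q)
  obtain ⟨T, hT, hT'⟩ := exists_dist_fourierInv (integrable_smul_transverse (integrable_dsym hl) Q)
  refine ⟨asDist (toL2 fun x => (green lam x : ℂ) • Q) + S, asDist (MQG lam Q : L2) + T,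
    fun k => res 0 k • Q, ?_, ?_, ?_, ?_⟩
  · refine ((isFunction_asDist _).add hS).congr ?_
    filter_upwards [coeFn_toL2 (memLp_green_smul hl Q), green_zero_sub_green_ae hl] with x h1 h2
    rw [h1, fourierInv_smul_const, ← h2, ← add_smul]
    congr 1
    push_cast
    ring
  · exact (isFunction_asDist _).add hT
  · rw [FourierTransform.fourier_add]
    refine ((isFunction_fourier _).add hS').congr ?_
    filter_upwards [fourier_toL2_green hl Q, Measure.ae_ne volume (0 : R3)] with k h1 hk
    rw [h1, ← add_smul, res_add_dsym hl hk]
  · rw [FourierTransform.fourier_add]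
    refine ((isFunction_fourier _).add hT').congr ?_
    filter_upwards [hat_MQG hl Q, Measure.ae_ne volume (0 : R3)] with k h1 hk
    rw [← hat_apply, h1, ← add_smul, res_add_dsym hl hk, transverse_smul]

/-- Makes the field W in `BoundaryCondition` unique up to a null set, so that `zeroField` may be
used in its place. -/
theorem IsDivFreeProjection.ae_eq {f g g' : R3 → C3} (h : IsDivFreeProjection f g)
    (h' : IsDivFreeProjection f g') : g =ᵐ[volume] g' := by
  obtain ⟨S, T, F, h1, h2, h3, h4⟩ := h
  obtain ⟨S', T', F', h1', h2', h3', h4'⟩ := h'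
  rw [← h1.unique h1'] at h3'
  have hF := h3.ae_eq h3'
  have h5 : 𝓕 T = 𝓕 T' := (h4.congr (by
    filter_upwards [hF] with k hk
    rw [hk])).unique h4'
  have h6 : T = T' := by
    rw [← FourierTransform.fourierInv_fourier_eq (F := 𝓢'(R3, C3)) T, h5,
      FourierTransform.fourierInv_fourier_eq]
  rw [← h6] at h2'
  exact h2.ae_eq h2'

/-! ### Polar coordinates -/

/-- The unit sphere. -/
abbrev S2 : Type := Metric.sphere (0 : R3) 1

/-- The surface measure of the unit sphere. -/
abbrev sphereMeasure : Measure S2 := (volume : Measure R3).toSphere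

theorem sphereMeasure_real_univ : sphereMeasure.real univ = 4 * Real.pi := by
  rw [Measure.toSphere_real_apply_univ, Measure.real, EuclideanSpace.volume_ball_fin_three,
    ENNReal.toReal_mul, ENNReal.toReal_ofReal (by positivity), finrank_euclideanSpace_fin]
  simp
  ring

theorem measurePreserving_polar :
    MeasurePreserving (fun p : S2 × Ioi (0 : ℝ) => (p.2 : ℝ) • (p.1 : R3))
      (sphereMeasure.prod (Measure.volumeIoiPow 2)) volume := by
  have h1 := (volume : Measure R3).measurePreserving_homeomorphUnitSphereProd
  rw [finrank_euclideanSpace_fin] at h1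
  have h2 := h1.symm (homeomorphUnitSphereProd R3).toMeasurableEquiv
  have h3 : MeasurePreserving (Subtype.val : ({(0 : R3)}ᶜ : Set R3) → R3)
      (Measure.comap Subtype.val volume) volume := by
    have h4 := measurePreserving_subtype_coe (μa := (volume : Measure R3))
      (measurableSet_singleton (0 : R3)).compl
    rwa [restrict_compl_singleton] at h4
  exact h3.comp h2

theorem measurableEmbedding_polar :
    MeasurableEmbedding (fun p : S2 × Ioi (0 : ℝ) => (p.2 : ℝ) • (p.1 : R3)) :=
  (MeasurableEmbedding.subtype_coe (measurableSet_singleton (0 : R3)).compl).comp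
    (homeomorphUnitSphereProd R3).symm.measurableEmbedding

theorem ae_volumeIoiPow {p : ℝ → Prop} (h : ∀ᵐ r : Ioi (0 : ℝ) ∂(Measure.volumeIoiPow 2), p r) :
    ∀ᵐ r : ℝ, 0 < r → p r := by
  rw [Measure.volumeIoiPow, ae_withDensity_iff (by fun_prop)] at h
  have h1 : ∀ᵐ r : Ioi (0 : ℝ) ∂(Measure.comap Subtype.val volume), p r := by
    filter_upwards [h] with r hr
    refine hr ?_
    have := r.2
    have hr : (0 : ℝ) < r := this
    simp only [ne_eq, ENNReal.ofReal_eq_zero, not_le]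
    positivity
  exact (ae_restrict_iff' measurableSet_Ioi).1 ((ae_restrict_iff_subtype measurableSet_Ioi).2 h1)

/-- Fubini in polar coordinates. This is what gives spherical means of a class of functions a sense
for almost every radius. -/
theorem ae_sphere {p : R3 → Prop} (h : ∀ᵐ x, p x) :
    ∀ᵐ r : ℝ, 0 < r → ∀ᵐ ω : S2 ∂sphereMeasure, p (r • (ω : R3)) := by
  have h1 := measurePreserving_polar.quasiMeasurePreserving.ae h
  have h2 := Measure.ae_ae_of_ae_prod
    (Measure.measurePreserving_swap.quasiMeasurePreserving.ae h1)
  exact ae_volumeIoiPow (p := fun r => ∀ᵐ ω : S2 ∂sphereMeasure, p (r • (ω : R3))) h2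

theorem integrable_volumeIoiPow_iff {F : Type*} [NormedAddCommGroup F] [NormedSpace ℝ F]
    {g : ℝ → F} : Integrable (fun r : Ioi (0 : ℝ) => g r) (Measure.volumeIoiPow 2) ↔
      IntegrableOn (fun r => r ^ 2 • g r) (Ioi 0) := by
  rw [integrableOn_iff_comap_subtypeVal measurableSet_Ioi, Measure.volumeIoiPow,
    integrable_withDensity_iff_integrable_smul' (by fun_prop) (by simp)]
  refine integrable_congr (Eventually.of_forall fun r => ?_)
  simp [ENNReal.toReal_ofReal (sq_nonneg (r : ℝ))]

theorem integral_volumeIoiPow {F : Type*} [NormedAddCommGroup F] [NormedSpace ℝ F] (g : ℝ → F) :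
    ∫ r : Ioi (0 : ℝ), g r ∂(Measure.volumeIoiPow 2) = ∫ r in Ioi (0 : ℝ), r ^ 2 • g r := by
  rw [Measure.volumeIoiPow, integral_withDensity_eq_integral_toReal_smul (by fun_prop) (by simp),
    ← integral_subtype_comap measurableSet_Ioi]
  refine integral_congr_ae (Eventually.of_forall fun r => ?_)
  simp [ENNReal.toReal_ofReal (sq_nonneg (r : ℝ))]

section Polar

variable {F : Type*} [NormedAddCommGroup F] {f : R3 → F}

theorem integrable_polar (hf : Integrable f) :
    Integrable (fun p : Ioi (0 : ℝ) × S2 => f ((p.1 : ℝ) • (p.2 : R3)))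
      ((Measure.volumeIoiPow 2).prod sphereMeasure) :=
  ((measurePreserving_polar.integrable_comp_emb measurableEmbedding_polar).2 hf).swap

theorem ae_integrable_sphere (hf : Integrable f) :
    ∀ᵐ r : ℝ, 0 < r → Integrable (fun ω : S2 => f (r • (ω : R3))) sphereMeasure :=
  ae_volumeIoiPow (p := fun r => Integrable (fun ω : S2 => f (r • (ω : R3))) sphereMeasure)
    (integrable_polar hf).prod_right_ae

theorem integrableOn_sphere [NormedSpace ℝ F] (hf : Integrable f) :
    IntegrableOn (fun r : ℝ => r ^ 2 • ∫ ω : S2, f (r • (ω : R3)) ∂sphereMeasure) (Ioi 0) :=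
  integrable_volumeIoiPow_iff.1 (integrable_polar hf).integral_prod_left

theorem integral_sphere [NormedSpace ℝ F] (hf : Integrable f) :
    ∫ x, f x = ∫ r in Ioi (0 : ℝ), r ^ 2 • ∫ ω : S2, f (r • (ω : R3)) ∂sphereMeasure := by
  rw [← integral_volumeIoiPow (fun r : ℝ => ∫ ω : S2, f (r • (ω : R3)) ∂sphereMeasure),
    ← integral_prod _ (integrable_polar hf), ← integral_prod_swap]
  exact (measurePreserving_polar.integral_comp measurableEmbedding_polar f).symm

end Polar

/-! ### Sphere means -/

theorem HasSphereMeans.congr {f g : R3 → C3} {S : ℝ → C3} (h : HasSphereMeans f S)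
    (hfg : f =ᵐ[volume] g) : HasSphereMeans g S := by
  refine ⟨h.1, ?_⟩
  filter_upwards [h.2, ae_sphere hfg] with r h1 h2 hr
  refine ⟨(h1 hr).1.congr (h2 hr), ?_⟩
  rw [(h1 hr).2, integral_congr_ae (h2 hr)]

theorem HasSphereMeans.eqOn {f : R3 → C3} {S S' : ℝ → C3} (h : HasSphereMeans f S)
    (h' : HasSphereMeans f S') : EqOn S S' (Ioi 0) := by
  refine Measure.eqOn_open_of_ae_eq (μ := volume) ?_ isOpen_Ioi h.1 h'.1
  refine (ae_restrict_iff' measurableSet_Ioi).2 ?_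
  filter_upwards [h.2, h'.2] with r h1 h2 hr
  rw [(h1 hr).2, (h2 hr).2]

theorem HasSphereMeans.tendsto_unique {f : R3 → C3} {S S' : ℝ → C3} (h : HasSphereMeans f S)
    (h' : HasSphereMeans f S') {v : C3} (hS : Tendsto S (𝓝[>] 0) (𝓝 v)) :
    Tendsto S' (𝓝[>] 0) (𝓝 v) :=
  hS.congr' (by
    filter_upwards [self_mem_nhdsWithin] with r hr
    exact h.eqOn h' hr)

/-- The spherical means of a continuous function. -/
theorem exists_sphereMeans_of_continuous {f : R3 → C3} (hf : Continuous f) :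
    ∃ S, HasSphereMeans f S ∧ Tendsto S (𝓝[>] 0) (𝓝 (f 0)) := by
  have hc : Continuous fun r : ℝ =>
      ((4 * Real.pi)⁻¹ : ℝ) • ∫ ω : S2, f (r • (ω : R3)) ∂sphereMeasure := by
    have h1 : Continuous (Function.uncurry fun (r : ℝ) (ω : S2) => f (r • (ω : R3))) := by
      unfold Function.uncurry
      fun_prop
    have h2 := continuous_parametric_integral_of_continuous (μ := sphereMeasure) h1 isCompact_univ
    simp only [Measure.restrict_univ] at h2
    exact Continuous.const_smul h2 ((4 * Real.pi)⁻¹ : ℝ)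
  refine ⟨_, ⟨hc.continuousOn, Eventually.of_forall fun r _ => ⟨?_, rfl⟩⟩, ?_⟩
  · exact Continuous.integrable_of_hasCompactSupport (by fun_prop)
      (HasCompactSupport.of_compactSpace _)
  · have h1 := hc.tendsto 0
    simp only [zero_smul, integral_const, sphereMeasure_real_univ, smul_smul] at h1
    rw [inv_mul_cancel₀ (by positivity), one_smul] at h1
    exact h1.mono_left nhdsWithin_le_nhds

/-- Spherical means are determined by integrals against radial test functions. -/
theorem hasSphereMeans_of_test {f : R3 → C3} (hf : MemLp f 2 volume) {S : ℝ → C3}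
    (hS : ContinuousOn S (Ioi 0))
    (h : ∀ η : ℝ → ℝ, ContDiff ℝ (⊤ : ℕ∞) η → HasCompactSupport η → tsupport η ⊆ Ioi 0 →
      ∫ x, η ‖x‖ • f x = ∫ r in Ioi (0 : ℝ), (4 * Real.pi * r ^ 2 * η r) • S r) :
    HasSphereMeans f S := by
  refine ⟨hS, ?_⟩
  have hnorm : ∀ r : ℝ, 0 < r → ∀ ω : S2, ‖r • (ω : R3)‖ = r := fun r hr ω => by
    rw [norm_smul, norm_eq_of_mem_sphere, mul_one, Real.norm_eq_abs, abs_of_pos hr]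
  -- cutting off at radius `b`
  have hcut : ∀ b : ℝ, Integrable ((Metric.ball (0 : R3) b).indicator f) := fun b => by
    rw [integrable_indicator_iff measurableSet_ball]
    exact (hf.locallyIntegrable (by norm_num)).integrableOn_isCompact
      (isCompact_closedBall (0 : R3) b) |>.mono_set Metric.ball_subset_closedBall
  have hcutval : ∀ b r : ℝ, 0 < r → r < b → ∀ ω : S2,
      (Metric.ball (0 : R3) b).indicator f (r • (ω : R3)) = f (r • (ω : R3)) := by
    intro b r hr hrb ω
    rw [indicator_of_mem]
    rw [mem_ball_zero_iff, hnorm r hr]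
    exact hrb
  have hint : ∀ᵐ r : ℝ, 0 < r → Integrable (fun ω : S2 => f (r • (ω : R3))) sphereMeasure := by
    filter_upwards [ae_all_iff.2 fun n : ℕ => ae_integrable_sphere (hcut n)] with r h1 hr
    obtain ⟨n, hn⟩ := exists_nat_gt r
    simpa only [hcutval n r hr hn] using h1 n hr
  set m : ℝ → C3 := fun r => ∫ ω : S2, f (r • (ω : R3)) ∂sphereMeasure with hm
  have hloc : LocallyIntegrableOn (fun r => r ^ 2 • m r) (Ioi 0) := by
    rw [locallyIntegrableOn_iff isOpen_Ioi.isLocallyClosed]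
    intro K hK hKc
    obtain ⟨b, hb⟩ := hKc.isBounded.subset_ball 0
    refine ((integrableOn_sphere (hcut b)).mono_set hK).congr_fun (fun r hr => ?_)
      hKc.measurableSet
    have hr0 : 0 < r := hK hr
    have hrb : r < b := by
      have := hb hr
      rw [mem_ball_zero_iff, Real.norm_eq_abs, abs_of_pos hr0] at this
      exact this
    simp only [hcutval b r hr0 hrb, hm]
  have hlocS : LocallyIntegrableOn (fun r => (4 * Real.pi * r ^ 2) • S r) (Ioi 0) := by
    refine ContinuousOn.locallyIntegrableOn ?_ measurableSet_Ioi
    exact ContinuousOn.smul (f := fun r : ℝ => 4 * Real.pi * r ^ 2) (by fun_prop) hS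
  -- Fubini turns the hypothesis into the equality of the pairings of r² m(r) and 4πr² S(r) with
  -- every test function supported in (0, ∞).
  have hzero : ∀ᵐ r : ℝ, r ∈ Ioi (0 : ℝ) → r ^ 2 • m r - (4 * Real.pi * r ^ 2) • S r = 0 := by
    refine isOpen_Ioi.ae_eq_zero_of_integral_contDiff_smul_eq_zero (hloc.sub hlocS)
      fun η η1 η2 η3 => ?_
    obtain ⟨b, hb⟩ := η2.isCompact.isBounded.subset_ball 0
    have hηb : ∀ r : ℝ, 0 < r → η r ≠ 0 → r < b := fun r hr hne => by
      have := hb (subset_tsupport _ hne)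
      rwa [mem_ball_zero_iff, Real.norm_eq_abs, abs_of_pos hr] at this
    have hη0 : ∀ r : ℝ, r ∉ Ioi (0 : ℝ) → η r = 0 := fun r hr => by
      by_contra hne
      exact hr (η3 (subset_tsupport _ hne))
    have hηf : Integrable fun x => η ‖x‖ • f x := by
      obtain ⟨C, hC⟩ := η2.exists_bound_of_continuous η1.continuous
      have : (fun x => η ‖x‖ • f x) = fun x => η ‖x‖ • (Metric.ball (0 : R3) b).indicator f x := by
        ext1 x
        by_cases hx : η ‖x‖ = 0
        · rw [hx, zero_smul, zero_smul]
        · have hx0 : 0 < ‖x‖ := by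
            by_contra h0
            exact hx (hη0 _ h0)
          rw [indicator_of_mem]
          rw [mem_ball_zero_iff]
          exact hηb _ hx0 hx
      rw [this]
      exact (hcut b).bdd_smul C (η1.continuous.comp continuous_norm).aestronglyMeasurable
        (Eventually.of_forall fun x => hC _)
    have e1 : ∫ x, η ‖x‖ • f x = ∫ r in Ioi (0 : ℝ), η r • (r ^ 2 • m r) := by
      rw [integral_sphere hηf]
      refine setIntegral_congr_fun measurableSet_Ioi fun r hr => ?_
      simp only [hnorm r hr, hm]
      rw [integral_smul, smul_comm]
    have e2 : ∫ r in Ioi (0 : ℝ), (4 * Real.pi * r ^ 2 * η r) • S r =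
        ∫ r in Ioi (0 : ℝ), η r • ((4 * Real.pi * r ^ 2) • S r) := by
      refine setIntegral_congr_fun measurableSet_Ioi fun r hr => ?_
      simp only [smul_smul]
      congr 1
      ring
    have i1 : IntegrableOn (fun r => η r • (r ^ 2 • m r)) (Ioi 0) := by
      refine (integrableOn_sphere hηf).congr_fun (fun r hr => ?_) measurableSet_Ioi
      simp only [hnorm r hr, hm]
      rw [integral_smul, smul_comm]
    have i2 : IntegrableOn (fun r => η r • ((4 * Real.pi * r ^ 2) • S r)) (Ioi 0) := by
      have hK := (locallyIntegrableOn_iff isOpen_Ioi.isLocallyClosed).1 hlocS _ η3 η2.isCompact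
      have h5 : IntegrableOn (fun r => η r • ((4 * Real.pi * r ^ 2) • S r)) (tsupport η) := by
        obtain ⟨C, hC⟩ := η2.exists_bound_of_continuous η1.continuous
        exact hK.bdd_smul C η1.continuous.aestronglyMeasurable (Eventually.of_forall fun x => hC _)
      refine IntegrableOn.of_forall_sdiff_eq_zero h5 measurableSet_Ioi fun r hr => ?_
      rw [image_eq_zero_of_notMem_tsupport hr.2, zero_smul]
    have e3 : ∫ r, η r • (r ^ 2 • m r - (4 * Real.pi * r ^ 2) • S r) =
        ∫ r in Ioi (0 : ℝ), η r • (r ^ 2 • m r - (4 * Real.pi * r ^ 2) • S r) := by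
      refine (setIntegral_eq_integral_of_forall_compl_eq_zero fun r hr => ?_).symm
      rw [hη0 r hr, zero_smul]
    rw [e3]
    simp only [smul_sub]
    rw [integral_sub i1 i2, ← e1, ← e2, h η η1 η2 η3, sub_self]
  filter_upwards [hint, hzero] with r h1 h2 hr
  refine ⟨h1 hr, ?_⟩
  have h3 := sub_eq_zero.1 (h2 hr)
  have hr2 : r ^ 2 ≠ 0 := by positivity
  have h4 : (4 * Real.pi) • S r = m r := by
    have := congrArg (fun v => (r ^ 2)⁻¹ • v) h3
    simp only [smul_smul] at this
    rw [inv_mul_cancel₀ hr2, one_smul, mul_comm (4 * Real.pi), ← mul_assoc, inv_mul_cancel₀ hr2,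
      one_mul] at this
    exact this.symm
  change S r = (4 * Real.pi)⁻¹ • m r
  rw [← h4, smul_smul, inv_mul_cancel₀ (by positivity), one_smul]

/-! ### Sobolev classes as ranges of multipliers -/

theorem mem_Hstar_iff (s : ℝ) (A : L2star) : A ∈ Hstar s ↔
    MemLp (fun k => ((((1 + ‖k‖ ^ 2) ^ (s / 2) : ℝ)) : ℂ) • hat A k) 2 volume :=
  memSobolev_iff s (A : L2)

/-- A symbol comparable with (1 + |k|²)^{−s/2} may be traded for the Sobolev weight at the cost of a
constant, whatever λ it depends on. -/
theorem mem_Hstar_iff_fmul {s : ℝ} {g : R3 → ℂ} (hg : BddMeas g) {c₁ c₂ : ℝ} (hc₁ : 0 < c₁)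
    (h₁ : ∀ k, c₁ ≤ ‖g k‖ * (1 + ‖k‖ ^ 2) ^ (s / 2))
    (h₂ : ∀ k, ‖g k‖ * (1 + ‖k‖ ^ 2) ^ (s / 2) ≤ c₂) (A : L2star) :
    A ∈ Hstar s ↔ ∃ B, A = fmul g hg B := by
  have hpos : ∀ k : R3, 0 < (1 + ‖k‖ ^ 2) ^ (s / 2) := fun k => by positivity
  have hwm : Measurable fun k : R3 => ((((1 + ‖k‖ ^ 2) ^ (s / 2) : ℝ)) : ℂ) := by fun_prop
  have hg0 : ∀ k, g k ≠ 0 := fun k h => by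
    have := h₁ k
    rw [h, norm_zero, zero_mul] at this
    exact absurd hc₁ (not_lt.2 this)
  rw [mem_Hstar_iff]
  constructor
  · intro h
    have h3 : MemLp (fun k => (g k)⁻¹ • hat A k) 2 volume := by
      refine MemLp.of_le_mul (c := c₁⁻¹) h (hg.1.inv.aestronglyMeasurable.smul
        (Lp.aestronglyMeasurable _)) (Eventually.of_forall fun k => ?_)
      rw [norm_smul, norm_smul, ← mul_assoc, norm_inv, Complex.norm_real, Real.norm_eq_abs,
        abs_of_pos (hpos k)]
      gcongr
      rw [inv_mul_eq_div, le_div_iff₀ hc₁, inv_mul_le_iff₀ (norm_pos_iff.2 (hg0 k))]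
      exact h₁ k
    have h4 : ∀ᵐ k, dotC k ((g k)⁻¹ • hat A k) = 0 := dotC_smul_hat _ A
    refine ⟨ofHat _ h3 h4, hat_ext ?_⟩
    filter_upwards [hat_fmul hg (ofHat _ h3 h4), hat_ofHat h3 h4] with k e1 e2
    rw [e1, e2, smul_smul, mul_inv_cancel₀ (hg0 k), one_smul]
  · rintro ⟨B, rfl⟩
    refine MemLp.of_le_mul (c := c₂) (Lp.memLp (hat B)) (hwm.aestronglyMeasurable.smul
        (Lp.aestronglyMeasurable _)) ?_
    filter_upwards [hat_fmul hg B] with k e1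
    rw [e1, norm_smul, norm_smul, ← mul_assoc, Complex.norm_real, Real.norm_eq_abs,
      abs_of_pos (hpos k), mul_comm _ ‖g k‖]
    gcongr
    exact h₂ k

theorem res_ratio_bounds {lam : ℝ} (hl : 0 < lam) (k : R3) :
    (4 * Real.pi ^ 2 + lam)⁻¹ ≤ (tau k + lam)⁻¹ * (1 + ‖k‖ ^ 2) ∧
      (tau k + lam)⁻¹ * (1 + ‖k‖ ^ 2) ≤ (4 * Real.pi ^ 2)⁻¹ + lam⁻¹ := by
  have ht := tau_nonneg k
  have hp : 0 < 4 * Real.pi ^ 2 := by positivity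
  constructor
  · rw [inv_mul_eq_div, le_div_iff₀ (by positivity), inv_mul_le_iff₀ (by positivity), tau]
    nlinarith [mul_nonneg hl.le (sq_nonneg ‖k‖)]
  · rw [inv_mul_le_iff₀ (by positivity), tau]
    -- Expanding the product yields 1 + |k|² plus nonnegative terms, which explains the sum of two
    -- constants.
    have : (4 * Real.pi ^ 2 * ‖k‖ ^ 2 + lam) * ((4 * Real.pi ^ 2)⁻¹ + lam⁻¹) =
        1 + ‖k‖ ^ 2 + (4 * Real.pi ^ 2 * ‖k‖ ^ 2 / lam + lam / (4 * Real.pi ^ 2)) := by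
      field_simp
      ring
    rw [this]
    have : 0 ≤ 4 * Real.pi ^ 2 * ‖k‖ ^ 2 / lam + lam / (4 * Real.pi ^ 2) := by positivity
    linarith

theorem norm_res {lam : ℝ} (hl : 0 < lam) (k : R3) : ‖res lam k‖ = (tau k + lam)⁻¹ := by
  have := tau_nonneg k
  rw [res, Complex.norm_real, Real.norm_eq_abs, abs_of_pos (by positivity)]

/-- The free resolvent `(-Δ + λ)⁻¹`. -/
def freeRes (lam : ℝ) (hl : 0 < lam) : L2star →L[ℂ] L2star := fmul (res lam) (bddMeas_res hl)

theorem hat_freeRes {lam : ℝ} (hl : 0 < lam) (A : L2star) :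
    hat (freeRes lam hl A) =ᵐ[volume] fun k => res lam k • hat A k := hat_fmul _ A

theorem mem_Hstar_two_iff {lam : ℝ} (hl : 0 < lam) (A : L2star) :
    A ∈ Hstar 2 ↔ ∃ B, A = freeRes lam hl B := by
  refine mem_Hstar_iff_fmul (bddMeas_res hl) (c₁ := (4 * Real.pi ^ 2 + lam)⁻¹) (by positivity)
    (c₂ := (4 * Real.pi ^ 2)⁻¹ + lam⁻¹) (fun k => ?_) (fun k => ?_) A
  all_goals
    rw [norm_res hl, show (2 : ℝ) / 2 = 1 by norm_num, Real.rpow_one]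
  · exact (res_ratio_bounds hl k).1
  · exact (res_ratio_bounds hl k).2

/-- The symbol `(4π²|k|² + λ)^{-1/2}`. -/
def rsq (lam : ℝ) (k : R3) : ℂ := (((Real.sqrt (tau k + lam))⁻¹ : ℝ) : ℂ)

theorem continuous_rsq {lam : ℝ} (hl : 0 < lam) : Continuous (rsq lam) := by
  unfold rsq
  have := continuous_tau
  refine Complex.continuous_ofReal.comp (Continuous.inv₀ (by fun_prop) fun k => ?_)
  have := tau_nonneg k
  positivity

theorem norm_rsq (lam : ℝ) (k : R3) : ‖rsq lam k‖ = (Real.sqrt (tau k + lam))⁻¹ := by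
  rw [rsq, Complex.norm_real, Real.norm_eq_abs, abs_of_nonneg (by positivity)]

theorem rsq_mul_rsq {lam : ℝ} (hl : 0 < lam) (k : R3) : rsq lam k * rsq lam k = res lam k := by
  have := tau_nonneg k
  rw [rsq, res, ← Complex.ofReal_mul, ← mul_inv, Real.mul_self_sqrt (by positivity)]

theorem conj_rsq (lam : ℝ) (k : R3) : (starRingEnd ℂ) (rsq lam k) = rsq lam k :=
  Complex.conj_ofReal _

theorem conj_res (lam : ℝ) (k : R3) : (starRingEnd ℂ) (res lam k) = res lam k :=
  Complex.conj_ofReal _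

theorem bddMeas_rsq {lam : ℝ} (hl : 0 < lam) : BddMeas (rsq lam) := by
  refine ⟨(continuous_rsq hl).measurable, (Real.sqrt lam)⁻¹, fun k => ?_⟩
  have := tau_nonneg k
  rw [norm_rsq]
  exact inv_anti₀ (Real.sqrt_pos.2 hl) (Real.sqrt_le_sqrt (by linarith))

/-- The operator `(-Δ + λ)^{-1/2}`. -/
def freeRsq (lam : ℝ) (hl : 0 < lam) : L2star →L[ℂ] L2star := fmul (rsq lam) (bddMeas_rsq hl)

theorem hat_freeRsq {lam : ℝ} (hl : 0 < lam) (A : L2star) :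
    hat (freeRsq lam hl A) =ᵐ[volume] fun k => rsq lam k • hat A k := hat_fmul _ A

theorem mem_Hstar_one_iff {lam : ℝ} (hl : 0 < lam) (A : L2star) :
    A ∈ Hstar 1 ↔ ∃ B, A = freeRsq lam hl B := by
  have key : ∀ k : R3, ‖rsq lam k‖ * (1 + ‖k‖ ^ 2) ^ (1 / 2 : ℝ) =
      Real.sqrt ((tau k + lam)⁻¹ * (1 + ‖k‖ ^ 2)) := fun k => by
    have := tau_nonneg k
    rw [norm_rsq, ← Real.sqrt_eq_rpow, Real.sqrt_mul (by positivity), Real.sqrt_inv]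
  refine mem_Hstar_iff_fmul (bddMeas_rsq hl) (c₁ := Real.sqrt (4 * Real.pi ^ 2 + lam)⁻¹)
    (by positivity) (c₂ := Real.sqrt ((4 * Real.pi ^ 2)⁻¹ + lam⁻¹)) (fun k => ?_) (fun k => ?_) A
  · rw [key]
    exact Real.sqrt_le_sqrt (res_ratio_bounds hl k).1
  · rw [key]
    exact Real.sqrt_le_sqrt (res_ratio_bounds hl k).2

/-! ### Sphere means of fields -/

/-- The norm is not smooth at the origin, but there η ∘ ‖·‖ vanishes identically. -/
theorem contDiff_radial {η : ℝ → ℝ} (h1 : ContDiff ℝ (⊤ : ℕ∞) η) (h3 : tsupport η ⊆ Ioi 0) :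
    ContDiff ℝ (⊤ : ℕ∞) fun x : R3 => η ‖x‖ := by
  rw [contDiff_iff_contDiffAt]
  intro x
  by_cases hx : x = 0
  · have h4 : ∀ᶠ y : R3 in 𝓝 x, η ‖y‖ = 0 := by
      have h5 : (tsupport η)ᶜ ∈ 𝓝 ‖x‖ := by
        refine (isClosed_tsupport η).isOpen_compl.mem_nhds fun h => ?_
        have := h3 h
        simp [hx] at this
      filter_upwards [continuous_norm.continuousAt.preimage_mem_nhds h5] with y hy
      exact image_eq_zero_of_notMem_tsupport hy
    exact (contDiffAt_const (c := (0 : ℝ))).congr_of_eventuallyEq h4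
  · exact h1.contDiffAt.comp x (contDiffAt_norm ℝ hx)

theorem hasCompactSupport_radial {η : ℝ → ℝ} (h2 : HasCompactSupport η) :
    HasCompactSupport fun x : R3 => η ‖x‖ := by
  obtain ⟨b, hb⟩ := h2.isCompact.isBounded.subset_closedBall 0
  refine HasCompactSupport.intro (isCompact_closedBall (0 : R3) b) fun x hx => ?_
  by_contra hne
  have := hb (subset_tsupport _ hne)
  rw [mem_closedBall_zero_iff, norm_norm] at this
  exact hx (by rwa [mem_closedBall_zero_iff])

/-- The Fourier transform of a radial test function. -/
def radialFT (η : ℝ → ℝ) (k : R3) : ℂ :=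
  ∫ r in Ioi (0 : ℝ), (4 * Real.pi * r ^ 2 * Real.sinc (2 * Real.pi * ‖k‖ * r)) • (η r : ℂ)

theorem isRadial_radialFT (η : ℝ → ℝ) : IsRadial (radialFT η) := fun k k' h => by
  simp only [radialFT, h]

/-- Integrals of a field against radial test functions through its Fourier transform. -/
theorem integral_radial_test {η : ℝ → ℝ} (h1 : ContDiff ℝ (⊤ : ℕ∞) η) (h2 : HasCompactSupport η)
    (h3 : tsupport η ⊆ Ioi 0) (A : L2) :
    MemLp (radialFT η) 2 volume ∧
      ∫ x, η ‖x‖ • A x = ∫ k, radialFT η k • (𝓕 A : L2) k := by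
  have g1 := contDiff_radial h1 h3
  have g2 := hasCompactSupport_radial h2
  have g1' : ContDiff ℝ (⊤ : ℕ∞) (Complex.ofRealCLM ∘ fun x : R3 => η ‖x‖) :=
    Complex.ofRealCLM.contDiff.comp g1
  have g2' : HasCompactSupport (Complex.ofRealCLM ∘ fun x : R3 => η ‖x‖) := g2.comp_left rfl
  set φ : 𝓢(R3, ℂ) := g2'.toSchwartzMap g1' with hφ
  have hφx : ∀ x, φ x = (η ‖x‖ : ℂ) := fun x => rfl
  -- The inverse transform at k is the transform at −k, and the sinc formula depends on |k| only.
  have h4 : ∀ k, (𝓕⁻ φ : 𝓢(R3, ℂ)) k = radialFT η k := by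
    intro k
    have hc : (⇑φ : R3 → ℂ) = fun x => ((fun r => (η r : ℂ)) ‖x‖) := funext hφx
    have hi : Integrable fun x : R3 => ((fun r => (η r : ℂ)) ‖x‖) := by
      rw [← hc]
      exact φ.integrable
    have hF := fourier_radial (η := fun r => (η r : ℂ))
      (by have := h1.continuous.measurable; fun_prop) hi (-k)
    rw [SchwartzMap.fourierInv_coe, Real.fourierInv_eq_fourier_neg, hc]
    refine hF.trans ?_
    rw [norm_neg]
    rfl
  have h5 : asDist A φ = 𝓕 (asDist A) (𝓕⁻ φ) := by
    rw [TemperedDistribution.fourier_apply, FourierTransform.fourier_fourierInv_eq]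
  rw [(isFunction_asDist A φ).2, (isFunction_fourier A _).2] at h5
  constructor
  · have := (𝓕⁻ φ : 𝓢(R3, ℂ)).memLp 2 volume
    rwa [show (⇑(𝓕⁻ φ : 𝓢(R3, ℂ)) : R3 → ℂ) = radialFT η from funext h4] at this
  · simp only [h4, hφx, Complex.coe_smul] at h5
    exact h5

theorem HasSphereMeans.add {f g : R3 → C3} {S T : ℝ → C3} (h : HasSphereMeans f S)
    (h' : HasSphereMeans g T) : HasSphereMeans (fun x => f x + g x) fun r => S r + T r := by
  refine ⟨h.1.add h'.1, ?_⟩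
  filter_upwards [h.2, h'.2] with r h1 h2 hr
  refine ⟨(h1 hr).1.add (h2 hr).1, ?_⟩
  rw [(h1 hr).2, (h2 hr).2, integral_add (h1 hr).1 (h2 hr).1, smul_add]

theorem HasSphereMeans.smul {f : R3 → C3} {S : ℝ → C3} (h : HasSphereMeans f S) (a : ℂ) :
    HasSphereMeans (fun x => a • f x) fun r => a • S r := by
  refine ⟨h.1.const_smul a, ?_⟩
  filter_upwards [h.2] with r h1 hr
  refine ⟨(h1 hr).1.smul a, ?_⟩
  rw [(h1 hr).2, integral_smul, smul_comm]

/-- The spherical means of `M Q G_λ`. -/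
theorem hasSphereMeans_MQG {lam : ℝ} (hl : 0 < lam) (Q : C3) :
    HasSphereMeans (MQG lam Q : L2) fun r => ((2 / 3 * greenProfile lam r : ℝ) : ℂ) • Q := by
  refine hasSphereMeans_of_test (Lp.memLp _) ?_ fun η h1 h2 h3 => ?_
  · refine ContinuousOn.smul (f := fun r => ((2 / 3 * greenProfile lam r : ℝ) : ℂ)) ?_
      continuousOn_const
    refine Complex.continuous_ofReal.comp_continuousOn (continuousOn_const.mul ?_)
    unfold greenProfile
    refine ContinuousOn.div (by fun_prop) (by fun_prop) fun r hr => ?_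
    have : (0 : ℝ) < r := hr
    positivity
  · obtain ⟨hL, e1⟩ := integral_radial_test h1 h2 h3 (MQG lam Q : L2)
    -- The unprojected field Q G_λ is tested alongside: a radial test function sees the transverse
    -- projection only as the factor 2/3.
    have e2 := (integral_radial_test h1 h2 h3 (toL2 fun x => (green lam x : ℂ) • Q)).2
    have e3 : ∫ k, radialFT η k • (𝓕 (MQG lam Q : L2) : L2) k =
        ∫ k, (radialFT η k * res lam k) • transverse k Q := by
      refine integral_congr_ae ?_
      filter_upwards [hat_MQG hl Q] with k hk
      rw [← hat_apply, hk, smul_smul]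
    have e4 : ∫ k, radialFT η k • (𝓕 (toL2 fun x => (green lam x : ℂ) • Q) : L2) k =
        (∫ k, radialFT η k * res lam k) • Q := by
      rw [← integral_smul_const]
      refine integral_congr_ae ?_
      filter_upwards [fourier_toL2_green hl Q] with k hk
      rw [hk, smul_smul]
    have e5 : ∫ x, η ‖x‖ • (toL2 (fun x => (green lam x : ℂ) • Q) : L2) x =
        ∫ r in Ioi (0 : ℝ), (4 * Real.pi * r ^ 2) • ((η r * greenProfile lam r) • Q) := by
      rw [← integral_R3_radial (fun r => (η r * greenProfile lam r) • Q)]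
      refine integral_congr_ae ?_
      filter_upwards [coeFn_toL2 (memLp_green_smul hl Q)] with x hx
      rw [hx, green_eq, mul_smul, Complex.coe_smul]
    have hint : Integrable fun k => radialFT η k * res lam k := hL.integrable_mul (memLp_res hl)
    rw [e1, e3, integral_smul_transverse (h := fun k => radialFT η k * res lam k) hint
      (fun k k' h => by simp only [isRadial_radialFT η k k' h, isRadial_res lam k k' h]),
      mul_smul, ← e4, ← e2, e5, ← integral_smul]
    refine setIntegral_congr_fun measurableSet_Ioi fun r _ => ?_
    show _ = _
    simp only [← Complex.coe_smul, smul_smul]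
    congr 1
    push_cast
    ring

/-- The quantity is sin(2π|k|r)/(2π|k|). A bound uniform in r is needed to dominate the means of an
H¹ field for all radii at once. -/
theorem norm_mul_sinc_le {k : R3} (hk : k ≠ 0) (r : ℝ) :
    |r * Real.sinc (2 * Real.pi * ‖k‖ * r)| ≤ (2 * Real.pi * ‖k‖)⁻¹ := by
  have hb : 0 < 2 * Real.pi * ‖k‖ := by positivity
  by_cases hr : r = 0
  · rw [hr, zero_mul, abs_zero]
    positivity
  · rw [Real.sinc_of_ne_zero (mul_ne_zero hb.ne' hr)]
    have : r * (Real.sin (2 * Real.pi * ‖k‖ * r) / (2 * Real.pi * ‖k‖ * r)) =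
        Real.sin (2 * Real.pi * ‖k‖ * r) * (2 * Real.pi * ‖k‖)⁻¹ := by
      field_simp
    rw [this, abs_mul, abs_of_pos (inv_pos.2 hb)]
    exact mul_le_of_le_one_left (by positivity) (Real.abs_sin_le_one _)

/-- Cauchy–Schwarz: Â = (τ + 1)^{-1/2} B̂, and the square of (2π|k|)⁻¹(τ + 1)^{-1/2} is exactly the
integrable `dsym 1`. -/
theorem integrable_norm_inv_smul_hat {A : L2star} (hA : A ∈ Hstar 1) :
    Integrable fun k => (2 * Real.pi * ‖k‖)⁻¹ * ‖hat A k‖ := by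
  obtain ⟨B, rfl⟩ := (mem_Hstar_one_iff one_pos A).1 hA
  have h1 : MemLp (fun k : R3 => (2 * Real.pi * ‖k‖)⁻¹ * ‖rsq 1 k‖) 2 volume := by
    have hm : Measurable fun k : R3 => (2 * Real.pi * ‖k‖)⁻¹ * ‖rsq 1 k‖ := by
      have := (continuous_rsq one_pos).measurable
      fun_prop
    rw [memLp_two_iff_integrable_sq hm.aestronglyMeasurable]
    refine (integrable_dsym one_pos).norm.congr (Eventually.of_forall fun k => ?_)
    have ht := tau_nonneg k
    simp only [norm_rsq, dsym, Complex.norm_real, Real.norm_eq_abs]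
    rw [abs_of_nonneg (by positivity), mul_pow, inv_pow, inv_pow, Real.sq_sqrt (by positivity),
      one_mul]
    congr 2
    rw [tau]
    ring
  have h2 := h1.integrable_mul (Lp.memLp (hat B)).norm
  refine h2.congr ?_
  filter_upwards [hat_freeRsq one_pos B] with k hk
  rw [hk, norm_smul, Pi.mul_apply]
  ring

/-- `r` times the spherical mean of an `H¹` field. -/
def meanTransform (A : L2star) (r : ℝ) : C3 :=
  ∫ k, (r * Real.sinc (2 * Real.pi * ‖k‖ * r)) • hat A k

theorem aestronglyMeasurable_sinc_smul (A : L2star) (r : ℝ) :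
    AEStronglyMeasurable (fun k => (r * Real.sinc (2 * Real.pi * ‖k‖ * r)) • hat A k) volume := by
  have := Real.continuous_sinc
  have h : Continuous fun k : R3 => r * Real.sinc (2 * Real.pi * ‖k‖ * r) := by fun_prop
  exact h.aestronglyMeasurable.smul (Lp.aestronglyMeasurable _)

theorem norm_sinc_smul_le (A : L2star) : ∀ᵐ k, ∀ r : ℝ,
    ‖(r * Real.sinc (2 * Real.pi * ‖k‖ * r)) • hat A k‖ ≤ (2 * Real.pi * ‖k‖)⁻¹ * ‖hat A k‖ := by
  filter_upwards [Measure.ae_ne volume (0 : R3)] with k hk r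
  rw [norm_smul, Real.norm_eq_abs]
  gcongr
  exact norm_mul_sinc_le hk r

/-- Dominated convergence. Since the transform vanishes at r = 0, r times the mean of an H¹ field
tends to 0, so that such a field carries no charge. -/
theorem continuous_meanTransform {A : L2star} (hA : A ∈ Hstar 1) :
    Continuous (meanTransform A) := by
  refine continuous_of_dominated (aestronglyMeasurable_sinc_smul A) (fun r => ?_)
    (integrable_norm_inv_smul_hat hA) (Eventually.of_forall fun k => ?_)
  · filter_upwards [norm_sinc_smul_le A] with k hk
    exact hk r
  · have := Real.continuous_sinc
    fun_prop

/-- A radial test function has a superposition of sinc functions as its transform; Fubini exchanges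
the integrals over k and over the radius. -/
theorem hasSphereMeans_Hstar_one {A : L2star} (hA : A ∈ Hstar 1) :
    HasSphereMeans (A : L2) fun r => r⁻¹ • meanTransform A r := by
  refine hasSphereMeans_of_test (Lp.memLp _) ?_ fun η h1 h2 h3 => ?_
  · refine ContinuousOn.smul (f := fun r : ℝ => r⁻¹) ?_ (continuous_meanTransform hA).continuousOn
    exact continuousOn_id.inv₀ fun r hr => (ne_of_gt hr)
  · rw [(integral_radial_test h1 h2 h3 (A : L2)).2]
    have e1 : ∀ k, radialFT η k • (𝓕 (A : L2) : L2) k = ∫ r in Ioi (0 : ℝ),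
        (4 * Real.pi * r * η r) • ((r * Real.sinc (2 * Real.pi * ‖k‖ * r)) • hat A k) := by
      intro k
      rw [radialFT, ← integral_smul_const, hat_apply]
      refine setIntegral_congr_fun measurableSet_Ioi fun r _ => ?_
      simp only [← Complex.coe_smul, smul_smul, smul_eq_mul]
      congr 1
      push_cast
      ring
    simp only [e1]
    have hηi : Integrable fun r : ℝ => 4 * Real.pi * r * η r :=
      Continuous.integrable_of_hasCompactSupport (by have := h1.continuous; fun_prop) h2.mul_left
    rw [integral_integral_swap]
    · refine setIntegral_congr_fun measurableSet_Ioi fun r hr => ?_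
      have hr : (0 : ℝ) < r := hr
      rw [integral_smul, smul_smul, meanTransform]
      congr 1
      field_simp
    · have hm : AEStronglyMeasurable (Function.uncurry fun (k : R3) (r : ℝ) =>
          (4 * Real.pi * r * η r) • ((r * Real.sinc (2 * Real.pi * ‖k‖ * r)) • hat A k))
          (volume.prod (volume.restrict (Ioi 0))) := by
        have := Real.continuous_sinc
        have := h1.continuous
        refine AEStronglyMeasurable.smul (f := fun p : R3 × ℝ => 4 * Real.pi * p.2 * η p.2) ?_
          (AEStronglyMeasurable.smul
            (f := fun p : R3 × ℝ => p.2 * Real.sinc (2 * Real.pi * ‖p.1‖ * p.2)) ?_ ?_)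
        · exact Continuous.aestronglyMeasurable (by fun_prop)
        · exact Continuous.aestronglyMeasurable (by fun_prop)
        · exact (Lp.aestronglyMeasurable (hat A)).comp_fst
      have hb := (integrable_norm_inv_smul_hat hA).mul_prod (hηi.norm.integrableOn (s := Ioi 0))
      refine hb.mono' hm ?_
      have h4 := norm_sinc_smul_le A
      have h5 := Measure.quasiMeasurePreserving_fst (μ := (volume : Measure R3))
        (ν := volume.restrict (Ioi (0 : ℝ))) |>.ae h4
      filter_upwards [h5] with p hp
      simp only [Function.uncurry]
      rw [norm_smul, mul_comm]
      gcongr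
      exact hp p.2

theorem regPart_add (e c lam : ℝ) (A : L2star) (Q : C3) :
    A = regPart e c lam A Q + ((4 * Real.pi * e / c : ℝ) : ℂ) • MQG lam Q := by
  simp [regPart]

/-- The charge of a field is read off from its spherical means. -/
theorem exists_sphereMeans_charge {e c lam : ℝ} (he : e ≠ 0) (hc : 0 < c) (hl : 0 < lam)
    {A : L2star} {Q : C3} (h : regPart e c lam A Q ∈ Hstar 1) :
    ∃ S : ℝ → C3, HasSphereMeans (A : L2) S ∧
      Tendsto (fun r : ℝ => ((3 * c / (2 * e) : ℝ) : ℂ) • (r : ℂ) • S r) (𝓝[>] 0) (𝓝 Q) := by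
  have h1 := (hasSphereMeans_Hstar_one h).add
    ((hasSphereMeans_MQG hl Q).smul ((4 * Real.pi * e / c : ℝ) : ℂ))
  refine ⟨_, h1.congr ?_, ?_⟩
  · have h2 := Lp.coeFn_add (regPart e c lam A Q : L2)
      ((((4 * Real.pi * e / c : ℝ) : ℂ) • MQG lam Q : L2star) : L2)
    rw [← Submodule.coe_add, ← regPart_add] at h2
    filter_upwards [h2, Lp.coeFn_smul ((4 * Real.pi * e / c : ℝ) : ℂ) (MQG lam Q : L2)] with x e1 e2
    rw [e1, Pi.add_apply, Submodule.coe_smul, e2, Pi.smul_apply]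
  -- The regular part contributes `meanTransform`, which is 0 at r = 0. For M Q G_λ the product of r
  -- and the mean is e^{−√λ r} Q/(6π), and (3c/2e)(4πe/c)/(6π) = 1.
  · have h3 : Tendsto (fun r : ℝ => ((3 * c / (2 * e) : ℝ) : ℂ) • meanTransform (regPart e c lam A Q) r
        + ((Real.exp (-Real.sqrt lam * r) : ℝ) : ℂ) • Q) (𝓝[>] 0) (𝓝 Q) := by
      have hcont : Continuous fun r : ℝ =>
          ((3 * c / (2 * e) : ℝ) : ℂ) • meanTransform (regPart e c lam A Q) r
            + ((Real.exp (-Real.sqrt lam * r) : ℝ) : ℂ) • Q := by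
        have := continuous_meanTransform h
        fun_prop
      have h4 := (hcont.tendsto 0).mono_left (nhdsWithin_le_nhds (s := Ioi (0 : ℝ)))
      simpa [meanTransform] using h4
    refine h3.congr' ?_
    filter_upwards [self_mem_nhdsWithin] with r hr
    have hr : (0 : ℝ) < r := hr
    have hr' : (r : ℂ) ≠ 0 := by exact_mod_cast hr.ne'
    have hc' : (c : ℂ) ≠ 0 := by exact_mod_cast hc.ne'
    have he' : (e : ℂ) ≠ 0 := by exact_mod_cast he
    have hpi : (Real.pi : ℂ) ≠ 0 := by exact_mod_cast Real.pi_ne_zero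
    rw [smul_add, smul_add]
    simp only [← Complex.coe_smul, smul_smul]
    congr 2
    · push_cast
      field_simp
    · rw [greenProfile]
      push_cast
      field_simp

/-- The limit of the spherical means involves A alone, so it knows neither the splitting nor the
value of λ. -/
theorem charge_unique {e c lam lam' : ℝ} (he : e ≠ 0) (hc : 0 < c) (hl : 0 < lam) (hl' : 0 < lam')
    {A : L2star} {Q Q' : C3} (h : regPart e c lam A Q ∈ Hstar 1)
    (h' : regPart e c lam' A Q' ∈ Hstar 1) : Q = Q' := by
  obtain ⟨S, hS, hS'⟩ := exists_sphereMeans_charge he hc hl h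
  obtain ⟨T, hT, hT'⟩ := exists_sphereMeans_charge he hc hl' h'
  refine tendsto_nhds_unique hS' (hT'.congr' ?_)
  filter_upwards [self_mem_nhdsWithin] with r hr
  rw [hS.eqOn hT hr]

/-! ### The coupling maps `Q ↦ M Q h` and the evaluation at the origin -/

/-- The bounded map `Q ↦ gvec h Q`. -/
def gmap (h : R3 → ℂ) (hh : MemLp h 2 volume) : C3 →L[ℂ] L2star :=
  LinearMap.toContinuousLinearMap (gvec h hh)

theorem gmap_apply {h : R3 → ℂ} (hh : MemLp h 2 volume) (Q : C3) : gmap h hh Q = gvec h hh Q := rfl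

theorem hat_gmap {h : R3 → ℂ} (hh : MemLp h 2 volume) (Q : C3) :
    hat (gmap h hh Q) =ᵐ[volume] fun k => h k • transverse k Q := hat_gvec hh Q

theorem integrable_smul_hat {h : R3 → ℂ} (hh : MemLp h 2 volume) (A : L2star) :
    Integrable fun k => (starRingEnd ℂ) (h k) • hat A k :=
  memLp_one_iff_integrable.1 ((Lp.memLp (hat A)).smul hh.star)

/-- The transverse projection disappears because `hat A` is already transverse. -/
theorem adjoint_gmap_apply {h : R3 → ℂ} (hh : MemLp h 2 volume) (A : L2star) :
    (gmap h hh).adjoint A = ∫ k, (starRingEnd ℂ) (h k) • hat A k := by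
  refine ext_inner_left ℂ fun Q => ?_
  rw [ContinuousLinearMap.adjoint_inner_right, inner_eq_integral_hat,
    ← integral_inner (integrable_smul_hat hh A) Q]
  refine integral_congr_ae ?_
  filter_upwards [hat_gmap hh Q, dotC_hat A] with k h1 h2
  rw [h1, inner_smul_left, inner_smul_right, inner_transverse_left Q h2]

theorem adjoint_gmap_gmap {h h' : R3 → ℂ} (hh : MemLp h 2 volume) (hh' : MemLp h' 2 volume)
    (hr : IsRadial h) (hr' : IsRadial h') (Q : C3) :
    (gmap h hh).adjoint (gmap h' hh' Q) =
      ((2 / 3 : ℂ) * (∫ k, (starRingEnd ℂ) (h k) * h' k)) • Q := by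
  refine ext_inner_left ℂ fun Q' => ?_
  rw [ContinuousLinearMap.adjoint_inner_right, gmap_apply, gmap_apply,
    inner_gvec_gvec hh hh' hr hr', inner_smul_right]

/-- The map `Q ↦ M Q G_λ`. -/
def chargeMap (lam : ℝ) (hl : 0 < lam) : C3 →L[ℂ] L2star := gmap (res lam) (memLp_res hl)

theorem chargeMap_apply {lam : ℝ} (hl : 0 < lam) (Q : C3) : chargeMap lam hl Q = MQG lam Q :=
  (MQG_eq hl Q).symm

theorem integrable_hat_freeRes {lam : ℝ} (hl : 0 < lam) (f : L2star) :
    Integrable fun k => hat (freeRes lam hl f) k := by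
  refine (integrable_smul_hat (memLp_res hl) f).congr ?_
  filter_upwards [hat_freeRes hl f] with k hk
  rw [hk, conj_res]

/-- The left side is the value at the origin of (−Δ + λ)⁻¹ f, by Fourier inversion: g_λ† is point
evaluation after the free resolvent. -/
theorem integral_hat_freeRes {lam : ℝ} (hl : 0 < lam) (f : L2star) :
    ∫ k, hat (freeRes lam hl f) k = (chargeMap lam hl).adjoint f := by
  rw [chargeMap, adjoint_gmap_apply]
  refine integral_congr_ae ?_
  filter_upwards [hat_freeRes hl f] with k hk
  rw [hk, conj_res]

theorem coe_eq_fourierInv_hat {A : L2star} (hA : Integrable fun k => hat A k) :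
    (A : L2) =ᵐ[volume] 𝓕⁻ fun k => hat A k := by
  have h := fourierInv_toLp hA (Lp.memLp (hat A))
  rw [Lp.toLp_coeFn, hat_apply, FourierTransform.fourierInv_fourier_eq] at h
  exact h

theorem fourierInv_zero (f : R3 → C3) : 𝓕⁻ f 0 = ∫ k, f k := by
  rw [Real.fourierInv_eq]
  simp

/-- The boundary condition in terms of the regular part. -/
theorem boundaryCondition_iff {e c m lam : ℝ} (he : e ≠ 0) (hc : 0 < c) (hl : 0 < lam)
    {A : L2star} {Q : C3} {f : L2star} (h : regPart e c lam A Q = freeRes lam hl f) :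
    BoundaryCondition e c m A Q ↔ (chargeMap lam hl).adjoint f =
      ((4 * Real.pi * e / c * GammaM e c m lam : ℝ) : ℂ) • Q := by
  obtain ⟨κ, hκ⟩ : ∃ κ : ℂ, κ = ((4 * Real.pi * e / c : ℝ) : ℂ) := ⟨_, rfl⟩
  obtain ⟨B, hB⟩ : ∃ B, B = freeRes lam hl f := ⟨_, rfl⟩
  have hBi : Integrable fun k => hat B k := hB ▸ integrable_hat_freeRes hl f
  have hDi : Integrable fun k => dsym lam k • transverse k Q :=
    integrable_smul_transverse (integrable_dsym hl) Q
  -- The continuous version of A − κ M Q G₀: the regular part, minus κ times the transverse part of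
  -- Q(G₀ − G_λ).
  obtain ⟨u, hu⟩ : ∃ u : R3 → C3, u = fun x => 𝓕⁻ (fun k => hat B k) x -
    κ • 𝓕⁻ (fun k => dsym lam k • transverse k Q) x := ⟨_, rfl⟩
  have huc : Continuous u := hu ▸ (continuous_fourierInv hBi).sub
    (Continuous.const_smul (continuous_fourierInv hDi) κ)
  have hu0 : u 0 = (chargeMap lam hl).adjoint f -
      ((4 * Real.pi * e / c * (Real.sqrt lam / (6 * Real.pi)) : ℝ) : ℂ) • Q := by
    rw [hu]
    simp only [fourierInv_zero]
    rw [hB, integral_hat_freeRes hl, integral_smul_transverse (integrable_dsym hl) (isRadial_dsym lam),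
      integral_dsym hl, smul_smul, hκ]
    congr 2
    push_cast
    ring
  have hA : (fun x => (A : L2) x - κ • zeroField lam Q x) =ᵐ[volume] u := by
    have h2 := Lp.coeFn_add (B : L2) ((κ • MQG lam Q : L2star) : L2)
    rw [← Submodule.coe_add, hB, ← h, hκ, ← regPart_add, h, ← hB, ← hκ] at h2
    filter_upwards [h2, Lp.coeFn_smul κ (MQG lam Q : L2), coe_eq_fourierInv_hat hBi] with x e1 e2 e3
    rw [e1, Pi.add_apply, Submodule.coe_smul, e2, Pi.smul_apply, e3, hu, zeroField, smul_add, add_comm (κ • (MQG lam Q : L2) x), add_sub_add_right_eq_sub]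
  obtain ⟨S₀, hS₀, hS₀'⟩ := exists_sphereMeans_of_continuous huc
  have hz := isDivFreeProjection_zeroField hl Q
  -- The field M Q G₀ is unique up to a null set and so is the continuous version of the means, so
  -- the condition only concerns the value of u at the origin.
  have key : BoundaryCondition e c m A Q ↔ u 0 = -((m * c / e : ℝ) : ℂ) • Q := by
    constructor
    · rintro ⟨W, S, hW, hS, hS'⟩
      rw [← hκ] at hS
      have h3 : HasSphereMeans u S := hS.congr (by
        filter_upwards [hW.ae_eq hz, hA] with x e1 e2
        rw [← e2, e1])
      exact tendsto_nhds_unique hS₀' (h3.tendsto_unique hS₀ hS')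
    · intro h0
      rw [h0] at hS₀'
      exact ⟨zeroField lam Q, S₀, hz, hκ ▸ hS₀.congr hA.symm, hS₀'⟩
  rw [key, hu0, sub_eq_iff_eq_add, ← add_smul]
  have h4 : -((m * c / e : ℝ) : ℂ) + ((4 * Real.pi * e / c * (Real.sqrt lam / (6 * Real.pi)) : ℝ) : ℂ)
      = ((4 * Real.pi * e / c * GammaM e c m lam : ℝ) : ℂ) := by
    rw [← Complex.ofReal_neg, ← Complex.ofReal_add, GammaM]
    congr 1
    have := Real.pi_ne_zero
    field_simp
  rw [h4]

/-! ### Resolvent identities -/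

theorem freeRes_sub {lam mu : ℝ} (hl : 0 < lam) (hm : 0 < mu) (f : L2star) :
    freeRes lam hl f = freeRes mu hm (f + ((mu - lam : ℝ) : ℂ) • freeRes lam hl f) := by
  refine hat_ext ?_
  filter_upwards [hat_freeRes hl f, hat_freeRes hm (f + ((mu - lam : ℝ) : ℂ) • freeRes lam hl f),
    hat_add f (((mu - lam : ℝ) : ℂ) • freeRes lam hl f),
    hat_smul ((mu - lam : ℝ) : ℂ) (freeRes lam hl f)] with k h1 h2 h3 h4
  rw [h2, h3, h4, h1, smul_smul, smul_add, smul_smul, ← add_smul]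
  congr 1
  have ht := tau_nonneg k
  simp only [res, ← Complex.ofReal_mul, ← Complex.ofReal_add]
  congr 1
  field_simp
  ring

theorem chargeMap_sub {lam mu : ℝ} (hl : 0 < lam) (hm : 0 < mu) (Q : C3) :
    chargeMap lam hl Q - chargeMap mu hm Q =
      freeRes mu hm (((mu - lam : ℝ) : ℂ) • chargeMap lam hl Q) := by
  refine hat_ext ?_
  filter_upwards [hat_sub (chargeMap lam hl Q) (chargeMap mu hm Q), hat_gmap (memLp_res hl) Q,
    hat_gmap (memLp_res hm) Q, hat_freeRes hm (((mu - lam : ℝ) : ℂ) • chargeMap lam hl Q),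
    hat_smul ((mu - lam : ℝ) : ℂ) (chargeMap lam hl Q)] with k h1 h2 h3 h4 h5
  rw [h1, h4, h5, chargeMap, chargeMap, h2, h3, ← sub_smul, res_sub_res hm hl, smul_smul, smul_smul]
  congr 1
  ring

/-- First resolvent identity for both summands of A: passing from λ to μ replaces f by f + (μ − λ)A
and keeps the charge. -/
theorem regPart_sub {e c lam mu : ℝ} (hl : 0 < lam) (hm : 0 < mu) {A f : L2star} {Q : C3}
    (h : regPart e c lam A Q = freeRes lam hl f) :
    regPart e c mu A Q = freeRes mu hm (f + ((mu - lam : ℝ) : ℂ) • A) := by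
  have h1 : A = freeRes lam hl f + ((4 * Real.pi * e / c : ℝ) : ℂ) • chargeMap lam hl Q := by
    rw [← h, chargeMap_apply]
    exact regPart_add e c lam A Q
  have h2 : regPart e c mu A Q = freeRes lam hl f +
      ((4 * Real.pi * e / c : ℝ) : ℂ) • (chargeMap lam hl Q - chargeMap mu hm Q) := by
    rw [regPart, ← chargeMap_apply hm, smul_sub]
    nth_rw 1 [h1]
    rw [add_sub_assoc]
  rw [h2, chargeMap_sub hl hm, freeRes_sub hl hm f,
    ← (freeRes mu hm).map_smul ((4 * Real.pi * e / c : ℝ) : ℂ), ← (freeRes mu hm).map_add]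
  congr 1
  nth_rw 1 [h1]
  rw [smul_add, smul_comm _ ((mu - lam : ℝ) : ℂ), add_assoc]

/-- `freeRes` inverts `-Δ + λ`. -/
theorem negLaplacian_freeRes {lam : ℝ} (hl : 0 < lam) {A : L2star} (hA : A ∈ Hstar 2) {f : L2star}
    (h : A = freeRes lam hl f) : negLaplacian ⟨A, hA⟩ + (lam : ℂ) • A = f := by
  refine hat_ext ?_
  filter_upwards [hat_add (negLaplacian ⟨A, hA⟩) ((lam : ℂ) • A), fourier_negLaplacian ⟨A, hA⟩,
    hat_smul (lam : ℂ) A, hat_freeRes hl f] with k h1 h2 h3 h4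
  rw [h1, h3, hat_apply, h2, ← hat_apply, ← add_smul, h, h4, smul_smul]
  have ht := tau_nonneg k
  rw [res, ← Complex.ofReal_add, ← Complex.ofReal_mul, mul_inv_cancel₀ (by positivity),
    Complex.ofReal_one, one_smul]

theorem freeRes_injective {lam : ℝ} (hl : 0 < lam) : Function.Injective (freeRes lam hl) := by
  intro f g h
  have h1 : freeRes lam hl f ∈ Hstar 2 := (mem_Hstar_two_iff hl _).2 ⟨f, rfl⟩
  rw [← negLaplacian_freeRes hl h1 rfl, negLaplacian_freeRes hl h1 h]

theorem conj_bddMeas {g : R3 → ℂ} (hg : BddMeas g) : BddMeas fun k => (starRingEnd ℂ) (g k) :=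
  ⟨Complex.continuous_conj.measurable.comp hg.1, hg.2.imp fun C h k => by
    rw [RCLike.norm_conj]; exact h k⟩

theorem inner_fmul_left {g : R3 → ℂ} (hg : BddMeas g) (A B : L2star) :
    inner ℂ (fmul g hg A) B = inner ℂ A (fmul _ (conj_bddMeas hg) B) := by
  rw [inner_eq_integral_hat, inner_eq_integral_hat]
  refine integral_congr_ae ?_
  filter_upwards [hat_fmul hg A, hat_fmul (conj_bddMeas hg) B] with k h1 h2
  rw [h1, h2, inner_smul_left, inner_smul_right]

theorem isSelfAdjoint_fmul {g : R3 → ℂ} (hg : BddMeas g) (hr : ∀ k, (starRingEnd ℂ) (g k) = g k) :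
    IsSelfAdjoint (fmul g hg) := by
  rw [ContinuousLinearMap.isSelfAdjoint_iff_isSymmetric]
  intro A B
  simp only [ContinuousLinearMap.coe_coe]
  rw [inner_fmul_left]
  simp only [hr]

theorem isSelfAdjoint_freeRes {lam : ℝ} (hl : 0 < lam) : IsSelfAdjoint (freeRes lam hl) :=
  isSelfAdjoint_fmul _ (conj_res lam)

theorem isSelfAdjoint_freeRsq {lam : ℝ} (hl : 0 < lam) : IsSelfAdjoint (freeRsq lam hl) :=
  isSelfAdjoint_fmul _ (conj_rsq lam)

theorem freeRsq_freeRsq {lam : ℝ} (hl : 0 < lam) (A : L2star) :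
    freeRsq lam hl (freeRsq lam hl A) = freeRes lam hl A := by
  refine hat_ext ?_
  filter_upwards [hat_freeRsq hl (freeRsq lam hl A), hat_freeRsq hl A, hat_freeRes hl A]
    with k h1 h2 h3
  rw [h1, h2, h3, smul_smul, rsq_mul_rsq hl]

/-! ### Operators and their resolvents -/

section Resolvents

variable {E : Type*} [NormedAddCommGroup E] [InnerProductSpace ℂ E]

/-- The operator with the resolvent `R` at `z`. -/
def ofResolvent (R : E →L[ℂ] E) (hR : Function.Injective R) (z : ℂ) : E →ₗ.[ℂ] E where
  domain := LinearMap.range R.toLinearMap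
  toFun := (LinearEquiv.ofInjective R.toLinearMap hR).symm.toLinearMap +
    z • (LinearMap.range R.toLinearMap).subtype

theorem ofResolvent_apply (R : E →L[ℂ] E) (hR : Function.Injective R) (z : ℂ) (x : E)
    (h : R x ∈ (ofResolvent R hR z).domain) : ofResolvent R hR z ⟨R x, h⟩ = x + z • R x := by
  have h1 : (LinearEquiv.ofInjective R.toLinearMap hR).symm ⟨R x, h⟩ = x := by
    rw [LinearEquiv.symm_apply_eq]
    rfl
  calc ofResolvent R hR z ⟨R x, h⟩
      = (LinearEquiv.ofInjective R.toLinearMap hR).symm ⟨R x, h⟩ + z • R x := rfl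
    _ = _ := by rw [h1]

theorem isResolventAt_ofResolvent (R : E →L[ℂ] E) (hR : Function.Injective R) (z : ℂ) :
    IsResolventAt (ofResolvent R hR z) z R := by
  refine ⟨fun x => ⟨⟨x, rfl⟩, ?_⟩, ?_⟩
  · exact (congrArg (· - z • R x) (ofResolvent_apply R hR z x ⟨x, rfl⟩)).trans
      (add_sub_cancel_right _ _)
  · rintro ⟨_, x, rfl⟩
    have := ofResolvent_apply R hR z x ⟨x, rfl⟩
    simp only [ContinuousLinearMap.coe_coe] at this ⊢
    rw [this, add_sub_cancel_right]

variable {T : E →ₗ.[ℂ] E} {R R' : E →L[ℂ] E} {z z₀ : ℂ}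

theorem IsResolventAt.mem_domain (h : IsResolventAt T z R) (x : E) : R x ∈ T.domain := (h.1 x).1

theorem IsResolventAt.apply (h : IsResolventAt T z R) (x : E) (hx : R x ∈ T.domain) :
    T ⟨R x, hx⟩ = x + z • R x := by
  obtain ⟨h1, h2⟩ := h.1 x
  exact (sub_eq_iff_eq_add.1 h2)

theorem IsResolventAt.exists_eq (h : IsResolventAt T z R) (x : T.domain) :
    (x : E) = R (T x - z • (x : E)) := (h.2 x).symm

theorem IsResolventAt.unique (h : IsResolventAt T z R) (h' : IsResolventAt T z R') : R = R' := by
  ext x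
  obtain ⟨h1, h2⟩ := h'.1 x
  have := h.2 ⟨R' x, h1⟩
  rw [h2] at this
  exact this

theorem IsResolventAt.injective (h : IsResolventAt T z R) : Function.Injective R := by
  intro x y hxy
  obtain ⟨h1, h2⟩ := h.1 x
  obtain ⟨h3, h4⟩ := h.1 y
  rw [← h2, ← h4]
  simp only [hxy]

/-- Both orders of the resolvent identity are needed. The first writes R'x as R of something, which
puts it in the domain and gives the right inverse; the second gives the left inverse. -/
theorem IsResolventAt.of_resolvent_eq (h : IsResolventAt T z₀ R)
    (h1 : R' = R + (z - z₀) • (R * R')) (h2 : R' = R + (z - z₀) • (R' * R)) :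
    IsResolventAt T z R' := by
  have e1 : ∀ x, R' x = R (x + (z - z₀) • R' x) := fun x => by
    rw [map_add, map_smul]
    exact congrArg (fun S : E →L[ℂ] E => S x) h1
  refine ⟨fun x => ⟨e1 x ▸ h.mem_domain _, ?_⟩, fun x => ?_⟩
  · have h3 := h.apply _ (h.mem_domain (x + (z - z₀) • R' x))
    simp only [← e1] at h3
    rw [h3, sub_smul]
    abel
  · set u := T x - z₀ • (x : E) with hu
    have hx : (x : E) = R u := h.exists_eq x
    have h3 : T x - z • (x : E) = u - (z - z₀) • R u := by
      rw [← hx, hu, sub_smul]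
      abel
    have h4 : R' u = R u + (z - z₀) • R' (R u) := congrArg (fun S : E →L[ℂ] E => S u) h2
    rw [h3, map_sub, map_smul, h4, add_sub_cancel_right, hx]

variable [CompleteSpace E]

theorem denseRange_adjoint {F : Type*} [NormedAddCommGroup F] [InnerProductSpace ℂ F]
    [CompleteSpace F] {j : F →L[ℂ] E} (hj : Function.Injective j) : DenseRange j.adjoint := by
  have h1 : j.adjoint.rangeᗮ = ⊥ := by
    rw [ContinuousLinearMap.orthogonal_range, ContinuousLinearMap.adjoint_adjoint]
    exact LinearMap.ker_eq_bot.2 hj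
  rw [← Submodule.topologicalClosure_eq_top_iff] at h1
  exact Submodule.dense_iff_topologicalClosure_eq_top.2 h1

theorem IsResolventAt.dense_domain (h : IsResolventAt T z R) (hR : IsSelfAdjoint R) :
    Dense (T.domain : Set E) := by
  have h1 := denseRange_adjoint h.injective
  rw [← ContinuousLinearMap.star_eq_adjoint, hR.star_eq] at h1
  refine h1.mono ?_
  rintro _ ⟨x, rfl⟩
  exact h.mem_domain x

/-- An operator with a bounded self-adjoint resolvent at a real point is self-adjoint. -/
theorem IsResolventAt.isSelfAdjoint {s : ℝ} (h : IsResolventAt T s R) (hR : IsSelfAdjoint R) :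
    IsSelfAdjoint T := by
  have hsym : ∀ x y, inner ℂ (R x) y = inner ℂ x (R y) :=
    (ContinuousLinearMap.isSelfAdjoint_iff_isSymmetric.1 hR)
  have hd : Dense (T.domain : Set E) := h.dense_domain hR
  rw [LinearPMap.isSelfAdjoint_def]
  have hle : T ≤ T.adjoint := by
    refine LinearPMap.IsFormalAdjoint.le_adjoint hd fun x y => ?_
    have hx := h.exists_eq x
    have hy := h.exists_eq y
    set u := T x - (s : ℂ) • (x : E) with hu
    set v := T y - (s : ℂ) • (y : E) with hv
    rw [eq_add_of_sub_eq hu.symm, eq_add_of_sub_eq hv.symm, inner_add_left, inner_add_right,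
      inner_smul_left, inner_smul_right, Complex.conj_ofReal]
    congr 1
    rw [hx, hy, hsym]
  refine (LinearPMap.eq_of_le_of_domain_eq hle (le_antisymm hle.1 fun y hy => ?_)).symm
  set w := T.adjoint ⟨y, hy⟩ with hw
  -- Pair y with an arbitrary u = (T − s)Ru and move T to the other side; the symmetry of R then
  -- exhibits y in its range, which is the domain of T.
  have key : y = R (w - (s : ℂ) • y) := by
    refine ext_inner_right ℂ fun u => ?_
    obtain ⟨h1, h2⟩ := h.1 u
    have h3 := LinearPMap.adjoint_isFormalAdjoint hd ⟨y, hy⟩ ⟨R u, h1⟩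
    rw [hsym, inner_sub_left, inner_smul_left, Complex.conj_ofReal]
    simp only at h3
    rw [← hw] at h3
    rw [h3]
    nth_rw 1 [← h2]
    rw [inner_sub_right, inner_smul_right]
  rw [key]
  exact h.mem_domain _

/-- 1 − aR = a(a⁻¹ − R), and the nonreal a⁻¹ is not in the spectrum of a self-adjoint operator. -/
theorem isUnit_one_sub_smul (hR : IsSelfAdjoint R) {a : ℂ} (ha : a.im ≠ 0) :
    IsUnit (1 - a • R) := by
  have ha0 : a ≠ 0 := fun h => ha (by rw [h, Complex.zero_im])
  have h1 : a⁻¹ ∉ spectrum ℂ R := fun hmem => by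
    have := hR.mem_spectrum_eq_re hmem
    have h2 : (a⁻¹).im = 0 := by rw [this, Complex.ofReal_im]
    rw [Complex.inv_im, div_eq_zero_iff, neg_eq_zero] at h2
    rcases h2 with h2 | h2
    · exact ha h2
    · exact ha0 (Complex.normSq_eq_zero.1 h2)
  rw [spectrum.notMem_iff] at h1
  have h2 : (1 - a • R) = (Units.mk0 a ha0) • (algebraMap ℂ (E →L[ℂ] E) a⁻¹ - R) := by
    rw [Units.smul_def, Units.val_mk0, smul_sub, Algebra.algebraMap_eq_smul_one, smul_smul,
      mul_inv_cancel₀ ha0, one_smul]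
  rw [h2]
  exact h1.smul _

/-- Solves the resolvent identity R' = R + (z − s)RR' for R'. -/
theorem IsResolventAt.nonreal {s : ℝ} (h : IsResolventAt T s R) (hR : IsSelfAdjoint R)
    (hz : z.im ≠ 0) : IsResolventAt T z (R * Ring.inverse (1 - (z - s) • R)) := by
  have hu : IsUnit (1 - (z - s) • R) := isUnit_one_sub_smul hR (by simpa using hz)
  have h1 := Ring.mul_inverse_cancel _ hu
  have h2 := Ring.inverse_mul_cancel _ hu
  set V := Ring.inverse (1 - (z - s) • R) with hV
  rw [sub_mul, one_mul, smul_mul_assoc, sub_eq_iff_eq_add] at h1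
  rw [mul_sub, mul_one, mul_smul_comm, sub_eq_iff_eq_add] at h2
  refine h.of_resolvent_eq ?_ ?_
  · nth_rw 1 [h1]
    rw [mul_add, mul_one, mul_smul_comm]
  · nth_rw 1 [h2]
    rw [mul_add, mul_one, mul_smul_comm, mul_assoc]

/-- Convergence of the resolvents at one real point implies norm resolvent convergence. -/
theorem normResolventTendsto_of_real {ι : Type*} {l : Filter ι} {H : ι → E →ₗ.[ℂ] E}
    {H' : E →ₗ.[ℂ] E} {s : ℝ} {S : ι → E →L[ℂ] E} {S' : E →L[ℂ] E}
    (h : ∀ᶠ i in l, IsResolventAt (H i) s (S i) ∧ IsSelfAdjoint (S i))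
    (h' : IsResolventAt H' s S') (hS' : IsSelfAdjoint S') (ht : Tendsto S l (𝓝 S')) :
    NormResolventTendsto H l H' := by
  intro z hz
  refine ⟨fun i => S i * Ring.inverse (1 - (z - s) • S i), _, ?_, h'.nonreal hS' hz, ?_⟩
  · filter_upwards [h] with i hi
    exact hi.1.nonreal hi.2 hz
  · obtain ⟨u, hu⟩ := isUnit_one_sub_smul hS' (a := z - s) (by simpa using hz)
    -- The resolvent at z is a continuous function of the one at s, inversion being continuous at a
    -- unit.
    have hc := NormedRing.inverse_continuousAt u
    rw [hu] at hc
    exact ht.mul (hc.tendsto.comp (tendsto_const_nhds.sub (ht.const_smul _)))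

end Resolvents

/-! ### Quadratic forms -/

section Forms

variable {E F : Type*} [NormedAddCommGroup E] [InnerProductSpace ℂ E] [CompleteSpace E]
  [NormedAddCommGroup F] [InnerProductSpace ℂ F] [CompleteSpace F]
  {T : E →ₗ.[ℂ] E} {R : E →L[ℂ] E} {w : ℝ} {j : F →L[ℂ] E}

/-- The form norm on `D(T)`, when the resolvent factors as `j j†`. -/
theorem re_inner_of_factor (h : IsResolventAt T ((-w : ℝ) : ℂ) R) (hj : ∀ x, R x = j (j.adjoint x))
    (u : T.domain) : j (j.adjoint (T u + (w : ℂ) • (u : E))) = u ∧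
      (inner ℂ (u : E) (T u)).re =
        ‖j.adjoint (T u + (w : ℂ) • (u : E))‖ ^ 2 - w * ‖(u : E)‖ ^ 2 := by
  have h1 := h.exists_eq u
  rw [Complex.ofReal_neg, neg_smul, sub_neg_eq_add, hj] at h1
  refine ⟨h1.symm, ?_⟩
  set x := T u + (w : ℂ) • (u : E) with hx
  have h2 : T u = x - (w : ℂ) • (u : E) := by rw [hx, add_sub_cancel_right]
  rw [h2, inner_sub_right, inner_smul_right, Complex.sub_re, Complex.re_ofReal_mul]
  congr 1
  · rw [h1, ← ContinuousLinearMap.adjoint_inner_right, inner_self_eq_norm_sq_to_K]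
    norm_cast
  · rw [inner_self_eq_norm_sq_to_K]
    norm_cast

/-- With D u = j†(T + w)u one has j(D u) = u, and the form is ‖D u‖² − w‖u‖². A sequence that
converges and is Cauchy for the form therefore has a convergent image under D, whose limit is the
preimage of A. Conversely the range of j† is dense because j is injective, which provides the
approximating sequence. -/
theorem hasFormValue_iff (h : IsResolventAt T ((-w : ℝ) : ℂ) R) (hj : ∀ x, R x = j (j.adjoint x))
    (hinj : Function.Injective j) (A : E) (v : ℝ) :
    HasFormValue T A v ↔ ∃ q, A = j q ∧ ‖q‖ ^ 2 = v + w * ‖A‖ ^ 2 := by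
  set D : T.domain → F := fun u => j.adjoint (T u + (w : ℂ) • (u : E)) with hD
  have hDsub : ∀ u u', D (u - u') = D u - D u' := fun u u' => by
    rw [hD]
    simp only
    rw [← map_sub, T.map_sub, Submodule.coe_sub, smul_sub]
    congr 1
    abel
  have hform : ∀ u : T.domain, (inner ℂ (u : E) (T u)).re = ‖D u‖ ^ 2 - w * ‖(u : E)‖ ^ 2 :=
    fun u => (re_inner_of_factor h hj u).2
  have hjD : ∀ u : T.domain, j (D u) = u := fun u => (re_inner_of_factor h hj u).1
  constructor
  · rintro ⟨u, h1, h2, h3⟩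
    have hc : CauchySeq fun n => D (u n) := by
      rw [Metric.cauchySeq_iff]
      intro ε hε
      obtain ⟨N₁, hN₁⟩ := h2 (ε ^ 2 / 2) (by positivity)
      -- This radius makes |w| ‖uₙ − u_k‖² less than ε²/2; the 1 added to |w| avoids a division by
      -- zero.
      obtain ⟨N₂, hN₂⟩ := Metric.cauchySeq_iff.1 h1.cauchySeq
        (Real.sqrt (ε ^ 2 / 2 / (|w| + 1))) (by positivity)
      refine ⟨max N₁ N₂, fun n hn k hk => ?_⟩
      have a1 := hN₁ n (le_of_max_le_left hn) k (le_of_max_le_left hk)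
      have a2 := hN₂ n (le_of_max_le_right hn) k (le_of_max_le_right hk)
      rw [hform, hDsub, abs_lt] at a1
      rw [dist_eq_norm, Real.lt_sqrt (norm_nonneg _), lt_div_iff₀ (by positivity)] at a2
      rw [dist_eq_norm]
      refine lt_of_pow_lt_pow_left₀ 2 hε.le ?_
      rw [Submodule.coe_sub] at a1
      have a3 : w * ‖(u n : E) - u k‖ ^ 2 ≤ |w| * ‖(u n : E) - u k‖ ^ 2 := by
        gcongr
        exact le_abs_self w
      nlinarith [sq_nonneg ‖(u n : E) - u k‖]
    obtain ⟨q, hq⟩ := cauchySeq_tendsto_of_complete hc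
    have hAq : A = j q := by
      refine tendsto_nhds_unique h1 ?_
      have := (j.continuous.tendsto q).comp hq
      refine this.congr fun n => hjD (u n)
    refine ⟨q, hAq, tendsto_nhds_unique (hq.norm.pow 2) ?_⟩
    refine (h3.add ((h1.norm.pow 2).const_mul w)).congr fun n => ?_
    rw [hform]
    ring
  · rintro ⟨q, rfl, hq⟩
    obtain ⟨y, hy, hyq⟩ := mem_closure_iff_seq_limit.1 (denseRange_adjoint hinj q)
    choose x hx using hy
    set u : ℕ → T.domain := fun n => ⟨R (x n), h.mem_domain (x n)⟩ with hu
    have hDu : ∀ n, D (u n) = y n := fun n => by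
      rw [← hx n, hD]
      simp only [hu]
      rw [h.apply, Complex.ofReal_neg, neg_smul, neg_add_cancel_right]
    have hlim : Tendsto (fun n => (u n : E)) atTop (𝓝 (j q)) := by
      refine ((j.continuous.tendsto q).comp hyq).congr fun n => ?_
      rw [Function.comp_apply, ← hDu, hjD]
    refine ⟨u, hlim, fun ε hε => ?_, ?_⟩
    · obtain ⟨N₁, hN₁⟩ := Metric.cauchySeq_iff.1 hyq.cauchySeq (Real.sqrt (ε / 2)) (by positivity)
      obtain ⟨N₂, hN₂⟩ := Metric.cauchySeq_iff.1 hlim.cauchySeq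
        (Real.sqrt (ε / 2 / (|w| + 1))) (by positivity)
      refine ⟨max N₁ N₂, fun n hn k hk => ?_⟩
      have a1 := hN₁ n (le_of_max_le_left hn) k (le_of_max_le_left hk)
      have a2 := hN₂ n (le_of_max_le_right hn) k (le_of_max_le_right hk)
      rw [dist_eq_norm, Real.lt_sqrt (norm_nonneg _)] at a1
      rw [dist_eq_norm, Real.lt_sqrt (norm_nonneg _), lt_div_iff₀ (by positivity)] at a2
      rw [hform, hDsub, hDu, hDu, Submodule.coe_sub]
      have a3 : |w * ‖(u n : E) - u k‖ ^ 2| = |w| * ‖(u n : E) - u k‖ ^ 2 := by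
        rw [abs_mul, abs_of_nonneg (sq_nonneg ‖(u n : E) - u k‖)]
      have a4 := abs_sub (‖y n - y k‖ ^ 2) (w * ‖(u n : E) - u k‖ ^ 2)
      rw [a3, abs_of_nonneg (sq_nonneg ‖y n - y k‖)] at a4
      nlinarith [sq_nonneg ‖(u n : E) - u k‖]
    · have h5 := (hyq.norm.pow 2).sub ((hlim.norm.pow 2).const_mul w)
      rw [hq, add_sub_cancel_right] at h5
      refine h5.congr fun n => ?_
      rw [hform, hDu]

end Forms

/-! ### Uniqueness in the Stieltjes transform -/

theorem im_inv_ofReal_sub (t x ε : ℝ) :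
    (((t : ℂ) - (x + ε * Complex.I))⁻¹).im = ε / ((t - x) ^ 2 + ε ^ 2) := by
  rw [Complex.inv_im]
  simp [Complex.normSq_apply, sq]

theorem integrable_inv_ofReal_sub (μ : Measure ℝ) [IsFiniteMeasure μ] {z : ℂ} (hz : z.im ≠ 0) :
    Integrable (fun t : ℝ => ((t : ℂ) - z)⁻¹) μ := by
  refine Integrable.of_bound (C := |z.im|⁻¹) ?_ (Eventually.of_forall fun t => ?_)
  · exact (by fun_prop : Measurable fun t : ℝ => ((t : ℂ) - z)⁻¹).aestronglyMeasurable
  · rw [norm_inv]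
    refine inv_anti₀ (abs_pos.2 hz) ?_
    have := Complex.abs_im_le_norm ((t : ℂ) - z)
    simpa using this

/-- A finite measure smeared with the Poisson kernel converges to the measure. -/
theorem tendsto_integral_poisson (μ : Measure ℝ) [IsFiniteMeasure μ]
    (f : BoundedContinuousFunction ℝ ℝ) :
    Tendsto (fun ε : ℝ => ∫ x : ℝ, f x * (∫ t : ℝ, ((t : ℂ) - (x + ε * Complex.I))⁻¹ ∂μ).im)
      (𝓝[>] 0) (𝓝 (Real.pi * ∫ t, f t ∂μ)) := by
  have hk : Integrable fun u : ℝ => (1 + u ^ 2)⁻¹ := integrable_inv_one_add_sq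
  have hb : ∀ x, ‖f x‖ ≤ ‖f‖ := f.norm_coe_le_norm
  -- After the substitution x = t + εu the Poisson kernel no longer depends on ε, and dominated
  -- convergence applies to f(t + εu).
  have hlim : Tendsto (fun ε : ℝ => ∫ p : ℝ × ℝ, f (p.1 + ε * p.2) * (1 + p.2 ^ 2)⁻¹ ∂(μ.prod volume))
      (𝓝[>] 0) (𝓝 (∫ p : ℝ × ℝ, f p.1 * (1 + p.2 ^ 2)⁻¹ ∂(μ.prod volume))) := by
    refine tendsto_integral_filter_of_dominated_convergence
      (fun p : ℝ × ℝ => ‖f‖ * (1 + p.2 ^ 2)⁻¹) ?_ ?_ ?_ ?_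
    · refine Eventually.of_forall fun ε => Continuous.aestronglyMeasurable ?_
      have := f.continuous
      refine (by fun_prop : Continuous fun p : ℝ × ℝ => f (p.1 + ε * p.2)).mul
        (Continuous.inv₀ (by fun_prop) fun p => ?_)
      positivity
    · refine Eventually.of_forall fun ε => Eventually.of_forall fun p => ?_
      rw [norm_mul, Real.norm_eq_abs ((1 + p.2 ^ 2)⁻¹), abs_of_nonneg (by positivity)]
      gcongr
      exact hb _
    · exact (integrable_const ‖f‖).mul_prod hk
    · refine Eventually.of_forall fun p => Tendsto.mul_const _ ?_
      have hc : Continuous fun ε : ℝ => f (p.1 + ε * p.2) := by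
        have := f.continuous
        fun_prop
      have := hc.tendsto 0
      simp only [zero_mul, add_zero] at this
      exact this.mono_left nhdsWithin_le_nhds
  have e1 : ∫ p : ℝ × ℝ, f p.1 * (1 + p.2 ^ 2)⁻¹ ∂(μ.prod volume) = Real.pi * ∫ t, f t ∂μ := by
    rw [integral_prod_mul (fun t => f t) fun u : ℝ => (1 + u ^ 2)⁻¹, integral_univ_inv_one_add_sq,
      mul_comm]
  rw [e1] at hlim
  refine hlim.congr' ?_
  filter_upwards [self_mem_nhdsWithin] with ε hε
  have hε : 0 < ε := hε
  have e2 : ∀ x : ℝ, (∫ t : ℝ, ((t : ℂ) - (x + ε * Complex.I))⁻¹ ∂μ).im =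
      ∫ t, ε / ((t - x) ^ 2 + ε ^ 2) ∂μ := fun x => by
    have h1 := integrable_inv_ofReal_sub μ (z := x + ε * Complex.I) (by simpa using hε.ne')
    have h2 := integral_im h1
    simp only [RCLike.im_to_complex, im_inv_ofReal_sub] at h2
    exact h2.symm
  have hint : Integrable (fun p : ℝ × ℝ => f (p.1 + ε * p.2) * (1 + p.2 ^ 2)⁻¹) (μ.prod volume) := by
    refine ((integrable_const ‖f‖).mul_prod hk).mono' (Continuous.aestronglyMeasurable ?_)
      (Eventually.of_forall fun p => ?_)
    · have := f.continuous
      refine (by fun_prop : Continuous fun p : ℝ × ℝ => f (p.1 + ε * p.2)).mul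
        (Continuous.inv₀ (by fun_prop) fun p => ?_)
      positivity
    · rw [norm_mul, Real.norm_eq_abs ((1 + p.2 ^ 2)⁻¹), abs_of_nonneg (by positivity)]
      gcongr
      exact hb _
  have e3 : ∀ (g : ℝ → ℝ) (t : ℝ), ∫ u, g (t + ε * u) * (1 + u ^ 2)⁻¹ =
      ∫ x, g x * (ε / ((t - x) ^ 2 + ε ^ 2)) := fun g t => by
    have h1 := Measure.integral_comp_mul_left (fun y => g (t + y) * (1 + (y / ε) ^ 2)⁻¹) ε
    have h2 := integral_add_left_eq_self (μ := (volume : Measure ℝ))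
      (fun x => g x * (1 + ((x - t) / ε) ^ 2)⁻¹) t
    simp only [mul_div_cancel_left₀ _ hε.ne', add_sub_cancel_left] at h1 h2
    rw [h1, h2, smul_eq_mul, ← integral_const_mul]
    congr 1
    ext x
    rw [abs_of_pos (inv_pos.2 hε)]
    field_simp
    ring
  have e4 : ∀ t : ℝ, ∫ x : ℝ, ε / ((t - x) ^ 2 + ε ^ 2) = Real.pi := fun t => by
    have := e3 (fun _ => 1) t
    simp only [one_mul, integral_univ_inv_one_add_sq] at this
    exact this.symm
  -- A function that is not integrable has integral 0 by convention, so the value π proves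
  -- integrability.
  have e5 : ∀ t : ℝ, Integrable fun x : ℝ => ε / ((t - x) ^ 2 + ε ^ 2) := fun t => by
    refine Integrable.of_integral_ne_zero ?_
    rw [e4]
    exact Real.pi_ne_zero
  have e6 : ∀ t x : ℝ, ‖f x * (ε / ((t - x) ^ 2 + ε ^ 2))‖ ≤ ‖f‖ * (ε / ((t - x) ^ 2 + ε ^ 2)) :=
    fun t x => by
      rw [norm_mul, Real.norm_eq_abs (ε / _), abs_of_nonneg (by positivity)]
      gcongr
      exact hb _
  have hcont : Continuous fun p : ℝ × ℝ => f p.2 * (ε / ((p.1 - p.2) ^ 2 + ε ^ 2)) := by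
    have := f.continuous
    refine (by fun_prop : Continuous fun p : ℝ × ℝ => f p.2).mul
      (Continuous.div (by fun_prop) (by fun_prop) fun p => ?_)
    positivity
  have hm : AEStronglyMeasurable
      (fun p : ℝ × ℝ => f p.2 * (ε / ((p.1 - p.2) ^ 2 + ε ^ 2))) (μ.prod volume) :=
    hcont.aestronglyMeasurable
  have e7 : ∀ t : ℝ, Integrable fun x : ℝ => f x * (ε / ((t - x) ^ 2 + ε ^ 2)) := fun t =>
    ((e5 t).const_mul ‖f‖).mono'
      (hcont.comp (Continuous.prodMk_right t)).aestronglyMeasurable (Eventually.of_forall (e6 t))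
  simp only [e2, ← integral_const_mul]
  rw [integral_prod _ hint]
  simp only [e3]
  rw [integral_integral_swap]
  refine (integrable_prod_iff hm).2 ⟨Eventually.of_forall e7, ?_⟩
  refine Integrable.of_bound (C := ‖f‖ * Real.pi) hm.norm.integral_prod_right'
    (Eventually.of_forall fun t => ?_)
  rw [Real.norm_eq_abs, abs_of_nonneg (integral_nonneg fun _ => norm_nonneg _), ← e4 t,
    ← integral_const_mul]
  exact integral_mono (e7 t).norm ((e5 t).const_mul _) (e6 t)

/-- Equal Stieltjes transforms have equal Poisson smearings, and these converge to the measures when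
tested with bounded continuous functions. -/
theorem measure_eq_of_stieltjes {μ ν : Measure ℝ} [IsFiniteMeasure μ] [IsFiniteMeasure ν]
    (h : ∀ z : ℂ, z.im ≠ 0 → ∫ t : ℝ, ((t : ℂ) - z)⁻¹ ∂μ = ∫ t : ℝ, ((t : ℂ) - z)⁻¹ ∂ν) : μ = ν := by
  refine ext_of_forall_integral_eq_of_IsFiniteMeasure fun f => ?_
  have h1 := tendsto_integral_poisson μ f
  have h2 := tendsto_integral_poisson ν f
  have h3 := tendsto_nhds_unique (h1.congr' ?_) h2
  · exact mul_left_cancel₀ Real.pi_ne_zero h3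
  · filter_upwards [self_mem_nhdsWithin] with ε hε
    refine integral_congr_ae (Eventually.of_forall fun x => ?_)
    have hε : 0 < ε := hε
    simp only
    rw [h _ (by simpa using hε.ne')]

theorem IsSpectralMeasure.unique {E : Type*} [NormedAddCommGroup E] [InnerProductSpace ℂ E]
    {T : E →ₗ.[ℂ] E} {x : E} {μ ν : Measure ℝ} (h : IsSpectralMeasure T x μ)
    (h' : IsSpectralMeasure T x ν) : μ = ν := by
  have := h.1
  have := h'.1
  refine measure_eq_of_stieltjes fun z hz => ?_
  obtain ⟨R, hR, hR'⟩ := h.2 z hz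
  obtain ⟨S, hS, hS'⟩ := h'.2 z hz
  rw [← hR', ← hS', hR.unique hS]

/-! ### The resolvent of the point interaction -/

/-- `(-Δ + w)⁻¹ + g⁻¹ ∑ⱼ ⟨M eⱼ G_w, ·⟩ M eⱼ G_w`. -/
def pointRes (w : ℝ) (hw : 0 < w) (g : ℝ) : L2star →L[ℂ] L2star :=
  freeRes w hw + ((g⁻¹ : ℝ) : ℂ) • (chargeMap w hw ∘L (chargeMap w hw).adjoint)

theorem pointRes_apply {w : ℝ} (hw : 0 < w) (g : ℝ) (A : L2star) : pointRes w hw g A =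
    freeRes w hw A + ((g⁻¹ : ℝ) : ℂ) • chargeMap w hw ((chargeMap w hw).adjoint A) := rfl

/-- A square root of `pointRes`. -/
def pointFactor (w : ℝ) (hw : 0 < w) (g : ℝ) : WithLp 2 (L2star × C3) →L[ℂ] L2star :=
  ((freeRsq w hw).coprod ((((Real.sqrt g)⁻¹ : ℝ) : ℂ) • chargeMap w hw)) ∘L
    (WithLp.prodContinuousLinearEquiv 2 ℂ L2star C3).toContinuousLinearMap

theorem pointFactor_apply {w : ℝ} (hw : 0 < w) (g : ℝ) (q : WithLp 2 (L2star × C3)) :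
    pointFactor w hw g q =
      freeRsq w hw q.fst + (((Real.sqrt g)⁻¹ : ℝ) : ℂ) • chargeMap w hw q.snd := rfl

theorem adjoint_pointFactor {w : ℝ} (hw : 0 < w) (g : ℝ) (A : L2star) :
    (pointFactor w hw g).adjoint A = WithLp.toLp 2
      (freeRsq w hw A, (((Real.sqrt g)⁻¹ : ℝ) : ℂ) • (chargeMap w hw).adjoint A) := by
  refine ext_inner_left ℂ fun q => ?_
  rw [ContinuousLinearMap.adjoint_inner_right, pointFactor_apply, inner_add_left,
    WithLp.prod_inner_apply]
  congr 1
  · exact (ContinuousLinearMap.isSelfAdjoint_iff_isSymmetric.1 (isSelfAdjoint_freeRsq hw)) _ _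
  · show _ = inner ℂ q.snd _
    have h1 := inner_smul_left (𝕜 := ℂ) (chargeMap w hw q.snd) A (((Real.sqrt g)⁻¹ : ℝ) : ℂ)
    rw [Complex.conj_ofReal] at h1
    rw [inner_smul_right, ContinuousLinearMap.adjoint_inner_right]
    exact h1

theorem pointRes_eq_factor {w : ℝ} (hw : 0 < w) {g : ℝ} (hg : 0 < g) (A : L2star) :
    pointRes w hw g A = pointFactor w hw g ((pointFactor w hw g).adjoint A) := by
  rw [adjoint_pointFactor, pointFactor_apply, pointRes_apply]
  show _ = freeRsq w hw (freeRsq w hw A) + _ • chargeMap w hw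
    ((((Real.sqrt g)⁻¹ : ℝ) : ℂ) • (chargeMap w hw).adjoint A)
  rw [freeRsq_freeRsq, map_smul, smul_smul, ← Complex.ofReal_mul, ← mul_inv,
    Real.mul_self_sqrt hg.le]

theorem freeRsq_injective {w : ℝ} (hw : 0 < w) : Function.Injective (freeRsq w hw) := by
  intro f g h
  refine freeRes_injective hw ?_
  rw [← freeRsq_freeRsq, ← freeRsq_freeRsq, h]

/-- A nonzero M Q G_w is never in the range of (−Δ + w)^{-1/2}: otherwise the zero field would have
two charges. -/
theorem pointFactor_injective {w : ℝ} (hw : 0 < w) {g : ℝ} (hg : 0 < g) :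
    Function.Injective (pointFactor w hw g) := by
  rw [injective_iff_map_eq_zero]
  intro q hq
  rw [pointFactor_apply] at hq
  have hs : (((Real.sqrt g)⁻¹ : ℝ) : ℂ) ≠ 0 := by
    rw [Complex.ofReal_ne_zero]
    positivity
  have h4 : ((4 * Real.pi * 1 / 1 : ℝ) : ℂ) ≠ 0 := by
    rw [Complex.ofReal_ne_zero]
    positivity
  -- The relation hq makes the regular part of the field 0 with a multiple of the charge `q.snd` an
  -- H¹ field; e = c = 1 is a mere normalization.
  have h1 : regPart 1 1 w 0 (((4 * Real.pi * 1 / 1 : ℝ) : ℂ)⁻¹ •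
      (((Real.sqrt g)⁻¹ : ℝ) : ℂ) • q.snd) ∈ Hstar 1 := by
    refine (mem_Hstar_one_iff hw _).2 ⟨q.fst, ?_⟩
    rw [regPart, ← chargeMap_apply hw, map_smul, map_smul, smul_smul, mul_inv_cancel₀ h4, one_smul,
      zero_sub, ← eq_neg_of_add_eq_zero_left hq]
  have h2 : regPart 1 1 w 0 0 ∈ Hstar 1 := by
    rw [regPart, ← chargeMap_apply hw, map_zero, smul_zero, sub_zero]
    exact Submodule.zero_mem _
  have h3 := charge_unique one_ne_zero one_pos hw hw h1 h2
  rw [smul_eq_zero_iff_right (inv_ne_zero h4), smul_eq_zero_iff_right hs] at h3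
  rw [h3, map_zero, smul_zero, add_zero] at hq
  have h5 : q.fst = 0 := freeRsq_injective hw (by rw [hq, map_zero])
  exact WithLp.ofLp_injective 2 (Prod.ext h5 h3)

theorem isSelfAdjoint_pointRes {w : ℝ} (hw : 0 < w) (g : ℝ) : IsSelfAdjoint (pointRes w hw g) := by
  rw [ContinuousLinearMap.isSelfAdjoint_iff_isSymmetric]
  intro A B
  have h1 : inner ℂ (freeRes w hw A) B = inner ℂ A (freeRes w hw B) :=
    (ContinuousLinearMap.isSelfAdjoint_iff_isSymmetric.1 (isSelfAdjoint_freeRes hw)) A B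
  have h2 := inner_smul_left (𝕜 := ℂ) (chargeMap w hw ((chargeMap w hw).adjoint A)) B
    ((g⁻¹ : ℝ) : ℂ)
  have h3 := inner_smul_right (𝕜 := ℂ) A (chargeMap w hw ((chargeMap w hw).adjoint B))
    ((g⁻¹ : ℝ) : ℂ)
  rw [Complex.conj_ofReal, ← ContinuousLinearMap.adjoint_inner_right] at h2
  rw [← ContinuousLinearMap.adjoint_inner_left] at h3
  simp only [ContinuousLinearMap.coe_coe]
  rw [pointRes_apply, pointRes_apply, inner_add_left, inner_add_right, h1, h2, h3]

/-- If j j†A = 0 then j†A = 0, and the first component of j†A is (−Δ + w)^{-1/2}A. -/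
theorem pointRes_injective {w : ℝ} (hw : 0 < w) {g : ℝ} (hg : 0 < g) :
    Function.Injective (pointRes w hw g) := by
  rw [injective_iff_map_eq_zero]
  intro A hA
  rw [pointRes_eq_factor hw hg] at hA
  have h1 := pointFactor_injective hw hg (hA.trans (map_zero _).symm)
  rw [adjoint_pointFactor] at h1
  have h2 : freeRsq w hw A = 0 := congrArg (fun q : WithLp 2 (L2star × C3) => q.fst) h1
  exact freeRsq_injective hw (by rw [h2, map_zero])

/-! ### The point interaction -/

/-- `√λ₀`. -/
def bindingRate (e c m : ℝ) : ℝ := 3 * m * c ^ 2 / (2 * e ^ 2)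

theorem bindingRate_pos {e c m : ℝ} (he : e ≠ 0) (hc : 0 < c) (hm : 0 < m) :
    0 < bindingRate e c m := by
  unfold bindingRate
  positivity

theorem GammaM_eq {e c m : ℝ} (he : e ≠ 0) (lam : ℝ) :
    GammaM e c m lam = (Real.sqrt lam - bindingRate e c m) / (6 * Real.pi) := by
  rw [GammaM, bindingRate]
  have := Real.pi_ne_zero
  field_simp
  ring

/-- The operator with resolvent `pointRes` at `-w`, where `Γ_m(w) > 0`. -/
def pointOp (e c m w : ℝ) (hw : 0 < w) (hg : 0 < GammaM e c m w) : L2star →ₗ.[ℂ] L2star :=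
  ofResolvent (pointRes w hw (GammaM e c m w)) (pointRes_injective hw hg) ((-w : ℝ) : ℂ)

section PointOp

variable {e c m w : ℝ} (he : e ≠ 0) (hc : 0 < c) (hw : 0 < w) (hg : 0 < GammaM e c m w)

theorem isResolventAt_pointOp : IsResolventAt (pointOp e c m w hw hg) ((-w : ℝ) : ℂ)
    (pointRes w hw (GammaM e c m w)) := isResolventAt_ofResolvent _ _ _

theorem isSelfAdjoint_pointOp : IsSelfAdjoint (pointOp e c m w hw hg) :=
  (isResolventAt_pointOp hw hg).isSelfAdjoint (isSelfAdjoint_pointRes hw _)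

include he hc in
theorem kappa_ne_zero : ((4 * Real.pi * e / c : ℝ) : ℂ) ≠ 0 := by
  rw [Complex.ofReal_ne_zero]
  positivity

-- The singular part of the resolvent applied to f is g_w(Γ⁻¹ g_w† f), so (4πe/c)Q must be Γ⁻¹ g_w†
-- f, and this is the boundary condition.
include he hc hg in
theorem eq_pointRes_iff {A f : L2star} : A = pointRes w hw (GammaM e c m w) f ↔
    ∃ Q, regPart e c w A Q = freeRes w hw f ∧ BoundaryCondition e c m A Q := by
  have hk := kappa_ne_zero he hc
  have hg' : ((GammaM e c m w : ℝ) : ℂ) ≠ 0 := Complex.ofReal_ne_zero.2 hg.ne'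
  constructor
  · intro h
    have h1 : regPart e c w A (((4 * Real.pi * e / c : ℝ) : ℂ)⁻¹ • ((GammaM e c m w : ℝ) : ℂ)⁻¹ •
        (chargeMap w hw).adjoint f) = freeRes w hw f := by
      rw [regPart, ← chargeMap_apply hw, map_smul, smul_smul, mul_inv_cancel₀ hk, one_smul, h,
        pointRes_apply, map_smul, Complex.ofReal_inv, add_sub_cancel_right]
    refine ⟨_, h1, (boundaryCondition_iff he hc hw h1).2 ?_⟩
    rw [smul_smul, smul_smul, Complex.ofReal_mul]
    field_simp
    rw [one_smul]
  · rintro ⟨Q, h1, h2⟩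
    rw [boundaryCondition_iff he hc hw h1] at h2
    rw [pointRes_apply, h2, map_smul, smul_smul, regPart_add e c w A Q, h1, chargeMap_apply]
    congr 2
    rw [← Complex.ofReal_mul]
    congr 1
    field_simp [hg.ne']

include he hc in
/-- Domain and action of the point interaction, for every `λ`. -/
theorem pointOp_spec {lam : ℝ} (hl : 0 < lam) {A f : L2star} {Q : C3}
    (h1 : regPart e c lam A Q = freeRes lam hl f) (h2 : BoundaryCondition e c m A Q) :
    ∃ hA : A ∈ (pointOp e c m w hw hg).domain,
      pointOp e c m w hw hg ⟨A, hA⟩ + (lam : ℂ) • A = f := by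
  have h3 := regPart_sub hl hw h1
  have h4 := (eq_pointRes_iff he hc hw hg).2 ⟨Q, h3, h2⟩
  have h5 : A ∈ (pointOp e c m w hw hg).domain := h4 ▸ (isResolventAt_pointOp hw hg).mem_domain _
  refine ⟨h5, ?_⟩
  have h6 := (isResolventAt_pointOp hw hg).apply _
    ((isResolventAt_pointOp hw hg).mem_domain (f + ((w - lam : ℝ) : ℂ) • A))
  simp only [← h4] at h6
  rw [h6]
  push_cast
  module

include he hc in
theorem mem_domain_pointOp_iff {lam : ℝ} (hl : 0 < lam) (A : L2star) :
    A ∈ (pointOp e c m w hw hg).domain ↔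
      ∃ Q, regPart e c lam A Q ∈ Hstar 2 ∧ BoundaryCondition e c m A Q := by
  constructor
  · intro hA
    obtain ⟨Q, h1, h2⟩ := (eq_pointRes_iff he hc hw hg).1
      ((isResolventAt_pointOp hw hg).exists_eq ⟨A, hA⟩)
    exact ⟨Q, (mem_Hstar_two_iff hl _).2 ⟨_, regPart_sub hw hl h1⟩, h2⟩
  · rintro ⟨Q, h1, h2⟩
    obtain ⟨f, hf⟩ := (mem_Hstar_two_iff hl _).1 h1
    exact (pointOp_spec he hc hw hg hl hf h2).1

include he hc in
theorem pointOp_apply {lam : ℝ} (hl : 0 < lam) (A : (pointOp e c m w hw hg).domain) (Q : C3)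
    (hQ : regPart e c lam A Q ∈ Hstar 2) (h2 : BoundaryCondition e c m A Q) :
    pointOp e c m w hw hg A + (lam : ℂ) • (A : L2star) =
      negLaplacian ⟨regPart e c lam A Q, hQ⟩ + (lam : ℂ) • regPart e c lam A Q := by
  obtain ⟨f, hf⟩ := (mem_Hstar_two_iff hl _).1 hQ
  rw [negLaplacian_freeRes hl hQ hf]
  exact (pointOp_spec he hc hw hg hl hf h2).2

theorem pointOp_bounded_below (A : (pointOp e c m w hw hg).domain) :
    -w * ‖(A : L2star)‖ ^ 2 ≤ (inner ℂ (A : L2star) (pointOp e c m w hw hg A)).re := by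
  rw [(re_inner_of_factor (isResolventAt_pointOp hw hg) (pointRes_eq_factor hw hg) A).2]
  nlinarith [sq_nonneg ‖(pointFactor w hw (GammaM e c m w)).adjoint
    (pointOp e c m w hw hg A + (w : ℂ) • (A : L2star))‖]

/-! ### The quadratic form -/

theorem Hstar_two_le_one : Hstar 2 ≤ Hstar 1 := by
  intro A hA
  obtain ⟨B, rfl⟩ := (mem_Hstar_two_iff one_pos A).1 hA
  exact (mem_Hstar_one_iff one_pos _).2 ⟨_, (freeRsq_freeRsq one_pos B).symm⟩

/-- Two fields M Q G_λ and M Q G_μ differ by an H² field. -/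
theorem regPart_mem_Hstar_one_iff {lam mu : ℝ} (hl : 0 < lam) (hm : 0 < mu) (A : L2star) (Q : C3) :
    regPart e c lam A Q ∈ Hstar 1 ↔ regPart e c mu A Q ∈ Hstar 1 := by
  have h1 : regPart e c mu A Q - regPart e c lam A Q ∈ Hstar 1 := by
    have : regPart e c mu A Q - regPart e c lam A Q =
        ((4 * Real.pi * e / c : ℝ) : ℂ) • (chargeMap lam hl Q - chargeMap mu hm Q) := by
      rw [regPart, regPart, chargeMap_apply, chargeMap_apply, smul_sub]
      abel
    rw [this, chargeMap_sub hl hm]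
    exact Submodule.smul_mem _ _ (Hstar_two_le_one ((mem_Hstar_two_iff hm _).2 ⟨_, rfl⟩))
  constructor
  · intro h
    simpa using Submodule.add_mem _ h1 h
  · intro h
    simpa using Submodule.sub_mem _ h h1

-- The preimage of A under `pointFactor` is b together with √Γ (4πe/c) Q, which produces the
-- coefficient of ‖Q‖².
include he hc in
theorem hasFormValue_pointOp_iff {A : L2star} {v : ℝ} :
    HasFormValue (pointOp e c m w hw hg) A v ↔ ∃ Q b, regPart e c w A Q = freeRsq w hw b ∧
      ‖b‖ ^ 2 + (4 * Real.pi * e / c) ^ 2 * GammaM e c m w * ‖Q‖ ^ 2 = v + w * ‖A‖ ^ 2 := by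
  have hk := kappa_ne_zero he hc
  have hsq : (Real.sqrt (GammaM e c m w)) ≠ 0 := (Real.sqrt_pos.2 hg).ne'
  have hs : ((Real.sqrt (GammaM e c m w) : ℝ) : ℂ) ≠ 0 := Complex.ofReal_ne_zero.2 hsq
  rw [hasFormValue_iff (isResolventAt_pointOp hw hg) (pointRes_eq_factor hw hg)
    (pointFactor_injective hw hg)]
  constructor
  · rintro ⟨q, h1, h2⟩
    rw [pointFactor_apply] at h1
    refine ⟨((4 * Real.pi * e / c : ℝ) : ℂ)⁻¹ • ((Real.sqrt (GammaM e c m w) : ℝ) : ℂ)⁻¹ • q.snd,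
      q.fst, ?_, ?_⟩
    · rw [regPart, ← chargeMap_apply hw, map_smul, smul_smul, mul_inv_cancel₀ hk, one_smul, h1,
        map_smul, Complex.ofReal_inv, add_sub_cancel_right]
    · rw [← h2, WithLp.prod_norm_sq_eq_of_L2, norm_smul, norm_smul, norm_inv, norm_inv,
        Complex.norm_real, Complex.norm_real, mul_pow, mul_pow, inv_pow, inv_pow, Real.norm_eq_abs,
        Real.norm_eq_abs, sq_abs, sq_abs, Real.sq_sqrt hg.le]
      field_simp
  · rintro ⟨Q, b, h1, h2⟩
    refine ⟨WithLp.toLp 2 (b, ((Real.sqrt (GammaM e c m w) : ℝ) : ℂ) •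
      ((4 * Real.pi * e / c : ℝ) : ℂ) • Q), ?_, ?_⟩
    · rw [pointFactor_apply]
      show _ = freeRsq w hw b + _ • chargeMap w hw (((Real.sqrt (GammaM e c m w) : ℝ) : ℂ) •
        ((4 * Real.pi * e / c : ℝ) : ℂ) • Q)
      rw [map_smul, smul_smul, Complex.ofReal_inv, inv_mul_cancel₀ hs, one_smul, map_smul, ← h1,
        chargeMap_apply]
      exact regPart_add e c w A Q
    · rw [← h2, WithLp.prod_norm_sq_eq_of_L2]
      show ‖b‖ ^ 2 + ‖((Real.sqrt (GammaM e c m w) : ℝ) : ℂ) •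
        ((4 * Real.pi * e / c : ℝ) : ℂ) • Q‖ ^ 2 = _
      rw [norm_smul, norm_smul, Complex.norm_real, Complex.norm_real, mul_pow, mul_pow,
        Real.norm_eq_abs, Real.norm_eq_abs, sq_abs, sq_abs, Real.sq_sqrt hg.le]
      ring

theorem integrable_normSq_hat (A : L2star) : Integrable fun k => ‖hat A k‖ ^ 2 :=
  (memLp_two_iff_integrable_sq_norm (Lp.aestronglyMeasurable _)).1 (Lp.memLp (hat A))

theorem normSq_eq_integral_hat (A : L2star) : ‖A‖ ^ 2 = ∫ k, ‖hat A k‖ ^ 2 := by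
  have h0 : inner ℂ A A = ((‖A‖ ^ 2 : ℝ) : ℂ) :=
    (inner_self_eq_norm_sq_to_K (𝕜 := ℂ) A).trans (by norm_cast)
  have h := h0.symm.trans (inner_eq_integral_hat A A)
  have h2 : ∀ k, inner ℂ (hat A k) (hat A k) = ((‖hat A k‖ ^ 2 : ℝ) : ℂ) := fun k => by
    rw [inner_self_eq_norm_sq_to_K]
    norm_cast
  simp only [h2] at h
  rw [integral_complex_ofReal] at h
  exact Complex.ofReal_injective h

/-- The form value does not depend on the splitting. -/
theorem form_identity (he : e ≠ 0) {lam mu : ℝ} (hl : 0 < lam) (hm : 0 < mu) {A b b' : L2star}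
    {Q : C3} (h : regPart e c lam A Q = freeRsq lam hl b)
    (h' : regPart e c mu A Q = freeRsq mu hm b') :
    ‖b‖ ^ 2 - lam * ‖A‖ ^ 2 + (4 * Real.pi * e / c) ^ 2 * GammaM e c m lam * ‖Q‖ ^ 2 =
      ‖b'‖ ^ 2 - mu * ‖A‖ ^ 2 + (4 * Real.pi * e / c) ^ 2 * GammaM e c m mu * ‖Q‖ ^ 2 := by
  obtain ⟨κ, hκ⟩ : ∃ κ : ℝ, κ = 4 * Real.pi * e / c := ⟨_, rfl⟩
  -- Pointwise in k, only the last term depends on s. The terms τ|Â|² and the cross term need not be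
  -- integrable, so they are cancelled between λ and μ before any integration.
  have key : ∀ {s : ℝ} (hs : 0 < s) {d : L2star} (hd : regPart e c s A Q = freeRsq s hs d),
      ∀ᵐ k, ‖hat d k‖ ^ 2 - s * ‖hat A k‖ ^ 2 = tau k * ‖hat A k‖ ^ 2 -
        2 * κ * (inner ℂ (hat A k) (transverse k Q)).re +
          κ ^ 2 * ((tau k + s)⁻¹ * ‖transverse k Q‖ ^ 2) := by
    intro s hs d hd
    rw [regPart] at hd
    filter_upwards [hat_freeRsq hs d, hat_sub A (((4 * Real.pi * e / c : ℝ) : ℂ) • MQG s Q),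
      hat_smul ((4 * Real.pi * e / c : ℝ) : ℂ) (MQG s Q), hat_MQG hs Q] with k h1 h2 h3 h4
    have ht := tau_nonneg k
    have hr : Real.sqrt (tau k + s) ^ 2 = tau k + s := Real.sq_sqrt (by positivity)
    have hr0 : 0 < Real.sqrt (tau k + s) := by positivity
    rw [← hd, h2, h3, h4, ← hκ, res, smul_smul, ← Complex.ofReal_mul] at h1
    have h5 : hat d k = ((Real.sqrt (tau k + s) : ℝ) : ℂ) •
        (hat A k - ((κ * (tau k + s)⁻¹ : ℝ) : ℂ) • transverse k Q) := by
      rw [h1, rsq, smul_smul, ← Complex.ofReal_mul, mul_inv_cancel₀ hr0.ne', Complex.ofReal_one,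
        one_smul]
    rw [h5, norm_smul, mul_pow, Complex.norm_real, Real.norm_eq_abs, sq_abs, hr,
      @norm_sub_sq ℂ, inner_smul_right, norm_smul, Complex.norm_real, mul_pow, Real.norm_eq_abs,
      sq_abs]
    simp only [RCLike.re_to_complex, Complex.re_ofReal_mul]
    field_simp
    ring
  have h1 : (fun k => (‖hat b k‖ ^ 2 - lam * ‖hat A k‖ ^ 2) - (‖hat b' k‖ ^ 2 - mu * ‖hat A k‖ ^ 2))
      =ᵐ[volume] fun k => κ ^ 2 * (mu - lam) *
        (inner ℂ (hat (MQG lam Q) k) (hat (MQG mu Q) k)).re := by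
    filter_upwards [key hl h, key hm h', hat_MQG hl Q, hat_MQG hm Q] with k e1 e2 e3 e4
    have ht := tau_nonneg k
    rw [e1, e2, e3, e4, inner_smul_left, inner_smul_right, conj_res, res, res,
      inner_self_eq_norm_sq_to_K, Complex.re_ofReal_mul, Complex.re_ofReal_mul]
    have : ((‖transverse k Q‖ : ℂ) ^ 2).re = ‖transverse k Q‖ ^ 2 := by norm_cast
    simp only [Complex.coe_algebraMap] 
    rw [this]
    field_simp
    ring
  have h2 := integral_congr_ae h1
  have i1 := integrable_normSq_hat b
  have i2 := integrable_normSq_hat b'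
  have i3 := integrable_normSq_hat A
  have j1 : Integrable fun k => ‖hat b k‖ ^ 2 - lam * ‖hat A k‖ ^ 2 := i1.sub (i3.const_mul lam)
  have j2 : Integrable fun k => ‖hat b' k‖ ^ 2 - mu * ‖hat A k‖ ^ 2 := i2.sub (i3.const_mul mu)
  rw [integral_sub j1 j2, integral_sub i1 (i3.const_mul _), integral_sub i2 (i3.const_mul _),
    integral_const_mul,
    integral_const_mul, integral_const_mul, ← normSq_eq_integral_hat, ← normSq_eq_integral_hat,
    ← normSq_eq_integral_hat] at h2
  have h3 : ∫ k, (inner ℂ (hat (MQG lam Q) k) (hat (MQG mu Q) k)).re =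
      (6 * Real.pi * (Real.sqrt lam + Real.sqrt mu))⁻¹ * ‖Q‖ ^ 2 := by
    have h4 : Integrable fun k => inner ℂ (hat (MQG lam Q) k) (hat (MQG mu Q) k) :=
      L2.integrable_inner _ _
    have h5 := integral_re h4
    simp only [RCLike.re_to_complex] at h5
    rw [h5, ← inner_eq_integral_hat, inner_MQG_MQG hl hm, inner_self_eq_norm_sq_to_K,
      Complex.re_ofReal_mul]
    norm_cast
  rw [h3] at h2
  -- (μ − λ)/(√λ + √μ) = √μ − √λ, so the Gram constant is the increment of Γ_m.
  have h6 : (mu - lam) * (6 * Real.pi * (Real.sqrt lam + Real.sqrt mu))⁻¹ =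
      GammaM e c m mu - GammaM e c m lam := by
    rw [GammaM, GammaM]
    have s1 := Real.sqrt_pos.2 hl
    have s2 := Real.sqrt_pos.2 hm
    nth_rw 1 [← Real.sq_sqrt hl.le, ← Real.sq_sqrt hm.le]
    field_simp
    ring
  rw [← hκ]
  linear_combination h2 + κ ^ 2 * ‖Q‖ ^ 2 * h6

include he hc in
theorem exists_hasFormValue_iff {lam : ℝ} (hl : 0 < lam) (A : L2star) :
    (∃ v, HasFormValue (pointOp e c m w hw hg) A v) ↔ ∃ Q, regPart e c lam A Q ∈ Hstar 1 := by
  constructor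
  · rintro ⟨v, hv⟩
    obtain ⟨Q, b, h1, -⟩ := (hasFormValue_pointOp_iff he hc hw hg).1 hv
    exact ⟨Q, (regPart_mem_Hstar_one_iff hw hl A Q).1 ((mem_Hstar_one_iff hw _).2 ⟨b, h1⟩)⟩
  · rintro ⟨Q, hQ⟩
    obtain ⟨b, hb⟩ := (mem_Hstar_one_iff hw _).1 ((regPart_mem_Hstar_one_iff hl hw A Q).1 hQ)
    exact ⟨‖b‖ ^ 2 + (4 * Real.pi * e / c) ^ 2 * GammaM e c m w * ‖Q‖ ^ 2 - w * ‖A‖ ^ 2,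
      (hasFormValue_pointOp_iff he hc hw hg).2 ⟨Q, b, hb, by ring⟩⟩

include he hc in
theorem hasFormValue_pointOp_eq {lam : ℝ} (hl : 0 < lam) {A : L2star} {v : ℝ}
    (hv : HasFormValue (pointOp e c m w hw hg) A v) {Q : C3}
    (hQ : regPart e c lam A Q ∈ Hstar 1) :
    ∃ B : L2, IsSqrtFree lam (regPart e c lam A Q) B ∧ v + lam * ‖A‖ ^ 2 =
      ‖B‖ ^ 2 + (4 * Real.pi * e / c) ^ 2 * GammaM e c m lam * ‖Q‖ ^ 2 := by
  obtain ⟨Q', b', h1, h2⟩ := (hasFormValue_pointOp_iff he hc hw hg).1 hv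
  obtain rfl := charge_unique he hc hw hl ((mem_Hstar_one_iff hw _).2 ⟨b', h1⟩) hQ
  obtain ⟨b, hb⟩ := (mem_Hstar_one_iff hl _).1 hQ
  refine ⟨b, (isSqrtFree_iff hl _ _).2 ?_, ?_⟩
  · filter_upwards [hat_freeRsq hl b] with k hk
    rw [← hat_apply, ← hat_apply, hb, hk, smul_smul, rsq, ← Complex.ofReal_mul, mul_inv_cancel₀,
      Complex.ofReal_one, one_smul]
    have := tau_nonneg k
    positivity
  · have h3 := form_identity (m := m) he hl hw hb h1
    have h4 : ‖(b : L2)‖ = ‖b‖ := rfl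
    rw [h4]
    linarith

end PointOp

/-! ### Real fields -/

theorem conj_fourier_of_real {φ : R3 → ℂ} (h : ∀ x, (starRingEnd ℂ) (φ x) = φ x) (k : R3) :
    (starRingEnd ℂ) (𝓕 φ k) = 𝓕 φ (-k) := by
  rw [Real.fourier_eq', Real.fourier_eq', ← integral_conj]
  congr 1
  ext x
  rw [smul_eq_mul, smul_eq_mul, map_mul, h, ← Complex.exp_conj]
  congr 2
  rw [inner_neg_right, map_mul, Complex.conj_ofReal, Complex.conj_I]
  push_cast
  ring

theorem fourier_comp_neg (φ : R3 → ℂ) (k : R3) : 𝓕 (fun x => φ (-x)) k = 𝓕 φ (-k) := by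
  rw [Real.fourier_eq', Real.fourier_eq', ← integral_neg_eq_self]
  simp

theorem exists_schwartz_of_test {g : R3 → ℝ} (h1 : ContDiff ℝ (⊤ : ℕ∞) g)
    (h2 : HasCompactSupport g) : ∃ φ : 𝓢(R3, ℂ), ∀ x, φ x = (g x : ℂ) := by
  have g2 : HasCompactSupport (Complex.ofRealCLM ∘ g) := h2.comp_left rfl
  exact ⟨g2.toSchwartzMap (Complex.ofRealCLM.contDiff.comp h1), fun x => rfl⟩

theorem ae_neg {p : R3 → Prop} (h : ∀ᵐ k, p k) : ∀ᵐ k : R3, p (-k) :=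
  (Measure.measurePreserving_neg (volume : Measure R3)).quasiMeasurePreserving.ae h

theorem memLp_coord {f : R3 → C3} (hf : MemLp f 2 volume) (i : Fin 3) :
    MemLp (fun x => f x i) 2 volume :=
  (EuclideanSpace.proj i : C3 →L[ℂ] ℂ).comp_memLp' hf

theorem integral_coord {f : R3 → C3} (hf : Integrable f) (i : Fin 3) :
    (∫ x, f x) i = ∫ x, f x i :=
  ((EuclideanSpace.proj i : C3 →L[ℂ] ℂ).integral_comp_comm hf).symm

theorem integral_fourier_coord (A : L2) (φ : 𝓢(R3, ℂ)) (i : Fin 3) :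
    ∫ k, φ k * (𝓕 A : L2) k i = ∫ x, 𝓕 (φ : R3 → ℂ) x * A x i := by
  have h1 := isFunction_fourier A φ
  have h2 := isFunction_asDist A (𝓕 φ)
  rw [TemperedDistribution.fourier_apply, h2.2] at h1
  have h3 := congrArg (fun v : C3 => v i) h1.2
  simp only [integral_coord h1.1, integral_coord h2.1] at h3
  rw [← SchwartzMap.fourier_coe]
  exact h3.symm

theorem ae_eq_of_test {a b : R3 → ℂ} (ha : MemLp a 2 volume) (hb : MemLp b 2 volume)
    (h : ∀ g : R3 → ℝ, ContDiff ℝ (⊤ : ℕ∞) g → HasCompactSupport g →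
      ∫ x, (g x : ℂ) * a x = ∫ x, (g x : ℂ) * b x) : a =ᵐ[volume] b := by
  have h1 := ae_eq_zero_of_integral_contDiff_smul_eq_zero
    ((ha.sub hb).locallyIntegrable one_le_two) fun g h1 h2 => by
      obtain ⟨φ, hφ⟩ := exists_schwartz_of_test h1 h2
      have i1 := integrable_smul_of_memLp ha φ
      have i2 := integrable_smul_of_memLp hb φ
      simp only [hφ, smul_eq_mul] at i1 i2
      have h3 := h g h1 h2
      rw [← sub_eq_zero, ← integral_sub i1 i2] at h3
      rw [← h3]
      congr 1
      ext x
      rw [Pi.sub_apply, Complex.real_smul, mul_sub]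
  filter_upwards [h1] with x hx
  exact sub_eq_zero.1 hx

/-- A field is real-valued if and only if its Fourier transform is Hermitian. -/
theorem isRealField_iff (A : L2) : IsRealField A ↔
    ∀ᵐ k, ∀ i, (𝓕 A : L2) (-k) i = (starRingEnd ℂ) ((𝓕 A : L2) k i) := by
  have hconj : ∀ {f : R3 → ℂ}, MemLp f 2 volume → MemLp (fun x => (starRingEnd ℂ) (f x)) 2 volume :=
    fun hf => hf.star
  have hneg : ∀ {f : R3 → ℂ}, MemLp f 2 volume → MemLp (fun x => f (-x)) 2 volume := fun hf =>
    hf.comp_measurePreserving (Measure.measurePreserving_neg (volume : Measure R3))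
  have hF : ∀ i, MemLp (fun k => (𝓕 A : L2) k i) 2 volume := memLp_coord (Lp.memLp (𝓕 A : L2))
  have hA : ∀ i, MemLp (fun x => A x i) 2 volume := memLp_coord (Lp.memLp A)
  constructor
  · intro h
    rw [ae_all_iff]
    intro i
    refine ae_eq_of_test (hneg (hF i)) (hconj (hF i)) fun g h1 h2 => ?_
    obtain ⟨φ, hφ⟩ := exists_schwartz_of_test h1 h2
    obtain ⟨ψ, hψ⟩ := exists_schwartz_of_test (g := fun x => g (-x)) (h1.comp contDiff_neg)
      (h2.comp_homeomorph (Homeomorph.neg R3))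
    have e0 : (ψ : R3 → ℂ) = fun x => φ (-x) := funext fun x => by rw [hψ, hφ]
    have e1 : ∫ k, (g k : ℂ) * (𝓕 A : L2) (-k) i = ∫ k, ψ k * (𝓕 A : L2) k i := by
      rw [← integral_neg_eq_self]
      simp only [neg_neg, hψ]
    have e2 : ∫ k, (g k : ℂ) * (starRingEnd ℂ) ((𝓕 A : L2) k i) =
        (starRingEnd ℂ) (∫ k, φ k * (𝓕 A : L2) k i) := by
      rw [← integral_conj]
      simp only [map_mul, hφ, Complex.conj_ofReal]
    rw [e1, e2, integral_fourier_coord, integral_fourier_coord, ← integral_conj, e0]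
    refine integral_congr_ae ?_
    filter_upwards [h] with x hx
    rw [fourier_comp_neg, map_mul, conj_fourier_of_real (fun x => by rw [hφ, Complex.conj_ofReal]),
      Complex.conj_eq_iff_im.2 (hx i)]
  · intro h
    rw [IsRealField, ae_all_iff]
    intro i
    have key : (fun x => A x i) =ᵐ[volume] fun x => (starRingEnd ℂ) (A x i) := by
      refine ae_eq_of_test (hA i) (hconj (hA i)) fun g h1 h2 => ?_
      obtain ⟨φ, hφ⟩ := exists_schwartz_of_test h1 h2
      set ψ : 𝓢(R3, ℂ) := 𝓕⁻ φ with hψ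
      have hψφ : 𝓕 (ψ : R3 → ℂ) = φ := by
        rw [← SchwartzMap.fourier_coe, hψ, FourierTransform.fourier_fourierInv_eq]
      have hψk : ∀ k, ψ k = 𝓕 (φ : R3 → ℂ) (-k) := fun k => by
        rw [hψ, SchwartzMap.fourierInv_coe, Real.fourierInv_eq_fourier_neg]
      have e1 : ∫ x, (g x : ℂ) * A x i = ∫ k, ψ k * (𝓕 A : L2) k i := by
        rw [integral_fourier_coord, hψφ]
        simp only [hφ]
      have e2 : ∫ x, (g x : ℂ) * (starRingEnd ℂ) (A x i) =
          (starRingEnd ℂ) (∫ x, (g x : ℂ) * A x i) := by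
        rw [← integral_conj]
        simp only [map_mul, Complex.conj_ofReal]
      rw [e2, e1, ← integral_conj, ← integral_neg_eq_self]
      refine integral_congr_ae ?_
      filter_upwards [h] with k hk
      rw [hk, map_mul, hψk, hψk, conj_fourier_of_real (fun x => by rw [hφ, Complex.conj_ofReal])]
    filter_upwards [key] with x hx
    exact Complex.conj_eq_iff_im.1 hx.symm

theorem isRealField_iff_hat (A : L2star) : IsRealField (A : L2) ↔
    ∀ᵐ k, ∀ i, hat A (-k) i = (starRingEnd ℂ) (hat A k i) := isRealField_iff _

theorem transverse_neg (k : R3) (w : C3) : transverse (-k) w = transverse k w := by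
  ext i
  simp [transverse, neg_div, sub_eq_add_neg]

theorem conj_transverse {w : C3} (hw : ∀ i, (w i).im = 0) (k : R3) (i : Fin 3) :
    (starRingEnd ℂ) (transverse k w i) = transverse k w i := by
  have h : ∀ j, (starRingEnd ℂ) (w j) = w j := fun j => Complex.conj_eq_iff_im.2 (hw j)
  simp [transverse, h]

theorem tau_neg (k : R3) : tau (-k) = tau k := by rw [tau, tau, norm_neg]

theorem isRealField_MQG {lam : ℝ} (hl : 0 < lam) {Q : C3} (hQ : ∀ i, (Q i).im = 0) :
    IsRealField (MQG lam Q : L2) := by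
  rw [isRealField_iff_hat]
  filter_upwards [hat_MQG hl Q, ae_neg (hat_MQG hl Q)] with k h1 h2 i
  rw [h1, h2, transverse_neg, PiLp.smul_apply, PiLp.smul_apply, smul_eq_mul, smul_eq_mul, map_mul,
    conj_res, conj_transverse hQ, res, res, tau_neg]

theorem isRealField_negLaplacian {A : negLaplacian.domain} (h : IsRealField ((A : L2star) : L2)) :
    IsRealField (negLaplacian A : L2) := by
  rw [isRealField_iff] at h ⊢
  filter_upwards [h, fourier_negLaplacian A, ae_neg (fourier_negLaplacian A)] with k h1 h2 h3 i
  rw [h2, h3, tau_neg, PiLp.smul_apply, PiLp.smul_apply, smul_eq_mul, smul_eq_mul, map_mul,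
    Complex.conj_ofReal, h1]

theorem IsRealField.add {A B : L2star} (hA : IsRealField (A : L2)) (hB : IsRealField (B : L2)) :
    IsRealField ((A + B : L2star) : L2) := by
  filter_upwards [hA, hB, Lp.coeFn_add (A : L2) (B : L2)] with x h1 h2 h3 i
  rw [Submodule.coe_add, h3, Pi.add_apply, PiLp.add_apply, Complex.add_im, h1, h2, add_zero]

theorem IsRealField.smul {A : L2star} (hA : IsRealField (A : L2)) (a : ℝ) :
    IsRealField (((a : ℂ) • A : L2star) : L2) := by
  filter_upwards [hA, Lp.coeFn_smul (a : ℂ) (A : L2)] with x h1 h3 i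
  rw [Submodule.coe_smul, h3, Pi.smul_apply, PiLp.smul_apply, smul_eq_mul, Complex.im_ofReal_mul,
    h1, mul_zero]

/-- Real fields have real charges. -/
theorem real_charge {e c lam : ℝ} (he : e ≠ 0) (hc : 0 < c) (hl : 0 < lam)
    {A : L2star} {Q : C3} (h : regPart e c lam A Q ∈ Hstar 1) (hA : IsRealField (A : L2)) (i : Fin 3) :
    (Q i).im = 0 := by
  obtain ⟨S, hS, hS'⟩ := exists_sphereMeans_charge he hc hl h
  have h1 : ∀ᵐ r : ℝ, 0 < r → (S r i).im = 0 := by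
    filter_upwards [hS.2, ae_sphere hA] with r e1 e2 hr
    obtain ⟨e3, e4⟩ := e1 hr
    have e5 : (∫ ω : S2, (A : L2) (r • (ω : R3)) ∂sphereMeasure) i =
        ∫ ω : S2, (A : L2) (r • (ω : R3)) i ∂sphereMeasure :=
      ((EuclideanSpace.proj i : C3 →L[ℂ] ℂ).integral_comp_comm e3).symm
    have e6 : Integrable (fun ω : S2 => (A : L2) (r • (ω : R3)) i) sphereMeasure :=
      (EuclideanSpace.proj i : C3 →L[ℂ] ℂ).integrable_comp e3
    have e7 : (∫ ω : S2, (A : L2) (r • (ω : R3)) i ∂sphereMeasure).im = 0 := by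
      have := integral_im e6
      simp only [RCLike.im_to_complex] at this
      rw [← this]
      refine integral_eq_zero_of_ae ?_
      filter_upwards [e2 hr] with ω hω
      exact hω i
    rw [e4, PiLp.smul_apply, e5, Complex.smul_im, e7, smul_zero]
  -- The means are real for almost every radius, hence for every one by continuity.
  have h2 : ∀ r : ℝ, 0 < r → (S r i).im = 0 := by
    have hc1 : ContinuousOn (fun r => (S r i).im) (Ioi 0) :=
      Complex.continuous_im.comp_continuousOn
        ((EuclideanSpace.proj i : C3 →L[ℂ] ℂ).continuous.comp_continuousOn hS.1)
    have h3 := Measure.eqOn_of_ae_eq (μ := (volume : Measure ℝ)) (s := Ioi 0)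
      (f := fun r => (S r i).im) (g := fun _ => 0)
      ((ae_restrict_iff' measurableSet_Ioi).2 h1) hc1 continuousOn_const
      (by rw [interior_Ioi]; exact subset_closure)
    exact fun r hr => h3 hr
  have h3 : Tendsto (fun r : ℝ => ((((3 * c / (2 * e) : ℝ) : ℂ) • (r : ℂ) • S r) i).im)
      (𝓝[>] 0) (𝓝 (Q i).im) :=
    ((Complex.continuous_im.comp (EuclideanSpace.proj i : C3 →L[ℂ] ℂ).continuous).tendsto Q).comp hS'
  refine tendsto_nhds_unique h3 (tendsto_const_nhds.congr' ?_)
  filter_upwards [self_mem_nhdsWithin] with r hr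
  rw [PiLp.smul_apply, PiLp.smul_apply, smul_eq_mul, smul_eq_mul, Complex.im_ofReal_mul,
    Complex.im_ofReal_mul, h2 r hr, mul_zero, mul_zero]

/-- With λ = 1, H_m A = −ΔA₁ + A₁ − A. The regular part A₁ is real because the charge is, and −Δ has
an even real symbol. -/
theorem isRealField_pointOp {e c m w : ℝ} (he : e ≠ 0) (hc : 0 < c) (hw : 0 < w)
    (hg : 0 < GammaM e c m w) (A : (pointOp e c m w hw hg).domain)
    (hA : IsRealField ((A : L2star) : L2)) : IsRealField (pointOp e c m w hw hg A : L2) := by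
  obtain ⟨Q, h1, h2⟩ := (mem_domain_pointOp_iff he hc hw hg one_pos (A : L2star)).1 A.2
  have h3 := pointOp_apply he hc hw hg one_pos A Q h1 h2
  have hQ := real_charge he hc one_pos (Hstar_two_le_one h1) hA
  have hr : IsRealField (regPart e c 1 A Q : L2) := by
    have := hA.add ((isRealField_MQG one_pos hQ).smul (-(4 * Real.pi * e / c)))
    rwa [Complex.ofReal_neg, neg_smul, ← sub_eq_add_neg] at this
  have h4 : pointOp e c m w hw hg A = negLaplacian ⟨regPart e c 1 A Q, h1⟩ +
      ((1 : ℝ) : ℂ) • regPart e c 1 A Q + ((-1 : ℝ) : ℂ) • (A : L2star) := by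
    rw [← h3]
    push_cast
    module
  rw [h4]
  exact ((isRealField_negLaplacian (A := ⟨regPart e c 1 A Q, h1⟩) hr).add (hr.smul 1)).add
    (hA.smul (-1))

/-! ### Spectral measures of multiplication operators -/

theorem ae_volumeIoiPow_of_ae {p : ℝ → Prop} (h : ∀ᵐ r : ℝ, 0 < r → p r) :
    ∀ᵐ r : Ioi (0 : ℝ) ∂(Measure.volumeIoiPow 2), p r := by
  rw [Measure.volumeIoiPow]
  refine withDensity_absolutelyContinuous _ _ ?_
  exact (ae_restrict_iff_subtype measurableSet_Ioi).1 ((ae_restrict_iff' measurableSet_Ioi).2 h)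

theorem ae_norm_of_ae {p : ℝ → Prop} (h : ∀ᵐ r : ℝ, 0 < r → p r) : ∀ᵐ k : R3, p ‖k‖ := by
  rw [← measurePreserving_polar.map_eq, measurableEmbedding_polar.ae_map_iff]
  have h1 := (Measure.quasiMeasurePreserving_snd (μ := sphereMeasure)
    (ν := Measure.volumeIoiPow 2)).ae (ae_volumeIoiPow_of_ae h)
  filter_upwards [h1] with q hq
  have hr : (0 : ℝ) < q.2 := q.2.2
  have h2 : ‖(q.1 : R3)‖ = 1 := by simp
  rwa [norm_smul, h2, mul_one, Real.norm_eq_abs, abs_of_pos hr]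

/-- The radius √t/(2π) is a differentiable function of t > 0, so it maps null sets to null sets.
This is the absolute continuity of the spectrum of −Δ. -/
theorem ae_tau_of_ae {p : ℝ → Prop} (h : ∀ᵐ t : ℝ, p t) : ∀ᵐ k : R3, p (tau k) := by
  refine ae_norm_of_ae (p := fun r => p (4 * Real.pi ^ 2 * r ^ 2)) ?_
  have h1 : volume ((fun t : ℝ => Real.sqrt t / (2 * Real.pi)) '' ({t | ¬p t} ∩ Ioi 0)) = 0 := by
    refine addHaar_image_eq_zero_of_differentiableOn_of_addHaar_eq_zero volume ?_
      (measure_mono_null inter_subset_left h)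
    intro t ht
    have ht0 : (0 : ℝ) < t := ht.2
    exact ((Real.hasDerivAt_sqrt ht0.ne').differentiableAt.div_const _).differentiableWithinAt
  refine measure_mono_null ?_ h1
  intro r hr
  simp only [mem_compl_iff, mem_ofPred_eq, Classical.not_imp] at hr
  have hr0 := hr.1
  refine ⟨4 * Real.pi ^ 2 * r ^ 2, ⟨hr.2, ?_⟩, ?_⟩
  · show (0 : ℝ) < _
    positivity
  · have : 4 * Real.pi ^ 2 * r ^ 2 = (2 * Real.pi * r) ^ 2 := by ring
    simp only
    rw [this, Real.sqrt_sq (by positivity)]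
    field_simp

/-- The spectral measure of `-Δ` at `A`. -/
def freeMeasure (A : L2star) : Measure ℝ :=
  (volume.withDensity fun k => ENNReal.ofReal (‖hat A k‖ ^ 2)).map tau

theorem measurable_tau : Measurable tau := continuous_tau.measurable

theorem aemeasurable_normSq_hat (A : L2star) :
    AEMeasurable (fun k => ENNReal.ofReal (‖hat A k‖ ^ 2)) volume :=
  (integrable_normSq_hat A).aestronglyMeasurable.aemeasurable.ennreal_ofReal

theorem freeMeasure_univ (A : L2star) : freeMeasure A univ = ENNReal.ofReal (‖A‖ ^ 2) := by
  rw [freeMeasure, Measure.map_apply measurable_tau MeasurableSet.univ, preimage_univ,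
    withDensity_apply _ MeasurableSet.univ, Measure.restrict_univ, normSq_eq_integral_hat,
    ofReal_integral_eq_lintegral_ofReal (integrable_normSq_hat A)
      (Eventually.of_forall fun k => sq_nonneg _)]

instance isFiniteMeasure_freeMeasure (A : L2star) : IsFiniteMeasure (freeMeasure A) :=
  ⟨by rw [freeMeasure_univ]; exact ENNReal.ofReal_lt_top⟩

theorem freeMeasure_absolutelyContinuous (A : L2star) : freeMeasure A ≪ volume := by
  refine Measure.AbsolutelyContinuous.mk fun s hs h0 => ?_
  rw [freeMeasure, Measure.map_apply measurable_tau hs]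
  refine withDensity_absolutelyContinuous _ _ ?_
  have h1 : ∀ᵐ t : ℝ, t ∉ s := measure_eq_zero_iff_ae_notMem.1 h0
  exact measure_eq_zero_iff_ae_notMem.2 (ae_tau_of_ae h1)

/-- The resolvent symbol `(τ - z)⁻¹`. -/
def rsym (z : ℂ) (k : R3) : ℂ := ((tau k : ℂ) - z)⁻¹

theorem bddMeas_rsym {z : ℂ} (hz : z ∉ Complex.ofReal '' Ici 0) : BddMeas (rsym z) := by
  refine ⟨?_, ?_⟩
  · unfold rsym
    have := measurable_tau
    fun_prop
  · have hcl : IsClosed (Complex.ofReal '' Ici 0) :=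
      Complex.isometry_ofReal.isClosedEmbedding.isClosedMap _ isClosed_Ici
    have hne : (Complex.ofReal '' Ici (0 : ℝ)).Nonempty := ⟨_, 0, by simp, rfl⟩
    have hd := (hcl.notMem_iff_infDist_pos hne).1 hz
    refine ⟨(Metric.infDist z (Complex.ofReal '' Ici 0))⁻¹, fun k => ?_⟩
    rw [rsym, norm_inv]
    refine inv_anti₀ hd ?_
    rw [← dist_eq_norm, dist_comm]
    exact Metric.infDist_le_dist_of_mem ⟨tau k, tau_nonneg k, rfl⟩

theorem inner_fmul_rsym {z : ℂ} (hz : z ∉ Complex.ofReal '' Ici 0) (A : L2star) :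
    inner ℂ A (fmul (rsym z) (bddMeas_rsym hz) A) = ∫ t : ℝ, ((t : ℂ) - z)⁻¹ ∂(freeMeasure A) := by
  have hm : Measurable fun t : ℝ => ((t : ℂ) - z)⁻¹ := by fun_prop
  rw [freeMeasure, integral_map measurable_tau.aemeasurable hm.aestronglyMeasurable,
    integral_withDensity_eq_integral_toReal_smul₀ (aemeasurable_normSq_hat A)
      (Eventually.of_forall fun _ => ENNReal.ofReal_lt_top), inner_eq_integral_hat]
  refine integral_congr_ae ?_
  filter_upwards [hat_fmul (bddMeas_rsym hz) A] with k hk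
  rw [hk, inner_smul_right, inner_self_eq_norm_sq_to_K, ENNReal.toReal_ofReal (sq_nonneg _), rsym,
    Complex.real_smul, mul_comm]
  norm_cast

theorem fmul_comm {g h : R3 → ℂ} (hg : BddMeas g) (hh : BddMeas h) :
    fmul g hg * fmul h hh = fmul h hh * fmul g hg := by
  ext1 A
  refine hat_ext ?_
  filter_upwards [hat_fmul hg (fmul h hh A), hat_fmul hh A, hat_fmul hh (fmul g hg A),
    hat_fmul hg A] with k h1 h2 h3 h4
  rw [mul_apply_eq_comp, mul_apply_eq_comp, h1, h2, h3, h4, smul_comm]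

theorem rsym_eq {w : ℝ} (hw : 0 < w) {z : ℂ} (hz : z ∉ Complex.ofReal '' Ici 0) :
    fmul (rsym z) (bddMeas_rsym hz) = freeRes w hw +
      (z + w) • (freeRes w hw * fmul (rsym z) (bddMeas_rsym hz)) := by
  ext1 A
  refine hat_ext ?_
  have hadd := hat_add (freeRes w hw A)
    ((z + w) • freeRes w hw (fmul (rsym z) (bddMeas_rsym hz) A))
  filter_upwards [hat_fmul (bddMeas_rsym hz) A, hat_freeRes hw A, hadd,
    hat_smul (z + w) (freeRes w hw (fmul (rsym z) (bddMeas_rsym hz) A)),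
    hat_freeRes hw (fmul (rsym z) (bddMeas_rsym hz) A)] with k h1 h2 h3 h4 h5
  refine Eq.trans ?_ h3.symm
  rw [h1, h2, h4, h5, h1, smul_smul, smul_smul, ← add_smul]
  congr 1
  have ht := tau_nonneg k
  have hz0 : (tau k : ℂ) - z ≠ 0 := fun h => hz ⟨tau k, ht, sub_eq_zero.1 h⟩
  have hw0 : (tau k : ℂ) + w ≠ 0 := by
    rw [← Complex.ofReal_add, Complex.ofReal_ne_zero]
    positivity
  rw [res, rsym]
  push_cast
  field_simp
  ring

/-- The transform of such an A lives on a level set of τ, which is null: the free operator has no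
eigenvectors. -/
theorem eq_zero_of_smul_freeRes {w : ℝ} (hw : 0 < w) {a : ℂ} {A : L2star}
    (h : A = a • freeRes w hw A) : A = 0 := by
  refine hat_ext ?_
  have h0 : hat (0 : L2star) =ᵐ[volume] 0 := by
    rw [map_zero]
    exact Lp.coeFn_zero _ _ _
  have h1 := hat_smul a (freeRes w hw A)
  rw [← h] at h1
  have h2 : ∀ᵐ k : R3, tau k ≠ a.re - w := ae_tau_of_ae (Measure.ae_ne volume _)
  filter_upwards [h0, h1, hat_freeRes hw A, h2] with k e0 e1 e2 e3
  rw [e2, smul_smul] at e1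
  rw [e0, Pi.zero_apply]
  by_contra hne
  have e4 : (1 - a * res w k) • hat A k = 0 := by
    rw [sub_smul, one_smul, ← e1, sub_self]
  rw [smul_eq_zero_iff_left hne, sub_eq_zero, res] at e4
  have ht := tau_nonneg k
  have e5 : a = ((tau k + w : ℝ) : ℂ) := by
    have hne2 : ((tau k + w : ℝ) : ℂ) ≠ 0 := by
      rw [Complex.ofReal_ne_zero]
      positivity
    rw [Complex.ofReal_inv] at e4
    exact ((eq_mul_inv_iff_mul_eq₀ hne2).1 e4).symm.trans (one_mul _)
  exact e3 (by rw [e5, Complex.ofReal_re, add_sub_cancel_right])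

/-! ### Spectral consequences of a diagonalization -/

section Algebra

variable {𝒜 : Type*} [Ring 𝒜] [Algebra ℂ 𝒜] {R P f n S₁ V₁ S₂ V₂ X : 𝒜} {ν α c : ℂ}

/-- Here Sᵢ stands for Vᵢ†, f for the free resolvent at −w and n for the one at z. Multiplying R by
the resolution of the identity gives R = νP + ∑ Sᵢ f Vᵢ, and the resolvent identity between f and n
is transported term by term. -/
theorem diag_resolvent_right (hsum : P + S₁ * V₁ + S₂ * V₂ = 1) (hP : R * P = ν • P)
    (h₁ : R * S₁ = S₁ * f) (h₂ : R * S₂ = S₂ * f) (hn : n = f + c • (f * n)) :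
    S₁ * n * V₁ + S₂ * n * V₂ = R - ν • P + c • (R * (S₁ * n * V₁ + S₂ * n * V₂)) := by
  have h3 : R = ν • P + S₁ * f * V₁ + S₂ * f * V₂ := by
    calc R = R * (P + S₁ * V₁ + S₂ * V₂) := by rw [hsum, mul_one]
      _ = _ := by rw [mul_add, mul_add, hP, ← mul_assoc, ← mul_assoc, h₁, h₂]
  have h4 : ∀ S V, S * n * V = S * f * V + c • (S * (f * n) * V) := fun S V => by
    nth_rw 1 [hn]
    rw [mul_add, add_mul, mul_smul_comm, smul_mul_assoc]
  have h5 : R * (S₁ * n * V₁ + S₂ * n * V₂) = S₁ * (f * n) * V₁ + S₂ * (f * n) * V₂ := by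
    rw [mul_add]
    simp only [← mul_assoc]
    rw [h₁, h₂]
  rw [h5]
  nth_rw 1 [h3]
  rw [h4 S₁, h4 S₂, smul_add]
  abel

omit [Algebra ℂ 𝒜] in
theorem diag_resolvent_comm (h₁ : R * S₁ = S₁ * f) (h₂ : R * S₂ = S₂ * f) (h₁' : V₁ * R = f * V₁)
    (h₂' : V₂ * R = f * V₂) (hc : f * n = n * f) :
    (S₁ * n * V₁ + S₂ * n * V₂) * R = R * (S₁ * n * V₁ + S₂ * n * V₂) := by
  have h3 : ∀ S V, R * S = S * f → V * R = f * V → S * n * V * R = R * (S * n * V) :=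
    fun S V hS hV => by
      rw [mul_assoc, hV, ← mul_assoc, mul_assoc S, ← hc, ← mul_assoc, ← hS, mul_assoc R,
        mul_assoc R]
  rw [add_mul, mul_add, h3 S₁ V₁ h₁ h₁', h3 S₂ V₂ h₂ h₂']

/-- On the range of P both resolvents are scalars; hα is the resolvent identity for these scalars.
-/
theorem add_resolvent_right (hP : R * P = ν • P) (hα : α = ν + c * (α * ν))
    (hX : X = R - ν • P + c • (R * X)) : α • P + X = R + c • (R * (α • P + X)) := by
  have h5 : α • P = ν • P + c • (α • ν • P) := by
    nth_rw 1 [hα]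
    module
  rw [mul_add, mul_smul_comm, hP, smul_add]
  nth_rw 1 [h5, hX]
  abel

theorem add_resolvent_left (hP : P * R = ν • P) (hα : α = ν + c * (α * ν))
    (hX : X = R - ν • P + c • (X * R)) : α • P + X = R + c • ((α • P + X) * R) := by
  have h5 : α • P = ν • P + c • (α • ν • P) := by
    nth_rw 1 [hα]
    module
  rw [add_mul, smul_mul_assoc, hP, smul_add]
  nth_rw 1 [h5, hX]
  abel

omit [Algebra ℂ 𝒜] in
theorem projection_mul_eq_zero (h₁ : P * S₁ = 0) (h₂ : P * S₂ = 0) :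
    P * (S₁ * n * V₁ + S₂ * n * V₂) = 0 := by
  rw [mul_add, ← mul_assoc, ← mul_assoc, ← mul_assoc, ← mul_assoc, h₁, h₂]
  simp only [zero_mul, add_zero]

end Algebra

section Star

variable {E : Type*} [NormedAddCommGroup E] [InnerProductSpace ℂ E]

variable {T : E →ₗ.[ℂ] E} {K : Submodule ℂ E} {z : ℂ}

theorem notMem_spec_partOn (S : E →L[ℂ] E) (hS : ∀ x ∈ K, S x ∈ K)
    (h1 : ∀ x ∈ K, ∃ h : S x ∈ T.domain, T ⟨S x, h⟩ = x + z • S x)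
    (h2 : ∀ (x : T.domain), (x : E) ∈ K → T x ∈ K → S (T x - z • (x : E)) = x) :
    z ∉ spec (partOn T K) := by
  intro hz
  refine hz ⟨(S.comp K.subtypeL).codRestrict K fun x => hS x x.2, fun x => ?_, fun x => ?_⟩
  · obtain ⟨h3, h4⟩ := h1 x x.2
    refine ⟨⟨h3, h4 ▸ K.add_mem x.2 (K.smul_mem _ (hS x x.2))⟩, Subtype.ext ?_⟩
    show T ⟨S x, h3⟩ - z • S x = x
    rw [h4, add_sub_cancel_right]
  · exact Subtype.ext (h2 ⟨((x : K) : E), x.2.1⟩ (x : K).2 x.2.2)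

/-- Weyl's criterion: with ε = 1/(2(‖S‖ + 1)) a resolvent S would give ‖x‖ ≤ ‖x‖/2. -/
theorem mem_spec_of_approx (h : ∀ ε > 0, ∃ x : T.domain, (x : E) ≠ 0 ∧
    ‖T x - z • (x : E)‖ ≤ ε * ‖(x : E)‖) : z ∈ spec T := by
  rintro ⟨S, hS⟩
  obtain ⟨x, hx, h2⟩ := h (1 / (2 * (‖S‖ + 1))) (by positivity)
  have h4 := S.le_opNorm (T x - z • (x : E))
  rw [hS.2 x] at h4
  have h5 : 0 < ‖(x : E)‖ := norm_pos_iff.2 hx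
  have h6 : ‖S‖ * ‖T x - z • (x : E)‖ ≤ ‖S‖ * (1 / (2 * (‖S‖ + 1)) * ‖(x : E)‖) := by gcongr
  have h7 : ‖S‖ * (1 / (2 * (‖S‖ + 1)) * ‖(x : E)‖) ≤ 1 / 2 * ‖(x : E)‖ := by
    rw [← mul_assoc]
    gcongr
    rw [mul_one_div, div_le_div_iff₀ (by positivity) two_pos]
    linarith [norm_nonneg S]
  linarith

theorem mem_spec_partOn (h : ∀ ε > 0, ∃ x : T.domain, (x : E) ≠ 0 ∧ (x : E) ∈ K ∧ T x ∈ K ∧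
    ‖T x - z • (x : E)‖ ≤ ε * ‖(x : E)‖) : z ∈ spec (partOn T K) := by
  refine mem_spec_of_approx fun ε hε => ?_
  obtain ⟨x, h1, h2, h3, h4⟩ := h ε hε
  exact ⟨⟨⟨x, h2⟩, x.2, h3⟩, fun h0 => h1 (congrArg Subtype.val h0), h4⟩

variable [CompleteSpace E]

theorem star_mul_operator (A B : E →L[ℂ] E) : star (A * B) = star B * star A := star_mul A B

theorem star_ofReal_smul_operator (a : ℝ) (A : E →L[ℂ] E) :
    star ((a : ℂ) • A) = (a : ℂ) • star A := by
  rw [star_smul, Complex.star_def, Complex.conj_ofReal]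

theorem star_zero_operator : star (0 : E →L[ℂ] E) = 0 := star_zero _

end Star

/-- A diagonalization of the operator `T`, whose resolvent at `-w` is `R`: on the range of the
projection `P` it is `-b`, and `V₁`, `V₂` transform the rest into `-Δ`. -/
structure Diagonalizes (T : L2star →ₗ.[ℂ] L2star) (b w : ℝ) (hw : 0 < w)
    (R P V₁ V₂ : L2star →L[ℂ] L2star) : Prop where
  pos : 0 < b
  lt : b < w
  isResolventAt : IsResolventAt T ((-w : ℝ) : ℂ) R
  selfAdjoint : IsSelfAdjoint R
  sum_eq : P + star V₁ * V₁ + star V₂ * V₂ = 1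
  selfAdjoint_P : IsSelfAdjoint P
  P_mul_P : P * P = P
  R_mul_P : R * P = (((w - b)⁻¹ : ℝ) : ℂ) • P
  V₁_mul_P : V₁ * P = 0
  V₂_mul_P : V₂ * P = 0
  V₁_mul_R : V₁ * R = freeRes w hw * V₁
  V₂_mul_R : V₂ * R = freeRes w hw * V₂
  -- The intertwiners are not assumed onto, so the other relations do not exclude gaps in [0, ∞).
  -- The vectors satisfy P x = 0 so that they also serve in the absolutely continuous subspace.
  weyl : ∀ t : ℝ, 0 ≤ t → ∀ ε > 0, ∃ x : L2star, x ≠ 0 ∧ P x = 0 ∧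
    ∃ h : x ∈ T.domain, ‖T ⟨x, h⟩ - (t : ℂ) • x‖ ≤ ε * ‖x‖

namespace Diagonalizes

variable {T : L2star →ₗ.[ℂ] L2star} {b w : ℝ} {hw : 0 < w} {R P V₁ V₂ : L2star →L[ℂ] L2star}
  (D : Diagonalizes T b w hw R P V₁ V₂)

include D

theorem P_mul_R : P * R = (((w - b)⁻¹ : ℝ) : ℂ) • P := by
  have := congrArg star D.R_mul_P
  rwa [star_mul_operator, star_ofReal_smul_operator, D.selfAdjoint.star_eq,
    D.selfAdjoint_P.star_eq] at this

theorem P_mul_star₁ : P * star V₁ = 0 := by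
  have := congrArg star D.V₁_mul_P
  rwa [star_mul_operator, D.selfAdjoint_P.star_eq, star_zero_operator] at this

theorem P_mul_star₂ : P * star V₂ = 0 := by
  have := congrArg star D.V₂_mul_P
  rwa [star_mul_operator, D.selfAdjoint_P.star_eq, star_zero_operator] at this

theorem R_mul_star₁ : R * star V₁ = star V₁ * freeRes w hw := by
  have := congrArg star D.V₁_mul_R
  rwa [star_mul_operator, star_mul_operator, D.selfAdjoint.star_eq, (isSelfAdjoint_freeRes hw).star_eq] at this

theorem R_mul_star₂ : R * star V₂ = star V₂ * freeRes w hw := by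
  have := congrArg star D.V₂_mul_R
  rwa [star_mul_operator, star_mul_operator, D.selfAdjoint.star_eq, (isSelfAdjoint_freeRes hw).star_eq] at this

omit D in
/-- The part of the resolvent off the eigenspace. -/
def acRes (V₁ V₂ : L2star →L[ℂ] L2star) (z : ℂ) (hz : z ∉ Complex.ofReal '' Ici 0) :
    L2star →L[ℂ] L2star :=
  star V₁ * fmul (rsym z) (bddMeas_rsym hz) * V₁ + star V₂ * fmul (rsym z) (bddMeas_rsym hz) * V₂

theorem acRes_eq_right {z : ℂ} (hz : z ∉ Complex.ofReal '' Ici 0) :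
    acRes V₁ V₂ z hz = R - (((w - b)⁻¹ : ℝ) : ℂ) • P + (z + w) • (R * acRes V₁ V₂ z hz) :=
  diag_resolvent_right D.sum_eq D.R_mul_P D.R_mul_star₁ D.R_mul_star₂ (rsym_eq hw hz)

theorem acRes_eq_left {z : ℂ} (hz : z ∉ Complex.ofReal '' Ici 0) :
    acRes V₁ V₂ z hz = R - (((w - b)⁻¹ : ℝ) : ℂ) • P + (z + w) • (acRes V₁ V₂ z hz * R) := by
  have h : acRes V₁ V₂ z hz * R = R * acRes V₁ V₂ z hz :=
    diag_resolvent_comm D.R_mul_star₁ D.R_mul_star₂ D.V₁_mul_R D.V₂_mul_R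
      (fmul_comm (bddMeas_res hw) (bddMeas_rsym hz))
  rw [h]
  exact D.acRes_eq_right hz

theorem P_mul_acRes {z : ℂ} (hz : z ∉ Complex.ofReal '' Ici 0) : P * acRes V₁ V₂ z hz = 0 :=
  projection_mul_eq_zero D.P_mul_star₁ D.P_mul_star₂

/-- Eigenvalue part plus transported free resolvents; both resolvent identities with R hold, the
scalar h4 being the one on the eigenspace. -/
theorem isResolventAt_of_notMem {z : ℂ} (hz : z ∉ Complex.ofReal '' Ici 0)
    (hb : z ≠ ((-b : ℝ) : ℂ)) :
    IsResolventAt T z ((((-b : ℝ) : ℂ) - z)⁻¹ • P + acRes V₁ V₂ z hz) := by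
  have h1 : ((-b : ℝ) : ℂ) - z ≠ 0 := sub_ne_zero.2 hb.symm
  have h2 : ((w - b : ℝ) : ℂ) ≠ 0 := Complex.ofReal_ne_zero.2 (sub_pos.2 D.lt).ne'
  have h3 : z - ((-w : ℝ) : ℂ) = z + w := by push_cast; ring
  have h4 : (((-b : ℝ) : ℂ) - z)⁻¹ = (((w - b)⁻¹ : ℝ) : ℂ) +
      (z + w) * ((((-b : ℝ) : ℂ) - z)⁻¹ * (((w - b)⁻¹ : ℝ) : ℂ)) := by
    rw [Complex.ofReal_inv]
    field_simp
    push_cast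
    ring
  refine D.isResolventAt.of_resolvent_eq ?_ ?_
  · rw [h3]
    exact add_resolvent_right D.R_mul_P h4 (D.acRes_eq_right hz)
  · rw [h3]
    exact add_resolvent_left D.P_mul_R h4 (D.acRes_eq_left hz)

theorem inner_P (x : L2star) : inner ℂ x (P x) = ((‖P x‖ ^ 2 : ℝ) : ℂ) := by
  have h1 : inner ℂ (P x) (P x) = inner ℂ x (P (P x)) :=
    (ContinuousLinearMap.isSelfAdjoint_iff_isSymmetric.1 D.selfAdjoint_P) x (P x)
  have h2 : P (P x) = P x := congrArg (fun S : L2star →L[ℂ] L2star => S x) D.P_mul_P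
  rw [h2] at h1
  rw [← h1]
  exact (inner_self_eq_norm_sq_to_K (𝕜 := ℂ) (P x)).trans (by norm_cast)

omit D in
theorem inner_star_mul (V m : L2star →L[ℂ] L2star) (x : L2star) :
    inner ℂ x ((star V * m * V) x) = inner ℂ (V x) (m (V x)) := by
  rw [mul_apply_eq_comp, mul_apply_eq_comp, ContinuousLinearMap.star_eq_adjoint,
    ContinuousLinearMap.adjoint_inner_right]

/-- The spectral measure at `x`. -/
theorem isSpectralMeasure (x : L2star) : IsSpectralMeasure T x
    (ENNReal.ofReal (‖P x‖ ^ 2) • Measure.dirac (-b) + freeMeasure (V₁ x) + freeMeasure (V₂ x)) := by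
  have hf : IsFiniteMeasure (ENNReal.ofReal (‖P x‖ ^ 2) • Measure.dirac (-b : ℝ)) :=
    Measure.smul_finite _ ENNReal.ofReal_ne_top
  refine ⟨inferInstance, fun z hz => ?_⟩
  have hz1 : z ∉ Complex.ofReal '' Ici 0 := by
    rintro ⟨t, -, rfl⟩
    exact hz (Complex.ofReal_im t)
  have hz2 : z ≠ ((-b : ℝ) : ℂ) := by
    rintro rfl
    exact hz (Complex.ofReal_im _)
  refine ⟨_, D.isResolventAt_of_notMem hz1 hz2, ?_⟩
  have i0 := integrable_inv_ofReal_sub (ENNReal.ofReal (‖P x‖ ^ 2) • Measure.dirac (-b : ℝ)) hz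
  have i1 := integrable_inv_ofReal_sub (freeMeasure (V₁ x)) hz
  have i2 := integrable_inv_ofReal_sub (freeMeasure (V₂ x)) hz
  rw [integral_add_measure (i0.add_measure i1) i2, integral_add_measure i0 i1,
    integral_smul_measure, integral_dirac, ← inner_fmul_rsym hz1, ← inner_fmul_rsym hz1]
  rw [add_apply, acRes, add_apply, inner_add_right, inner_add_right, inner_star_mul,
    inner_star_mul, smul_apply, inner_smul_right, D.inner_P, ENNReal.toReal_ofReal (sq_nonneg _),
    Complex.real_smul]
  ring

theorem norm_sq_eq (x : L2star) : ‖x‖ ^ 2 = ‖P x‖ ^ 2 + ‖V₁ x‖ ^ 2 + ‖V₂ x‖ ^ 2 := by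
  have h1 := congrArg (fun S : L2star →L[ℂ] L2star => inner ℂ x (S x)) D.sum_eq
  have h2 : ∀ y : L2star, inner ℂ y y = ((‖y‖ ^ 2 : ℝ) : ℂ) := fun y =>
    (inner_self_eq_norm_sq_to_K (𝕜 := ℂ) y).trans (by norm_cast)
  have h3 : ∀ V : L2star →L[ℂ] L2star, inner ℂ x ((star V * V) x) = ((‖V x‖ ^ 2 : ℝ) : ℂ) :=
    fun V => by
      have e : inner ℂ x (V.adjoint (V x)) = inner ℂ (V x) (V x) :=
        ContinuousLinearMap.adjoint_inner_right V x (V x)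
      exact e.trans (h2 _)
  simp only [add_apply, inner_add_right, D.inner_P, h3] at h1
  have h4 := h1.trans (h2 x)
  exact_mod_cast h4.symm

theorem P_eq_zero_of_dirac {x : L2star} {μ : Measure ℝ} (h : IsSpectralMeasure T x μ)
    (h0 : μ {(-b : ℝ)} = 0) : P x = 0 := by
  rw [h.unique (D.isSpectralMeasure x)] at h0
  simp only [Measure.add_apply, Measure.smul_apply, add_eq_zero] at h0
  have := h0.1.1
  simpa using this

/-- The spectral measure of x has the mass ‖P x‖² at −b, which must vanish under absolute
continuity; when it vanishes only free spectral measures remain. -/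
theorem acSubspace_eq : acSubspace T = LinearMap.ker P.toLinearMap := by
  refine le_antisymm ?_ ?_
  · refine Submodule.topologicalClosure_minimal _ (Submodule.span_le.2 ?_) P.isClosed_ker
    rintro x ⟨μ, h1, h2⟩
    exact D.P_eq_zero_of_dirac h1 (h2 (measure_singleton _))
  · intro x hx
    refine Submodule.le_topologicalClosure _ (Submodule.subset_span ?_)
    have hx : P x = 0 := hx
    refine ⟨_, D.isSpectralMeasure x, ?_⟩
    rw [hx, norm_zero, zero_pow two_ne_zero, ENNReal.ofReal_zero, zero_smul, zero_add]
    exact (freeMeasure_absolutelyContinuous _).add_left (freeMeasure_absolutelyContinuous _)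

/-- Without an atom the spectral measure is absolutely continuous. Being singular as well it is
zero, and its total mass is ‖x‖². -/
theorem scSubspace_eq : scSubspace T = ⊥ := by
  have h : {x : L2star | ∃ μ : Measure ℝ, IsSpectralMeasure T x μ ∧
      (∀ t, μ {t} = 0) ∧ μ ⟂ₘ (volume : Measure ℝ)} ⊆ ((⊥ : Submodule ℂ L2star) : Set L2star) := by
    rintro x ⟨μ, h1, h2, h3⟩
    have hP := D.P_eq_zero_of_dirac h1 (h2 _)
    have h4 := h1.unique (D.isSpectralMeasure x)
    rw [hP, norm_zero, zero_pow two_ne_zero, ENNReal.ofReal_zero, zero_smul, zero_add] at h4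
    have h5 : μ ≪ volume := by
      rw [h4]
      exact (freeMeasure_absolutelyContinuous _).add_left (freeMeasure_absolutelyContinuous _)
    have h6 : μ = 0 := Measure.eq_zero_of_absolutelyContinuous_of_mutuallySingular h5 h3
    rw [h6] at h4
    have h7 := congrArg (fun ν : Measure ℝ => ν univ) h4
    simp only [Measure.coe_zero, Pi.zero_apply, Measure.add_apply, freeMeasure_univ] at h7
    obtain ⟨h8, h9⟩ := add_eq_zero.1 h7.symm
    rw [ENNReal.ofReal_eq_zero] at h8 h9
    have h10 := D.norm_sq_eq x
    rw [hP, norm_zero] at h10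
    show x = 0
    rw [← norm_eq_zero]
    nlinarith [sq_nonneg ‖x‖]
  rw [scSubspace, Submodule.span_eq_bot.2 h]
  refine le_antisymm ?_ bot_le
  exact Submodule.topologicalClosure_minimal _ le_rfl isClosed_singleton

theorem mem_eigenspace {z : ℂ} {x : L2star} (hx : x ∈ eigenspace T z) :
    x = (z + w) • R x := by
  obtain ⟨h, h'⟩ := hx
  have h1 := D.isResolventAt.exists_eq ⟨x, h⟩
  rw [h'] at h1
  simp only at h1
  rw [← map_smul]
  convert h1 using 2
  push_cast
  module

/-- V₁x and V₂x would be eigenvectors of the free resolvent, hence vanish. -/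
theorem eq_P_of_mem_eigenspace {z : ℂ} {x : L2star} (hx : x ∈ eigenspace T z) : P x = x := by
  have h1 := D.mem_eigenspace hx
  have h2 : ∀ {V : L2star →L[ℂ] L2star}, V * R = freeRes w hw * V → V x = 0 := fun {V} hV => by
    refine eq_zero_of_smul_freeRes hw (a := z + w) ?_
    have h3 : V (R x) = freeRes w hw (V x) := congrArg (fun S : L2star →L[ℂ] L2star => S x) hV
    nth_rw 1 [h1]
    rw [map_smul, h3]
  have h4 := congrArg (fun S : L2star →L[ℂ] L2star => S x) D.sum_eq
  simp only [add_apply, mul_apply_eq_comp, h2 D.V₁_mul_R,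
    h2 D.V₂_mul_R, map_zero, add_zero] at h4
  exact h4

theorem eigenspace_eq : eigenspace T ((-b : ℝ) : ℂ) = LinearMap.range P.toLinearMap := by
  have h2 : ((w - b : ℝ) : ℂ) ≠ 0 := Complex.ofReal_ne_zero.2 (sub_pos.2 D.lt).ne'
  refine le_antisymm (fun x hx => ⟨x, D.eq_P_of_mem_eigenspace hx⟩) ?_
  rintro _ ⟨x, rfl⟩
  have h1 : R (P x) = (((w - b)⁻¹ : ℝ) : ℂ) • P x :=
    congrArg (fun S : L2star →L[ℂ] L2star => S x) D.R_mul_P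
  have h3 : P x = R (((w - b : ℝ) : ℂ) • P x) := by
    rw [map_smul, h1, smul_smul, Complex.ofReal_inv, mul_inv_cancel₀ h2, one_smul]
  have h4 := D.isResolventAt.apply _ (D.isResolventAt.mem_domain (((w - b : ℝ) : ℂ) • P x))
  simp only [← h3] at h4
  refine ⟨h3 ▸ D.isResolventAt.mem_domain _, ?_⟩
  refine h4.trans ?_
  simp only [ContinuousLinearMap.coe_coe]
  push_cast
  module

theorem eigenspace_eq_bot {z : ℂ} (hz : z ≠ ((-b : ℝ) : ℂ)) : eigenspace T z = ⊥ := by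
  have h2 : ((w - b : ℝ) : ℂ) ≠ 0 := Complex.ofReal_ne_zero.2 (sub_pos.2 D.lt).ne'
  rw [Submodule.eq_bot_iff]
  intro x hx
  by_contra hne
  have h1 := D.mem_eigenspace hx
  have h3 : R (P x) = (((w - b)⁻¹ : ℝ) : ℂ) • P x :=
    congrArg (fun S : L2star →L[ℂ] L2star => S x) D.R_mul_P
  rw [D.eq_P_of_mem_eigenspace hx] at h3
  rw [h3, smul_smul] at h1
  have h4 : (1 - (z + w) * (((w - b)⁻¹ : ℝ) : ℂ)) • x = 0 := by
    rw [sub_smul, one_smul, ← h1, sub_self]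
  rw [smul_eq_zero_iff_left hne, sub_eq_zero, Complex.ofReal_inv, eq_mul_inv_iff_mul_eq₀ h2] at h4
  refine hz ?_
  push_cast at h4 ⊢
  linear_combination -h4

theorem ofReal_mem_spec {t : ℝ} (ht : 0 ≤ t) : (t : ℂ) ∈ spec T := by
  refine mem_spec_of_approx fun ε hε => ?_
  obtain ⟨x, hx, -, h1, h2⟩ := D.weyl t ht ε hε
  exact ⟨⟨x, h1⟩, hx, h2⟩

theorem spec_eq (hP : P ≠ 0) : spec T = insert ((-b : ℝ) : ℂ) (Complex.ofReal '' Ici 0) := by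
  ext z
  constructor
  · intro h
    by_contra h'
    rw [mem_insert_iff, not_or] at h'
    exact h ⟨_, D.isResolventAt_of_notMem h'.2 h'.1⟩
  · rintro (rfl | ⟨t, ht, rfl⟩)
    · rintro ⟨S, hS⟩
      refine hP (ContinuousLinearMap.ext fun x => ?_)
      have h1 : P x ∈ eigenspace T ((-b : ℝ) : ℂ) := by
        rw [D.eigenspace_eq]
        exact ⟨x, rfl⟩
      obtain ⟨h2, h3⟩ := h1
      have h4 := hS.2 ⟨P x, h2⟩
      simp only at h4
      rw [h3, sub_self, map_zero] at h4
      exact h4.symm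
    · exact D.ofReal_mem_spec ht

theorem pointSpectrum_eq (hP : P ≠ 0) : pointSpectrum T = {((-b : ℝ) : ℂ)} := by
  ext z
  rw [mem_singleton_iff]
  constructor
  · intro h
    by_contra h'
    exact h (D.eigenspace_eq_bot h')
  · rintro rfl
    show eigenspace T _ ≠ ⊥
    rw [D.eigenspace_eq]
    intro h
    exact hP (ContinuousLinearMap.ext fun x => LinearMap.congr_fun (LinearMap.range_eq_bot.1 h) x)

theorem essentialSpectrum_eq (hP : P ≠ 0) (hfin : FiniteDimensional ℂ (LinearMap.range P.toLinearMap)) :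
    essentialSpectrum T = Complex.ofReal '' Ici 0 := by
  have hb := D.pos
  ext z
  constructor
  · rintro ⟨h1, h2⟩
    rw [D.spec_eq hP] at h1
    rcases h1 with rfl | h1
    -- The open ball of radius b about −b misses [0, ∞), so −b is isolated in the spectrum.
    · refine absurd ⟨?_, ?_, b, hb, ?_⟩ h2
      · have : ((-b : ℝ) : ℂ) ∈ pointSpectrum T := by rw [D.pointSpectrum_eq hP]; rfl
        exact this
      · rw [D.eigenspace_eq]
        exact hfin
      · rw [D.spec_eq hP]
        ext y
        simp only [mem_inter_iff, mem_insert_iff, mem_image, Metric.mem_ball, mem_singleton_iff]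
        constructor
        · rintro ⟨rfl | ⟨t, ht, rfl⟩, h4⟩
          · rfl
          · exfalso
            rw [Complex.dist_of_im_eq (by simp), Complex.ofReal_re, Complex.ofReal_re,
              Real.dist_eq, abs_lt] at h4
            have ht : (0 : ℝ) ≤ t := ht
            linarith [h4.2]
        · rintro rfl
          exact ⟨Or.inl rfl, by rwa [dist_self]⟩
    · exact h1
  · rintro ⟨t, ht, rfl⟩
    refine ⟨D.ofReal_mem_spec ht, fun h => h.1 (D.eigenspace_eq_bot ?_)⟩
    rw [ne_eq, Complex.ofReal_inj]
    have ht : (0 : ℝ) ≤ t := ht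
    linarith

omit D in
theorem scSpectrum_eq_of_bot (h : scSubspace T = ⊥) : scSpectrum T = ∅ := by
  rw [scSpectrum, h]
  ext z
  simp only [mem_empty_iff_false, iff_false]
  intro hz
  -- On the zero space every equation holds, so 0 is a resolvent at every z.
  refine hz ⟨0, fun x => ?_, fun x => ?_⟩
  · exact ⟨by simp, Subsingleton.elim _ _⟩
  · exact Subsingleton.elim _ _

theorem P_apply_eq_zero {x : T.domain} (hx : P (x : L2star) = 0) : P (T x) = 0 := by
  have e1 := D.isResolventAt.exists_eq x
  have e2 := congrArg (fun S : L2star →L[ℂ] L2star =>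
    S (T x - ((-w : ℝ) : ℂ) • (x : L2star))) D.P_mul_R
  simp only [mul_apply_eq_comp, smul_apply, ← e1, hx] at e2
  have e3 := (smul_eq_zero_iff_right (Complex.ofReal_ne_zero.2
    (inv_ne_zero (sub_pos.2 D.lt).ne'))).1 e2.symm
  rwa [map_sub, map_smul, hx, smul_zero, sub_zero] at e3

/-- The absolutely continuous subspace is the kernel of P. `acRes` maps into this kernel and inverts
T − z on it, while the Weyl vectors lie there. -/
theorem acSpectrum_eq : acSpectrum T = Complex.ofReal '' Ici 0 := by
  have hmem : ∀ {x : L2star}, x ∈ acSubspace T ↔ P x = 0 := fun {x} => by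
    rw [D.acSubspace_eq]
    rfl
  ext z
  constructor
  · intro h
    by_contra hz
    refine notMem_spec_partOn (acRes V₁ V₂ z hz) (fun x _ => hmem.2 ?_) (fun x hx => ?_)
      (fun x hx hTx => ?_) h
    · exact congrArg (fun S : L2star →L[ℂ] L2star => S x) (D.P_mul_acRes hz)
    · rw [hmem] at hx
      have h1 : acRes V₁ V₂ z hz x = R (x + (z + w) • acRes V₁ V₂ z hz x) := by
        have h2 := congrArg (fun S : L2star →L[ℂ] L2star => S x) (D.acRes_eq_right hz)
        simp only [add_apply, sub_apply, smul_apply, hx, smul_zero, sub_zero, mul_apply_eq_comp]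
          at h2
        rw [map_add, map_smul]
        exact h2
      have h3 := D.isResolventAt.apply _
        (D.isResolventAt.mem_domain (x + (z + w) • acRes V₁ V₂ z hz x))
      simp only [← h1] at h3
      refine ⟨h1 ▸ D.isResolventAt.mem_domain _, h3.trans ?_⟩
      push_cast
      module
    · rw [hmem] at hx hTx
      have h1 := D.isResolventAt.exists_eq x
      set u := T x - ((-w : ℝ) : ℂ) • (x : L2star) with hu
      have hPu : P u = 0 := by rw [hu, map_sub, map_smul, hx, hTx, smul_zero, sub_zero]
      have h2 := congrArg (fun S : L2star →L[ℂ] L2star => S u) (D.acRes_eq_left hz)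
      simp only [add_apply, sub_apply, smul_apply, hPu, smul_zero, sub_zero, mul_apply_eq_comp,
        ← h1] at h2
      have h3 : T x - z • (x : L2star) = u - (z + w) • (x : L2star) := by
        rw [hu]
        push_cast
        module
      rw [h3, map_sub, map_smul, h2, add_sub_cancel_right]
  · rintro ⟨t, ht, rfl⟩
    refine mem_spec_partOn fun ε hε => ?_
    obtain ⟨x, hx, hPx, h1, h2⟩ := D.weyl t ht ε hε
    exact ⟨⟨x, h1⟩, hx, hmem.2 hPx, hmem.2 (D.P_apply_eq_zero (x := ⟨x, h1⟩) hPx), h2⟩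

theorem scSpectrum_eq : scSpectrum T = ∅ := scSpectrum_eq_of_bot D.scSubspace_eq

end Diagonalizes

/-! ### Partial isometries from Gram matrices -/

theorem inner_linearCombination {E ι : Type*} [NormedAddCommGroup E] [InnerProductSpace ℂ E]
    (x : ι → E) (c d : ι →₀ ℂ) :
    inner ℂ (Finsupp.linearCombination ℂ x c) (Finsupp.linearCombination ℂ x d) =
      d.sum fun j b => b * c.sum fun i a => (starRingEnd ℂ) a * inner ℂ (x i) (x j) := by
  simp only [Finsupp.linearCombination_apply, Finsupp.sum, sum_inner, inner_sum, inner_smul_left,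
    inner_smul_right]

section PartialIsometry

variable {E F ι : Type*} [NormedAddCommGroup E] [InnerProductSpace ℂ E] [CompleteSpace E]
  [NormedAddCommGroup F] [InnerProductSpace ℂ F] [CompleteSpace F]

/-- Equal Gram matrices make ∑ cᵢxᵢ ↦ ∑ cᵢyᵢ well defined and isometric. It extends to the closed
span by density and to the whole space by 0 on the orthogonal complement. -/
theorem exists_partialIsometry (x : ι → E) (y : ι → F)
    (h : ∀ i j, inner ℂ (x i) (x j) = inner ℂ (y i) (y j)) :
    ∃ V : E →L[ℂ] F, (∀ i, V (x i) = y i) ∧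
      (∀ u, (∀ i, inner ℂ (x i) u = 0) → V u = 0) ∧
      ∀ u ∈ (Submodule.span ℂ (range x)).topologicalClosure, V.adjoint (V u) = u := by
  set X := Finsupp.linearCombination ℂ x with hX
  set Y := Finsupp.linearCombination ℂ y with hY
  set K : Submodule ℂ E := (Submodule.span ℂ (range x)).topologicalClosure with hK
  have hKc : IsClosed (K : Set E) := Submodule.isClosed_topologicalClosure _
  have : CompleteSpace K := hKc.completeSpace_coe
  have hXK : ∀ c, X c ∈ K := fun c => Submodule.le_topologicalClosure _ (by
    rw [← Finsupp.range_linearCombination]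
    exact ⟨c, rfl⟩)
  have hnorm : ∀ c, ‖Y c‖ = ‖X c‖ := fun c => by
    have h1 : inner ℂ (X c) (X c) = inner ℂ (Y c) (Y c) := by
      rw [hX, hY, inner_linearCombination, inner_linearCombination]
      simp only [h]
    rw [← sq_eq_sq₀ (norm_nonneg _) (norm_nonneg _), ← @inner_self_eq_norm_sq ℂ,
      ← @inner_self_eq_norm_sq ℂ, h1]
  set e : (ι →₀ ℂ) →ₗ[ℂ] K := X.codRestrict K hXK with he
  have hd : DenseRange e := by
    intro u
    have h1 : (u : E) ∈ closure (Submodule.span ℂ (range x) : Set E) := u.2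
    rw [Metric.mem_closure_iff] at h1 ⊢
    intro ε hε
    obtain ⟨v, hv, hv'⟩ := h1 ε hε
    rw [← Finsupp.range_linearCombination] at hv
    obtain ⟨c, rfl⟩ := hv
    exact ⟨e c, ⟨c, rfl⟩, hv'⟩
  have hb : ∀ c, ‖Y c‖ ≤ 1 * ‖e c‖ := fun c => by
    rw [one_mul, hnorm]
    rfl
  set V' : K →L[ℂ] F := Y.extendOfNorm e with hV'
  have hV'e : ∀ c, V' (e c) = Y c := fun c => LinearMap.extendOfNorm_eq hd ⟨1, hb⟩ c
  have hV'n : ∀ u, ‖V' u‖ = ‖u‖ := fun u => by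
    refine hd.induction_on (p := fun u => ‖V' u‖ = ‖u‖) u
      (isClosed_eq (by fun_prop) (by fun_prop)) fun c => ?_
    rw [hV'e, hnorm]
    rfl
  let L : K →ₗᵢ[ℂ] F := ⟨V'.toLinearMap, hV'n⟩
  have hL : ∀ u v, inner ℂ (V' u) (V' v) = inner ℂ u v := fun u v => L.inner_map_map u v
  have hproj : ∀ u : K, K.orthogonalProjectionOnto (u : E) = u := fun u => by simp
  refine ⟨V' ∘L K.orthogonalProjectionOnto, fun i => ?_, fun u hu => ?_, fun u hu => ?_⟩
  · have h1 : X (Finsupp.single i 1) = x i := by simp [hX]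
    have h2 : Y (Finsupp.single i 1) = y i := by simp [hY]
    rw [ContinuousLinearMap.comp_apply, ← h1, ← h2, ← hV'e]
    exact congrArg V' (hproj (e (Finsupp.single i 1)))
  · have h1 : u ∈ Kᗮ := by
      rw [hK, Submodule.orthogonal_closure, Submodule.mem_orthogonal]
      intro v hv
      induction hv using Submodule.span_induction with
      | mem v hv =>
        obtain ⟨i, rfl⟩ := hv
        exact hu i
      | zero => exact inner_zero_left _
      | add v v' _ _ h1 h2 => rw [inner_add_left, h1, h2, add_zero]
      | smul a v _ h1 => rw [inner_smul_left, h1, mul_zero]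
    rw [ContinuousLinearMap.comp_apply, Submodule.orthogonalProjectionOnto_apply_of_mem_orthogonal h1,
      map_zero]
  · refine ext_inner_left ℂ fun v => ?_
    rw [ContinuousLinearMap.adjoint_inner_right, ContinuousLinearMap.comp_apply,
      ContinuousLinearMap.comp_apply, hL, hproj ⟨u, hu⟩]
    exact Submodule.inner_orthogonalProjectionOnto_eq_of_mem_right ⟨u, hu⟩ v

/-- Diagonalization of a self-adjoint operator `R` off the range of a projection `P`, from a family
of vectors on which the action of `R` is known. -/
theorem exists_diagonalization (x y : ι → E)
    (h : ∀ i j, inner ℂ (x i) (x j) = inner ℂ (y i) (y j)) {R f P : E →L[ℂ] E}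
    (hR : IsSelfAdjoint R) (hP : IsSelfAdjoint P) (hPP : P * P = P) (hRP : P * R = R * P)
    (hf : IsSelfAdjoint f) (hPx : ∀ i, P (x i) = 0)
    (hRx : ∀ i, R (x i) ∈ (Submodule.span ℂ (range x)).topologicalClosure)
    (hV : ∀ V : E →L[ℂ] E, (∀ i, V (x i) = y i) → ∀ i, V (R (x i)) = f (y i))
    (hfree : ∀ u, P u = 0 → (∀ i, inner ℂ (x i) u = 0) → R u = f u) :
    ∃ V₁ V₂ : E →L[ℂ] E, P + star V₁ * V₁ + star V₂ * V₂ = 1 ∧ V₁ * P = 0 ∧ V₂ * P = 0 ∧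
      V₁ * R = f * V₁ ∧ V₂ * R = f * V₂ := by
  obtain ⟨V, h1, h2, h3⟩ := exists_partialIsometry x y h
  have hRs := ContinuousLinearMap.isSelfAdjoint_iff_isSymmetric.1 hR
  have hPs := ContinuousLinearMap.isSelfAdjoint_iff_isSymmetric.1 hP
  set K : Submodule ℂ E := (Submodule.span ℂ (range x)).topologicalClosure with hK
  have hKc : IsClosed (K : Set E) := Submodule.isClosed_topologicalClosure _
  have : CompleteSpace K := hKc.completeSpace_coe
  have hxK : ∀ i, x i ∈ K := fun i =>
    Submodule.le_topologicalClosure _ (Submodule.subset_span ⟨i, rfl⟩)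
  have hind : ∀ {A B : E →L[ℂ] E}, (∀ i, A (x i) = B (x i)) → ∀ u ∈ K, A u = B u := by
    intro A B hAB u hu
    have h4 : K ≤ LinearMap.eqLocus A.toLinearMap B.toLinearMap := by
      refine Submodule.topologicalClosure_minimal _ (Submodule.span_le.2 ?_)
        (isClosed_eq A.continuous B.continuous)
      rintro _ ⟨i, rfl⟩
      exact hAB i
    exact h4 hu
  have hRK : ∀ u ∈ K, R u ∈ K := by
    intro u hu
    have h4 : K ≤ K.comap R.toLinearMap := by
      refine Submodule.topologicalClosure_minimal _ (Submodule.span_le.2 ?_)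
        (hKc.preimage R.continuous)
      rintro _ ⟨i, rfl⟩
      exact hRx i
    exact h4 hu
  have hPK : ∀ u ∈ K, P u = 0 := fun u hu => hind (A := P) (B := 0) hPx u hu
  have hdec : ∀ u : E, ∃ v ∈ K, ∃ v' ∈ Kᗮ, u = v + v' := fun u =>
    ⟨K.starProjection u, K.starProjection_apply_mem u, u - K.starProjection u,
      K.sub_starProjection_mem_orthogonal u, by abel⟩
  have hperp : ∀ u ∈ Kᗮ, ∀ i, inner ℂ (x i) u = 0 := fun u hu i =>
    (Submodule.mem_orthogonal _ _).1 hu _ (hxK i)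
  have hRperp : ∀ u ∈ Kᗮ, R u ∈ Kᗮ := fun u hu => by
    rw [Submodule.mem_orthogonal] at hu ⊢
    intro v hv
    have h4 : inner ℂ (R v) u = inner ℂ v (R u) := hRs v u
    rw [← h4]
    exact hu _ (hRK v hv)
  have hVP : V * P = 0 := by
    ext u
    refine h2 _ fun i => ?_
    have h4 : inner ℂ (P (x i)) u = inner ℂ (x i) (P u) := hPs (x i) u
    exact h4.symm.trans (by rw [hPx, inner_zero_left])
  have hVR : V * R = f * V := by
    ext u
    obtain ⟨v, hv, v', hv', rfl⟩ := hdec u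
    have h4 : V (R v) = f (V v) := hind (A := V * R) (B := f * V)
      (fun i => by
        rw [mul_apply_eq_comp, mul_apply_eq_comp, h1]
        exact hV V h1 i) v hv
    have h5 : V v' = 0 := h2 _ (hperp v' hv')
    have h6 : V (R v') = 0 := h2 _ (hperp _ (hRperp v' hv'))
    rw [mul_apply_eq_comp, mul_apply_eq_comp, map_add, map_add, map_add, h4, h5, h6, add_zero,
      add_zero]
  have hPV : P * star V = 0 := by
    have := congrArg star hVP
    rwa [star_mul, hP.star_eq, star_zero] at this
  have hRV : R * star V = star V * f := by
    have := congrArg star hVR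
    rwa [star_mul, star_mul, hR.star_eq, hf.star_eq] at this
  have hVV : star V * V * (star V * V) = star V * V := by
    ext u
    obtain ⟨v, hv, v', hv', rfl⟩ := hdec u
    have h5 : V v' = 0 := h2 _ (hperp v' hv')
    have h6 : (star V) (V v) = v := h3 v hv
    simp only [mul_apply_eq_comp, map_add, h5, map_zero, add_zero, h6]
  have hPW : P * (star V * V) = 0 := by rw [← mul_assoc, hPV, zero_mul]
  have hWP : star V * V * P = 0 := by rw [mul_assoc, hVP, mul_zero]
  have hWR : star V * V * R = R * (star V * V) := by
    rw [mul_assoc, hVR, ← mul_assoc, ← hRV, mul_assoc]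
  set W := star V * V with hW
  have hWs : star W = W := by rw [hW, star_mul, star_star]
  -- The projection onto what neither the bound states nor the xᵢ reach; it serves as the second
  -- intertwiner.
  set U : E →L[ℂ] E := 1 - P - W with hU
  have hUs : star U = U := by rw [hU, star_sub, star_sub, star_one, hP.star_eq, hWs]
  have hUP : U * P = 0 := by rw [hU, sub_mul, sub_mul, one_mul, hPP, hWP, sub_self, sub_zero]
  have hUW : U * W = 0 := by rw [hU, sub_mul, sub_mul, one_mul, hPW, hVV, sub_zero, sub_self]
  have hUU : U * U = U := by
    nth_rw 2 [hU]
    rw [mul_sub, mul_sub, mul_one, hUP, hUW, sub_zero, sub_zero]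
  have hPU : P * U = 0 := by rw [hU, mul_sub, mul_sub, mul_one, hPP, hPW, sub_self, sub_zero]
  have hVU : V * U = 0 := by
    ext u
    have h4 : W (U u) = 0 := congrArg (fun S : E →L[ℂ] E => S u)
      (show W * U = 0 by rw [hU, mul_sub, mul_sub, mul_one, hWP, hVV, sub_zero, sub_self])
    have h5 : inner ℂ (U u) ((star V) (V (U u))) = inner ℂ (V (U u)) (V (U u)) :=
      ContinuousLinearMap.adjoint_inner_right V _ _
    have h6 : (star V) (V (U u)) = 0 := h4
    rw [h6, inner_zero_right] at h5
    exact inner_self_eq_zero.1 h5.symm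
  refine ⟨V, U, ?_, hVP, hUP, hVR, ?_⟩
  · rw [hUs, hUU, hU]
    abel
  -- U commutes with R, and its range is killed by P and orthogonal to all xᵢ, where R and f agree
  -- by hypothesis.
  · have h4 : U * R = R * U := by
      rw [hU, sub_mul, sub_mul, mul_sub, mul_sub, one_mul, mul_one, hRP, hWR]
    rw [h4]
    ext u
    refine hfree (U u) (congrArg (fun S : E →L[ℂ] E => S u) hPU) fun i => ?_
    have h5 : inner ℂ ((star V) (V (x i))) (U u) = inner ℂ (V (x i)) (V (U u)) :=
      ContinuousLinearMap.adjoint_inner_left V _ _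
    have h6 : (star V) (V (x i)) = x i := h3 _ (hxK i)
    have h7 : V (U u) = 0 := congrArg (fun S : E →L[ℂ] E => S u) hVU
    rw [h6, h7, inner_zero_right] at h5
    exact h5

end PartialIsometry

/-! ### Rank perturbations with a Cauchy kernel -/

section CauchyKernel

variable {E F : Type*} [NormedAddCommGroup E] [InnerProductSpace ℂ E] [CompleteSpace E]
  [NormedAddCommGroup F] [InnerProductSpace ℂ F] [CompleteSpace F] {G : Ioi (0 : ℝ) → F →L[ℂ] E}

/-- The Gram matrix of the family `G` is the Cauchy kernel. -/
def CauchyGram (G : Ioi (0 : ℝ) → F →L[ℂ] E) : Prop := ∀ (s t : Ioi (0 : ℝ)) (Q Q' : F),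
  inner ℂ (G s Q) (G t Q') = (((6 * Real.pi * ((s : ℝ) + t))⁻¹ : ℝ) : ℂ) * inner ℂ Q Q'

theorem CauchyGram.adjoint_apply (hG : CauchyGram G) (s t : Ioi (0 : ℝ)) (Q : F) :
    (G s).adjoint (G t Q) = (((6 * Real.pi * ((s : ℝ) + t))⁻¹ : ℝ) : ℂ) • Q := by
  refine ext_inner_left ℂ fun Q' => ?_
  rw [ContinuousLinearMap.adjoint_inner_right, hG, inner_smul_right]

omit [CompleteSpace E] [CompleteSpace F] in
theorem CauchyGram.norm_sub_sq (hG : CauchyGram G) (s t : Ioi (0 : ℝ)) (Q : F) :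
    ‖G s Q - G t Q‖ ^ 2 = ((6 * Real.pi * ((s : ℝ) + s))⁻¹ + (6 * Real.pi * ((t : ℝ) + t))⁻¹
      - 2 * (6 * Real.pi * ((s : ℝ) + t))⁻¹) * ‖Q‖ ^ 2 := by
  have h := inner_self_eq_norm_sq_to_K (𝕜 := ℂ) (G s Q - G t Q)
  rw [inner_sub_left, inner_sub_right, inner_sub_right, hG, hG, hG, hG,
    inner_self_eq_norm_sq_to_K] at h
  have h2 : (((‖G s Q - G t Q‖ ^ 2 : ℝ)) : ℂ) =
      ((((6 * Real.pi * ((s : ℝ) + s))⁻¹ + (6 * Real.pi * ((t : ℝ) + t))⁻¹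
      - 2 * (6 * Real.pi * ((s : ℝ) + t))⁻¹) * ‖Q‖ ^ 2 : ℝ) : ℂ) := by
    rw [Complex.ofReal_pow]
    refine h.symm.trans ?_
    rw [add_comm (t : ℝ) s]
    simp only [Complex.coe_algebraMap]
    push_cast
    ring
  exact_mod_cast h2

-- Continuity in the rate follows from the Gram matrix alone. It is needed to reach the rate Ω,
-- where the identities below would divide by Ω² − s² = 0.
omit [CompleteSpace E] [CompleteSpace F] in
theorem CauchyGram.tendsto (hG : CauchyGram G) (t : Ioi (0 : ℝ)) (Q : F) :
    Tendsto (fun s => G s Q) (𝓝 t) (𝓝 (G t Q)) := by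
  rw [tendsto_iff_norm_sub_tendsto_zero]
  have ht : (0 : ℝ) < t := t.2
  have h1 : Tendsto (fun s : Ioi (0 : ℝ) => ‖G s Q - G t Q‖ ^ 2) (𝓝 t) (𝓝 0) := by
    simp only [hG.norm_sub_sq]
    have h2 : ContinuousAt (fun s : Ioi (0 : ℝ) => ((6 * Real.pi * ((s : ℝ) + s))⁻¹ +
        (6 * Real.pi * ((t : ℝ) + t))⁻¹ - 2 * (6 * Real.pi * ((s : ℝ) + t))⁻¹) * ‖Q‖ ^ 2) t := by
      have := Real.pi_pos
      have h3 : 6 * Real.pi * ((t : ℝ) + t) ≠ 0 := by positivity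
      fun_prop (disch := assumption)
    refine h2.tendsto.trans (le_of_eq ?_)
    congr 1
    ring
  have h2 := h1.sqrt
  simpa only [Real.sqrt_sq (norm_nonneg _), Real.sqrt_zero] using h2

/-- The perturbation of `f` by the charges. -/
def cauchyRes (G : Ioi (0 : ℝ) → F →L[ℂ] E) (f : E →L[ℂ] E) (a Ω : Ioi (0 : ℝ)) : E →L[ℂ] E :=
  f + ((((Ω - a : ℝ) / (6 * Real.pi))⁻¹ : ℝ) : ℂ) • (G Ω ∘L (G Ω).adjoint)

/-- The projection onto the bound states. -/
def boundProj (G : Ioi (0 : ℝ) → F →L[ℂ] E) (a : Ioi (0 : ℝ)) : E →L[ℂ] E :=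
  ((12 * Real.pi * a : ℝ) : ℂ) • (G a ∘L (G a).adjoint)

theorem isSelfAdjoint_real_smul_comp_adjoint (r : ℝ) (S : F →L[ℂ] E) :
    IsSelfAdjoint ((r : ℂ) • (S ∘L S.adjoint)) := by
  refine IsSelfAdjoint.smul (Complex.conj_ofReal r) ?_
  rw [ContinuousLinearMap.isSelfAdjoint_iff', ContinuousLinearMap.adjoint_comp,
    ContinuousLinearMap.adjoint_adjoint]

variable (hG : CauchyGram G) {a Ω : Ioi (0 : ℝ)} {f q : E →L[ℂ] E}

theorem boundProj_apply (u : E) :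
    boundProj G a u = ((12 * Real.pi * a : ℝ) : ℂ) • G a ((G a).adjoint u) := rfl

theorem cauchyRes_apply (u : E) : cauchyRes G f a Ω u =
    f u + ((((Ω - a : ℝ) / (6 * Real.pi))⁻¹ : ℝ) : ℂ) • G Ω ((G Ω).adjoint u) := rfl

include hG

theorem boundProj_G (s : Ioi (0 : ℝ)) (Q : F) :
    boundProj G a (G s Q) = ((2 * a / (a + s) : ℝ) : ℂ) • G a Q := by
  have ha : (0 : ℝ) < a := a.2
  have hs : (0 : ℝ) < s := s.2
  have := Real.pi_pos
  rw [boundProj_apply, hG.adjoint_apply, map_smul, smul_smul, ← Complex.ofReal_mul]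
  congr 2
  field_simp
  norm_num

/-- The normalization 12πa inverts the Gram constant 1/(6π(a + a)). -/
theorem boundProj_G_self (Q : F) : boundProj G a (G a Q) = G a Q := by
  have ha : (a : ℝ) ≠ 0 := (ne_of_gt a.2)
  rw [boundProj_G hG, show (2 * a / (a + a) : ℝ) = 1 by field_simp; norm_num, Complex.ofReal_one,
    one_smul]

theorem boundProj_mul_self : boundProj G a * boundProj G a = boundProj G a := by
  ext u
  rw [mul_apply_eq_comp, boundProj_apply u, map_smul, boundProj_G_self hG]

theorem range_boundProj :
    LinearMap.range (boundProj G a).toLinearMap = LinearMap.range (G a).toLinearMap := by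
  ext u
  constructor
  · rintro ⟨v, rfl⟩
    exact ⟨((12 * Real.pi * a : ℝ) : ℂ) • (G a).adjoint v, map_smul _ _ _⟩
  · rintro ⟨Q, rfl⟩
    exact ⟨G a Q, boundProj_G_self hG Q⟩

theorem adjoint_eq_zero_of_boundProj {u : E} (h : boundProj G a u = 0) : (G a).adjoint u = 0 := by
  have ha : (a : ℝ) ≠ 0 := (ne_of_gt a.2)
  have h1 := congrArg (G a).adjoint h
  rw [boundProj_apply, map_smul, hG.adjoint_apply, map_zero, smul_smul, ← Complex.ofReal_mul] at h1
  refine (smul_eq_zero.1 h1).resolve_left ?_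
  rw [Complex.ofReal_eq_zero, ← two_mul]
  have := Real.pi_ne_zero
  positivity

variable (haΩ : (a : ℝ) < Ω)
  (hfG : ∀ (s : Ioi (0 : ℝ)) (Q : F), (((Ω : ℝ) ^ 2 - (s : ℝ) ^ 2 : ℝ) : ℂ) • f (G s Q) = G s Q - G Ω Q)

include haΩ hfG

/-- The free part gives −1 in front of G_Ω and the perturbation (Ω − s)/(Ω − a). The sum (a − s)/(Ω
− a) vanishes exactly at s = a, which makes G_a Q an eigenvector. -/
theorem smul_cauchyRes_G (s : Ioi (0 : ℝ)) (Q : F) :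
    (((Ω : ℝ) ^ 2 - (s : ℝ) ^ 2 : ℝ) : ℂ) • cauchyRes G f a Ω (G s Q) =
      G s Q + (((a - s) / (Ω - a) : ℝ) : ℂ) • G Ω Q := by
  have hΩ : (0 : ℝ) < Ω := Ω.2
  have hs : (0 : ℝ) < s := s.2
  have h1 : (Ω - a : ℝ) ≠ 0 := (sub_pos.2 haΩ).ne'
  have := Real.pi_pos
  rw [cauchyRes_apply, smul_add, hfG, hG.adjoint_apply, map_smul, smul_smul, smul_smul,
    ← Complex.ofReal_mul, ← Complex.ofReal_mul]
  have h2 : ((Ω : ℝ) ^ 2 - (s : ℝ) ^ 2) * ((Ω - a : ℝ) / (6 * Real.pi))⁻¹ *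
      (6 * Real.pi * ((Ω : ℝ) + s))⁻¹ = 1 + (a - s) / (Ω - a) := by
    field_simp
    ring
  rw [h2, Complex.ofReal_add, Complex.ofReal_one]
  module

theorem cauchyRes_G_self (Q : F) : cauchyRes G f a Ω (G a Q) =
    ((((Ω : ℝ) ^ 2 - (a : ℝ) ^ 2)⁻¹ : ℝ) : ℂ) • G a Q := by
  have h1 := smul_cauchyRes_G hG haΩ hfG a Q
  have ha : (0 : ℝ) < a := a.2
  have h2 : ((Ω : ℝ) ^ 2 - (a : ℝ) ^ 2 : ℝ) ≠ 0 := by nlinarith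
  rw [sub_self, zero_div, Complex.ofReal_zero, zero_smul, add_zero] at h1
  nth_rw 2 [← h1]
  rw [smul_smul, ← Complex.ofReal_mul, inv_mul_cancel₀ h2, Complex.ofReal_one, one_smul]

theorem cauchyRes_mul_boundProj : cauchyRes G f a Ω * boundProj G a =
    ((((Ω : ℝ) ^ 2 - (a : ℝ) ^ 2)⁻¹ : ℝ) : ℂ) • boundProj G a := by
  ext u
  rw [mul_apply_eq_comp, smul_apply, boundProj_apply, map_smul, cauchyRes_G_self hG haΩ hfG,
    smul_comm]

theorem boundProj_mul_cauchyRes (hf : IsSelfAdjoint f) : boundProj G a * cauchyRes G f a Ω =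
    cauchyRes G f a Ω * boundProj G a := by
  have h1 := cauchyRes_mul_boundProj hG haΩ hfG
  have hP : star (boundProj G a) = boundProj G a :=
    isSelfAdjoint_real_smul_comp_adjoint (12 * Real.pi * a) (G a)
  have hR : star (cauchyRes G f a Ω) = cauchyRes G f a Ω :=
    hf.add (isSelfAdjoint_real_smul_comp_adjoint _ (G Ω))
  have h2 := congrArg star h1
  rw [star_mul, star_smul, hP, hR] at h2
  rw [h2, h1]
  congr 1
  exact Complex.conj_ofReal _

/-- Off the bound states the perturbed resolvent is unitarily equivalent to two pieces of the free
one. -/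
theorem exists_diagonalization_cauchyRes (hf : IsSelfAdjoint f) (hq : IsSelfAdjoint q)
    (hfq : f * q = q * f)
    (hqG : ∀ (s : Ioi (0 : ℝ)) (Q : F), (((a : ℝ) ^ 2 - (s : ℝ) ^ 2 : ℝ) : ℂ) • q (q (G s Q)) = G s Q - G a Q) :
    ∃ V₁ V₂ : E →L[ℂ] E, boundProj G a + star V₁ * V₁ + star V₂ * V₂ = 1 ∧
      V₁ * boundProj G a = 0 ∧ V₂ * boundProj G a = 0 ∧
      V₁ * cauchyRes G f a Ω = f * V₁ ∧ V₂ * cauchyRes G f a Ω = f * V₂ := by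
  have ha : (0 : ℝ) < a := a.2
  have hΩ : (0 : ℝ) < Ω := Ω.2
  have hπ := Real.pi_pos
  have hΩa : (Ω - a : ℝ) ≠ 0 := (sub_pos.2 haΩ).ne'
  have hqs := ContinuousLinearMap.isSelfAdjoint_iff_isSymmetric.1 hq
  -- x is (a + s) times the part of G_s Q orthogonal to the bound states.
  obtain ⟨x, hx⟩ : ∃ x : Ioi (0 : ℝ) × F → E, ∀ i, x i =
    ((a + i.1 : ℝ) : ℂ) • G i.1 i.2 - ((2 * a : ℝ) : ℂ) • G a i.2 := ⟨_, fun _ => rfl⟩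
  -- Since q² is the free resolvent at −a², the Gram matrix of the vectors y is again a difference
  -- of Cauchy kernels, and the factor a² − s² makes it that of the x.
  obtain ⟨y, hy⟩ : ∃ y : Ioi (0 : ℝ) × F → E, ∀ i, y i =
    (((a : ℝ) ^ 2 - (i.1 : ℝ) ^ 2 : ℝ) : ℂ) • q (G i.1 i.2) := ⟨_, fun _ => rfl⟩
  have hxx : ∀ i j, inner ℂ (x i) (x j) =
      ((((a - i.1) * (a - j.1) / (6 * Real.pi * (i.1 + j.1)) : ℝ)) : ℂ) * inner ℂ i.2 j.2 := by
    intro i j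
    have hi : (0 : ℝ) < i.1 := i.1.2
    have hj : (0 : ℝ) < j.1 := j.1.2
    simp only [hx, inner_sub_left, inner_sub_right, inner_smul_left, inner_smul_right, hG _ _ _ _,
      Complex.conj_ofReal]
    have h1 : (a - i.1) * (a - j.1) / (6 * Real.pi * (i.1 + j.1)) =
        (a + j.1) * ((a + i.1) * (6 * Real.pi * ((i.1 : ℝ) + j.1))⁻¹)
        - (a + j.1) * (2 * a * (6 * Real.pi * ((a : ℝ) + j.1))⁻¹)
        - (2 * a * ((a + i.1) * (6 * Real.pi * ((i.1 : ℝ) + a))⁻¹)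
          - 2 * a * (2 * a * (6 * Real.pi * ((a : ℝ) + a))⁻¹)) := by
      field_simp
      ring
    rw [h1]
    push_cast
    ring
  have hyy : ∀ i j, inner ℂ (y i) (y j) =
      ((((a - i.1) * (a - j.1) / (6 * Real.pi * (i.1 + j.1)) : ℝ)) : ℂ) * inner ℂ i.2 j.2 := by
    intro i j
    have hi : (0 : ℝ) < i.1 := i.1.2
    have hj : (0 : ℝ) < j.1 := j.1.2
    have h0 : ∀ u v, inner ℂ (q u) v = inner ℂ u (q v) := fun u v => hqs u v
    rw [hy, hy, inner_smul_left, inner_smul_right, h0, ← inner_smul_right, hqG, inner_sub_right, hG,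
      hG, Complex.conj_ofReal]
    have h1 : (a - i.1) * (a - j.1) / (6 * Real.pi * (i.1 + j.1)) =
        ((a : ℝ) ^ 2 - (i.1 : ℝ) ^ 2) * ((6 * Real.pi * ((i.1 : ℝ) + j.1))⁻¹
        - (6 * Real.pi * ((i.1 : ℝ) + a))⁻¹) := by
      field_simp
      ring
    rw [h1]
    push_cast
    ring
  have hPx : ∀ i, boundProj G a (x i) = 0 := by
    intro i
    have hi : (0 : ℝ) < i.1 := i.1.2
    rw [hx, map_sub, map_smul, map_smul, boundProj_G_self hG, boundProj_G hG, smul_smul,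
      ← Complex.ofReal_mul, ← sub_smul, ← Complex.ofReal_sub]
    rw [show (a + i.1 : ℝ) * (2 * a / (a + i.1)) - 2 * a = 0 by field_simp; ring,
      Complex.ofReal_zero, zero_smul]
  -- The coefficients coincide with those in `hfy` for f and y, so x ↦ y intertwines the two
  -- resolvents.
  have hRx : ∀ i, (((Ω : ℝ) ^ 2 - (i.1 : ℝ) ^ 2 : ℝ) : ℂ) • cauchyRes G f a Ω (x i) =
      x i + ((((a : ℝ) ^ 2 - (i.1 : ℝ) ^ 2) / ((Ω : ℝ) ^ 2 - (a : ℝ) ^ 2) : ℝ) : ℂ) • x (Ω, i.2) := by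
    intro i
    have h2 : ((Ω : ℝ) ^ 2 - (a : ℝ) ^ 2 : ℝ) ≠ 0 := by nlinarith
    rw [hx, hx, map_sub, map_smul, map_smul, cauchyRes_G_self hG haΩ hfG, smul_sub, smul_comm,
      smul_cauchyRes_G hG haΩ hfG]
    simp only [smul_sub, smul_add, smul_smul, ← Complex.ofReal_mul]
    have h3 : ((a + i.1) * ((a - i.1) / (Ω - a)) : ℝ) =
        ((a : ℝ) ^ 2 - (i.1 : ℝ) ^ 2) / ((Ω : ℝ) ^ 2 - (a : ℝ) ^ 2) * (a + Ω) := by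
      have : (Ω : ℝ) ^ 2 - (a : ℝ) ^ 2 = (Ω - a) * (a + Ω) := by ring
      rw [this]
      field_simp
      ring
    have h4 : (((Ω : ℝ) ^ 2 - (i.1 : ℝ) ^ 2) * (2 * a * ((Ω : ℝ) ^ 2 - (a : ℝ) ^ 2)⁻¹) : ℝ) =
        2 * a + ((a : ℝ) ^ 2 - (i.1 : ℝ) ^ 2) / ((Ω : ℝ) ^ 2 - (a : ℝ) ^ 2) * (2 * a) := by
      field_simp
      ring
    rw [h3, h4, Complex.ofReal_add]
    module
  have hfy : ∀ i, (((Ω : ℝ) ^ 2 - (i.1 : ℝ) ^ 2 : ℝ) : ℂ) • f (y i) =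
      y i + ((((a : ℝ) ^ 2 - (i.1 : ℝ) ^ 2) / ((Ω : ℝ) ^ 2 - (a : ℝ) ^ 2) : ℝ) : ℂ) • y (Ω, i.2) := by
    intro i
    have h2 : ((Ω : ℝ) ^ 2 - (a : ℝ) ^ 2 : ℝ) ≠ 0 := by nlinarith
    have h3 : ∀ u, f (q u) = q (f u) := fun u => congrArg (fun S : E →L[ℂ] E => S u) hfq
    rw [hy, hy, map_smul, h3, smul_comm, ← map_smul, hfG, map_sub, smul_sub, smul_smul,
      ← Complex.ofReal_mul, show (((a : ℝ) ^ 2 - (i.1 : ℝ) ^ 2) / ((Ω : ℝ) ^ 2 - (a : ℝ) ^ 2) * ((a : ℝ) ^ 2 - (Ω : ℝ) ^ 2) : ℝ) =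
        -((a : ℝ) ^ 2 - (i.1 : ℝ) ^ 2) by field_simp; ring, Complex.ofReal_neg]
    module
  have hxt : ∀ Q, Tendsto (fun s => x (s, Q)) (𝓝[≠] Ω) (𝓝 (x (Ω, Q))) := by
    intro Q
    simp only [hx]
    have h1 := (hG.tendsto Ω Q).mono_left (nhdsWithin_le_nhds (s := {Ω}ᶜ))
    have h2 : Tendsto (fun s : Ioi (0 : ℝ) => ((a + s : ℝ) : ℂ)) (𝓝[≠] Ω) (𝓝 ((a + Ω : ℝ) : ℂ)) :=
      (Continuous.tendsto (by fun_prop) Ω).mono_left nhdsWithin_le_nhds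
    exact (h2.smul h1).sub_const _
  have hyt : ∀ Q, Tendsto (fun s => y (s, Q)) (𝓝[≠] Ω) (𝓝 (y (Ω, Q))) := by
    intro Q
    simp only [hy]
    have h1 := (hG.tendsto Ω Q).mono_left (nhdsWithin_le_nhds (s := {Ω}ᶜ))
    have h2 : Tendsto (fun s : Ioi (0 : ℝ) => (((a : ℝ) ^ 2 - (s : ℝ) ^ 2 : ℝ) : ℂ)) (𝓝[≠] Ω)
        (𝓝 (((a : ℝ) ^ 2 - (Ω : ℝ) ^ 2 : ℝ) : ℂ)) :=
      (Continuous.tendsto (by fun_prop) Ω).mono_left nhdsWithin_le_nhds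
    exact h2.smul ((q.continuous.tendsto _).comp h1)
  -- Ω is not an isolated rate, so the limits s → Ω with s ≠ Ω are meaningful.
  have hne : (𝓝[≠] Ω).NeBot := by
    rw [← mem_closure_iff_nhdsWithin_neBot, Metric.mem_closure_iff]
    intro ε hε
    refine ⟨⟨Ω + ε / 2, mem_Ioi.2 (by positivity)⟩, fun h => ?_, ?_⟩
    · have := congrArg Subtype.val (mem_singleton_iff.1 h)
      simp only at this
      linarith
    · rw [Subtype.dist_eq, Real.dist_eq, abs_sub_lt_iff]
      constructor <;> simp only <;> linarith
  have hsq : ∀ s : Ioi (0 : ℝ), s ≠ Ω → (((Ω : ℝ) ^ 2 - (s : ℝ) ^ 2 : ℝ) : ℂ) ≠ 0 := by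
    intro s hs
    have h0 : (0 : ℝ) < s := s.2
    rw [Complex.ofReal_ne_zero, sq_sub_sq]
    exact mul_ne_zero (by positivity) (sub_ne_zero.2 fun h => hs (Subtype.ext h.symm))
  have hR : IsSelfAdjoint (cauchyRes G f a Ω) :=
    hf.add (isSelfAdjoint_real_smul_comp_adjoint _ (G Ω))
  refine exists_diagonalization x y (fun i j => (hxx i j).trans (hyy i j).symm) hR
    (isSelfAdjoint_real_smul_comp_adjoint _ _) (boundProj_mul_self hG)
    (boundProj_mul_cauchyRes hG haΩ hfG hf) hf hPx ?_ ?_ ?_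
  · have h1 : ∀ i : Ioi (0 : ℝ) × F, i.1 ≠ Ω → cauchyRes G f a Ω (x i) ∈
        (Submodule.span ℂ (range x)).topologicalClosure := by
      intro i hi
      have h2 := congrArg (fun v => (((Ω : ℝ) ^ 2 - (i.1 : ℝ) ^ 2 : ℝ) : ℂ)⁻¹ • v) (hRx i)
      rw [inv_smul_smul₀ (hsq _ hi)] at h2
      rw [h2]
      exact Submodule.le_topologicalClosure _ (Submodule.smul_mem _ _ (Submodule.add_mem _
        (Submodule.subset_span ⟨_, rfl⟩) (Submodule.smul_mem _ _ (Submodule.subset_span ⟨_, rfl⟩))))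
    rintro ⟨s, Q⟩
    by_cases hs : s = Ω
    · subst hs
      refine (Submodule.isClosed_topologicalClosure _).mem_of_tendsto
        (((cauchyRes G f a s).continuous.tendsto _).comp (hxt Q)) ?_
      filter_upwards [self_mem_nhdsWithin] with t ht
      exact h1 (t, Q) ht
    · exact h1 (s, Q) hs
  · intro V hV
    have h1 : ∀ i : Ioi (0 : ℝ) × F, i.1 ≠ Ω → V (cauchyRes G f a Ω (x i)) = f (y i) := by
      intro i hi
      refine smul_right_injective E (hsq _ hi) ?_
      simp only
      rw [hfy, ← map_smul, hRx, map_add, map_smul, hV, hV]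
    rintro ⟨s, Q⟩
    by_cases hs : s = Ω
    · subst hs
      refine tendsto_nhds_unique ((V.continuous.tendsto _).comp
        (((cauchyRes G f a s).continuous.tendsto _).comp (hxt Q)))
        (((f.continuous.tendsto _).comp (hyt Q)).congr' ?_)
      filter_upwards [self_mem_nhdsWithin] with t ht
      exact (h1 (t, Q) ht).symm
    · exact h1 (s, Q) hs
  -- Orthogonality to the bound states and to x at the rate Ω removes the charge at Ω, and with it
  -- the perturbation.
  · intro u hu hxu
    have h1 := adjoint_eq_zero_of_boundProj hG hu
    have h2 : (G Ω).adjoint u = 0 := by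
      refine ext_inner_left ℂ fun Q => ?_
      have h3 := hxu (Ω, Q)
      rw [hx, inner_sub_left, inner_smul_left, inner_smul_left,
        ← ContinuousLinearMap.adjoint_inner_right, ← ContinuousLinearMap.adjoint_inner_right, h1,
        inner_zero_right, mul_zero, sub_zero, Complex.conj_ofReal] at h3
      rw [inner_zero_right]
      refine (mul_eq_zero.1 h3).resolve_left ?_
      rw [Complex.ofReal_eq_zero]
      exact (add_pos ha hΩ).ne'
    rw [cauchyRes_apply, h2, map_zero, smul_zero, add_zero]

end CauchyKernel

/-! ### Diagonalization of the point interaction -/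

/-- The charge maps, indexed by the decay rate. -/
def rateMap (s : Ioi (0 : ℝ)) : C3 →L[ℂ] L2star := chargeMap ((s : ℝ) ^ 2) (pow_pos s.2 2)

theorem cauchyGram_rateMap : CauchyGram rateMap := by
  intro s t Q Q'
  have hs : (0 : ℝ) < s := s.2
  have ht : (0 : ℝ) < t := t.2
  rw [rateMap, rateMap, chargeMap_apply, chargeMap_apply, inner_MQG_MQG (pow_pos hs 2) (pow_pos ht 2),
    Real.sqrt_sq hs.le, Real.sqrt_sq ht.le]

theorem freeRes_rateMap (t s : Ioi (0 : ℝ)) (Q : C3) :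
    (((t : ℝ) ^ 2 - (s : ℝ) ^ 2 : ℝ) : ℂ) • freeRes ((t : ℝ) ^ 2) (pow_pos t.2 2) (rateMap s Q) =
      rateMap s Q - rateMap t Q := by
  rw [rateMap, rateMap, chargeMap_sub, map_smul]

/-! ### Approximate eigenvectors without charge -/

/-- A divergence-free field concentrated on a shell in Fourier space. -/
def shellField (s t : ℝ) (k : R3) : C3 :=
  (tau ⁻¹' Ioo s t).indicator (fun k => WithLp.toLp 2 ![(k 1 : ℂ), -(k 0 : ℂ), 0]) k

theorem shellField_neg (s t : ℝ) (k : R3) : shellField s t (-k) = -shellField s t k := by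
  have h1 : tau (-k) = tau k := by simp [tau]
  by_cases hk : tau k ∈ Ioo s t
  · rw [shellField, shellField, indicator_of_mem (show -k ∈ tau ⁻¹' Ioo s t by rwa [mem_preimage, h1]),
      indicator_of_mem (show k ∈ tau ⁻¹' Ioo s t from hk)]
    ext i
    fin_cases i <;> simp
  · rw [shellField, shellField, indicator_of_notMem (show -k ∉ tau ⁻¹' Ioo s t by rwa [mem_preimage, h1]),
      indicator_of_notMem (show k ∉ tau ⁻¹' Ioo s t from hk), neg_zero]

theorem dotC_shellField (s t : ℝ) (k : R3) : dotC k (shellField s t k) = 0 := by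
  by_cases hk : tau k ∈ Ioo s t
  · rw [shellField, indicator_of_mem (show k ∈ tau ⁻¹' Ioo s t from hk)]
    simp [dotC, Fin.sum_univ_three]
    ring
  · rw [shellField, indicator_of_notMem (show k ∉ tau ⁻¹' Ioo s t from hk)]
    simp [dotC]

theorem isBounded_shell (s t : ℝ) : Bornology.IsBounded (tau ⁻¹' Ioo s t) := by
  refine (Metric.isBounded_closedBall (x := (0 : R3)) (r := Real.sqrt t)).subset fun k hk => ?_
  rw [mem_closedBall_zero_iff]
  refine Real.le_sqrt_of_sq_le ?_
  have h1 : tau k < t := hk.2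
  have h2 : ‖k‖ ^ 2 ≤ tau k := by
    rw [tau]
    have h3 := Real.pi_gt_three
    exact le_mul_of_one_le_left (sq_nonneg _) (by nlinarith)
  linarith

theorem memLp_shellField (s t : ℝ) : MemLp (shellField s t) 2 volume := by
  have hS : MeasurableSet (tau ⁻¹' Ioo s t) := measurable_tau measurableSet_Ioo
  have hb := isBounded_shell s t
  obtain ⟨C, hC⟩ := hb.subset_closedBall 0
  have hf : Continuous fun k : R3 => (WithLp.toLp 2 ![(k 1 : ℂ), -(k 0 : ℂ), 0] : C3) := by
    refine (PiLp.continuous_toLp 2 _).comp (continuous_pi fun i => ?_)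
    fin_cases i <;> simp <;> fun_prop
  have h1 : IsCompact (Metric.closedBall (0 : R3) C) := isCompact_closedBall 0 C
  obtain ⟨B, hB⟩ := (h1.image hf).isBounded.subset_closedBall 0
  have hi : MemLp (fun k => (tau ⁻¹' Ioo s t).indicator (fun _ => B) k) 2 volume :=
    memLp_indicator_const 2 hS B (Or.inr hb.measure_lt_top.ne)
  refine hi.mono' (hf.measurable.indicator hS).aestronglyMeasurable (Eventually.of_forall fun k => ?_)
  by_cases hk : k ∈ tau ⁻¹' Ioo s t
  · rw [shellField, indicator_of_mem hk, indicator_of_mem hk]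
    exact mem_closedBall_zero_iff.1 (hB ⟨k, hC hk, rfl⟩)
  · rw [shellField, indicator_of_notMem hk, indicator_of_notMem hk, norm_zero]

theorem not_shellField_ae_eq_zero {s t : ℝ} (hs : 0 ≤ s) (ht : s < t) :
    ¬ shellField s t =ᵐ[volume] 0 := by
  intro h
  have hopen : IsOpen (tau ⁻¹' Ioo s t ∩ {k : R3 | k 0 ≠ 0}) :=
    (isOpen_Ioo.preimage continuous_tau).inter (isOpen_ne_fun (by fun_prop) continuous_const)
  have hne : (tau ⁻¹' Ioo s t ∩ {k : R3 | k 0 ≠ 0}).Nonempty := by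
    have h0 : 0 < (s + t) / 2 := by linarith
    -- A point of the first axis with τ = (s + t)/2; its first coordinate is nonzero, so the field
    -- does not vanish there.
    refine ⟨EuclideanSpace.single 0 (Real.sqrt ((s + t) / 2) / (2 * Real.pi)), ?_, ?_⟩
    · have h1 : tau (EuclideanSpace.single 0 (Real.sqrt ((s + t) / 2) / (2 * Real.pi))) =
          (s + t) / 2 := by
        have := Real.pi_pos
        rw [tau, PiLp.norm_single, Real.norm_eq_abs, sq_abs, div_pow, Real.sq_sqrt h0.le]
        field_simp
        ring
      rw [mem_preimage, h1]
      constructor <;> linarith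
    · have := Real.pi_pos
      have h1 := Real.sqrt_pos.2 h0
      simp only [mem_ofPred_eq, PiLp.single_apply, if_pos]
      positivity
  refine (hopen.measure_pos volume hne).ne' (measure_mono_null (fun k hk => ?_) h)
  simp only [mem_compl_iff, mem_ofPred_eq, Pi.zero_apply]
  intro h1
  rw [shellField, indicator_of_mem hk.1] at h1
  have h2 := congrArg (fun v : C3 => v 1) h1
  simp at h2
  exact hk.2 h2

/-- A radial symbol is even, so its integral against an odd field vanishes: odd fields carry no
charge. -/
theorem adjoint_gmap_eq_zero_of_odd {h : R3 → ℂ} (hh : MemLp h 2 volume) (hr : IsRadial h)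
    {A : L2star} {f : R3 → C3} (hA : hat A =ᵐ[volume] f) (hf : ∀ k, f (-k) = -f k) :
    (gmap h hh).adjoint A = 0 := by
  rw [adjoint_gmap_apply]
  have h1 : ∫ k, (starRingEnd ℂ) (h k) • hat A k = ∫ k, (starRingEnd ℂ) (h k) • f k :=
    integral_congr_ae (hA.mono fun k hk => by simp only [hk])
  have h2 : ∫ k, (starRingEnd ℂ) (h k) • f k = -∫ k, (starRingEnd ℂ) (h k) • f k := by
    rw [← integral_neg, ← integral_neg_eq_self]
    refine integral_congr_ae (Eventually.of_forall fun k => ?_)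
    simp only [hf, hr (-k) k (norm_neg k), smul_neg]
  have h3 : (2 : ℂ) • ∫ k, (starRingEnd ℂ) (h k) • f k = 0 := by
    rw [two_smul]
    nth_rw 1 [h2]
    exact neg_add_cancel _
  rw [h1]
  exact (smul_eq_zero.1 h3).resolve_left two_ne_zero

/-- Approximate eigenvectors without charge. -/
theorem exists_weyl {t : ℝ} (ht : 0 ≤ t) {ε : ℝ} (hε : 0 < ε) {w : ℝ} (hw : 0 < w) :
    ∃ x f : L2star, x ≠ 0 ∧ (∀ s, (rateMap s).adjoint x = 0) ∧ (∀ s, (rateMap s).adjoint f = 0) ∧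
      x = freeRes w hw f ∧ ‖f - (w : ℂ) • x - (t : ℂ) • x‖ ≤ ε * ‖x‖ := by
  obtain ⟨x, hx⟩ : ∃ x : L2star, x = ofHat _ (memLp_shellField t (t + ε))
    (Eventually.of_forall (dotC_shellField t (t + ε))) := ⟨_, rfl⟩
  have hxh : hat x =ᵐ[volume] shellField t (t + ε) := hx ▸ hat_ofHat _ _
  have hS : MeasurableSet (tau ⁻¹' Ioo t (t + ε)) := measurable_tau measurableSet_Ioo
  -- τ + w cut off to the shell t < τ < t + ε: a bounded symbol that acts on x as −Δ + w and differs
  -- there from w + t by at most ε.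
  obtain ⟨g, hg⟩ : ∃ g : R3 → ℂ, g = fun k =>
    (tau ⁻¹' Ioo t (t + ε)).indicator (fun k => ((tau k + w : ℝ) : ℂ)) k := ⟨_, rfl⟩
  have hgb : BddMeas g := by
    rw [hg]
    refine ⟨Measurable.indicator (by have := measurable_tau; fun_prop) hS, t + ε + w, fun k => ?_⟩
    simp only
    by_cases hk : k ∈ tau ⁻¹' Ioo t (t + ε)
    · rw [indicator_of_mem hk, Complex.norm_real, Real.norm_eq_abs,
        abs_of_pos (by have := tau_nonneg k; linarith)]
      linarith [hk.2]
    · rw [indicator_of_notMem hk, norm_zero]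
      linarith
  have hfh : hat (fmul g hgb x) =ᵐ[volume] fun k => g k • shellField t (t + ε) k := by
    filter_upwards [hat_fmul hgb x, hxh] with k h1 h2
    rw [h1, h2]
  have hge : ∀ k, g (-k) = g k := fun k => by
    have h1 : tau (-k) = tau k := by simp [tau]
    simp only [hg, indicator, mem_preimage, h1]
  refine ⟨x, fmul g hgb x, fun h0 => ?_, fun s => ?_, fun s => ?_, ?_, ?_⟩
  · refine not_shellField_ae_eq_zero ht (lt_add_of_pos_right t hε) (hxh.symm.trans ?_)
    rw [h0, map_zero]
    exact Lp.coeFn_zero _ _ _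
  · exact adjoint_gmap_eq_zero_of_odd _ (isRadial_res _) hxh (shellField_neg _ _)
  · refine adjoint_gmap_eq_zero_of_odd _ (isRadial_res _) hfh fun k => ?_
    rw [shellField_neg, hge, smul_neg]
  · refine hat_ext ?_
    filter_upwards [hat_freeRes hw (fmul g hgb x), hfh, hxh] with k h1 h2 h3
    rw [h1, h2, h3, smul_smul]
    by_cases hk : k ∈ tau ⁻¹' Ioo t (t + ε)
    · have := tau_nonneg k
      simp only [hg]
      rw [indicator_of_mem hk, res, ← Complex.ofReal_mul, inv_mul_cancel₀ (by positivity),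
        Complex.ofReal_one, one_smul]
    · rw [shellField, indicator_of_notMem hk, smul_zero]
  · rw [← hat.norm_map, ← hat.norm_map x]
    refine Lp.norm_le_mul_norm_of_ae_le_mul ?_
    filter_upwards [hat_sub (fmul g hgb x - (w : ℂ) • x) ((t : ℂ) • x),
      hat_sub (fmul g hgb x) ((w : ℂ) • x), hat_smul (w : ℂ) x, hat_smul (t : ℂ) x, hfh, hxh]
      with k h1 h2 h3 h4 h5 h6
    rw [h1, h2, h3, h4, h5, h6, ← sub_smul, ← sub_smul, norm_smul]
    by_cases hk : k ∈ tau ⁻¹' Ioo t (t + ε)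
    · refine mul_le_mul_of_nonneg_right ?_ (norm_nonneg _)
      simp only [hg]
      rw [indicator_of_mem hk, ← Complex.ofReal_sub, ← Complex.ofReal_sub, Complex.norm_real,
        Real.norm_eq_abs, abs_of_pos (by linarith [hk.1])]
      linarith [hk.2]
    · rw [shellField, indicator_of_notMem hk, norm_zero, mul_zero, mul_zero]

/-! ### The diagonalization with the constants of the theorem -/

section

variable {e c m : ℝ} (he : e ≠ 0) (hc : 0 < c) (hm : 0 < m)

theorem lam0_eq : lam0 e c m = bindingRate e c m ^ 2 := rfl

/-- A spectral parameter below the ground state. -/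
def refRate (e c m : ℝ) : ℝ := (2 * bindingRate e c m) ^ 2

include he hc hm

theorem refRate_pos : 0 < refRate e c m := by
  have := bindingRate_pos he hc hm
  unfold refRate
  positivity

theorem GammaM_refRate : GammaM e c m (refRate e c m) =
    (2 * bindingRate e c m - bindingRate e c m) / (6 * Real.pi) := by
  have := bindingRate_pos he hc hm
  rw [GammaM_eq he, refRate, Real.sqrt_sq (by positivity)]

theorem GammaM_refRate_pos : 0 < GammaM e c m (refRate e c m) := by
  have h1 := bindingRate_pos he hc hm
  have := Real.pi_pos
  rw [GammaM_refRate he hc hm, show 2 * bindingRate e c m - bindingRate e c m = bindingRate e c m by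
    ring]
  positivity

/-- The abstract scheme with a = √λ₀, Ω = 2a, f the free resolvent at −Ω² and q = (−Δ + a²)^{-1/2};
then Γ_m(Ω²) = (Ω − a)/(6π) is the coupling in `cauchyRes`. -/
theorem exists_diagonalizes : ∃ V₁ V₂ : L2star →L[ℂ] L2star,
    Diagonalizes (pointOp e c m (refRate e c m) (refRate_pos he hc hm) (GammaM_refRate_pos he hc hm))
      (lam0 e c m) (refRate e c m) (refRate_pos he hc hm)
      (pointRes (refRate e c m) (refRate_pos he hc hm) (GammaM e c m (refRate e c m)))
      (boundProj rateMap ⟨bindingRate e c m, bindingRate_pos he hc hm⟩) V₁ V₂ := by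
  have ha := bindingRate_pos he hc hm
  obtain ⟨a, ha'⟩ : ∃ a : Ioi (0 : ℝ), a = ⟨bindingRate e c m, ha⟩ := ⟨_, rfl⟩
  obtain ⟨Ω, hΩ⟩ : ∃ Ω : Ioi (0 : ℝ), Ω = ⟨2 * bindingRate e c m, by
    rw [mem_Ioi]; positivity⟩ := ⟨_, rfl⟩
  have haΩ : (a : ℝ) < Ω := by
    rw [ha', hΩ]
    simp only
    linarith
  have hR : pointRes (refRate e c m) (refRate_pos he hc hm) (GammaM e c m (refRate e c m)) =
      cauchyRes rateMap (freeRes (refRate e c m) (refRate_pos he hc hm)) a Ω := by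
    rw [pointRes, GammaM_refRate he hc hm, ha', hΩ]
    rfl
  have hfG : ∀ (s : Ioi (0 : ℝ)) (Q : C3), (((Ω : ℝ) ^ 2 - (s : ℝ) ^ 2 : ℝ) : ℂ) •
      freeRes (refRate e c m) (refRate_pos he hc hm) (rateMap s Q) = rateMap s Q - rateMap Ω Q := by
    subst hΩ
    exact freeRes_rateMap _
  have hqG : ∀ (s : Ioi (0 : ℝ)) (Q : C3), (((a : ℝ) ^ 2 - (s : ℝ) ^ 2 : ℝ) : ℂ) •
      freeRsq ((a : ℝ) ^ 2) (pow_pos a.2 2) (freeRsq ((a : ℝ) ^ 2) (pow_pos a.2 2) (rateMap s Q)) =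
      rateMap s Q - rateMap a Q := by
    intro s Q
    rw [freeRsq_freeRsq]
    exact freeRes_rateMap a s Q
  obtain ⟨V₁, V₂, h1, h2, h3, h4, h5⟩ := exists_diagonalization_cauchyRes cauchyGram_rateMap haΩ hfG
    (isSelfAdjoint_freeRes (refRate_pos he hc hm)) (isSelfAdjoint_freeRsq (pow_pos a.2 2))
    (fmul_comm _ _) hqG
  have hP := isSelfAdjoint_real_smul_comp_adjoint (12 * Real.pi * a) (rateMap a)
  have hPP := boundProj_mul_self cauchyGram_rateMap (a := a)
  have hRP := cauchyRes_mul_boundProj cauchyGram_rateMap haΩ hfG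
  rw [← hR] at h4 h5 hRP
  subst ha'
  refine ⟨V₁, V₂, ⟨pow_pos ha 2, ?_, isResolventAt_pointOp _ _, isSelfAdjoint_pointRes _ _, h1, hP, hPP,
    ?_, h2, h3, h4, h5, ?_⟩⟩
  · rw [lam0_eq, refRate]
    nlinarith
  · rw [hRP, hΩ]
    rfl
  · intro t ht ε hε
    obtain ⟨x, f, hx0, hx, hf, hxf, hn⟩ := exists_weyl ht hε (refRate_pos he hc hm)
    -- f carries no charge, so the perturbed resolvent acts on it as the free one.
    have hRf : pointRes (refRate e c m) (refRate_pos he hc hm) (GammaM e c m (refRate e c m)) f = x := by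
      rw [hR, cauchyRes_apply, hf, map_zero, smul_zero, add_zero, hxf]
    obtain ⟨hd, he'⟩ := (isResolventAt_pointOp (refRate_pos he hc hm)
      (GammaM_refRate_pos he hc hm)).1 f
    subst hRf
    refine ⟨_, hx0, ?_, hd, ?_⟩
    · rw [boundProj_apply, hx, map_zero, smul_zero]
    · convert hn using 2
      rw [sub_eq_iff_eq_add.1 he', Complex.ofReal_neg]
      module

end

/-! ### The spectrum of the point interaction -/

section

variable {e c m : ℝ} (he : e ≠ 0) (hc : 0 < c) (hm : 0 < m)

include he hc hm

theorem lam0_pos : 0 < lam0 e c m := pow_pos (bindingRate_pos he hc hm) 2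

/-- (3√(2πm) c/e)² = 18πmc²/e² equals 12π√λ₀, the inverse of the Gram constant at λ₀. -/
theorem orthonormal_boundStates (b : OrthonormalBasis (Fin 3) ℂ C3) :
    Orthonormal ℂ fun j => ((3 * Real.sqrt (2 * Real.pi * m) * (c / e) : ℝ) : ℂ) •
      MQG (lam0 e c m) (b j) := by
  have ha := bindingRate_pos he hc hm
  have hl := lam0_pos he hc hm
  rw [orthonormal_iff_ite]
  intro i j
  have h1 := inner_smul_left (𝕜 := ℂ) (MQG (lam0 e c m) (b i))
    (((3 * Real.sqrt (2 * Real.pi * m) * (c / e) : ℝ) : ℂ) • MQG (lam0 e c m) (b j))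
    ((3 * Real.sqrt (2 * Real.pi * m) * (c / e) : ℝ) : ℂ)
  have h2 := inner_smul_right (𝕜 := ℂ) (MQG (lam0 e c m) (b i)) (MQG (lam0 e c m) (b j))
    ((3 * Real.sqrt (2 * Real.pi * m) * (c / e) : ℝ) : ℂ)
  rw [h1, h2, inner_MQG_MQG hl hl, Complex.conj_ofReal, orthonormal_iff_ite.1 b.orthonormal i j,
    ← mul_assoc, ← mul_assoc, ← Complex.ofReal_mul, ← Complex.ofReal_mul]
  have hs : Real.sqrt (lam0 e c m) = bindingRate e c m := by
    rw [lam0_eq, Real.sqrt_sq ha.le]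
  have hq : Real.sqrt (2 * Real.pi * m) ^ 2 = 2 * Real.pi * m :=
    Real.sq_sqrt (by have := Real.pi_pos; positivity)
  have h3 : 3 * Real.sqrt (2 * Real.pi * m) * (c / e) * (3 * Real.sqrt (2 * Real.pi * m) * (c / e)) *
      (6 * Real.pi * (Real.sqrt (lam0 e c m) + Real.sqrt (lam0 e c m)))⁻¹ = 1 := by
    rw [hs, show 3 * Real.sqrt (2 * Real.pi * m) * (c / e) *
      (3 * Real.sqrt (2 * Real.pi * m) * (c / e)) = 9 * Real.sqrt (2 * Real.pi * m) ^ 2 * (c / e) ^ 2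
      by ring, hq, bindingRate]
    have := Real.pi_pos
    field_simp
    norm_num
  rw [h3, Complex.ofReal_one, one_mul]

theorem span_boundStates (b : OrthonormalBasis (Fin 3) ℂ C3) :
    Submodule.span ℂ (range fun j => ((3 * Real.sqrt (2 * Real.pi * m) * (c / e) : ℝ) : ℂ) •
      MQG (lam0 e c m) (b j)) = LinearMap.range (chargeMap (lam0 e c m) (lam0_pos he hc hm)).toLinearMap := by
  have hne : ((3 * Real.sqrt (2 * Real.pi * m) * (c / e) : ℝ) : ℂ) ≠ 0 := by
    rw [Complex.ofReal_ne_zero]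
    have := Real.pi_pos
    have := hc.ne'
    positivity
  apply le_antisymm
  · rw [Submodule.span_le]
    rintro _ ⟨j, rfl⟩
    refine ⟨((3 * Real.sqrt (2 * Real.pi * m) * (c / e) : ℝ) : ℂ) • b j, ?_⟩
    simp only [← chargeMap_apply (lam0_pos he hc hm)]
    exact map_smul _ _ _
  · rintro _ ⟨Q, rfl⟩
    have h1 : Q ∈ Submodule.span ℂ (range b) := by
      rw [← OrthonormalBasis.coe_toBasis, Module.Basis.span_eq]
      exact Submodule.mem_top
    induction h1 using Submodule.span_induction with
    | mem Q hQ =>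
      obtain ⟨j, rfl⟩ := hQ
      have h2 := Submodule.smul_mem (Submodule.span ℂ (range fun j =>
        ((3 * Real.sqrt (2 * Real.pi * m) * (c / e) : ℝ) : ℂ) • MQG (lam0 e c m) (b j)))
        ((3 * Real.sqrt (2 * Real.pi * m) * (c / e) : ℝ) : ℂ)⁻¹ (Submodule.subset_span ⟨j, rfl⟩)
      simp only [inv_smul_smul₀ hne] at h2
      rwa [← chargeMap_apply (lam0_pos he hc hm)] at h2
    | zero => rw [map_zero]; exact Submodule.zero_mem _
    | add Q Q' _ _ h h' => rw [map_add]; exact Submodule.add_mem _ h h'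
    | smul a Q _ h => rw [map_smul]; exact Submodule.smul_mem _ _ h

/-- The operator `H_m`. -/
def hamiltonian : L2star →ₗ.[ℂ] L2star :=
  pointOp e c m (refRate e c m) (refRate_pos he hc hm) (GammaM_refRate_pos he hc hm)

theorem range_boundProj_rateMap :
    LinearMap.range (boundProj rateMap ⟨bindingRate e c m, bindingRate_pos he hc hm⟩).toLinearMap =
      LinearMap.range (chargeMap (lam0 e c m) (lam0_pos he hc hm)).toLinearMap :=
  range_boundProj cauchyGram_rateMap

theorem eigenspace_hamiltonian : eigenspace (hamiltonian he hc hm) ((-lam0 e c m : ℝ) : ℂ) =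
    LinearMap.range (chargeMap (lam0 e c m) (lam0_pos he hc hm)).toLinearMap := by
  obtain ⟨V₁, V₂, D⟩ := exists_diagonalizes he hc hm
  exact D.eigenspace_eq.trans (range_boundProj_rateMap he hc hm)

theorem finrank_eigenspace_hamiltonian :
    Module.finrank ℂ (eigenspace (hamiltonian he hc hm) ((-lam0 e c m : ℝ) : ℂ)) = 3 := by
  rw [eigenspace_hamiltonian, ← span_boundStates he hc hm (EuclideanSpace.basisFun (Fin 3) ℂ)]
  exact (finrank_span_eq_card
    (orthonormal_boundStates he hc hm (EuclideanSpace.basisFun (Fin 3) ℂ)).linearIndependent).trans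
    (Fintype.card_fin 3)

theorem spectra_hamiltonian :
    essentialSpectrum (hamiltonian he hc hm) = Complex.ofReal '' Ici 0 ∧
      acSpectrum (hamiltonian he hc hm) = Complex.ofReal '' Ici 0 ∧
      scSpectrum (hamiltonian he hc hm) = ∅ ∧
      pointSpectrum (hamiltonian he hc hm) = {((-lam0 e c m : ℝ) : ℂ)} := by
  obtain ⟨V₁, V₂, D⟩ := exists_diagonalizes he hc hm
  have hfin : FiniteDimensional ℂ (LinearMap.range
      (boundProj rateMap ⟨bindingRate e c m, bindingRate_pos he hc hm⟩).toLinearMap) := by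
    rw [range_boundProj_rateMap he hc hm]
    infer_instance
  have hP : boundProj rateMap ⟨bindingRate e c m, bindingRate_pos he hc hm⟩ ≠ 0 := by
    intro h
    have h1 := finrank_eigenspace_hamiltonian he hc hm
    rw [eigenspace_hamiltonian, ← range_boundProj_rateMap he hc hm, h] at h1
    have h2 : LinearMap.range (0 : L2star →L[ℂ] L2star).toLinearMap = ⊥ := LinearMap.range_zero
    rw [h2, finrank_bot] at h1
    omega
  exact ⟨D.essentialSpectrum_eq hP hfin, D.acSpectrum_eq, D.scSpectrum_eq, D.pointSpectrum_eq hP⟩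

end

/-! ### Radial densities -/

/-- Square integrable spherically symmetric probability densities. -/
structure IsDensity (ρ : R3 → ℝ) : Prop where
  memLp : MemLp ρ 2 volume
  nonneg : ∀ x, 0 ≤ ρ x
  integral_eq : ∫ x, ρ x = 1
  radial : ∀ x y, ‖x‖ = ‖y‖ → ρ x = ρ y

theorem integral_rescale_smul {F : Type*} [NormedAddCommGroup F] [NormedSpace ℝ F] (ρ : R3 → ℝ)
    {r : ℝ} (hr : 0 < r) (g : R3 → F) : ∫ x, rescale ρ r x • g x = ∫ x, ρ x • g (r • x) := by
  have h1 := Measure.integral_comp_inv_smul_of_nonneg volume (fun x : R3 => ρ x • g (r • x)) hr.le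
  rw [finrank_euclideanSpace_fin] at h1
  simp only [smul_inv_smul₀ hr.ne'] at h1
  simp only [rescale, mul_smul]
  rw [integral_smul, h1, inv_smul_smul₀ (pow_pos hr 3).ne']

namespace IsDensity

variable {ρ : R3 → ℝ} (hρ : IsDensity ρ)

include hρ

theorem integrable : Integrable ρ := by
  by_contra h
  have := hρ.integral_eq
  rw [integral_undef h] at this
  exact zero_ne_one this

theorem integrable_ofReal : Integrable fun x => (ρ x : ℂ) := hρ.integrable.ofReal

theorem rescale {r : ℝ} (hr : 0 < r) : IsDensity (rescale ρ r) where
  memLp := by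
    have h1 : AEStronglyMeasurable (fun x : R3 => ρ (r⁻¹ • x)) volume :=
      hρ.memLp.1.comp_quasiMeasurePreserving (Measure.quasiMeasurePreserving_smul volume (inv_ne_zero hr.ne'))
    have h2 : MemLp (fun x : R3 => ρ (r⁻¹ • x)) 2 volume := by
      rw [memLp_two_iff_integrable_sq h1]
      exact ((memLp_two_iff_integrable_sq hρ.memLp.1).1 hρ.memLp).comp_smul (inv_ne_zero hr.ne')
    exact h2.const_mul _
  nonneg x := mul_nonneg (by positivity) (hρ.nonneg _)
  integral_eq := by
    have h1 := integral_rescale_smul ρ hr (fun _ => (1 : ℝ))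
    simpa [hρ.integral_eq] using h1
  radial x y h := by
    rw [PointCharge.rescale, PointCharge.rescale, hρ.radial _ (r⁻¹ • y) (by rw [norm_smul, norm_smul, h])]

end IsDensity

/-- Scaling moves r from the density to f(rx), and dominated convergence applies. -/
theorem weaklyTendstoDelta {ρ : R3 → ℝ} (hρ : IsDensity ρ) : WeaklyTendstoDelta ρ := by
  intro f
  have h1 : ∀ᶠ r in 𝓝[>] (0 : ℝ), ∫ x, ρ x • f (r • x) = ∫ x, rescale ρ r x * f x := by
    filter_upwards [self_mem_nhdsWithin] with r hr
    exact (integral_rescale_smul ρ hr f).symm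
  refine Tendsto.congr' h1 ?_
  have h2 : ∫ x, ρ x • f 0 = f 0 := by
    rw [integral_smul_const, hρ.integral_eq, one_smul]
  show Tendsto _ _ (𝓝 (f 0))
  rw [← h2]
  refine tendsto_integral_filter_of_dominated_convergence (fun x => ‖f‖ * ρ x) ?_ ?_
    (hρ.integrable.const_mul _) ?_
  · exact Eventually.of_forall fun r =>
      hρ.memLp.1.smul (by fun_prop : Continuous fun x : R3 => f (r • x)).aestronglyMeasurable
  · refine Eventually.of_forall fun r => Eventually.of_forall fun x => ?_
    rw [norm_smul, Real.norm_eq_abs, abs_of_nonneg (hρ.nonneg x), mul_comm]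
    exact mul_le_mul_of_nonneg_right (f.norm_coe_le_norm _) (hρ.nonneg x)
  · refine Eventually.of_forall fun x => Tendsto.const_smul ?_ _
    have h3 : Continuous fun r : ℝ => f (r • x) := by fun_prop
    have h4 := h3.tendsto 0
    rw [zero_smul] at h4
    exact h4.mono_left nhdsWithin_le_nhds

/-! ### The form factor -/

/-- The Fourier transform of a density. -/
def formFactor (ρ : R3 → ℝ) : R3 → ℂ := 𝓕 fun x => (ρ x : ℂ)

theorem formFactor_eq (ρ : R3 → ℝ) (k : R3) :
    formFactor ρ k = ∫ x, ρ x • Complex.exp (((-2 * Real.pi * inner ℝ x k : ℝ) : ℂ) * Complex.I) := by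
  rw [formFactor, Real.fourier_eq']
  simp only [smul_eq_mul, Complex.real_smul, mul_comm]

theorem formFactor_rescale (ρ : R3 → ℝ) {r : ℝ} (hr : 0 < r) (k : R3) :
    formFactor (rescale ρ r) k = formFactor ρ (r • k) := by
  rw [formFactor_eq, formFactor_eq, integral_rescale_smul ρ hr]
  simp only [inner_smul_left, inner_smul_right]
  rfl

namespace IsDensity

variable {ρ : R3 → ℝ} (hρ : IsDensity ρ)

include hρ

theorem continuous_formFactor : Continuous (formFactor ρ) := continuous_fourier hρ.integrable_ofReal

theorem norm_formFactor_le (k : R3) : ‖formFactor ρ k‖ ≤ 1 := by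
  refine (norm_fourier_le_integral _ k).trans (le_of_eq ?_)
  rw [← hρ.integral_eq]
  refine integral_congr_ae (Eventually.of_forall fun x => ?_)
  simp [abs_of_nonneg (hρ.nonneg x)]

theorem formFactor_zero : formFactor ρ 0 = 1 := by
  rw [formFactor_eq]
  simp only [inner_zero_right, mul_zero, Complex.ofReal_zero, zero_mul, Complex.exp_zero]
  rw [integral_smul_const, hρ.integral_eq, one_smul]

/-- The reflection that exchanges k and k' leaves ρ invariant. -/
theorem isRadial_formFactor : IsRadial (formFactor ρ) := by
  intro k k' h
  have h2 := Real.fourier_comp_linearIsometry (ℝ ∙ (k - k'))ᗮ.reflection (fun x => (ρ x : ℂ)) k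
  rw [Submodule.reflection_sub h] at h2
  rw [formFactor, ← h2]
  refine congrFun (congrArg 𝓕 (funext fun x => ?_)) k
  rw [Function.comp_apply, hρ.radial _ x (LinearIsometryEquiv.norm_map _ x)]

theorem fourierInv_eq_formFactor (k : R3) : 𝓕⁻ (fun x => (ρ x : ℂ)) k = formFactor ρ k := by
  rw [Real.fourierInv_eq_fourier_neg]
  exact hρ.isRadial_formFactor _ _ (norm_neg k)

theorem conj_formFactor (k : R3) : (starRingEnd ℂ) (formFactor ρ k) = formFactor ρ k := by
  have h1 := hρ.isRadial_formFactor _ _ (norm_neg k)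
  rw [formFactor_eq, formFactor_eq] at h1
  rw [formFactor_eq, ← h1, ← integral_conj, h1]
  refine integral_congr_ae (Eventually.of_forall fun x => ?_)
  simp only [Complex.real_smul, map_mul, Complex.conj_ofReal, ← Complex.exp_conj, Complex.conj_I,
    inner_neg_right]
  congr 2
  push_cast
  ring

theorem memLp_smul (Q : C3) : MemLp (fun x => (ρ x : ℂ) • Q) 2 volume :=
  MemLp.of_le_mul (c := ‖Q‖) hρ.memLp (hρ.integrable_ofReal.smul_const Q).1
    (Eventually.of_forall fun x => by rw [norm_smul, Complex.norm_real, mul_comm])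

theorem fourier_toL2 (Q : C3) :
    (𝓕 (toL2 fun x => (ρ x : ℂ) • Q) : L2) =ᵐ[volume] fun k => formFactor ρ k • Q := by
  rw [toL2_eq (hρ.memLp_smul Q)]
  filter_upwards [fourier_toLp (hρ.integrable_ofReal.smul_const Q) (hρ.memLp_smul Q)] with k h1
  exact h1.trans (fourier_smul_const Q k)

theorem memLp_formFactor : MemLp (formFactor ρ) 2 volume := by
  have h1 := (memLp_congr_ae (hρ.fourier_toL2 (EuclideanSpace.single 0 1))).1 (Lp.memLp _)
  refine MemLp.of_le h1 hρ.continuous_formFactor.aestronglyMeasurable (Eventually.of_forall fun k => ?_)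
  rw [norm_smul]
  simp

theorem tendsto_formFactor_rescale (k : R3) :
    Tendsto (fun r => formFactor (PointCharge.rescale ρ r) k) (𝓝[>] 0) (𝓝 1) := by
  have h1 : Continuous fun r : ℝ => formFactor ρ (r • k) :=
    hρ.continuous_formFactor.comp (by fun_prop)
  have h2 := (h1.tendsto 0).mono_left (nhdsWithin_le_nhds (s := Ioi 0))
  rw [zero_smul, hρ.formFactor_zero] at h2
  refine h2.congr' ?_
  filter_upwards [self_mem_nhdsWithin] with r hr
  exact (formFactor_rescale ρ hr k).symm

end IsDensity

/-! ### The electrostatic energy -/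

theorem green_neg (lam : ℝ) (x : R3) : green lam (-x) = green lam x := by
  rw [green, green, norm_neg]

theorem green_le_green_zero (lam : ℝ) (x : R3) : green lam x ≤ green 0 x := by
  unfold green
  have := Real.pi_pos
  have h1 : 0 ≤ Real.sqrt lam * ‖x‖ := by positivity
  rw [Real.sqrt_zero, neg_zero, zero_mul, neg_mul]
  refine div_le_div_of_nonneg_right (Real.exp_le_exp.2 (by linarith)) (by positivity)

/-- 1 ≤ e^{−s} + s. The Coulomb kernel is thus dominated by an integrable kernel plus a constant. -/
theorem green_zero_le (x : R3) : green 0 x ≤ green 1 x + (4 * Real.pi)⁻¹ := by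
  have hπ := Real.pi_pos
  rcases eq_or_ne x 0 with rfl | hx
  · simp [green]
    positivity
  · have h0 : 0 < ‖x‖ := norm_pos_iff.2 hx
    have h1 := Real.add_one_le_exp (-‖x‖)
    simp only [green, Real.sqrt_zero, Real.sqrt_one, neg_zero, zero_mul, Real.exp_zero, neg_mul, one_mul]
    rw [div_add' _ _ _ (by positivity), div_le_div_iff_of_pos_right (by positivity)]
    field_simp
    linarith

theorem tendsto_green_atTop (x : R3) : Tendsto (fun lam => green lam x) atTop (𝓝 0) := by
  unfold green
  rcases eq_or_ne x 0 with rfl | hx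
  · simp
  · have h0 : 0 < ‖x‖ := norm_pos_iff.2 hx
    have h1 : Tendsto (fun lam => Real.sqrt lam * ‖x‖) atTop atTop :=
      Real.tendsto_sqrt_atTop.atTop_mul_const h0
    have h2 := (Real.tendsto_exp_neg_atTop_nhds_zero.comp h1).div_const (4 * Real.pi * ‖x‖)
    rw [zero_div] at h2
    refine h2.congr fun lam => ?_
    rw [Function.comp_apply, neg_mul]

theorem fourierInv_mul_char (f : R3 → ℂ) (x y : R3) :
    𝓕⁻ f (x - y) = 𝓕 (fun k => Complex.exp (((2 * Real.pi * inner ℝ k x : ℝ) : ℂ) * Complex.I) * f k)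
      y := by
  rw [Real.fourierInv_eq', Real.fourier_eq']
  refine integral_congr_ae (Eventually.of_forall fun k => ?_)
  simp only [smul_eq_mul]
  rw [← mul_assoc, ← Complex.exp_add]
  congr 2
  rw [inner_sub_right]
  push_cast
  ring

theorem integrable_mul_sub {f h : R3 → ℝ} (hf : Integrable f) (hh : Integrable h) :
    Integrable (fun p : R3 × R3 => f p.2 * h (p.1 - p.2)) (volume.prod volume) :=
  Integrable.convolution_integrand (ContinuousLinearMap.mul ℝ ℝ) hf hh

namespace IsDensity

variable {ρ : R3 → ℝ} (hρ : IsDensity ρ)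

include hρ

theorem aestronglyMeasurable_mul_green (lam : ℝ) : AEStronglyMeasurable
    (fun p : R3 × R3 => ρ p.1 * ρ p.2 * green lam (p.1 - p.2)) (volume.prod volume) :=
  (hρ.memLp.1.comp_fst.mul hρ.memLp.1.comp_snd).mul
    ((measurable_green lam).comp measurable_sub).aestronglyMeasurable

/-- ρ(x)ρ(y) ≤ ρ(x)² + ρ(y)², and ρ² convolved with the integrable G₁ is integrable; the constant
left over meets ρ ⊗ ρ. -/
theorem integrable_mul_green_zero : Integrable
    (fun p : R3 × R3 => ρ p.1 * ρ p.2 * green 0 (p.1 - p.2)) (volume.prod volume) := by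
  have h1 := integrable_mul_sub hρ.memLp.integrable_sq (integrable_green one_pos)
  have h2 : Integrable (fun p : R3 × R3 => ρ p.1 ^ 2 * green 1 (p.1 - p.2)) (volume.prod volume) := by
    refine h1.swap.congr (Eventually.of_forall fun p => ?_)
    rw [Function.comp_apply, Prod.fst_swap, Prod.snd_swap, ← green_neg, neg_sub]
  have h3 := (hρ.integrable.mul_prod hρ.integrable).mul_const (4 * Real.pi)⁻¹
  refine ((h1.add h2).add h3).mono' (hρ.aestronglyMeasurable_mul_green 0)
    (Eventually.of_forall fun p => ?_)
  have e1 := hρ.nonneg p.1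
  have e2 := hρ.nonneg p.2
  have e3 := green_nonneg 1 (p.1 - p.2)
  have e4 := green_nonneg 0 (p.1 - p.2)
  have e5 := green_zero_le (p.1 - p.2)
  rw [Real.norm_eq_abs, abs_of_nonneg (by positivity)]
  have e6 : ρ p.1 * ρ p.2 ≤ ρ p.2 ^ 2 + ρ p.1 ^ 2 := by nlinarith [sq_nonneg (ρ p.1 - ρ p.2)]
  calc ρ p.1 * ρ p.2 * green 0 (p.1 - p.2)
      ≤ ρ p.1 * ρ p.2 * (green 1 (p.1 - p.2) + (4 * Real.pi)⁻¹) := by gcongr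
    _ = ρ p.1 * ρ p.2 * green 1 (p.1 - p.2) + ρ p.1 * ρ p.2 * (4 * Real.pi)⁻¹ := mul_add _ _ _
    _ ≤ (ρ p.2 ^ 2 + ρ p.1 ^ 2) * green 1 (p.1 - p.2) + ρ p.1 * ρ p.2 * (4 * Real.pi)⁻¹ := by gcongr
    _ = _ := by
      simp only [Pi.add_apply]
      ring

theorem norm_mul_green_le (lam : ℝ) (p : R3 × R3) :
    ‖ρ p.1 * ρ p.2 * green lam (p.1 - p.2)‖ ≤ ρ p.1 * ρ p.2 * green 0 (p.1 - p.2) := by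
  have e1 := hρ.nonneg p.1
  have e2 := hρ.nonneg p.2
  have e3 := green_nonneg lam (p.1 - p.2)
  rw [Real.norm_eq_abs, abs_of_nonneg (by positivity)]
  have := green_le_green_zero lam (p.1 - p.2)
  gcongr

theorem integrable_mul_green (lam : ℝ) : Integrable
    (fun p : R3 × R3 => ρ p.1 * ρ p.2 * green lam (p.1 - p.2)) (volume.prod volume) :=
  hρ.integrable_mul_green_zero.mono' (hρ.aestronglyMeasurable_mul_green lam)
    (Eventually.of_forall (hρ.norm_mul_green_le lam))

theorem tendsto_integral_mul_green : Tendsto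
    (fun lam => ∫ p : R3 × R3, ρ p.1 * ρ p.2 * green lam (p.1 - p.2) ∂(volume.prod volume))
    atTop (𝓝 0) := by
  have h1 : ∫ p : R3 × R3, (0 : ℝ) ∂((volume : Measure R3).prod (volume : Measure R3)) = 0 :=
    integral_zero _ _
  rw [← h1]
  refine tendsto_integral_filter_of_dominated_convergence _
    (Eventually.of_forall hρ.aestronglyMeasurable_mul_green)
    (Eventually.of_forall fun lam => Eventually.of_forall (hρ.norm_mul_green_le lam))
    hρ.integrable_mul_green_zero (Eventually.of_forall fun p => ?_)
  simpa using (tendsto_green_atTop (p.1 - p.2)).const_mul (ρ p.1 * ρ p.2)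

theorem energy_eq : energy ρ =
    ∫ p : R3 × R3, ρ p.1 * ρ p.2 * green 0 (p.1 - p.2) ∂(volume.prod volume) := by
  rw [energy, integral_prod _ hρ.integrable_mul_green_zero, ← integral_const_mul]
  refine integral_congr_ae (Eventually.of_forall fun x => ?_)
  simp only
  rw [← integral_const_mul]
  refine integral_congr_ae (Eventually.of_forall fun y => ?_)
  simp only [green, Real.sqrt_zero, neg_zero, zero_mul, Real.exp_zero]
  have := Real.pi_ne_zero
  rcases eq_or_ne ‖x - y‖ 0 with h | h
  · simp [h]
  · field_simp

/-- Taken for the difference of kernels, whose symbol is integrable, so that ordinary Fourier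
inversion and the exchange of 𝓕 between two integrable functions suffice. -/
theorem energy_sub {lam : ℝ} (hl : 0 < lam) :
    ((energy ρ - ∫ p : R3 × R3, ρ p.1 * ρ p.2 * green lam (p.1 - p.2) ∂(volume.prod volume) : ℝ) : ℂ)
      = ∫ k, (formFactor ρ k * formFactor ρ k) * dsym lam k := by
  have hd := integrable_dsym hl
  have hφd : Integrable fun k => formFactor ρ k * dsym lam k :=
    hd.bdd_mul (c := 1) hρ.continuous_formFactor.aestronglyMeasurable
      (Eventually.of_forall hρ.norm_formFactor_le)
  rw [hρ.energy_eq, ← integral_sub hρ.integrable_mul_green_zero (hρ.integrable_mul_green lam),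
    integral_prod (fun p : R3 × R3 => ρ p.1 * ρ p.2 * green 0 (p.1 - p.2) -
      ρ p.1 * ρ p.2 * green lam (p.1 - p.2))
      (hρ.integrable_mul_green_zero.sub (hρ.integrable_mul_green lam)), ← integral_complex_ofReal]
  have h1 : ∀ x, ((∫ y, (ρ x * ρ y * green 0 (x - y) - ρ x * ρ y * green lam (x - y)) : ℝ) : ℂ) =
      (ρ x : ℂ) • 𝓕⁻ (fun k => formFactor ρ k * dsym lam k) x := by
    intro x
    rw [← integral_complex_ofReal]
    have h2 : ∫ y, ((ρ x * ρ y * green 0 (x - y) - ρ x * ρ y * green lam (x - y) : ℝ) : ℂ) =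
        ∫ y, (ρ x : ℂ) • ((ρ y : ℂ) • 𝓕 (fun k =>
          Complex.exp (((2 * Real.pi * inner ℝ k x : ℝ) : ℂ) * Complex.I) * dsym lam k) y) := by
      refine integral_congr_ae ?_
      filter_upwards [(quasiMeasurePreserving_sub_left volume x).ae (green_zero_sub_green_ae hl)]
        with y hy
      rw [← fourierInv_mul_char, ← hy, smul_eq_mul, smul_eq_mul]
      push_cast
      ring
    have h3 : Integrable fun k =>
        Complex.exp (((2 * Real.pi * inner ℝ k x : ℝ) : ℂ) * Complex.I) * dsym lam k :=
      hd.bdd_mul (c := 1) (by fun_prop : Continuous fun k : R3 =>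
        Complex.exp (((2 * Real.pi * inner ℝ k x : ℝ) : ℂ) * Complex.I)).aestronglyMeasurable
        (Eventually.of_forall fun k => (Complex.norm_exp_ofReal_mul_I _).le)
    rw [h2, integral_smul, ← integral_fourier_smul hρ.integrable_ofReal h3, Real.fourierInv_eq']
    congr 1
    refine integral_congr_ae (Eventually.of_forall fun k => ?_)
    simp only [smul_eq_mul, formFactor]
    ring
  have h4 : ∫ x, ((∫ y, (ρ x * ρ y * green 0 (x - y) - ρ x * ρ y * green lam (x - y)) : ℝ) : ℂ) =
      ∫ x, (ρ x : ℂ) • 𝓕⁻ (fun k => formFactor ρ k * dsym lam k) x := by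
    simp only [h1]
  refine h4.trans ?_
  rw [← integral_fourierInv_smul hρ.integrable_ofReal hφd]
  refine integral_congr_ae (Eventually.of_forall fun k => ?_)
  simp only [smul_eq_mul]
  rw [hρ.fourierInv_eq_formFactor]
  ring

end IsDensity

/-! ### The energy in Fourier space -/

/-- `∫ |ρ̂|² / (τ + λ)`. -/
def resIntegral (ρ : R3 → ℝ) (lam : ℝ) : ℝ := ∫ k, ‖formFactor ρ k‖ ^ 2 * (tau k + lam)⁻¹

/-- `∫ |ρ̂|² λ / (τ (τ + λ))`. -/
def diffIntegral (ρ : R3 → ℝ) (lam : ℝ) : ℝ :=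
  ∫ k, ‖formFactor ρ k‖ ^ 2 * (lam * ((tau k)⁻¹ * (tau k + lam)⁻¹))

theorem integrable_diff_profile {lam : ℝ} (hl : 0 < lam) :
    Integrable fun k : R3 => lam * ((tau k)⁻¹ * (tau k + lam)⁻¹) := by
  have h := (integrable_dsym hl).re
  exact h

theorem integral_diff_profile {lam : ℝ} (hl : 0 < lam) :
    ∫ k : R3, lam * ((tau k)⁻¹ * (tau k + lam)⁻¹) = Real.sqrt lam / (4 * Real.pi) := by
  have h := integral_dsym hl
  unfold dsym at h
  rw [integral_complex_ofReal] at h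
  exact_mod_cast h

theorem resIntegrand_bound (ρ : R3 → ℝ) {lam : ℝ} (hl : 0 < lam) (k : R3) :
    ‖‖formFactor ρ k‖ ^ 2 * (tau k + lam)⁻¹‖ ≤ lam⁻¹ * ‖formFactor ρ k‖ ^ 2 := by
  have ht := tau_nonneg k
  rw [Real.norm_eq_abs, abs_of_nonneg (by positivity), mul_comm]
  have : (tau k + lam)⁻¹ ≤ lam⁻¹ := inv_anti₀ hl (by linarith)
  gcongr

theorem resIntegral_nonneg (ρ : R3 → ℝ) {lam : ℝ} (hl : 0 < lam) : 0 ≤ resIntegral ρ lam :=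
  integral_nonneg fun k => by have := tau_nonneg k; simp only [Pi.zero_apply]; positivity

namespace IsDensity

variable {ρ : R3 → ℝ} (hρ : IsDensity ρ)

include hρ

theorem formFactor_mul_self (k : R3) :
    formFactor ρ k * formFactor ρ k = ((‖formFactor ρ k‖ ^ 2 : ℝ) : ℂ) := by
  nth_rw 1 [← hρ.conj_formFactor k]
  rw [mul_comm, Complex.mul_conj, Complex.normSq_eq_norm_sq]

theorem sq_norm_formFactor_le (k : R3) : ‖formFactor ρ k‖ ^ 2 ≤ 1 :=
  pow_le_one₀ (norm_nonneg _) (hρ.norm_formFactor_le k)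

theorem integrable_sq_norm_formFactor : Integrable fun k => ‖formFactor ρ k‖ ^ 2 :=
  (memLp_two_iff_integrable_sq_norm hρ.memLp_formFactor.1).1 hρ.memLp_formFactor

theorem measurable_formFactor : Measurable (formFactor ρ) := hρ.continuous_formFactor.measurable

theorem integrable_resIntegrand {lam : ℝ} (hl : 0 < lam) :
    Integrable fun k => ‖formFactor ρ k‖ ^ 2 * (tau k + lam)⁻¹ := by
  have h1 := hρ.measurable_formFactor
  have h2 := continuous_tau.measurable
  exact (hρ.integrable_sq_norm_formFactor.const_mul lam⁻¹).mono'
    (by fun_prop : Measurable fun k => ‖formFactor ρ k‖ ^ 2 * (tau k + lam)⁻¹).aestronglyMeasurable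
    (Eventually.of_forall (resIntegrand_bound ρ hl))

theorem resIntegral_le {lam : ℝ} (hl : 0 < lam) :
    resIntegral ρ lam ≤ lam⁻¹ * ∫ k, ‖formFactor ρ k‖ ^ 2 := by
  rw [resIntegral, ← integral_const_mul]
  exact integral_mono (hρ.integrable_resIntegrand hl) (hρ.integrable_sq_norm_formFactor.const_mul _)
    fun k => (le_abs_self _).trans (resIntegrand_bound ρ hl k)

theorem diffIntegrand_bound {lam : ℝ} (hl : 0 < lam) (k : R3) :
    ‖‖formFactor ρ k‖ ^ 2 * (lam * ((tau k)⁻¹ * (tau k + lam)⁻¹))‖ ≤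
      lam * ((tau k)⁻¹ * (tau k + lam)⁻¹) := by
  have ht := tau_nonneg k
  rw [Real.norm_eq_abs, abs_of_nonneg (by positivity)]
  exact mul_le_of_le_one_left (by positivity) (hρ.sq_norm_formFactor_le k)

theorem aestronglyMeasurable_diffIntegrand (lam : ℝ) : AEStronglyMeasurable
    (fun k => ‖formFactor ρ k‖ ^ 2 * (lam * ((tau k)⁻¹ * (tau k + lam)⁻¹))) volume := by
  have h1 := hρ.measurable_formFactor
  have h2 := continuous_tau.measurable
  exact Measurable.aestronglyMeasurable (by fun_prop)

theorem integrable_diffIntegrand {lam : ℝ} (hl : 0 < lam) :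
    Integrable fun k => ‖formFactor ρ k‖ ^ 2 * (lam * ((tau k)⁻¹ * (tau k + lam)⁻¹)) :=
  (integrable_diff_profile hl).mono' (hρ.aestronglyMeasurable_diffIntegrand lam)
    (Eventually.of_forall (hρ.diffIntegrand_bound hl))

theorem energy_sub_eq_diffIntegral {lam : ℝ} (hl : 0 < lam) :
    energy ρ - ∫ p : R3 × R3, ρ p.1 * ρ p.2 * green lam (p.1 - p.2) ∂(volume.prod volume) =
      diffIntegral ρ lam := by
  have h := hρ.energy_sub hl
  simp only [hρ.formFactor_mul_self, dsym, ← Complex.ofReal_mul] at h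
  rw [integral_complex_ofReal] at h
  exact_mod_cast h

/-- Both integrands add up to |ρ̂|²/τ. -/
theorem diffIntegral_add_resIntegral {lam mu : ℝ} (hl : 0 < lam) (hm : 0 < mu) :
    diffIntegral ρ lam + resIntegral ρ lam = diffIntegral ρ mu + resIntegral ρ mu := by
  unfold diffIntegral resIntegral
  rw [← integral_add (hρ.integrable_diffIntegrand hl) (hρ.integrable_resIntegrand hl),
    ← integral_add (hρ.integrable_diffIntegrand hm) (hρ.integrable_resIntegrand hm)]
  refine integral_congr_ae ?_
  filter_upwards [Measure.ae_ne volume (0 : R3)] with k hk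
  have ht := tau_pos hk
  field_simp
  ring

/-- The sum on the right does not depend on λ, so its distance from the energy can be computed at
any μ. There it is ∬ ρρG_μ minus `resIntegral`, and both vanish as μ → ∞. -/
theorem energy_eq_add {lam : ℝ} (hl : 0 < lam) :
    energy ρ = diffIntegral ρ lam + resIntegral ρ lam := by
  have h1 : Tendsto (fun mu => (∫ p : R3 × R3, ρ p.1 * ρ p.2 * green mu (p.1 - p.2)
      ∂(volume.prod volume)) - resIntegral ρ mu) atTop (𝓝 0) := by
    have h2 : Tendsto (fun mu => resIntegral ρ mu) atTop (𝓝 0) := by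
      have h3 : Tendsto (fun mu : ℝ => mu⁻¹ * ∫ k, ‖formFactor ρ k‖ ^ 2) atTop (𝓝 0) := by
        simpa using tendsto_inv_atTop_zero.mul_const (∫ k, ‖formFactor ρ k‖ ^ 2)
      refine squeeze_zero' ?_ ?_ h3
      · filter_upwards [eventually_gt_atTop 0] with mu hmu using resIntegral_nonneg ρ hmu
      · filter_upwards [eventually_gt_atTop 0] with mu hmu using hρ.resIntegral_le hmu
    simpa using hρ.tendsto_integral_mul_green.sub h2
  have h2 : (fun _ : ℝ => energy ρ - (diffIntegral ρ lam + resIntegral ρ lam)) =ᶠ[atTop]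
      fun mu => (∫ p : R3 × R3, ρ p.1 * ρ p.2 * green mu (p.1 - p.2)
      ∂(volume.prod volume)) - resIntegral ρ mu := by
    filter_upwards [eventually_gt_atTop 0] with mu hmu
    have h3 := hρ.energy_sub_eq_diffIntegral hmu
    have h4 := hρ.diffIntegral_add_resIntegral hl hmu
    linarith
  have h3 := tendsto_nhds_unique (tendsto_const_nhds.congr' h2) h1
  linarith

theorem tendsto_diffIntegral {lam : ℝ} (hl : 0 < lam) :
    Tendsto (fun r => diffIntegral (PointCharge.rescale ρ r) lam) (𝓝[>] 0)
      (𝓝 (Real.sqrt lam / (4 * Real.pi))) := by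
  rw [← integral_diff_profile hl]
  refine tendsto_integral_filter_of_dominated_convergence _ ?_ ?_ (integrable_diff_profile hl) ?_
  · filter_upwards [self_mem_nhdsWithin] with r hr
    exact (hρ.rescale hr).aestronglyMeasurable_diffIntegrand lam
  · filter_upwards [self_mem_nhdsWithin] with r hr
    exact Eventually.of_forall ((hρ.rescale hr).diffIntegrand_bound hl)
  · refine Eventually.of_forall fun k => ?_
    have := ((hρ.tendsto_formFactor_rescale k).norm.pow 2).mul_const
      (lam * ((tau k)⁻¹ * (tau k + lam)⁻¹))
    simpa using this

end IsDensity

/-! ### Finite rank perturbations -/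

section Perturbation

variable {E F : Type*} [NormedAddCommGroup E] [InnerProductSpace ℂ E] [CompleteSpace E]
  [NormedAddCommGroup F] [InnerProductSpace ℂ F] [CompleteSpace F]

/-- Krein's formula. As D†RD is the scalar β, inverting 1/κ + D†RD is a division, and all the
algebra reduces to (κ⁻¹ + β)⁻¹(κβ + 1) = κ. -/
theorem isResolventAt_vadd {T : E →ₗ.[ℂ] E} {z : ℂ} {R : E →L[ℂ] E} (h : IsResolventAt T z R)
    {D : F →L[ℂ] E} {B : E →ₗ[ℂ] E} {κ β : ℂ} (hB : ∀ x, B x = κ • D (D.adjoint x)) (hκ : κ ≠ 0)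
    (hD : ∀ Q, D.adjoint (R (D Q)) = β • Q) (hd : κ⁻¹ + β ≠ 0) :
    IsResolventAt (B +ᵥ T) z (R - (κ⁻¹ + β)⁻¹ • (R ∘L D ∘L D.adjoint ∘L R)) := by
  have hS : ∀ x, (R - (κ⁻¹ + β)⁻¹ • (R ∘L D ∘L D.adjoint ∘L R)) x =
      R (x - (κ⁻¹ + β)⁻¹ • D (D.adjoint (R x))) := fun x => by
    rw [map_sub, map_smul]
    rfl
  have he : (κ⁻¹ + β)⁻¹ * (κ * β + 1) = κ := by
    rw [inv_mul_eq_iff_eq_mul₀ hd]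
    field_simp
    ring
  constructor
  · intro x
    obtain ⟨h1, h2⟩ := h.1 (x - (κ⁻¹ + β)⁻¹ • D (D.adjoint (R x)))
    rw [← hS] at h1
    refine ⟨h1, ?_⟩
    have h3 : (B +ᵥ T) ⟨_, h1⟩ = B ((R - (κ⁻¹ + β)⁻¹ • (R ∘L D ∘L D.adjoint ∘L R)) x) + T ⟨_, h1⟩ :=
      rfl
    simp only [← hS] at h2
    rw [h3, add_sub_assoc, h2, hB, hS, map_sub, map_sub, map_smul, map_smul, hD, map_sub, map_smul,
      map_smul, smul_sub, smul_smul, smul_smul]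
    have h4 : κ - κ * (κ⁻¹ + β)⁻¹ * β - (κ⁻¹ + β)⁻¹ = 0 := by linear_combination -he
    have h5 : κ • D (D.adjoint (R x)) - (κ * (κ⁻¹ + β)⁻¹ * β) • D (D.adjoint (R x)) +
        (x - (κ⁻¹ + β)⁻¹ • D (D.adjoint (R x))) =
        x + (κ - κ * (κ⁻¹ + β)⁻¹ * β - (κ⁻¹ + β)⁻¹) • D (D.adjoint (R x)) := by module
    rw [h5, h4, zero_smul, add_zero]
  · intro x
    have h1 : (B +ᵥ T) x - z • (x : E) = κ • D (D.adjoint x) + (T x - z • (x : E)) := by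
      have h3 : (B +ᵥ T) x = B x + T x := rfl
      rw [h3, hB, add_sub_assoc]
    have h2 : R (κ • D (D.adjoint x) + (T x - z • (x : E))) = κ • R (D (D.adjoint x)) + x := by
      rw [map_add, map_smul]
      congr 1
      exact h.2 x
    have h6 : D.adjoint (κ • R (D (D.adjoint x)) + x) = (κ * β + 1) • D.adjoint x := by
      rw [map_add, map_smul, hD]
      module
    rw [hS, h1, map_sub, h2, map_smul, h6, map_smul, map_smul, smul_smul, he]
    abel

theorem comp_adjoint_comp {R : E →L[ℂ] E} (hR : IsSelfAdjoint R) (D : F →L[ℂ] E) :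
    R ∘L D ∘L D.adjoint ∘L R = (R ∘L D) ∘L (R ∘L D).adjoint := by
  have h : R.adjoint = R := hR.star_eq
  rw [ContinuousLinearMap.adjoint_comp, h]
  rfl

theorem isSelfAdjoint_sub_smul {R : E →L[ℂ] E} (hR : IsSelfAdjoint R) (D : F →L[ℂ] E) (g : ℝ) :
    IsSelfAdjoint (R - (g : ℂ) • (D ∘L D.adjoint)) :=
  hR.sub (isSelfAdjoint_real_smul_comp_adjoint g D)

end Perturbation

/-! ### The regularized operators -/

theorem isResolventAt_negLaplacian {lam : ℝ} (hl : 0 < lam) :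
    IsResolventAt negLaplacian ((-lam : ℝ) : ℂ) (freeRes lam hl) := by
  constructor
  · intro f
    refine ⟨(mem_Hstar_two_iff hl _).2 ⟨f, rfl⟩, ?_⟩
    rw [Complex.ofReal_neg, neg_smul, sub_neg_eq_add]
    exact negLaplacian_freeRes hl _ rfl
  · intro A
    obtain ⟨f, hf⟩ := (mem_Hstar_two_iff hl (A : L2star)).1 A.2
    have h1 := negLaplacian_freeRes hl A.2 hf
    rw [Complex.ofReal_neg, neg_smul, sub_neg_eq_add]
    exact (congrArg (freeRes lam hl) h1).trans hf.symm

theorem BddMeas.memLp_mul {g h : R3 → ℂ} (hg : BddMeas g) (hh : MemLp h 2 volume) :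
    MemLp (fun k => g k * h k) 2 volume := by
  obtain ⟨hm, C, hC⟩ := hg
  refine MemLp.of_le_mul (c := C) hh (hm.aestronglyMeasurable.mul hh.1)
    (Eventually.of_forall fun k => ?_)
  rw [norm_mul]
  gcongr
  exact hC k

theorem fmul_gmap {g h : R3 → ℂ} (hg : BddMeas g) (hh : MemLp h 2 volume) (Q : C3) :
    fmul g hg (gmap h hh Q) = gmap (fun k => g k * h k) (hg.memLp_mul hh) Q := by
  refine hat_ext ?_
  filter_upwards [hat_fmul hg (gmap h hh Q), hat_gmap hh Q, hat_gmap (hg.memLp_mul hh) Q]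
    with k h1 h2 h3
  rw [h1, h2, h3, smul_smul]

theorem norm_gmap_sub_le {h h' : R3 → ℂ} (hh : MemLp h 2 volume) (hh' : MemLp h' 2 volume) :
    ‖gmap h hh - gmap h' hh'‖ ≤ Real.sqrt (∫ k, ‖h k - h' k‖ ^ 2) := by
  refine ContinuousLinearMap.opNorm_le_bound _ (Real.sqrt_nonneg _) fun Q => ?_
  refine le_of_sq_le_sq ?_ (by positivity)
  have hi : Integrable fun k => ‖h k - h' k‖ ^ 2 :=
    (memLp_two_iff_integrable_sq_norm (hh.sub hh').1).1 (hh.sub hh')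
  rw [mul_pow, Real.sq_sqrt (integral_nonneg fun k => sq_nonneg _), ← integral_mul_const,
    normSq_eq_integral_hat]
  refine integral_mono_ae (integrable_normSq_hat _) (hi.mul_const _) ?_
  filter_upwards [hat_sub (gmap h hh Q) (gmap h' hh' Q), hat_gmap hh Q, hat_gmap hh' Q]
    with k h1 h2 h3
  rw [sub_apply, h1, h2, h3, ← sub_smul, norm_smul, mul_pow]
  have := norm_transverse_le k Q
  gcongr

namespace IsDensity

variable {ρ : R3 → ℝ} (hρ : IsDensity ρ)

include hρ

theorem M_toL2 (Q : C3) : M (toL2 fun x => (ρ x : ℂ) • Q) = gmap _ hρ.memLp_formFactor Q := by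
  refine hat_ext ?_
  filter_upwards [hat_gmap hρ.memLp_formFactor Q, hat_M (toL2 fun x => (ρ x : ℂ) • Q),
    hρ.fourier_toL2 Q] with k h1 h2 h3
  rw [h1, h2, h3, transverse_smul]

/-- M ρ ⊗ ρ has the form D D† with D the map Q ↦ M ρ Q; the three terms of the tensor are the
components along the standard basis. -/
theorem M_rhoTensor (A : L2star) : M (rhoTensor ρ (A : L2)) =
    gmap _ hρ.memLp_formFactor ((gmap _ hρ.memLp_formFactor).adjoint A) := by
  have h1 : ∀ Q : C3, inner ℂ (toL2 fun x => (ρ x : ℂ) • Q) (A : L2) =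
      inner ℂ Q ((gmap _ hρ.memLp_formFactor).adjoint A) := by
    intro Q
    rw [ContinuousLinearMap.adjoint_inner_right, ← hρ.M_toL2]
    exact (Submodule.inner_orthogonalProjectionOnto_eq_of_mem_right A _).symm
  have h2 := (EuclideanSpace.basisFun (Fin 3) ℂ).sum_repr
    ((gmap _ hρ.memLp_formFactor).adjoint A)
  nth_rw 1 [← h2]
  rw [rhoTensor, LinearMap.coe_mk, AddHom.coe_mk, map_sum, map_sum]
  refine Finset.sum_congr rfl fun j _ => ?_
  rw [map_smul, map_smul, hρ.M_toL2, h1, OrthonormalBasis.repr_apply_apply,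
    EuclideanSpace.basisFun_apply]

theorem adjoint_gmap_freeRes {lam : ℝ} (hl : 0 < lam) (Q : C3) :
    (gmap _ hρ.memLp_formFactor).adjoint (freeRes lam hl (gmap _ hρ.memLp_formFactor Q)) =
      ((2 / 3 * resIntegral ρ lam : ℝ) : ℂ) • Q := by
  have hr : IsRadial fun k => res lam k * formFactor ρ k := fun k k' h => by
    simp only
    rw [isRadial_res lam k k' h, hρ.isRadial_formFactor k k' h]
  rw [freeRes, fmul_gmap, adjoint_gmap_gmap _ _ hρ.isRadial_formFactor hr]
  congr 1
  rw [resIntegral, Complex.ofReal_mul, ← integral_complex_ofReal]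
  congr 1
  · push_cast
    rfl
  refine integral_congr_ae (Eventually.of_forall fun k => ?_)
  simp only
  rw [hρ.conj_formFactor, mul_left_comm, hρ.formFactor_mul_self, res, ← Complex.ofReal_mul, mul_comm]

end IsDensity

/-! ### Norm resolvent convergence -/

/-- The inverse coupling constant of the resolvent of `H_r` at `-λ`. -/
def regCoupling (e c m : ℝ) (ρ : R3 → ℝ) (lam r : ℝ) : ℝ :=
  renMass e c m ρ r * c ^ 2 / (4 * Real.pi * e ^ 2) + 2 / 3 * resIntegral (rescale ρ r) lam

theorem tendsto_sub_smul_comp_adjoint {E F ι : Type*} [NormedAddCommGroup E] [InnerProductSpace ℂ E]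
    [CompleteSpace E] [NormedAddCommGroup F] [InnerProductSpace ℂ F] [CompleteSpace F] {l : Filter ι}
    {X : ι → F →L[ℂ] E} {X' : F →L[ℂ] E} (R : E →L[ℂ] E) {g : ι → ℝ} {g' : ℝ}
    (hg : Tendsto g l (𝓝 g')) (hX : Tendsto (fun i => ‖X i - X'‖) l (𝓝 0)) :
    Tendsto (fun i => R - (g i : ℂ) • (X i ∘L (X i).adjoint)) l
      (𝓝 (R - (g' : ℂ) • (X' ∘L X'.adjoint))) := by
  have h1 : Tendsto X l (𝓝 X') := tendsto_iff_norm_sub_tendsto_zero.2 hX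
  have h2 : Tendsto (fun i => (X i).adjoint) l (𝓝 X'.adjoint) :=
    ((ContinuousLinearMap.adjoint (𝕜 := ℂ) (E := F) (F := E)).continuous.tendsto _).comp h1
  have h3 : Continuous fun p : (F →L[ℂ] E) × (E →L[ℂ] F) => p.1 ∘L p.2 :=
    continuous_fst.clm_comp continuous_snd
  exact tendsto_const_nhds.sub (((Complex.continuous_ofReal.tendsto _).comp hg).smul
    ((h3.tendsto _).comp (h1.prodMk_nhds h2)))

section

variable {e c m : ℝ} (he : e ≠ 0) (hc : 0 < c) {ρ : R3 → ℝ} (hρ : IsDensity ρ)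

include he hc hρ

theorem isResolventAt_Hreg {r : ℝ} (hr : 0 < r) (hm : renMass e c m ρ r ≠ 0) {lam : ℝ} (hl : 0 < lam)
    (hd : regCoupling e c m ρ lam r ≠ 0) :
    IsResolventAt (Hreg e c m ρ r) ((-lam : ℝ) : ℂ) (freeRes lam hl -
      (((regCoupling e c m ρ lam r)⁻¹ : ℝ) : ℂ) •
        ((freeRes lam hl ∘L gmap _ (hρ.rescale hr).memLp_formFactor) ∘L
          (freeRes lam hl ∘L gmap _ (hρ.rescale hr).memLp_formFactor).adjoint)) := by
  have hπ := Real.pi_pos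
  have hκ : ((4 * Real.pi * e ^ 2 / (renMass e c m ρ r * c ^ 2) : ℝ) : ℂ) ≠ 0 := by
    rw [Complex.ofReal_ne_zero]
    have := hc.ne'
    positivity
  have hdd : (((4 * Real.pi * e ^ 2 / (renMass e c m ρ r * c ^ 2) : ℝ) : ℂ))⁻¹ +
      ((2 / 3 * resIntegral (rescale ρ r) lam : ℝ) : ℂ) =
      ((regCoupling e c m ρ lam r : ℝ) : ℂ) := by
    rw [regCoupling, ← Complex.ofReal_inv, ← Complex.ofReal_add, inv_div]
  have h := isResolventAt_vadd (isResolventAt_negLaplacian hl)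
    (D := gmap _ (hρ.rescale hr).memLp_formFactor)
    (B := (((4 * Real.pi * e ^ 2 / (renMass e c m ρ r * c ^ 2) : ℝ) : ℂ) •
      (M.toLinearMap ∘ₗ rhoTensor (rescale ρ r) ∘ₗ L2star.subtype)))
    (fun x => congrArg (fun v => ((4 * Real.pi * e ^ 2 / (renMass e c m ρ r * c ^ 2) : ℝ) : ℂ) • v)
      ((hρ.rescale hr).M_rhoTensor x)) hκ ((hρ.rescale hr).adjoint_gmap_freeRes hl)
    (by rw [hdd, Complex.ofReal_ne_zero]; exact hd)
  rw [hdd, comp_adjoint_comp (isSelfAdjoint_freeRes hl), ← Complex.ofReal_inv] at h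
  exact h

theorem isSelfAdjoint_Hreg {r : ℝ} (hr : 0 < r) (hm : renMass e c m ρ r ≠ 0) :
    IsSelfAdjoint (Hreg e c m ρ r) := by
  have hπ := Real.pi_pos
  obtain ⟨K, hK⟩ : ∃ K, K = renMass e c m ρ r * c ^ 2 / (4 * Real.pi * e ^ 2) := ⟨_, rfl⟩
  have hK0 : 0 < |K| := by
    rw [hK, abs_pos]
    have := hc.ne'
    positivity
  obtain ⟨N, hN⟩ : ∃ N, N = ∫ k, ‖formFactor (rescale ρ r) k‖ ^ 2 := ⟨_, rfl⟩
  have hN0 : 0 ≤ N := hN ▸ integral_nonneg fun k => sq_nonneg _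
  -- `resIntegral` is at most N/λ = |K| N/(N + 1) < |K|, so the two terms of the coupling cannot
  -- cancel.
  obtain ⟨lam, hlam⟩ : ∃ lam, lam = (N + 1) / |K| := ⟨_, rfl⟩
  have hl : 0 < lam := by rw [hlam]; positivity
  have h1 := resIntegral_nonneg (rescale ρ r) hl
  have h2 : resIntegral (rescale ρ r) lam < |K| := by
    refine ((hρ.rescale hr).resIntegral_le hl).trans_lt ?_
    rw [← hN, hlam, inv_div, div_mul_eq_mul_div, div_lt_iff₀ (by positivity)]
    nlinarith
  have hd : regCoupling e c m ρ lam r ≠ 0 := by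
    intro h0
    rw [regCoupling, ← hK] at h0
    have h3 : |K| = 2 / 3 * resIntegral (rescale ρ r) lam := by
      rw [eq_neg_of_add_eq_zero_left h0, abs_neg, abs_of_nonneg (by positivity)]
    linarith
  exact (isResolventAt_Hreg he hc hρ hr hm hl hd).isSelfAdjoint
    (isSelfAdjoint_sub_smul (isSelfAdjoint_freeRes hl) _ _)

/-- The renormalized mass subtracts (2/3)E(ρ_r), and E(ρ_r) − `resIntegral` = `diffIntegral` has the
finite limit √λ/(4π): the divergences cancel. -/
theorem tendsto_regCoupling {lam : ℝ} (hl : 0 < lam) :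
    Tendsto (regCoupling e c m ρ lam) (𝓝[>] 0) (𝓝 (-GammaM e c m lam)) := by
  have hπ := Real.pi_pos
  have h1 : ∀ᶠ r in 𝓝[>] (0 : ℝ), m * c ^ 2 / (4 * Real.pi * e ^ 2) -
      2 / 3 * diffIntegral (rescale ρ r) lam = regCoupling e c m ρ lam r := by
    filter_upwards [self_mem_nhdsWithin] with r hr
    rw [regCoupling, renMass, (hρ.rescale hr).energy_eq_add hl]
    field_simp
    ring
  have h2 : -GammaM e c m lam = m * c ^ 2 / (4 * Real.pi * e ^ 2) -
      2 / 3 * (Real.sqrt lam / (4 * Real.pi)) := by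
    rw [GammaM]
    field_simp
    ring
  rw [h2]
  exact (((hρ.tendsto_diffIntegral hl).const_mul _).const_sub _).congr' h1

/-- Zero mass would make the coupling (2/3) `resIntegral`, which is nonnegative, whereas it tends to
−Γ_m < 0 at the reference parameter. -/
theorem eventually_renMass_ne_zero (hm : 0 < m) :
    ∀ᶠ r in 𝓝[>] (0 : ℝ), renMass e c m ρ r ≠ 0 := by
  have hl := refRate_pos he hc hm
  have h1 := tendsto_regCoupling (m := m) he hc hρ hl
  have hg := GammaM_refRate_pos he hc hm
  filter_upwards [h1.eventually (gt_mem_nhds (neg_lt_zero.2 hg))] with r hr h0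
  rw [regCoupling, h0, zero_mul, zero_div, zero_add] at hr
  have := resIntegral_nonneg (rescale ρ r) hl
  linarith

omit he hc in
theorem tendsto_integral_formFactor {lam : ℝ} (hl : 0 < lam) :
    Tendsto (fun r => ∫ k, ‖res lam k * formFactor (rescale ρ r) k - res lam k‖ ^ 2) (𝓝[>] 0)
      (𝓝 0) := by
  have hres := (memLp_two_iff_integrable_sq_norm (memLp_res hl).1).1 (memLp_res hl)
  have h0 : ∫ _ : R3, (0 : ℝ) = 0 := integral_zero _ _
  suffices h1 : Tendsto (fun r => ∫ k, ‖res lam k * formFactor (rescale ρ r) k - res lam k‖ ^ 2)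
      (𝓝[>] 0) (𝓝 (∫ _ : R3, (0 : ℝ))) by rwa [h0] at h1
  -- The form factor differs from 1 by at most 2, whence the factor 4.
  refine tendsto_integral_filter_of_dominated_convergence (fun k => 4 * ‖res lam k‖ ^ 2) ?_ ?_
    (hres.const_mul 4) (Eventually.of_forall fun k => ?_)
  · filter_upwards [self_mem_nhdsWithin] with r hr
    have h1 := (hρ.rescale hr).continuous_formFactor
    have h2 := continuous_res hl
    exact Continuous.aestronglyMeasurable (by fun_prop)
  · filter_upwards [self_mem_nhdsWithin] with r hr
    refine Eventually.of_forall fun k => ?_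
    have h1 := (hρ.rescale hr).norm_formFactor_le k
    rw [Real.norm_eq_abs, abs_of_nonneg (sq_nonneg _), ← mul_sub_one, norm_mul, mul_pow, mul_comm]
    have h2 : ‖formFactor (rescale ρ r) k - 1‖ ≤ 2 := by
      refine (norm_sub_le _ _).trans ?_
      rw [norm_one]
      linarith
    have h3 : ‖formFactor (rescale ρ r) k - 1‖ ^ 2 ≤ 4 := by
      nlinarith [norm_nonneg (formFactor (rescale ρ r) k - 1)]
    gcongr
  · have h1 := ((((hρ.tendsto_formFactor_rescale k).const_mul (res lam k)).sub_const (res lam k)).norm).pow 2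
    simpa using h1

theorem normResolventTendsto_Hreg (hm : 0 < m) :
    NormResolventTendsto (Hreg e c m ρ) (𝓝[>] 0) (hamiltonian he hc hm) := by
  have hl := refRate_pos he hc hm
  have hg := GammaM_refRate_pos he hc hm
  obtain ⟨X, hX⟩ : ∃ X : ℝ → C3 →L[ℂ] L2star, ∀ r (hr : 0 < r),
      X r = freeRes _ hl ∘L gmap _ (hρ.rescale hr).memLp_formFactor := by
    classical
    exact ⟨fun r => if hr : 0 < r then freeRes _ hl ∘L gmap _ (hρ.rescale hr).memLp_formFactor else 0,
      fun r hr => dif_pos hr⟩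
  have hXt : Tendsto (fun r => ‖X r - chargeMap _ hl‖) (𝓝[>] 0) (𝓝 0) := by
    have h1 := (tendsto_integral_formFactor hρ hl).sqrt
    rw [Real.sqrt_zero] at h1
    refine squeeze_zero' (Eventually.of_forall fun r => ContinuousLinearMap.opNorm_nonneg _) ?_ h1
    filter_upwards [self_mem_nhdsWithin] with r hr
    have h2 : X r = gmap _ ((bddMeas_res hl).memLp_mul (hρ.rescale hr).memLp_formFactor) := by
      rw [hX r hr]
      ext1 Q
      exact fmul_gmap (bddMeas_res hl) _ Q
    rw [h2]
    exact norm_gmap_sub_le _ _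
  have hdt := tendsto_regCoupling (m := m) he hc hρ hl
  refine normResolventTendsto_of_real (s := -refRate e c m)
    (S := fun r => freeRes _ hl - (((regCoupling e c m ρ (refRate e c m) r)⁻¹ : ℝ) : ℂ) •
      (X r ∘L (X r).adjoint))
    (S' := pointRes _ hl (GammaM e c m (refRate e c m))) ?_ (isResolventAt_pointOp hl hg)
    (isSelfAdjoint_pointRes hl _) ?_
  · filter_upwards [self_mem_nhdsWithin, eventually_renMass_ne_zero he hc hρ hm,
      hdt.eventually_ne (neg_ne_zero.2 hg.ne')] with r hr h1 h2
    refine ⟨?_, isSelfAdjoint_sub_smul (isSelfAdjoint_freeRes hl) _ _⟩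
    rw [hX r hr]
    exact isResolventAt_Hreg he hc hρ hr h1 hl h2
  -- The limit coupling is −Γ_m, so the minus sign of Krein's formula becomes the plus sign of
  -- `pointRes`.
  · have h1 : pointRes _ hl (GammaM e c m (refRate e c m)) = freeRes _ hl -
        (((-GammaM e c m (refRate e c m))⁻¹ : ℝ) : ℂ) •
          (chargeMap _ hl ∘L (chargeMap _ hl).adjoint) := by
      rw [pointRes, inv_neg, Complex.ofReal_neg, neg_smul, sub_neg_eq_add]
    rw [h1]
    exact tendsto_sub_smul_comp_adjoint _ (hdt.inv₀ (neg_ne_zero.2 hg.ne')) hXt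

end

end PointCharge

end

theorem theorem3p1 (e c m : ℝ) (he : e ≠ 0) (hc : 0 < c) (hm : 0 < m) :
    ∃ Hm : PointCharge.L2star →ₗ.[ℂ] PointCharge.L2star,
      IsSelfAdjoint Hm ∧
      -- convergence of the regularized operators in norm resolvent sense
      (∀ ρ : PointCharge.R3 → ℝ, MemLp ρ 2 volume → (∀ x, 0 ≤ ρ x) → ∫ x, ρ x = 1 →
        Bornology.IsBounded (Function.support ρ) → (∀ x y, ‖x‖ = ‖y‖ → ρ x = ρ y) →
        (∀ r > 0, PointCharge.renMass e c m ρ r ≠ 0 →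
          IsSelfAdjoint (PointCharge.Hreg e c m ρ r)) ∧
        PointCharge.WeaklyTendstoDelta ρ ∧
        (∀ᶠ r in 𝓝[>] (0 : ℝ), PointCharge.renMass e c m ρ r ≠ 0) ∧
        PointCharge.NormResolventTendsto (PointCharge.Hreg e c m ρ) (𝓝[>] 0) Hm) ∧
      -- domain and action
      (∀ lam > 0, ∀ A : PointCharge.L2star, A ∈ Hm.domain ↔
        ∃ Q : PointCharge.C3, PointCharge.regPart e c lam A Q ∈ PointCharge.Hstar 2 ∧
          PointCharge.BoundaryCondition e c m A Q) ∧
      (∀ lam > 0, ∀ (A : Hm.domain) (Q : PointCharge.C3)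
        (hQ : PointCharge.regPart e c lam A Q ∈ PointCharge.Hstar 2),
        PointCharge.BoundaryCondition e c m A Q →
        Hm A + (lam : ℂ) • (A : PointCharge.L2star) =
          PointCharge.negLaplacian ⟨PointCharge.regPart e c lam A Q, hQ⟩ +
            (lam : ℂ) • PointCharge.regPart e c lam A Q) ∧
      -- spectrum
      PointCharge.essentialSpectrum Hm = Complex.ofReal '' Ici 0 ∧
      PointCharge.acSpectrum Hm = Complex.ofReal '' Ici 0 ∧
      PointCharge.scSpectrum Hm = ∅ ∧
      PointCharge.pointSpectrum Hm = {((-PointCharge.lam0 e c m : ℝ) : ℂ)} ∧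
      Module.finrank ℂ (PointCharge.eigenspace Hm ((-PointCharge.lam0 e c m : ℝ) : ℂ)) = 3 ∧
      (∀ b : OrthonormalBasis (Fin 3) ℂ PointCharge.C3,
        Orthonormal ℂ (fun j => ((3 * Real.sqrt (2 * Real.pi * m) * (c / e) : ℝ) : ℂ) •
          PointCharge.MQG (PointCharge.lam0 e c m) (b j)) ∧
        Submodule.span ℂ (Set.range fun j =>
          ((3 * Real.sqrt (2 * Real.pi * m) * (c / e) : ℝ) : ℂ) •
            PointCharge.MQG (PointCharge.lam0 e c m) (b j)) =
          PointCharge.eigenspace Hm ((-PointCharge.lam0 e c m : ℝ) : ℂ)) ∧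
      -- quadratic form
      (∃ γ : ℝ, ∀ A : Hm.domain, γ * ‖(A : PointCharge.L2star)‖ ^ 2 ≤
        (inner ℂ (A : PointCharge.L2star) (Hm A)).re) ∧
      (∀ lam > 0, ∀ A : PointCharge.L2star, (∃ v, PointCharge.HasFormValue Hm A v) ↔
        ∃ Q : PointCharge.C3, PointCharge.regPart e c lam A Q ∈ PointCharge.Hstar 1) ∧
      (∀ lam > 0, ∀ (A : PointCharge.L2star) (v : ℝ), PointCharge.HasFormValue Hm A v →
        ∀ Q : PointCharge.C3, PointCharge.regPart e c lam A Q ∈ PointCharge.Hstar 1 →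
        (∃ B : PointCharge.L2,
          PointCharge.IsSqrtFree lam (PointCharge.regPart e c lam A Q) B ∧
          v + lam * ‖A‖ ^ 2 =
            ‖B‖ ^ 2 + (4 * Real.pi * e / c) ^ 2 * PointCharge.GammaM e c m lam * ‖Q‖ ^ 2) ∧
        -- the charge
        (∃ S : ℝ → PointCharge.C3, PointCharge.HasSphereMeans (A : PointCharge.L2) S ∧
          Tendsto (fun r : ℝ => ((3 * c / (2 * e) : ℝ) : ℂ) • (r : ℂ) • S r) (𝓝[>] 0) (𝓝 Q)) ∧
        -- real fields have real charges
        (PointCharge.IsRealField A → ∀ i, (Q i).im = 0)) ∧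
      -- `Hm` maps real fields to real fields
      (∀ A : Hm.domain, PointCharge.IsRealField (A : PointCharge.L2star) →
        PointCharge.IsRealField (Hm A : PointCharge.L2star)) := by
  refine ⟨PointCharge.hamiltonian he hc hm, PointCharge.isSelfAdjoint_pointOp _ _,
    fun ρ h1 h2 h3 h4 h5 => ?_, fun lam hl A => PointCharge.mem_domain_pointOp_iff he hc _ _ hl A,
    fun lam hl A Q hQ h => PointCharge.pointOp_apply he hc _ _ hl A Q hQ h,
    (PointCharge.spectra_hamiltonian he hc hm).1, (PointCharge.spectra_hamiltonian he hc hm).2.1,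
    (PointCharge.spectra_hamiltonian he hc hm).2.2.1,
    (PointCharge.spectra_hamiltonian he hc hm).2.2.2,
    PointCharge.finrank_eigenspace_hamiltonian he hc hm,
    fun b => ⟨PointCharge.orthonormal_boundStates he hc hm b, ?_⟩,
    ⟨_, fun A => PointCharge.pointOp_bounded_below _ _ A⟩,
    fun lam hl A => PointCharge.exists_hasFormValue_iff he hc _ _ hl A,
    fun lam hl A v hv Q hQ => ⟨PointCharge.hasFormValue_pointOp_eq he hc _ _ hl hv hQ,
      PointCharge.exists_sphereMeans_charge he hc hl hQ,
      fun hA i => PointCharge.real_charge he hc hl hQ hA i⟩,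
    fun A hA => PointCharge.isRealField_pointOp he hc _ _ A hA⟩
  · have hρ : PointCharge.IsDensity ρ := ⟨h1, h2, h3, h5⟩
    exact ⟨fun r hr hm' => PointCharge.isSelfAdjoint_Hreg he hc hρ hr hm',
      PointCharge.weaklyTendstoDelta hρ, PointCharge.eventually_renMass_ne_zero he hc hρ hm,
      PointCharge.normResolventTendsto_Hreg he hc hρ hm⟩
  · rw [PointCharge.span_boundStates he hc hm b, PointCharge.eigenspace_hamiltonian he hc hm]
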